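/- Let $S$ be a string of length $n>0$ over an arbitrary linearly ordered alphabet, and write $S[i..j]$ for its substring from position $i$ to position $j$ (positions start at $0$). A valid sequence of windows is a sequence $S[i_t..j_t]$, $t=0,\dots,T$, with $i_0=j_0=0$, $0\le i_t\le j_t\le n-1$, and, for each $t<T$, either $(i_{t+1},j_{t+1})=(i_t+1,j_t)$ (delete the leftmost character) or $(i_{t+1},j_{t+1})=(i_t,j_t+1)$ (append a character). Suppose that every window has length at most $d$. Let $\sigma'$ be the maximum number of distinct characters in a window, and $d'$ the maximum number of distinct non-empty palindromic substrings of a window; then $d'\le d$. The eertree of a string $w$ has one ordinary node for each distinct non-empty palindromic substring of $w$, whose length is that of the palindrome, and two auxiliary nodes, of lengths $0$ and $-1$, whose palindrome is the empty string. There is an edge labelled $c$ from $u$ to $v$ if the length of $v$ is that of $u$ plus $2$, the palindrome of $u$ is that of $v$ without its first and last characters, and $c$ is the first character of the palindrome of $v$. The suffix link of a node of length at least $2$ points to the node of the longest palindromic proper suffix of its palindrome, that of a node of length $1$ points to the $0$-node, and those of the $0$-node and of the $-1$-node point to the $-1$-node. **Theorem.** There are a constant $C$ and a single online algorithm, which is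 given $d$ in advance and then the deletions and appends one at a time, such that for every alphabet, string $S$, bound $d$ and valid sequence of windows as above, the algorithm maintains the eertree of the current window: after each operation, its memory stores exactly the nodes of $\mathsf{eertree}(S[i_t..j_t])$, each with its length, its suffix link, its parent and incoming label (for ordinary nodes), and its outgoing edges in a binary search tree that is sorted by label and has height at most $C\lfloor\log_2(\sigma'+1)\rfloor$. The total running time for all windows is at most $C\,n\lfloor\log_2(\sigma'+1)\rfloor$, that is, $O(n\log(\sigma'+1))$, and the space used is at most $d+C d'$ words of memory, that is, $O(d')+d$ words, in addition to a constant number of registers. Here the model is a unit-cost RAM whose words hold either a character or an integer of absolute value at most $C(n+d)$, and whose memory is initially zero. Characters can only be copied and compared. The characters of the current window (for a deletion, the window before it; for an append, the window after it) can be read at unit cost by position, and are not counted in the space. -/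

import Mathlib

open Finset

universe u

/-! ### Strings, palindromes and the abstract eertree -/

/-- The substring `S[i..j]` (both ends included, positions counted from `0`). -/
def substr {α : Type u} (S : List α) (i j : ℕ) : List α := (S.drop i).take (j + 1 - i)

/-- The distinct non-empty palindromic substrings of `w`. -/
def palSubstrings {α : Type u} (w : List α) : Set (List α) :=
  {p | p ≠ [] ∧ p <:+: w ∧ p.Palindrome}

/-- Potential nodes of an eertree: the two auxiliary nodes, and one ordinary node per string. -/
inductive ENode (α : Type u) : Type u
  | negOne : ENode α
  | zero : ENode α
  | ord (p : List α) : ENode α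

namespace ENode

variable {α : Type u}

/-- `v` is a node of `eertree(w)`. -/
def IsNode (w : List α) : ENode α → Prop
  | negOne => True
  | zero => True
  | ord p => p ∈ palSubstrings w

/-- The palindrome of a node; the auxiliary nodes get the empty string. -/
def pal : ENode α → List α
  | negOne => []
  | zero => []
  | ord p => p

def len : ENode α → ℤ
  | negOne => -1
  | zero => 0
  | ord p => p.length

/-- There is an edge from `v` to `v'`, labelled by `c`: the lengths differ by two, `pal v` is
`pal v'` without its first and last characters, and `c` is the first character of `pal v'`. -/
def Edge (v v' : ENode α) (c : α) : Prop :=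
  v.len + 2 = v'.len ∧ v.pal = v'.pal.tail.dropLast ∧ v'.pal.head? = some c

/-- `q` is the longest palindromic proper suffix of `p`. -/
def IsLongestPalProperSuffix (q p : List α) : Prop :=
  (q <:+ p ∧ q ≠ p ∧ q.Palindrome) ∧
    ∀ q' : List α, q' <:+ p → q' ≠ p → q'.Palindrome → q'.length ≤ q.length

/-- `SLink v v'`: the suffix link of `v` points to `v'`. -/
inductive SLink : ENode α → ENode α → Prop
  | negOne : SLink negOne negOne
  | zero : SLink zero negOne
  | single (a : α) : SLink (ord [a]) zero
  | long (p q : List α) : 2 ≤ p.length → IsLongestPalProperSuffix q p → SLink (ord p) (ord q)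

end ENode

/-! ### The machine: a unit-cost RAM over an ordered alphabet

A word is an integer of bounded size or a character; characters can only be copied and compared.
Programs do not depend on the alphabet. -/

inductive Word (α : Type u) : Type u
  | int (k : ℤ) : Word α
  | chr (c : α) : Word α

/-- A machine state: the registers (a program mentions only finitely many of them) and the
random-access memory. -/
structure MState (α : Type u) : Type u where
  reg : ℕ → Word α
  mem : ℕ → Word α

namespace MState

variable {α : Type u}

def setReg (s : MState α) (r : ℕ) (x : Word α) : MState α :=
  { s with reg := Function.update s.reg r x }

def setMem (s : MState α) (p : ℕ) (x : Word α) : MState α :=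
  { s with mem := Function.update s.mem p x }

/-- The start state: the integer `d` in register `0`, and zero everywhere else. -/
def start (d : ℕ) : MState α where
  reg := Function.update (fun _ => Word.int 0) 0 (Word.int d)
  mem := fun _ => Word.int 0

end MState

inductive ArithOp
  | add | sub | mul | div | mod

def ArithOp.eval : ArithOp → ℤ → ℤ → ℤ
  | add, x, y => x + y
  | sub, x, y => x - y
  | mul, x, y => x * y
  | div, x, y => x / y
  | mod, x, y => x % y

/-- Comparisons between the contents of two registers. -/
inductive Test
  | eq (a b : ℕ)
  | lt (a b : ℕ)

/-- The value of a comparison; comparing an integer with a character is undefined. -/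
def Test.eval {α : Type u} [LinearOrder α] (s : MState α) : Test → Option Bool
  | eq a b =>
    match s.reg a, s.reg b with
    | Word.int x, Word.int y => some (decide (x = y))
    | Word.chr x, Word.chr y => some (decide (x = y))
    | _, _ => none
  | lt a b =>
    match s.reg a, s.reg b with
    | Word.int x, Word.int y => some (decide (x < y))
    | Word.chr x, Word.chr y => some (decide (x < y))
    | _, _ => none

/-- Programs. The natural-number arguments are register names, except that `const r k` puts the
constant `k` into register `r`. -/
inductive Prog
  | skip
  | const (r : ℕ) (k : ℤ)
  | copy (r a : ℕ)
  | arith (op : ArithOp) (r a b : ℕ)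
  | load (r a : ℕ)
  | store (a b : ℕ)
  | read (r a : ℕ)
  | seq (P Q : Prog)
  | ite (t : Test) (P Q : Prog)
  | while (t : Test) (P : Prog)

/-- What a program runs against: the text, of which only the characters at the positions
`lo, …, hi` can be read, the number `space` of available memory cells, and the largest absolute
value `wordMax` of an integer that fits into a word. A program cannot inspect the last two: an
access to a cell with address at least `space`, and the computation of an integer that does not fit
into a word, are run-time errors. -/
structure Env (α : Type u) : Type u where
  text : List α
  lo : ℕ
  hi : ℕ
  space : ℕ
  wordMax : ℕ

/-- `Exec E P s s' k`: in the environment `E`, the program `P`, started in the state `s`, terminates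
without an error in the state `s'` after `k` elementary steps. -/
inductive Exec {α : Type u} [LinearOrder α] (E : Env α) :
    Prog → MState α → MState α → ℕ → Prop
  | skip (s : MState α) : Exec E Prog.skip s s 1
  | const (s : MState α) (r : ℕ) (k : ℤ) : |k| ≤ E.wordMax →
      Exec E (Prog.const r k) s (s.setReg r (Word.int k)) 1
  | copy (s : MState α) (r a : ℕ) :
      Exec E (Prog.copy r a) s (s.setReg r (s.reg a)) 1
  | arith (s : MState α) (op : ArithOp) (r a b : ℕ) (x y : ℤ) :
      s.reg a = Word.int x → s.reg b = Word.int y → |op.eval x y| ≤ E.wordMax →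
      Exec E (Prog.arith op r a b) s (s.setReg r (Word.int (op.eval x y))) 1
  | load (s : MState α) (r a p : ℕ) : s.reg a = Word.int p → p < E.space →
      Exec E (Prog.load r a) s (s.setReg r (s.mem p)) 1
  | store (s : MState α) (a b p : ℕ) : s.reg a = Word.int p → p < E.space →
      Exec E (Prog.store a b) s (s.setMem p (s.reg b)) 1
  | read (s : MState α) (r a p : ℕ) (c : α) : s.reg a = Word.int p → E.lo ≤ p → p ≤ E.hi →
      E.text[p]? = some c →
      Exec E (Prog.read r a) s (s.setReg r (Word.chr c)) 1
  | seq (P Q : Prog) (s s' s'' : MState α) (k l : ℕ) :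
      Exec E P s s' k → Exec E Q s' s'' l → Exec E (Prog.seq P Q) s s'' (k + l)
  | ite_true (t : Test) (P Q : Prog) (s s' : MState α) (k : ℕ) : t.eval s = some true →
      Exec E P s s' k → Exec E (Prog.ite t P Q) s s' (k + 1)
  | ite_false (t : Test) (P Q : Prog) (s s' : MState α) (k : ℕ) : t.eval s = some false →
      Exec E Q s s' k → Exec E (Prog.ite t P Q) s s' (k + 1)
  | while_false (t : Test) (P : Prog) (s : MState α) : t.eval s = some false →
      Exec E (Prog.while t P) s s 1
  | while_true (t : Test) (P : Prog) (s s' s'' : MState α) (k l : ℕ) : t.eval s = some true →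
      Exec E P s s' k → Exec E (Prog.while t P) s' s'' l →
      Exec E (Prog.while t P) s s'' (k + l + 1)

/-! ### Eertrees in memory -/

/-- `EdgeTree mem M q L h`: the memory cells with addresses below `M` contain, at the address `q`, a
binary tree of height `h` whose in-order list of entries is `L`. An entry consists of an edge label
and the address of the node that the edge leads to. Each tree node consists of the four cells label,
target, left subtree, right subtree; the empty tree is the null pointer `0`. -/
inductive EdgeTree {α : Type u} (mem : ℕ → Word α) (M : ℕ) : ℕ → List (α × ℕ) → ℕ → Prop
  | nil : EdgeTree mem M 0 [] 0
  | node (q l r a : ℕ) (c : α) (L R : List (α × ℕ)) (h h' : ℕ) :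
      q ≠ 0 → q + 3 < M →
      mem q = Word.chr c → mem (q + 1) = Word.int a →
      mem (q + 2) = Word.int l → mem (q + 3) = Word.int r →
      EdgeTree mem M l L h → EdgeTree mem M r R h' →
      EdgeTree mem M q (L ++ (c, a) :: R) (max h h' + 1)

/-- The state `s` stores `eertree(w)` in the memory cells with addresses below `M`. Registers `1`
and `2` point to the `-1`-node and to the `0`-node. Distinct nodes have distinct addresses, and the
record of a node consists of the cells: length, suffix link, parent, label of the incoming edge
(the last two for ordinary nodes only), and the root of a binary search tree of height at most `h`,
which is sorted by label and contains exactly the outgoing edges of the node. -/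
def StoresEertree {α : Type u} [LinearOrder α] (s : MState α) (M h : ℕ) (w : List α) : Prop :=
  ∃ addr : ENode α → ℕ,
    Set.InjOn addr {v | v.IsNode w} ∧
    s.reg 1 = Word.int (addr ENode.negOne) ∧
    s.reg 2 = Word.int (addr ENode.zero) ∧
    ∀ v : ENode α, v.IsNode w →
      addr v ≠ 0 ∧ addr v + 4 < M ∧
      s.mem (addr v) = Word.int v.len ∧
      (∃ v' : ENode α, v'.IsNode w ∧ v.SLink v' ∧ s.mem (addr v + 1) = Word.int (addr v')) ∧
      (∀ (v' : ENode α) (c : α), v'.IsNode w → v'.Edge v c →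
        s.mem (addr v + 2) = Word.int (addr v') ∧ s.mem (addr v + 3) = Word.chr c) ∧
      ∃ (q : ℕ) (L : List (α × ℕ)) (k : ℕ),
        s.mem (addr v + 4) = Word.int q ∧ EdgeTree s.mem M q L k ∧ k ≤ h ∧
        (L.map Prod.fst).Pairwise (· < ·) ∧
        ∀ (c : α) (a : ℕ),
          (c, a) ∈ L ↔ ∃ v' : ENode α, v'.IsNode w ∧ v.Edge v' c ∧ a = addr v'

/-! ### Sliding windows -/

/-- The windows `[i t, j t]`, at the times `t = 0, …, T`, form a valid sequence of windows over a
string of length `n`: it starts with `[0, 0]`, all windows are non-empty and lie inside the string,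
and each step deletes the leftmost character or appends a character on the right. -/
def IsWindowSeq (n T : ℕ) (i j : ℕ → ℕ) : Prop :=
  i 0 = 0 ∧ j 0 = 0 ∧ (∀ t ≤ T, i t ≤ j t ∧ j t < n) ∧
    ∀ t < T, (i (t + 1) = i t + 1 ∧ j (t + 1) = j t) ∨ (i (t + 1) = i t ∧ j (t + 1) = j t + 1)

/-- The maximum number of distinct characters in a window. -/
def maxChars {α : Type u} [LinearOrder α] (S : List α) (T : ℕ) (i j : ℕ → ℕ) : ℕ :=
  (Finset.range (T + 1)).sup fun t => (substr S (i t) (j t)).toFinset.card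

/-- The maximum number of distinct non-empty palindromes in a window. -/
noncomputable def maxPals {α : Type u} (S : List α) (T : ℕ) (i j : ℕ → ℕ) : ℕ :=
  (Finset.range (T + 1)).sup fun t => (palSubstrings (substr S (i t) (j t))).ncard

/-- A sliding-window algorithm: a routine for the first window, one for deleting the leftmost
character, and one for appending a character. Registers and memory persist between calls. -/
structure SlidingAlg where
  init : Prog
  delete : Prog
  append : Prog

/-- `A.Run S M W d T i j st cost`: the algorithm `A` processes the windows online, with `M` memory
cells, with words that hold integers of absolute value at most `W`, and with the bound `d` as its
only other input; `st t` is the state in which the routine called at time `t` halts, and `cost t` is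
the number of steps of this routine. The characters that the routine can read are those of the
window before a deletion, and those of the window after an append. -/
def SlidingAlg.Run {α : Type u} [LinearOrder α] (A : SlidingAlg) (S : List α) (M W d T : ℕ)
    (i j : ℕ → ℕ) (st : ℕ → MState α) (cost : ℕ → ℕ) : Prop :=
  Exec ⟨S, i 0, j 0, M, W⟩ A.init (MState.start d) (st 0) (cost 0) ∧
    ∀ t < T,
      (i (t + 1) = i t + 1 →
        Exec ⟨S, i t, j t, M, W⟩ A.delete (st t) (st (t + 1)) (cost (t + 1))) ∧
      (j (t + 1) = j t + 1 →
        Exec ⟨S, i (t + 1), j (t + 1), M, W⟩ A.append (st t) (st (t + 1)) (cost (t + 1)))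

/-! Appending a character `c` to `w` creates at most one palindrome, the longest palindromic suffix
of `wc` (`palSubstrings_concat`): a shorter palindromic suffix is, by reflection inside the longest
one, also a prefix of it, and so it occurs in `w` already. By reversal, deleting the first character
destroys at most one palindrome, the longest palindromic prefix `P` (`palSubstrings_cons`). Hence
each operation adds or removes at most one node.

Append. The nodes of the palindromic suffixes of `w` form a chain of suffix links that starts at the
longest one. The first node on it that can be extended by `c` on both sides is the parent of the new
longest palindromic suffix (`lpsuf_concat`), and the next such node gives the suffix link of the new
node (`plink_ext`). For the current node `v`, use the potential `v.len + (slink v).len`. Up to a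
constant per append, the steps of both searches are paid for by a fall of the potential; an append
raises it by at most 4 (`potAt_append`), and a deletion does not raise it (`potAt_delete`). So the
number of link steps is linear in `n`. Everything else in an operation is a bounded number of
accesses to balanced trees, which have at most as many entries as the window has distinct
characters.

Delete. The question is whether `P` occurs again in the remaining window. Call an occurrence of a
palindrome a surface if it is neither a proper prefix nor a proper suffix of a longer palindromic
occurrence in the window. An array of `d` cells, indexed by positions modulo `d`, registers at most
one palindrome per starting position, and the invariant `Registered` says that all surfaces are
registered. Another occurrence of `P` is either a surface, hence registered, or a prefix or suffix
of a longer palindrome; in the latter case `P` is, by symmetry, a suffix of a longer palindrome and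
therefore the target of a suffix link (`lppre_mem_iff`). So a counter of registrations and incoming
suffix links at each node decides whether the node must go. The invariant survives an append if the
new longest palindromic suffix is registered (`Registered.append`), and a deletion if the longest
proper palindromic suffix of `P` is registered where the deleted occurrence of `P` ends
(`Registered.delete`). That no other surface can arise is the combinatorial core, `exists_pal_sub`.

Memory. An ordinary node has exactly one incoming edge, so the search-tree node of this edge shares
a block of 13 cells with the node itself. Freed blocks are reused before fresh ones are taken, so
the space is a null block, the array, and 13 cells for each of at most `d' + 2` blocks. The edge
trees are height-balanced.

Verification. Programs act on structured states `AS`, in which fields are independent functions of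
pointers, and `Tr` is total correctness with a bound on the steps. The combinatorics enters only
through the invariant `NInv` on such states. -/

namespace SlidingEertree

section

/-! ### A structured view of the machine -/

/-- Named integer registers. -/
inductive Reg
  | d | neg | zero | lo | hi | cur | free | bump | zr | one
  | nx | nv | ny | pos | ix | tmp
  | q | tp | u | fl | tv | tm | xs | pn
  | bl | br | ba | b1 | b2 | h1 | h2 | h3
  deriving DecidableEq

/-- Named character registers. -/
inductive CReg
  | c | t
  deriving DecidableEq

/-- These numbers lie above those of the integer registers; register 62 is left as scratch space for
addresses. -/
def CReg.num : CReg → ℕ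
  | c => 60
  | t => 61

/-- The fields of records. -/
inductive Fld
  | len | link | par | lab | root | cnt
  | tlab | tgt | l | r | ht | up | dir
  | arr
  deriving DecidableEq

/-- In a block at `p`, the cells 0 to 4 are the record of a node and cell 12 is its reference
counter. The cells 5 to 11 are the search-tree node of its incoming edge, which is addressed by the
pointer `p + 5`; hence the offsets from `tlab` to `dir` start again at 0. The offset of `arr` skips
the null block. -/
def Fld.off : Fld → ℕ
  | len => 0
  | link => 1
  | par => 2
  | lab => 3
  | root => 4
  | cnt => 12
  | tlab => 0
  | tgt => 1
  | l => 2
  | r => 3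
  | ht => 4
  | up => 5
  | dir => 6
  | arr => 13

def Fld.isChar : Fld → Bool
  | lab => true
  | tlab => true
  | _ => false

/-- `p` is the address of one of the blocks of 13 cells that follow the null block and the array. -/
def Blk (d M : ℕ) (p : ℤ) : Prop := ∃ k : ℕ, p = 13 + d + 13 * k ∧ 13 + d + 13 * k + 13 ≤ M

/-- The field `fl` can be accessed at the pointer `p`. -/
def Valid (d M : ℕ) : Fld → ℤ → Prop
  | .len, p => p = 0 ∨ Blk d M p
  | .cnt, p => p = 0 ∨ Blk d M p
  | .link, p => Blk d M p
  | .par, p => Blk d M p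
  | .lab, p => Blk d M p
  | .root, p => Blk d M p
  | .ht, p => p = 0 ∨ Blk d M (p - 5)
  | .tlab, p => Blk d M (p - 5)
  | .tgt, p => Blk d M (p - 5)
  | .l, p => Blk d M (p - 5)
  | .r, p => Blk d M (p - 5)
  | .up, p => Blk d M (p - 5)
  | .dir, p => Blk d M (p - 5)
  | .arr, p => 0 ≤ p ∧ p < d

theorem Valid.nonneg {d M : ℕ} {fl : Fld} {p : ℤ} (h : Valid d M fl p) : 0 ≤ p := by
  cases fl <;> simp only [Valid, Blk] at h <;> omega

theorem Valid.lt {d M : ℕ} (hM : 13 + d ≤ M) {fl : Fld} {p : ℤ} (h : Valid d M fl p) :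
    (p + fl.off).toNat < M := by
  cases fl <;> simp only [Valid, Blk, Fld.off] at h ⊢ <;> omega

/-- Different accessible fields lie in different cells. -/
theorem Valid.disjoint {d M : ℕ} {fl fl' : Fld} {p p' : ℤ} (h : Valid d M fl p)
    (h' : Valid d M fl' p') (he : p + fl.off = p' + fl'.off) : fl = fl' ∧ p = p' := by
  -- A normal form of addresses: one of three cells of the null block, a cell of the array, or a
  -- cell of a block, whose number within the block includes the shift by 5 for the fields of tree
  -- nodes.
  have key : ∀ {fl : Fld} {p : ℤ}, Valid d M fl p →
      (p = 0 ∧ (fl = .len ∨ fl = .cnt ∨ fl = .ht)) ∨ (fl = .arr ∧ 0 ≤ p ∧ p < d) ∨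
      (∃ k : ℕ, p + fl.off = 13 + d + 13 * k + (fl.off + if fl ∈ [.tlab, .tgt, .l, .r, .ht, .up, .dir]
        then 5 else 0 : ℕ) ∧ fl ≠ .arr) := by
    intro fl p h
    cases fl <;> simp only [Valid, Blk, Fld.off] at h ⊢ <;> simp only [reduceCtorEq] <;> simp <;>
      first | omega | (rcases h with h | ⟨k, h, _⟩; · omega
                       right; exact ⟨k, by omega⟩) | (obtain ⟨k, h, _⟩ := h; exact ⟨k, by omega⟩)
  -- The cell number within a block is the residue modulo 13, and distinct fields have distinct cell
  -- numbers.
  have inj : ∀ {fl fl' : Fld} {k k' : ℤ}, fl ≠ .arr → fl' ≠ .arr →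
      13 + (d : ℤ) + 13 * k + (fl.off + if fl ∈ [.tlab, .tgt, .l, .r, .ht, .up, .dir]
        then 5 else 0 : ℕ) = 13 + d + 13 * k' + (fl'.off +
        if fl' ∈ [.tlab, .tgt, .l, .r, .ht, .up, .dir] then 5 else 0 : ℕ) → fl = fl' := by
    intro fl fl' k k' h h' he
    cases fl <;> cases fl' <;> simp [Fld.off] at h h' he ⊢ <;> omega
  have hlt : ∀ fl : Fld, fl ≠ .arr → fl.off < 13 := by
    intro fl; cases fl <;> simp [Fld.off]
  rcases key h with ⟨h0, h1⟩ | ⟨h0, h1⟩ | ⟨k, hk, hn⟩ <;>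
    rcases key h' with ⟨h0', h1'⟩ | ⟨h0', h1'⟩ | ⟨k', hk', hn'⟩
  · rcases h1 with rfl | rfl | rfl <;> rcases h1' with rfl | rfl | rfl <;>
      simp [Fld.off] at he ⊢ <;> omega
  · subst h0'; exfalso
    rcases h1 with rfl | rfl | rfl <;> simp [Fld.off] at he <;> omega
  · exfalso; rcases h1 with rfl | rfl | rfl <;> simp [Fld.off] at he <;> omega
  · subst h0; exfalso
    rcases h1' with rfl | rfl | rfl <;> simp [Fld.off] at he <;> omega
  · subst h0; subst h0'; exact ⟨rfl, by omega⟩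
  · subst h0; exfalso; simp [Fld.off] at he; omega
  · exfalso; rcases h1' with rfl | rfl | rfl <;> simp [Fld.off] at he <;> omega
  · subst h0'; exfalso; simp [Fld.off] at he; omega
  · have : fl = fl' := inj hn hn' (by rw [← hk, ← hk', he])
    subst this
    exact ⟨rfl, by omega⟩

/-- A structured machine state. -/
structure AS (α : Type u) where
  r : Reg → ℤ
  c : CReg → Word α
  f : Fld → ℤ → ℤ
  g : Fld → ℤ → Word α

variable {α : Type u}

/-- The machine state `s` represents the structured state `a`. -/
structure Rep (d M : ℕ) (s : MState α) (a : AS α) : Prop where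
  reg : ∀ x : Reg, s.reg x.ctorIdx = Word.int (a.r x)
  creg : ∀ x : CReg, s.reg x.num = a.c x
  fld : ∀ fl p, Valid d M fl p →
    s.mem (p + fl.off).toNat = if fl.isChar then a.g fl p else Word.int (a.f fl p)

theorem Reg.ctorIdx_inj {x y : Reg} (h : x.ctorIdx = y.ctorIdx) : x = y := by
  rw [← Reg.ofNat_ctorIdx x, ← Reg.ofNat_ctorIdx y, h]

theorem Reg.ctorIdx_lt (x : Reg) : x.ctorIdx < 60 := by cases x <;> decide

theorem CReg.num_inj {x y : CReg} (h : x.num = y.num) : x = y := by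
  cases x <;> cases y <;> simp [CReg.num] at h ⊢

theorem CReg.num_ge (x : CReg) : 60 ≤ x.num ∧ x.num < 62 := by cases x <;> decide

theorem Rep.setReg {d M : ℕ} {s : MState α} {a : AS α} (h : Rep d M s a) (x : Reg) (v : ℤ) :
    Rep d M (s.setReg x.ctorIdx (Word.int v)) { a with r := Function.update a.r x v } where
  reg y := by
    by_cases e : y = x
    · subst e; simp [MState.setReg]
    · have : y.ctorIdx ≠ x.ctorIdx := fun h => e (Reg.ctorIdx_inj h)
      simp [MState.setReg, Function.update_of_ne this, Function.update_of_ne e, h.reg]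
  creg y := by
    have : y.num ≠ x.ctorIdx := by have := y.num_ge; have := x.ctorIdx_lt; omega
    simp [MState.setReg, Function.update_of_ne this, h.creg]
  fld := h.fld

theorem Rep.setCReg {d M : ℕ} {s : MState α} {a : AS α} (h : Rep d M s a) (x : CReg)
    (v : Word α) : Rep d M (s.setReg x.num v) { a with c := Function.update a.c x v } where
  reg y := by
    have : y.ctorIdx ≠ x.num := by have := x.num_ge; have := y.ctorIdx_lt; omega
    simp [MState.setReg, Function.update_of_ne this, h.reg]
  creg y := by
    by_cases e : y = x
    · subst e; simp [MState.setReg]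
    · have : y.num ≠ x.num := fun h => e (CReg.num_inj h)
      simp [MState.setReg, Function.update_of_ne this, Function.update_of_ne e, h.creg]
  fld := h.fld

theorem Rep.setScratch {d M : ℕ} {s : MState α} {a : AS α} (h : Rep d M s a) (v : Word α) :
    Rep d M (s.setReg 62 v) a where
  reg y := by
    have : y.ctorIdx ≠ 62 := by have := y.ctorIdx_lt; omega
    simp [MState.setReg, Function.update_of_ne this, h.reg]
  creg y := by
    have : y.num ≠ 62 := by have := y.num_ge; omega
    simp [MState.setReg, Function.update_of_ne this, h.creg]
  fld := h.fld

/-- By `Valid.disjoint`, a store to one field cannot be seen through any other field or pointer.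
This is what allows memory to be treated as a family of independent functions. -/
theorem Rep.setFld {d M : ℕ} {s : MState α} {a : AS α} (h : Rep d M s a) {fl : Fld} {p : ℤ}
    (hv : Valid d M fl p) (hc : fl.isChar = false) (v : ℤ) :
    Rep d M (s.setMem (p + fl.off).toNat (Word.int v))
      { a with f := Function.update a.f fl (Function.update (a.f fl) p v) } where
  reg := h.reg
  creg := h.creg
  fld fl' p' hv' := by
    by_cases e : p' + fl'.off = p + fl.off
    · obtain ⟨rfl, rfl⟩ := hv'.disjoint hv e
      simp [MState.setMem, hc]
    · have h1 : (p' + fl'.off).toNat ≠ (p + fl.off).toNat := by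
        have := hv.nonneg; have := hv'.nonneg; omega
      simp only [MState.setMem, Function.update_of_ne h1, h.fld fl' p' hv']
      by_cases e' : fl' = fl
      · subst e'
        have : p' ≠ p := by rintro rfl; exact e rfl
        simp [Function.update_of_ne this]
      · simp [Function.update_of_ne e']

theorem Rep.setCFld {d M : ℕ} {s : MState α} {a : AS α} (h : Rep d M s a) {fl : Fld} {p : ℤ}
    (hv : Valid d M fl p) (hc : fl.isChar = true) (v : Word α) :
    Rep d M (s.setMem (p + fl.off).toNat v)
      { a with g := Function.update a.g fl (Function.update (a.g fl) p v) } where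
  reg := h.reg
  creg := h.creg
  fld fl' p' hv' := by
    by_cases e : p' + fl'.off = p + fl.off
    · obtain ⟨rfl, rfl⟩ := hv'.disjoint hv e
      simp [MState.setMem, hc]
    · have h1 : (p' + fl'.off).toNat ≠ (p + fl.off).toNat := by
        have := hv.nonneg; have := hv'.nonneg; omega
      simp only [MState.setMem, Function.update_of_ne h1, h.fld fl' p' hv']
      by_cases e' : fl' = fl
      · subst e'
        have : p' ≠ p := by rintro rfl; exact e rfl
        simp [Function.update_of_ne this]
      · simp [Function.update_of_ne e']

/-- Structured instructions. -/
inductive Instr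
  | const (x : Reg) (k : ℤ)
  | copy (x y : Reg)
  | arith (op : ArithOp) (x y z : Reg)
  | ld (x : Reg) (fl : Fld) (y : Reg)
  | st (fl : Fld) (y x : Reg)
  | ldc (x : CReg) (fl : Fld) (y : Reg)
  | stc (fl : Fld) (y : Reg) (x : CReg)
  | read (x : CReg) (y : Reg)

def Instr.compile : Instr → Prog
  | const x k => .const x.ctorIdx k
  | copy x y => .copy x.ctorIdx y.ctorIdx
  | arith op x y z => .arith op x.ctorIdx y.ctorIdx z.ctorIdx
  | ld x fl y => .seq (.const 62 fl.off) (.seq (.arith .add 62 y.ctorIdx 62) (.load x.ctorIdx 62))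
  | st fl y x => .seq (.const 62 fl.off) (.seq (.arith .add 62 y.ctorIdx 62) (.store 62 x.ctorIdx))
  | ldc x fl y => .seq (.const 62 fl.off) (.seq (.arith .add 62 y.ctorIdx 62) (.load x.num 62))
  | stc fl y x => .seq (.const 62 fl.off) (.seq (.arith .add 62 y.ctorIdx 62) (.store 62 x.num))
  | read x y => .read x.num y.ctorIdx

/-- The character at a position of the text, as a word. -/
def charAt (S : List α) (k : ℕ) : Word α :=
  match S[k]? with
  | some ch => Word.chr ch
  | none => Word.int 0

def Instr.ev (E : Env α) (a : AS α) : Instr → AS α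
  | const x k => { a with r := Function.update a.r x k }
  | copy x y => { a with r := Function.update a.r x (a.r y) }
  | arith op x y z => { a with r := Function.update a.r x (op.eval (a.r y) (a.r z)) }
  | ld x fl y => { a with r := Function.update a.r x (a.f fl (a.r y)) }
  | st fl y x => { a with f := Function.update a.f fl (Function.update (a.f fl) (a.r y) (a.r x)) }
  | ldc x fl y => { a with c := Function.update a.c x (a.g fl (a.r y)) }
  | stc fl y x => { a with g := Function.update a.g fl (Function.update (a.g fl) (a.r y) (a.c x)) }
  | read x y => { a with c := Function.update a.c x (charAt E.text (a.r y).toNat) }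

def Instr.Ok (E : Env α) (d : ℕ) (a : AS α) : Instr → Prop
  | const _ k => |k| ≤ E.wordMax
  | copy _ _ => True
  | arith op _ y z => |op.eval (a.r y) (a.r z)| ≤ E.wordMax
  | ld _ fl y => fl.isChar = false ∧ Valid d E.space fl (a.r y)
  | st fl y _ => fl.isChar = false ∧ Valid d E.space fl (a.r y)
  | ldc _ fl y => fl.isChar = true ∧ Valid d E.space fl (a.r y)
  | stc fl y _ => fl.isChar = true ∧ Valid d E.space fl (a.r y)
  | read _ y => (E.lo : ℤ) ≤ a.r y ∧ a.r y ≤ E.hi ∧ (a.r y).toNat < E.text.length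

/-- The environment has enough room for the null block and the array, and words are large enough
for addresses. -/
structure Fits (E : Env α) (d : ℕ) : Prop where
  space : 13 + d ≤ E.space
  word : E.space ≤ E.wordMax

theorem Fld.off_le (fl : Fld) : fl.off ≤ 13 := by cases fl <;> decide

end

/-! ### Executing structured programs: total correctness with step bounds -/

section

variable {α : Type u} [LinearOrder α]

/-- The address computation shared by all four kinds of field access: two steps leave the address in
the scratch register, and `P` stands for the load or store that follows. -/
theorem exec_addr {E : Env α} {d : ℕ} (hE : Fits E d) {s : MState α} {a : AS α}
    (h : Rep d E.space s a) {y : Reg} {fl : Fld} (hv : Valid d E.space fl (a.r y)) :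
    ∃ s1 : MState α, (∀ P s2, Exec E P s1 s2 1 →
        Exec E (.seq (.const 62 fl.off) (.seq (.arith .add 62 y.ctorIdx 62) P)) s s2 3) ∧
      s1.reg 62 = Word.int ((a.r y + fl.off).toNat : ℕ) ∧ Rep d E.space s1 a ∧
      (a.r y + fl.off).toNat < E.space := by
  have h1 := hv.nonneg
  have h2 := hv.lt hE.space
  have h3 := hE.word
  have h4 := fl.off_le
  have hs := hE.space
  have e : (((a.r y + fl.off).toNat : ℕ) : ℤ) = a.r y + fl.off := by omega
  refine ⟨(s.setReg 62 (Word.int fl.off)).setReg 62 (Word.int (a.r y + fl.off)), ?_, ?_,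
    (h.setScratch _).setScratch _, h2⟩
  · intro P s2 hP
    refine Exec.seq _ _ _ _ _ 1 2 (Exec.const _ _ _ ?_)
      (Exec.seq _ _ _ _ _ 1 1 (Exec.arith _ _ _ _ _ (a.r y) fl.off ?_ ?_ ?_) hP)
    · rw [abs_le]; omega
    · exact (h.setScratch _).reg y
    · simp [MState.setReg]
    · simp only [ArithOp.eval]; rw [abs_le]; omega
  · simp [MState.setReg, e]

theorem Instr.exec {E : Env α} {d : ℕ} (hE : Fits E d) {a : AS α} {I : Instr} (hI : I.Ok E d a)
    {s : MState α} (h : Rep d E.space s a) :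
    ∃ s' k, Exec E I.compile s s' k ∧ k ≤ 3 ∧ Rep d E.space s' (I.ev E a) := by
  cases I with
  | const x k => exact ⟨_, 1, Exec.const _ _ _ hI, by omega, h.setReg _ _⟩
  | copy x y =>
    refine ⟨_, 1, Exec.copy _ _ _, by omega, ?_⟩
    rw [h.reg]; exact h.setReg _ _
  | arith op x y z =>
    exact ⟨_, 1, Exec.arith _ _ _ _ _ _ _ (h.reg y) (h.reg z) hI, by omega, h.setReg _ _⟩
  | ld x fl y =>
    obtain ⟨s1, h1, h2, h3, h4⟩ := exec_addr hE h hI.2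
    refine ⟨_, 3, h1 _ _ (Exec.load _ _ _ _ h2 h4), le_rfl, ?_⟩
    rw [h3.fld fl _ hI.2, hI.1]
    exact h3.setReg _ _
  | st fl y x =>
    obtain ⟨s1, h1, h2, h3, h4⟩ := exec_addr hE h hI.2
    refine ⟨_, 3, h1 _ _ (Exec.store _ _ _ _ h2 h4), le_rfl, ?_⟩
    rw [h3.reg]
    exact h3.setFld hI.2 hI.1 _
  | ldc x fl y =>
    obtain ⟨s1, h1, h2, h3, h4⟩ := exec_addr hE h hI.2
    refine ⟨_, 3, h1 _ _ (Exec.load _ _ _ _ h2 h4), le_rfl, ?_⟩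
    rw [h3.fld fl _ hI.2, hI.1]
    exact h3.setCReg _ _
  | stc fl y x =>
    obtain ⟨s1, h1, h2, h3, h4⟩ := exec_addr hE h hI.2
    refine ⟨_, 3, h1 _ _ (Exec.store _ _ _ _ h2 h4), le_rfl, ?_⟩
    rw [h3.creg]
    exact h3.setCFld hI.2 hI.1 _
  | read x y =>
    obtain ⟨h1, h2, h3⟩ := hI
    have hg : E.text[(a.r y).toNat]? = some (E.text[(a.r y).toNat]) := List.getElem?_eq_getElem h3
    refine ⟨_, 1, Exec.read _ _ _ (a.r y).toNat _ ?_ ?_ ?_ hg, by omega, ?_⟩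
    · rw [h.reg, Int.toNat_of_nonneg (by omega)]
    · omega
    · omega
    · simp only [Instr.ev, charAt, hg]
      exact h.setCReg _ _

/-- The program that executes a list of instructions. -/
def blk : List Instr → Prog
  | [] => .skip
  | I :: l => .seq I.compile (blk l)

def evs (E : Env α) (a : AS α) : List Instr → AS α
  | [] => a
  | I :: l => evs E (I.ev E a) l

def Oks (E : Env α) (d : ℕ) (a : AS α) : List Instr → Prop
  | [] => True
  | I :: l => I.Ok E d a ∧ Oks E d (I.ev E a) l

/-- Total correctness with a bound on the number of steps: from every machine state that represents
`a`, the program `P` terminates within `K` steps in a state that represents some `a'` with `Q a'`,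
where `a'` depends on `a` only. -/
def Tr (E : Env α) (d : ℕ) (P : Prog) (a : AS α) (K : ℕ) (Q : AS α → Prop) : Prop :=
  ∃ a', Q a' ∧ ∀ s, Rep d E.space s a →
    ∃ s' k, Exec E P s s' k ∧ k ≤ K ∧ Rep d E.space s' a'

section
variable {E : Env α} {d : ℕ} {P P' : Prog} {a : AS α} {K K' : ℕ} {Q Q' : AS α → Prop}

theorem Tr.mono (h : Tr E d P a K Q) (hK : K ≤ K') (hQ : ∀ a', Q a' → Q' a') :
    Tr E d P a K' Q' := by
  obtain ⟨a', h1, h2⟩ := h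
  refine ⟨a', hQ _ h1, fun s hs => ?_⟩
  obtain ⟨s', k, h3, h4, h5⟩ := h2 s hs
  exact ⟨s', k, h3, h4.trans hK, h5⟩

theorem Tr.seq (h : Tr E d P a K Q) (h' : ∀ a', Q a' → Tr E d P' a' K' Q') :
    Tr E d (.seq P P') a (K + K') Q' := by
  obtain ⟨a', h1, h2⟩ := h
  obtain ⟨a'', h1', h2'⟩ := h' a' h1
  refine ⟨a'', h1', fun s hs => ?_⟩
  obtain ⟨s', k, h3, h4, h5⟩ := h2 s hs
  obtain ⟨s'', k', h3', h4', h5'⟩ := h2' s' h5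
  exact ⟨s'', k + k', Exec.seq _ _ _ _ _ _ _ h3 h3', by omega, h5'⟩

/-- An instruction costs at most 3 steps, namely two for the address of a field and one for the
access; the last step is the final `skip`. Straight-line code thus reduces to evaluating `evs`. -/
theorem Tr.blk (hE : Fits E d) {l : List Instr} (h : Oks E d a l) (hQ : Q (evs E a l)) :
    Tr E d (blk l) a (3 * l.length + 1) Q := by
  refine ⟨_, hQ, fun s hs => ?_⟩
  clear hQ
  induction l generalizing a s with
  | nil => exact ⟨s, 1, Exec.skip _, by simp, hs⟩
  | cons I l ih =>
    obtain ⟨s', k, h3, h4, h5⟩ := Instr.exec hE h.1 hs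
    obtain ⟨s'', k', h3', h4', h5'⟩ := ih h.2 s' h5
    exact ⟨s'', k + k', Exec.seq _ _ _ _ _ _ _ h3 h3', by simp; omega, h5'⟩

/-- A comparison of two integer registers or of two character registers. -/
inductive BT
  | eq (x y : Reg)
  | lt (x y : Reg)
  | ceq (x y : CReg)
  | clt (x y : CReg)

def BT.compile : BT → Test
  | eq x y => .eq x.ctorIdx y.ctorIdx
  | lt x y => .lt x.ctorIdx y.ctorIdx
  | ceq x y => .eq x.num y.num
  | clt x y => .lt x.num y.num

/-- The test `t` is defined at `a`, and holds if and only if `p` does. -/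
def BT.Is (t : BT) (a : AS α) (p : Prop) : Prop :=
  match t with
  | eq x y => p ↔ a.r x = a.r y
  | lt x y => p ↔ a.r x < a.r y
  | ceq x y => ∃ b c, a.c x = Word.chr b ∧ a.c y = Word.chr c ∧ (p ↔ b = c)
  | clt x y => ∃ b c, a.c x = Word.chr b ∧ a.c y = Word.chr c ∧ (p ↔ b < c)

theorem BT.eval {M : ℕ} {t : BT} {p : Prop} [Decidable p] (h : t.Is a p) {s : MState α}
    (hs : Rep d M s a) : t.compile.eval s = some (decide p) := by
  cases t with
  | eq x y => simp only [BT.Is] at h; simp [BT.compile, Test.eval, hs.reg, h]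
  | lt x y => simp only [BT.Is] at h; simp [BT.compile, Test.eval, hs.reg, h]
  | ceq x y => obtain ⟨b, c, h1, h2, h3⟩ := h; simp [BT.compile, Test.eval, hs.creg, h1, h2, h3]
  | clt x y => obtain ⟨b, c, h1, h2, h3⟩ := h; simp [BT.compile, Test.eval, hs.creg, h1, h2, h3]

theorem Tr.ite {t : BT} (p : Prop) (ht : t.Is a p) (h1 : p → Tr E d P a K Q)
    (h2 : ¬ p → Tr E d P' a K Q) : Tr E d (.ite t.compile P P') a (K + 1) Q := by
  classical
  by_cases hp : p
  · obtain ⟨a', h3, h4⟩ := h1 hp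
    refine ⟨a', h3, fun s hs => ?_⟩
    obtain ⟨s', k, h5, h6, h7⟩ := h4 s hs
    exact ⟨s', k + 1, Exec.ite_true _ _ _ _ _ _ (by simp [BT.eval ht hs, hp]) h5, by omega, h7⟩
  · obtain ⟨a', h3, h4⟩ := h2 hp
    refine ⟨a', h3, fun s hs => ?_⟩
    obtain ⟨s', k, h5, h6, h7⟩ := h4 s hs
    exact ⟨s', k + 1, Exec.ite_false _ _ _ _ _ _ (by simp [BT.eval ht hs, hp]) h5, by omega, h7⟩

theorem Tr.while_false {t : BT} {p : Prop} (ht : t.Is a p) (hp : ¬ p) (hQ : Q a) :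
    Tr E d (.while t.compile P) a 1 Q := by
  classical
  exact ⟨a, hQ, fun s hs => ⟨s, 1, Exec.while_false _ _ _ (by simp [BT.eval ht hs, hp]), le_rfl, hs⟩⟩

/-- The rest of the loop is part of the postcondition of the body. Loops can therefore be verified
by induction on any measure, and the budget `K'` of the remaining iterations may depend on that
measure. -/
theorem Tr.while_true {t : BT} {p : Prop} (ht : t.Is a p) (hp : p)
    (h : Tr E d P a K (fun a' => Tr E d (.while t.compile P) a' K' Q)) :
    Tr E d (.while t.compile P) a (K + K' + 1) Q := by
  classical
  obtain ⟨a', ⟨a'', h1, h2⟩, h3⟩ := h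
  refine ⟨a'', h1, fun s hs => ?_⟩
  obtain ⟨s', k, h5, h6, h7⟩ := h3 s hs
  obtain ⟨s'', k', h5', h6', h7'⟩ := h2 s' h7
  exact ⟨s'', k + k' + 1, Exec.while_true _ _ _ _ _ _ _ (by simp [BT.eval ht hs, hp]) h5 h5',
    by omega, h7'⟩

end

end

section

/-! ### Height-balanced trees of pointers -/

/-- Binary trees of pointers. -/
inductive T
  | nil
  | node (l : T) (q : ℤ) (r : T)

namespace T

def ptr : T → ℤ
  | nil => 0
  | node _ q _ => q

def ht : T → ℕ
  | nil => 0
  | node l _ r => max l.ht r.ht + 1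

def list : T → List ℤ
  | nil => []
  | node l q r => l.list ++ q :: r.list

def Avl : T → Prop
  | nil => True
  | node l _ r => l.Avl ∧ r.Avl ∧ l.ht ≤ r.ht + 1 ∧ r.ht ≤ l.ht + 1

/-- The tree is stored in the fields `f`. -/
def In (f : Fld → ℤ → ℤ) : T → Prop
  | nil => True
  | node l q r => f .l q = l.ptr ∧ f .r q = r.ptr ∧ f .ht q = (max l.ht r.ht + 1 : ℕ) ∧
      l.In f ∧ r.In f

theorem In_congr {f f' : Fld → ℤ → ℤ} {t : T}
    (h : ∀ q ∈ t.list, f' .l q = f .l q ∧ f' .r q = f .r q ∧ f' .ht q = f .ht q)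
    (ht : t.In f) : t.In f' := by
  induction t with
  | nil => trivial
  | node l q r ihl ihr =>
    simp only [list, List.mem_append, List.mem_cons] at h
    obtain ⟨h1, h2, h3, h4, h5⟩ := ht
    obtain ⟨e1, e2, e3⟩ := h q (by simp)
    exact ⟨by rw [e1, h1], by rw [e2, h2], by rw [e3, h3], ihl (fun p hp => h p (by simp [hp])) h4,
      ihr (fun p hp => h p (by simp [hp])) h5⟩

theorem ht_le (t : T) : t.ht ≤ t.list.length := by
  induction t with
  | nil => simp [ht]
  | node l q r ihl ihr => simp [ht, list]; omega

/-- Both subtrees of a balanced tree have height at least that of the tree minus 2, so two levels at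
least double the size. This is weaker than the Fibonacci bound, but it suffices. -/
theorem two_pow_le {t : T} (h : t.Avl) : 2 ^ ((t.ht + 1) / 2) ≤ t.list.length + 1 := by
  induction t with
  | nil => simp [ht]
  | node l q r ihl ihr =>
    obtain ⟨h1, h2, h3, h4⟩ := h
    have i1 := ihl h1
    have i2 := ihr h2
    have p : (2 : ℕ) ^ ((max l.ht r.ht + 1 + 1) / 2) = 2 * 2 ^ ((max l.ht r.ht) / 2) := by
      rw [← pow_succ']; congr 1; omega
    have m1 : (2 : ℕ) ^ ((max l.ht r.ht) / 2) ≤ 2 ^ ((l.ht + 1) / 2) :=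
      Nat.pow_le_pow_right (by norm_num) (by omega)
    have m2 : (2 : ℕ) ^ ((max l.ht r.ht) / 2) ≤ 2 ^ ((r.ht + 1) / 2) :=
      Nat.pow_le_pow_right (by norm_num) (by omega)
    simp only [ht, list, List.length_append, List.length_cons, p]
    omega

theorem Avl.ht_le_log {t : T} (h : t.Avl) : t.ht ≤ 2 * Nat.log 2 (t.list.length + 1) := by
  have := Nat.le_log_of_pow_le (by norm_num) (two_pow_le h)
  omega

/-- The node with subtrees `x` on the side `s` and `y` on the other side. -/
def mk (s : Bool) (x : T) (q : ℤ) (y : T) : T :=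
  if s then node x q y else node y q x

/-- The pointers in order, seen from the side `s`. -/
def lst (s : Bool) (t : T) : List ℤ :=
  if s then t.list else t.list.reverse

theorem mem_lst {s : Bool} {t : T} {q : ℤ} : q ∈ t.lst s ↔ q ∈ t.list := by
  cases s <;> simp [lst]

theorem lst_mk (s : Bool) (x : T) (q : ℤ) (y : T) :
    (mk s x q y).lst s = x.lst s ++ q :: y.lst s := by
  cases s <;> simp [lst, mk, list]

theorem ptr_mk (s : Bool) (x : T) (q : ℤ) (y : T) : (mk s x q y).ptr = q := by
  cases s <;> simp [mk, ptr]

theorem ht_mk (s : Bool) (x : T) (q : ℤ) (y : T) : (mk s x q y).ht = max x.ht y.ht + 1 := by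
  cases s <;> simp [mk, ht, max_comm]

theorem avl_mk (s : Bool) (x : T) (q : ℤ) (y : T) :
    (mk s x q y).Avl ↔ x.Avl ∧ y.Avl ∧ x.ht ≤ y.ht + 1 ∧ y.ht ≤ x.ht + 1 := by
  cases s <;> simp [mk, Avl]; tauto

end T

/-- The field for the child on the side `s`. -/
def sl (s : Bool) : Fld := if s then .l else .r

/-- The field for the child on the side opposite to `s`. -/
def sr (s : Bool) : Fld := if s then .r else .l

theorem T.in_mk {f : Fld → ℤ → ℤ} (s : Bool) (x : T) (q : ℤ) (y : T) :
    (T.mk s x q y).In f ↔ f (sl s) q = x.ptr ∧ f (sr s) q = y.ptr ∧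
      f .ht q = (max x.ht y.ht + 1 : ℕ) ∧ x.In f ∧ y.In f := by
  cases s <;> simp [T.mk, T.In, sl, sr, max_comm]; tauto

theorem T.exists_mk (s : Bool) {t : T} (h : t.ht ≠ 0) : ∃ x q y, t = T.mk s x q y := by
  cases t with
  | nil => simp [T.ht] at h
  | node l q r =>
    cases s
    · exact ⟨r, q, l, by simp [T.mk]⟩
    · exact ⟨l, q, r, by simp [T.mk]⟩

variable {α : Type u} [LinearOrder α]

/-- Recomputes the height of the tree node in the register `y` from those of its children. -/
def fixht (y : Reg) : Prog :=
  .seq (blk [.ld .b1 .l y, .ld .b2 .r y, .ld .h1 .ht .b1, .ld .h2 .ht .b2])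
    (.ite (BT.lt .h1 .h2).compile
      (blk [.arith .add .h2 .h2 .one, .st .ht y .h2])
      (blk [.arith .add .h1 .h1 .one, .st .ht y .h1]))

/-- `a'` agrees with `a` up to the registers in `rs` and the integer fields. -/
structure Keeps (rs : List Reg) (a a' : AS α) : Prop where
  g : a'.g = a.g
  c : a'.c .c = a.c .c
  r : ∀ x, x ∉ rs → a'.r x = a.r x

omit [LinearOrder α] in
theorem Keeps.trans {rs : List Reg} {a a' a'' : AS α} (h : Keeps rs a a') (h' : Keeps rs a' a'') :
    Keeps rs a a'' :=
  ⟨h'.g.trans h.g, h'.c.trans h.c, fun x hx => (h'.r x hx).trans (h.r x hx)⟩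

omit [LinearOrder α] in
theorem Keeps.mono {rs rs' : List Reg} {a a' : AS α} (h : Keeps rs a a') (hs : rs ⊆ rs') :
    Keeps rs' a a' :=
  ⟨h.g, h.c, fun x hx => h.r x (fun hh => hx (hs hh))⟩

/-- A null pointer or a pointer to a tree node. -/
def TPtr (d M : ℕ) (p : ℤ) : Prop := p = 0 ∨ Blk d M (p - 5)

theorem T.ptr_valid {d M : ℕ} {t : T} (h : ∀ q ∈ t.list, Blk d M (q - 5)) : TPtr d M t.ptr := by
  cases t with
  | nil => exact Or.inl rfl
  | node l q r => exact Or.inr (h q (by simp [T.list]))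

/-- The null pointer has a height cell of its own, kept at 0, so the programs read the heights of
children without testing for empty trees. -/
theorem T.In.ht_ptr {f : Fld → ℤ → ℤ} {t : T} (h : t.In f) (h0 : f .ht 0 = 0) :
    f .ht t.ptr = t.ht := by
  cases t with
  | nil => simpa [T.ptr, T.ht] using h0
  | node l q r => exact h.2.2.1

theorem fixht_spec {E : Env α} {d : ℕ} (hE : Fits E d) (a : AS α) (y : Reg)
    (hy : y ∉ [Reg.b1, .b2, .h1, .h2, .one])
    (hone : a.r .one = 1) (hv : Blk d E.space (a.r y - 5))
    (hl : TPtr d E.space (a.f .l (a.r y))) (hr : TPtr d E.space (a.f .r (a.r y))) (m m' : ℕ)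
    (hm : a.f .ht (a.f .l (a.r y)) = m) (hm' : a.f .ht (a.f .r (a.r y)) = m')
    (hW : m + 1 ≤ E.wordMax) (hW' : m' + 1 ≤ E.wordMax) :
    Tr E d (fixht y) a 21 fun a' =>
      a'.f = Function.update a.f .ht (Function.update (a.f .ht) (a.r y) (max m m' + 1 : ℕ)) ∧
      Keeps [.b1, .b2, .h1, .h2] a a' := by
  simp only [List.mem_cons, List.not_mem_nil, or_false, not_or] at hy
  obtain ⟨y1, y2, y3, y4, y5⟩ := hy
  refine (Tr.seq (K := 13) (K' := 8) (Q := fun a1 => a1.f = a.f ∧ Keeps [.b1, .b2, .h1, .h2] a a1 ∧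
    a1.r .h1 = m ∧ a1.r .h2 = m') (Tr.blk hE ?_ ?_) ?_)
  · simp [Oks, Instr.Ok, Instr.ev, Fld.isChar, Valid, hv, y1, Function.update_of_ne]
    exact ⟨hl, hr⟩
  · refine ⟨rfl, ⟨rfl, rfl, fun x hx => ?_⟩, ?_, ?_⟩
    · simp only [List.mem_cons, List.not_mem_nil, or_false, not_or] at hx
      simp [evs, Instr.ev, Function.update_of_ne, hx]
    · simp [evs, Instr.ev, hm, y1]
    · simp [evs, Instr.ev, hm', y1]
  · rintro a1 ⟨f1, k1, e1, e2⟩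
    have o1 : a1.r .one = 1 := by rw [k1.r _ (by simp), hone]
    have ey : a1.r y = a.r y := k1.r _ (by simp [y1, y2, y3, y4])
    refine Tr.ite (K := 7) (m < m') (by simp [BT.Is, e1, e2]) (fun h => ?_) (fun h => ?_)
    · refine Tr.blk hE ?_ ?_
      · simp [Oks, Instr.Ok, Instr.ev, Fld.isChar, Valid, ArithOp.eval, y4, o1, e2, ey, hv]
        rw [abs_le]; omega
      · refine ⟨?_, k1.trans ⟨rfl, rfl, fun x hx => ?_⟩⟩
        · simp [evs, Instr.ev, ArithOp.eval, y4, ey, f1, e2, o1, max_eq_right h.le]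
        · simp only [List.mem_cons, List.not_mem_nil, or_false, not_or] at hx
          simp [evs, Instr.ev, Function.update_of_ne, hx]
    · refine Tr.blk hE ?_ ?_
      · simp [Oks, Instr.Ok, Instr.ev, Fld.isChar, Valid, ArithOp.eval, y3, o1, e1, ey, hv]
        rw [abs_le]; omega
      · refine ⟨?_, k1.trans ⟨rfl, rfl, fun x hx => ?_⟩⟩
        · simp [evs, Instr.ev, ArithOp.eval, y3, ey, f1, e1, o1, max_eq_left (not_lt.1 h)]
        · simp only [List.mem_cons, List.not_mem_nil, or_false, not_or] at hx
          simp [evs, Instr.ev, Function.update_of_ne, hx]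

end

/-! ### Rotations and rebalancing -/

section

variable {α : Type u} [LinearOrder α]

/-- `f'` agrees with `f` up to the children and heights of the tree nodes in `P`. -/
def TreeFrame (P : List ℤ) (f f' : Fld → ℤ → ℤ) : Prop :=
  ∀ fl p, (fl ∈ [Fld.l, .r, .ht] → p ∉ P) → f' fl p = f fl p

theorem TreeFrame.trans {P : List ℤ} {f f' f'' : Fld → ℤ → ℤ} (h : TreeFrame P f f')
    (h' : TreeFrame P f' f'') : TreeFrame P f f'' :=
  fun fl p hp => (h' fl p hp).trans (h fl p hp)

theorem TreeFrame.mono {P P' : List ℤ} {f f' : Fld → ℤ → ℤ} (h : TreeFrame P f f') (hs : P ⊆ P') :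
    TreeFrame P' f f' :=
  fun fl p hp => h fl p (fun h1 h2 => hp h1 (hs h2))

theorem T.In.frame {P : List ℤ} {f f' : Fld → ℤ → ℤ} (h : TreeFrame P f f') {t : T}
    (ht : t.In f) (hd : ∀ q ∈ t.list, q ∉ P) : t.In f' :=
  T.In_congr (fun q hq => ⟨h _ _ (fun _ => hd q hq), h _ _ (fun _ => hd q hq),
    h _ _ (fun _ => hd q hq)⟩) ht

/-- A double rotation at `tp` and its child `bl` on the side `s`, with inner grandchild `ba`. -/
def rotDouble (s : Bool) : Prog :=
  .seq (blk [.ld .b1 (sl s) .ba, .ld .b2 (sr s) .ba, .st (sr s) .bl .b1, .st (sl s) .tp .b2,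
      .st (sl s) .ba .bl, .st (sr s) .ba .tp])
    (.seq (fixht .bl) (.seq (fixht .tp) (.seq (fixht .ba) (blk [.copy .q .ba]))))

/-- A single rotation at `tp` and its child `bl` on the side `s`, with inner grandchild `ba`. -/
def rotSingle (s : Bool) : Prog :=
  .seq (blk [.st (sl s) .tp .ba, .st (sr s) .bl .tp])
    (.seq (fixht .tp) (.seq (fixht .bl) (blk [.copy .q .bl])))

/-- Rebalances the tree at `tp`, whose child `bl` on the side `s` is too high. -/
def balSide (s : Bool) : Prog :=
  .seq (blk [.ld .b1 (sl s) .bl, .ld .ba (sr s) .bl, .ld .h1 .ht .b1, .ld .h2 .ht .ba])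
    (.ite (BT.lt .h1 .h2).compile (rotDouble s) (rotSingle s))

/-- The registers used by the rebalancing routines. -/
def balRegs : List Reg := [.q, .bl, .br, .ba, .b1, .b2, .h1, .h2, .h3]

/-- Only the height cell of the root is written, and the pointers are distinct, so the subtrees stay
stored. The side `s` makes one statement serve a rotation and its mirror image. -/
theorem fixht_mk {E : Env α} {d : ℕ} (hE : Fits E d) (s : Bool) (a : AS α) (y : Reg)
    (hy : y ∉ [Reg.b1, .b2, .h1, .h2, .one]) (h0 : a.f .ht 0 = 0)
    (hone : a.r .one = 1) (t1 t2 : T) (h1 : a.f (sl s) (a.r y) = t1.ptr)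
    (h2 : a.f (sr s) (a.r y) = t2.ptr) (hin1 : t1.In a.f) (hin2 : t2.In a.f)
    (hv : ∀ q ∈ t1.lst s ++ a.r y :: t2.lst s, Blk d E.space (q - 5))
    (hd : (t1.lst s ++ a.r y :: t2.lst s).Nodup)
    (hW : t1.list.length + t2.list.length + 1 ≤ E.wordMax) :
    Tr E d (fixht y) a 21 fun a' =>
      (T.mk s t1 (a.r y) t2).In a'.f ∧
      (∀ fl p, (fl = .ht → p ≠ a.r y) → a'.f fl p = a.f fl p) ∧
      Keeps [.b1, .b2, .h1, .h2] a a' := by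
  have l1 := t1.ht_le
  have l2 := t2.ht_le
  simp only [List.mem_append, List.mem_cons, T.mem_lst] at hv
  have v1 : TPtr d E.space t1.ptr := T.ptr_valid fun q hq => hv q (by simp [hq])
  have v2 : TPtr d E.space t2.ptr := T.ptr_valid fun q hq => hv q (by simp [hq])
  have n1 : ∀ q ∈ t1.list, q ≠ a.r y := by
    rintro q hq rfl
    simp only [List.nodup_append, T.mem_lst, List.mem_cons] at hd
    exact hd.2.2 _ hq _ (Or.inl rfl) rfl
  have n2 : ∀ q ∈ t2.list, q ≠ a.r y := by
    rintro q hq rfl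
    simp only [List.nodup_append, List.nodup_cons, T.mem_lst] at hd
    exact hd.2.1.1 hq
  have key : Tr E d (fixht y) a 21 fun a' =>
      a'.f = Function.update a.f .ht (Function.update (a.f .ht) (a.r y)
        (max t1.ht t2.ht + 1 : ℕ)) ∧ Keeps [.b1, .b2, .h1, .h2] a a' := by
    cases s
    · simp only [sl, sr, Bool.false_eq_true, if_false] at h1 h2
      rw [max_comm]
      exact fixht_spec hE a y hy hone (hv _ (by simp)) (h2 ▸ v2) (h1 ▸ v1) _ _
        (h2 ▸ hin2.ht_ptr h0) (h1 ▸ hin1.ht_ptr h0) (by omega) (by omega)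
    · simp only [sl, sr, if_true] at h1 h2
      exact fixht_spec hE a y hy hone (hv _ (by simp)) (h1 ▸ v1) (h2 ▸ v2) _ _
        (h1 ▸ hin1.ht_ptr h0) (h2 ▸ hin2.ht_ptr h0) (by omega) (by omega)
  refine key.mono le_rfl ?_
  rintro a' ⟨hf, hk⟩
  have fr : ∀ fl p, (fl = .ht → p ≠ a.r y) → a'.f fl p = a.f fl p := by
    intro fl p h
    rw [hf]
    by_cases e : fl = .ht
    · subst e; simp [h rfl]
    · simp [Function.update_of_ne e]
  refine ⟨(T.in_mk _ _ _ _).2 ⟨?_, ?_, ?_, ?_, ?_⟩, fr, hk⟩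
  · rw [fr _ _ (by cases s <;> simp [sl]), h1]
  · rw [fr _ _ (by cases s <;> simp [sr]), h2]
  · simp [hf]
  · exact T.In_congr (fun q hq => ⟨fr _ _ (by simp), fr _ _ (by simp), fr _ _ fun _ => n1 q hq⟩) hin1
  · exact T.In_congr (fun q hq => ⟨fr _ _ (by simp), fr _ _ (by simp), fr _ _ fun _ => n2 q hq⟩) hin2

theorem sl_ne_sr (s : Bool) : sl s ≠ sr s := by cases s <;> simp [sl, sr]

theorem sl_props (s : Bool) : (sl s).isChar = false ∧ (sr s).isChar = false ∧ sl s ≠ .ht ∧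
    sr s ≠ .ht ∧ sl s ∈ [Fld.l, .r, .ht] ∧ sr s ∈ [Fld.l, .r, .ht] := by
  cases s <;> simp [sl, sr, Fld.isChar]

theorem valid_side {d M : ℕ} {p : ℤ} (s : Bool) (h : Blk d M (p - 5)) :
    Valid d M (sl s) p ∧ Valid d M (sr s) p := by
  cases s <;> simpa [sl, sr, Valid] using h

theorem T.list_length_lst (s : Bool) (t : T) : (t.lst s).length = t.list.length := by
  cases s <;> simp [T.lst]

theorem Blk.pos {d M : ℕ} {p : ℤ} (h : Blk d M (p - 5)) : 0 < p := by
  obtain ⟨k, h, -⟩ := h; omega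

theorem T.In.frame_ht {f f' : Fld → ℤ → ℤ} {p : ℤ}
    (h : ∀ fl q, (fl = .ht → q ≠ p) → f' fl q = f fl q) {t : T} (ht : t.In f)
    (hp : ∀ q ∈ t.list, q ≠ p) : t.In f' :=
  T.In_congr (fun q hq => ⟨h _ _ fun _ => hp q hq, h _ _ fun _ => hp q hq,
    h _ _ fun _ => hp q hq⟩) ht

/-- A rotation preserves the in-order list `L`, so it is a pure relinking; balance plays no role
here and is left to `balSide_spec`. -/
theorem rotDouble_spec {E : Env α} {d : ℕ} (hE : Fits E d) (s : Bool) (a : AS α)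
    (h0 : a.f .ht 0 = 0) (hone : a.r .one = 1) (ll t1 t2 y : T) (x b m : ℤ) (hx : a.r .tp = x)
    (hb : a.r .bl = b) (hm : a.r .ba = m)
    (hin1 : ll.In a.f) (i3 : t1.In a.f) (i4 : t2.In a.f) (hin3 : y.In a.f)
    (hx2 : a.f (sr s) x = y.ptr) (hb1 : a.f (sl s) b = ll.ptr)
    (i1 : a.f (sl s) m = t1.ptr) (i2 : a.f (sr s) m = t2.ptr)
    (L : List ℤ) (hL : L = ll.lst s ++ b :: (t1.lst s ++ m :: (t2.lst s ++ x :: y.lst s)))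
    (hv : ∀ q ∈ L, Blk d E.space (q - 5)) (hd : L.Nodup) (hW : L.length + 1 ≤ E.wordMax) :
    Tr E d (rotDouble s) a 86 fun a' =>
      (T.mk s (T.mk s ll b t1) m (T.mk s t2 x y)).In a'.f ∧ a'.r .q = m ∧
      Keeps balRegs a a' ∧ TreeFrame L a.f a'.f := by
  obtain ⟨c1, c2, c3, c4, c5, c6⟩ := sl_props s
  have c7 := sl_ne_sr s
  have hvq : ∀ q, (q ∈ ll.list ∨ q = b ∨ q ∈ t1.list ∨ q = m ∨ q ∈ t2.list ∨ q = x ∨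
      q ∈ y.list) ↔ q ∈ L := by
    intro q
    simp only [hL, List.mem_append, List.mem_cons, T.mem_lst]
  have vb : Blk d E.space (b - 5) := hv b ((hvq _).1 (by simp))
  have vx : Blk d E.space (x - 5) := hv x ((hvq _).1 (by simp))
  have vm : Blk d E.space (m - 5) := hv m ((hvq _).1 (by simp))
  have sb := valid_side s vb
  have sx := valid_side s vx
  have sm := valid_side s vm
  -- All disequalities of pointers that separate the stores below come from the absence of
  -- repetitions in the in-order list.
  have dd := hd
  simp only [hL, List.nodup_append, List.nodup_cons, List.mem_append, List.mem_cons,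
    not_or, T.mem_lst] at dd
  obtain ⟨-, ⟨⟨nb1, nbm, nb2, nbx, nby⟩, -, ⟨⟨nm2, nmx, nmy⟩, -, ⟨nxy, -⟩, n2⟩, n1⟩, n3⟩ := dd
  have n2x : ∀ q ∈ t2.list, q ≠ x := fun q hq => n2 q hq x (by simp)
  have n1x : ∀ q ∈ t1.list, q ≠ x := fun q hq => n1 q hq x (by simp)
  have n1m : ∀ q ∈ t1.list, q ≠ m := fun q hq => n1 q hq m (by simp)
  have nlx : ∀ q ∈ ll.list, q ≠ x := fun q hq => n3 q hq x (by simp)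
  have nlm : ∀ q ∈ ll.list, q ≠ m := fun q hq => n3 q hq m (by simp)
  have nlb : ∀ q ∈ ll.list, q ≠ b := fun q hq => n3 q hq b (by simp)
  have nym : ∀ q ∈ y.list, q ≠ m := by rintro q hq rfl; exact nmy hq
  have n2m : ∀ q ∈ t2.list, q ≠ m := by rintro q hq rfl; exact nm2 hq
  have n1b : ∀ q ∈ t1.list, q ≠ b := by rintro q hq rfl; exact nb1 hq
  have n2b : ∀ q ∈ t2.list, q ≠ b := by rintro q hq rfl; exact nb2 hq
  have nyb : ∀ q ∈ y.list, q ≠ b := by rintro q hq rfl; exact nby hq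
  have nyx : ∀ q ∈ y.list, q ≠ x := by rintro q hq rfl; exact nxy hq
  have nmb : m ≠ b := fun h => nbm h.symm
  have nxb : x ≠ b := fun h => nbx h.symm
  have nxm : x ≠ m := fun h => nmx h.symm
  refine (Tr.seq (K := 19) (K' := 67) (Q := fun a2 => Keeps balRegs a a2 ∧
    a2.r .ba = m ∧ a2.r .bl = b ∧ (∀ fl p, fl ≠ sl s → fl ≠ sr s → a2.f fl p = a.f fl p) ∧
    (∀ fl p, p ≠ b → p ≠ m → p ≠ x → a2.f fl p = a.f fl p) ∧
    a2.f (sl s) b = ll.ptr ∧ a2.f (sr s) b = t1.ptr ∧ a2.f (sl s) x = t2.ptr ∧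
    a2.f (sr s) x = y.ptr ∧ a2.f (sl s) m = b ∧ a2.f (sr s) m = x) (Tr.blk hE ?_ ?_) ?_)
  · simp [Oks, Instr.Ok, Instr.ev, hx, hb, hm, c1, c2, sb, sx, sm]
  · refine ⟨⟨rfl, rfl, fun x hx => ?_⟩, ?_, ?_, ?_, ?_, ?_⟩
    · simp only [balRegs, List.mem_cons, List.not_mem_nil, or_false, not_or] at hx
      simp [evs, Instr.ev, Function.update_of_ne, hx]
    · simp [evs, Instr.ev, hm]
    · simp [evs, Instr.ev, hb]
    · intro fl p h1 h2
      simp [evs, Instr.ev, Function.update_of_ne, h1, h2]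
    · intro fl p h1 h2 h3
      by_cases g1 : fl = sl s
      · subst g1; simp [evs, Instr.ev, hm, hb, hx, h2, h3, c7]
      · by_cases g2 : fl = sr s
        · subst g2; simp [evs, Instr.ev, hm, hb, hx, h1, h2, c7.symm]
        · simp [evs, Instr.ev, Function.update_of_ne, g1, g2]
    · simp [evs, Instr.ev, hm, hb, hx, c7, c7.symm, i1, i2, hb1, hx2, nbm, nbx,
        nxb, nxm]
  rintro a2 ⟨k2, em, eb, g1, g2, fb1, fb2, fx1, fx2, fm1, fm2⟩
  have ex2 : a2.r .tp = x := by rw [k2.r _ (by simp [balRegs]), hx]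
  have o2 : a2.r .one = 1 := by rw [k2.r _ (by simp [balRegs]), hone]
  have z2 : a2.f .ht 0 = 0 := by rw [g1 _ _ c3.symm c4.symm]; exact h0
  have fr2 : ∀ t : T, t.In a.f → (∀ q ∈ t.list, q ≠ b) → (∀ q ∈ t.list, q ≠ m) →
      (∀ q ∈ t.list, q ≠ x) → t.In a2.f := fun t ht h1 h2 h3 =>
    T.In_congr (fun q hq => ⟨g2 _ _ (h1 q hq) (h2 q hq) (h3 q hq),
      g2 _ _ (h1 q hq) (h2 q hq) (h3 q hq), g2 _ _ (h1 q hq) (h2 q hq) (h3 q hq)⟩) ht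
  have hle := T.list_length_lst s
  have hlen : L.length = ll.list.length + t1.list.length + t2.list.length + y.list.length + 3 := by
    simp only [hL, List.length_append, List.length_cons, hle]; omega
  have d1 : (ll.lst s ++ b :: t1.lst s).Nodup := by
    rw [hL] at hd
    refine hd.sublist ?_
    simp
  have d2 : (t2.lst s ++ x :: y.lst s).Nodup := by
    have : L = (ll.lst s ++ b :: (t1.lst s ++ [m])) ++ (t2.lst s ++ x :: y.lst s) := by simp [hL]
    rw [this] at hd
    exact (List.nodup_append.1 hd).2.1
  -- Heights are recomputed bottom-up: first at the two nodes that become children, then at the new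
  -- root.
  refine Tr.seq (K := 21) (K' := 46) (fixht_mk hE s a2 .bl (by simp) z2 o2 ll t1
    (by rw [eb]; exact fb1) (by rw [eb]; exact fb2)
    (fr2 _ hin1 nlb nlm nlx) (fr2 _ i3 n1b n1m n1x) ?_ (by rw [eb]; exact d1) (by omega)) ?_
  · intro q hq
    simp only [eb, List.mem_append, List.mem_cons, T.mem_lst] at hq
    exact hv q ((hvq q).1 (by tauto))
  rintro a3 ⟨T1, g3, k3⟩
  rw [eb] at T1 g3
  have ex3 : a3.r .tp = x := by rw [k3.r _ (by simp), ex2]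
  have o3 : a3.r .one = 1 := by rw [k3.r _ (by simp), o2]
  have z3 : a3.f .ht 0 = 0 := by rw [g3 _ _ (fun _ => vb.pos.ne), z2]
  refine Tr.seq (K := 21) (K' := 25) (fixht_mk hE s a3 .tp (by simp) z3 o3 t2 y
    (by rw [ex3, g3 _ _ (by simp [c3])]; exact fx1)
    (by rw [ex3, g3 _ _ (by simp [c4])]; exact fx2)
    (T.In.frame_ht g3 (fr2 _ i4 n2b n2m n2x) n2b) (T.In.frame_ht g3 (fr2 _ hin3 nyb nym nyx) nyb) ?_
    (by rw [ex3]; exact d2) (by omega)) ?_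
  · intro q hq
    simp only [ex3, List.mem_append, List.mem_cons, T.mem_lst] at hq
    exact hv q ((hvq q).1 (by tauto))
  rintro a4 ⟨T2, g4, k4⟩
  rw [ex3] at T2 g4
  have em4 : a4.r .ba = m := by rw [k4.r _ (by simp), k3.r _ (by simp), em]
  have o4 : a4.r .one = 1 := by rw [k4.r _ (by simp), o3]
  have z4 : a4.f .ht 0 = 0 := by rw [g4 _ _ (fun _ => vx.pos.ne), z3]
  have T1' : (T.mk s ll b t1).In a4.f := by
    refine T.In.frame_ht g4 T1 fun q hq => ?_
    rw [← T.mem_lst (s := s), T.lst_mk] at hq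
    simp only [List.mem_append, List.mem_cons, T.mem_lst] at hq
    rcases hq with hq | rfl | hq
    exacts [nlx q hq, nbx, n1x q hq]
  refine Tr.seq (K := 21) (K' := 4) (fixht_mk hE s a4 .ba (by simp) z4 o4 (T.mk s ll b t1)
    (T.mk s t2 x y)
    (by rw [em4, g4 _ _ (by simp [c3]), g3 _ _ (by simp [c3]), T.ptr_mk]; exact fm1)
    (by rw [em4, g4 _ _ (by simp [c4]), g3 _ _ (by simp [c4]), T.ptr_mk]; exact fm2)
    T1' T2 ?_ (by rw [em4, T.lst_mk, T.lst_mk]; simpa [hL] using hd) ?_) ?_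
  · intro q hq
    simp only [em4, T.lst_mk, List.mem_append, List.mem_cons, T.mem_lst] at hq
    exact hv q ((hvq q).1 (by tauto))
  · rw [← hle, ← hle, T.lst_mk, T.lst_mk]
    simp only [List.length_append, List.length_cons, hle]
    omega
  rintro a5 ⟨T3, g5, k5⟩
  rw [em4] at T3 g5
  have hs : ([.b1, .b2, .h1, .h2] : List Reg) ⊆ balRegs := by simp [balRegs]
  refine Tr.blk hE ?_ ⟨T3, ?_, ?_, ?_⟩
  · simp [Oks, Instr.Ok]
  · simp [evs, Instr.ev, k5.r, em4]
  · refine (((k2.trans (k3.mono hs)).trans (k4.mono hs)).trans (k5.mono hs)).trans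
      ⟨rfl, rfl, fun x hx => ?_⟩
    simp only [balRegs, List.mem_cons, List.not_mem_nil, or_false, not_or] at hx
    simp [evs, Instr.ev, Function.update_of_ne, hx]
  · intro fl p hp
    change a5.f fl p = _
    rw [← hvq] at hp
    by_cases hfl : fl ∈ [Fld.l, .r, .ht]
    · have hp := hp hfl
      simp only [not_or] at hp
      rw [g5 _ _ fun _ => hp.2.2.2.1, g4 _ _ fun _ => hp.2.2.2.2.2.1, g3 _ _ fun _ => hp.2.1,
        g2 _ _ hp.2.1 hp.2.2.2.1 hp.2.2.2.2.2.1]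
    · have hfl' : fl ≠ .ht := by rintro rfl; simp at hfl
      rw [g5 _ _ fun h => absurd h hfl', g4 _ _ fun h => absurd h hfl',
        g3 _ _ fun h => absurd h hfl', g1]
      · rintro rfl; exact hfl c5
      · rintro rfl; exact hfl c6

/-- The bound 86 is generous; it agrees with that of the double rotation because both are branches
of one conditional. -/
theorem rotSingle_spec {E : Env α} {d : ℕ} (hE : Fits E d) (s : Bool) (a : AS α)
    (h0 : a.f .ht 0 = 0) (hone : a.r .one = 1) (ll lr y : T) (x b : ℤ) (hx : a.r .tp = x)
    (hb : a.r .bl = b) (hm : a.r .ba = lr.ptr)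
    (hin1 : ll.In a.f) (hin2 : lr.In a.f) (hin3 : y.In a.f)
    (hx2 : a.f (sr s) x = y.ptr) (hb1 : a.f (sl s) b = ll.ptr)
    (L : List ℤ) (hL : L = ll.lst s ++ b :: (lr.lst s ++ x :: y.lst s))
    (hv : ∀ q ∈ L, Blk d E.space (q - 5)) (hd : L.Nodup) (hW : L.length + 1 ≤ E.wordMax) :
    Tr E d (rotSingle s) a 86 fun a' =>
      (T.mk s ll b (T.mk s lr x y)).In a'.f ∧ a'.r .q = b ∧
      Keeps balRegs a a' ∧ TreeFrame L a.f a'.f := by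
  obtain ⟨c1, c2, c3, c4, c5, c6⟩ := sl_props s
  have c7 := sl_ne_sr s
  have hvq : ∀ q, (q ∈ ll.list ∨ q = b ∨ q ∈ lr.list ∨ q = x ∨ q ∈ y.list) ↔ q ∈ L := by
    intro q
    simp only [hL, List.mem_append, List.mem_cons, T.mem_lst]
  have vb : Blk d E.space (b - 5) := hv b ((hvq _).1 (by simp))
  have vx : Blk d E.space (x - 5) := hv x ((hvq _).1 (by simp))
  have sb := valid_side s vb
  have sx := valid_side s vx
  have dd := hd
  simp only [hL, List.nodup_append, List.nodup_cons, List.mem_append, List.mem_cons,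
    not_or, T.mem_lst] at dd
  obtain ⟨-, ⟨⟨nb1, nbx, nby⟩, -, ⟨nxy, -⟩, n1⟩, n3⟩ := dd
  have n1x : ∀ q ∈ lr.list, q ≠ x := fun q hq => n1 q hq x (by simp)
  have nlx : ∀ q ∈ ll.list, q ≠ x := fun q hq => n3 q hq x (by simp)
  have nlb : ∀ q ∈ ll.list, q ≠ b := fun q hq => n3 q hq b (by simp)
  have n1b : ∀ q ∈ lr.list, q ≠ b := by rintro q hq rfl; exact nb1 hq
  have nyb : ∀ q ∈ y.list, q ≠ b := by rintro q hq rfl; exact nby hq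
  have nyx : ∀ q ∈ y.list, q ≠ x := by rintro q hq rfl; exact nxy hq
  have nxb : x ≠ b := fun h => nbx h.symm
  refine (Tr.seq (K := 7) (K' := 46) (Q := fun a2 => Keeps balRegs a a2 ∧
    a2.r .bl = b ∧ (∀ fl p, fl ≠ sl s → fl ≠ sr s → a2.f fl p = a.f fl p) ∧
    (∀ fl p, p ≠ b → p ≠ x → a2.f fl p = a.f fl p) ∧
    a2.f (sl s) b = ll.ptr ∧ a2.f (sr s) b = x ∧ a2.f (sl s) x = lr.ptr ∧
    a2.f (sr s) x = y.ptr) (Tr.blk hE ?_ ?_) ?_).mono (by norm_num) fun _ h => h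
  · simp [Oks, Instr.Ok, Instr.ev, hx, hb, c1, c2, sb, sx]
  · refine ⟨⟨rfl, rfl, fun x hx => ?_⟩, ?_, ?_, ?_, ?_⟩
    · simp only [balRegs, List.mem_cons, List.not_mem_nil, or_false, not_or] at hx
      simp [evs, Instr.ev]
    · simp [evs, Instr.ev, hb]
    · intro fl p h1 h2
      simp [evs, Instr.ev, Function.update_of_ne, h1, h2]
    · intro fl p h1 h2
      by_cases g1 : fl = sl s
      · subst g1; simp [evs, Instr.ev, hx, h2, c7]
      · by_cases g2 : fl = sr s
        · subst g2; simp [evs, Instr.ev, hb, hx, h1, c7.symm]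
        · simp [evs, Instr.ev, Function.update_of_ne, g1, g2]
    · simp [evs, Instr.ev, hm, hb, hx, c7, c7.symm, hb1, hx2, nbx, nxb]
  rintro a2 ⟨k2, eb, g1, g2, fb1, fb2, fx1, fx2⟩
  have ex2 : a2.r .tp = x := by rw [k2.r _ (by simp [balRegs]), hx]
  have o2 : a2.r .one = 1 := by rw [k2.r _ (by simp [balRegs]), hone]
  have z2 : a2.f .ht 0 = 0 := by rw [g1 _ _ c3.symm c4.symm]; exact h0
  have fr2 : ∀ t : T, t.In a.f → (∀ q ∈ t.list, q ≠ b) →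
      (∀ q ∈ t.list, q ≠ x) → t.In a2.f := fun t ht h1 h3 =>
    T.In_congr (fun q hq => ⟨g2 _ _ (h1 q hq) (h3 q hq),
      g2 _ _ (h1 q hq) (h3 q hq), g2 _ _ (h1 q hq) (h3 q hq)⟩) ht
  have hle := T.list_length_lst s
  have hlen : L.length = ll.list.length + lr.list.length + y.list.length + 2 := by
    simp only [hL, List.length_append, List.length_cons, hle]; omega
  have d2 : (lr.lst s ++ x :: y.lst s).Nodup := by
    have : L = (ll.lst s ++ [b]) ++ (lr.lst s ++ x :: y.lst s) := by simp [hL]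
    rw [this] at hd
    exact (List.nodup_append.1 hd).2.1
  refine Tr.seq (K := 21) (K' := 25) (fixht_mk hE s a2 .tp (by simp) z2 o2 lr y
    (by rw [ex2]; exact fx1) (by rw [ex2]; exact fx2)
    (fr2 _ hin2 n1b n1x) (fr2 _ hin3 nyb nyx) ?_ (by rw [ex2]; exact d2) (by omega)) ?_
  · intro q hq
    simp only [ex2, List.mem_append, List.mem_cons, T.mem_lst] at hq
    exact hv q ((hvq q).1 (by tauto))
  rintro a3 ⟨T1, g3, k3⟩
  rw [ex2] at T1 g3
  have eb3 : a3.r .bl = b := by rw [k3.r _ (by simp), eb]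
  have o3 : a3.r .one = 1 := by rw [k3.r _ (by simp), o2]
  have z3 : a3.f .ht 0 = 0 := by rw [g3 _ _ (fun _ => vx.pos.ne), z2]
  refine Tr.seq (K := 21) (K' := 4) (fixht_mk hE s a3 .bl (by simp) z3 o3 ll (T.mk s lr x y)
    (by rw [eb3, g3 _ _ (by simp [c3])]; exact fb1)
    (by rw [eb3, g3 _ _ (by simp [c4]), T.ptr_mk]; exact fb2)
    (T.In.frame_ht g3 (fr2 _ hin1 nlb nlx) nlx) T1 ?_
    (by rw [eb3, T.lst_mk]; simpa [hL] using hd) ?_) ?_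
  · intro q hq
    simp only [eb3, T.lst_mk, List.mem_append, List.mem_cons, T.mem_lst] at hq
    exact hv q ((hvq q).1 (by tauto))
  · rw [← hle (T.mk s lr x y), T.lst_mk]
    simp only [List.length_append, List.length_cons, hle]
    omega
  rintro a4 ⟨T2, g4, k4⟩
  rw [eb3] at T2 g4
  have hs : ([.b1, .b2, .h1, .h2] : List Reg) ⊆ balRegs := by simp [balRegs]
  refine Tr.blk hE ?_ ⟨T2, ?_, ?_, ?_⟩
  · simp [Oks, Instr.Ok]
  · simp [evs, Instr.ev, k4.r, eb3]
  · refine ((k2.trans (k3.mono hs)).trans (k4.mono hs)).trans ⟨rfl, rfl, fun x hx => ?_⟩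
    simp only [balRegs, List.mem_cons, List.not_mem_nil, or_false, not_or] at hx
    simp [evs, Instr.ev, Function.update_of_ne, hx]
  · intro fl p hp
    change a4.f fl p = _
    rw [← hvq] at hp
    by_cases hfl : fl ∈ [Fld.l, .r, .ht]
    · have hp := hp hfl
      simp only [not_or] at hp
      rw [g4 _ _ fun _ => hp.2.1, g3 _ _ fun _ => hp.2.2.2.1, g2 _ _ hp.2.1 hp.2.2.2.1]
    · have hfl' : fl ≠ .ht := by rintro rfl; simp at hfl
      rw [g4 _ _ fun h => absurd h hfl', g3 _ _ fun h => absurd h hfl', g1]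
      · rintro rfl; exact hfl c5
      · rintro rfl; exact hfl c6

/-- A double rotation is needed exactly if the inner grandchild is higher than the outer one. If
both have the same height, which happens after deletions, a single rotation works and the height
stays `y.ht + 3`; otherwise it drops to `y.ht + 2`. -/
theorem balSide_spec {E : Env α} {d : ℕ} (hE : Fits E d) (s : Bool) (a : AS α) (h0 : a.f .ht 0 = 0)
    (hone : a.r .one = 1) (t y : T) (x : ℤ) (hx : a.r .tp = x) (hb : a.r .bl = t.ptr)
    (hin1 : t.In a.f) (hin3 : y.In a.f) (hx2 : a.f (sr s) x = y.ptr)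
    (L : List ℤ) (hL : L = t.lst s ++ x :: y.lst s)
    (hv : ∀ q ∈ L, Blk d E.space (q - 5)) (hd : L.Nodup) (hW : L.length + 1 ≤ E.wordMax)
    (ha1 : t.Avl) (ha2 : y.Avl) (hh : t.ht = y.ht + 2) :
    Tr E d (balSide s) a 100 fun a' => ∃ t' : T,
      t'.lst s = L ∧ t'.In a'.f ∧ t'.Avl ∧ y.ht + 2 ≤ t'.ht ∧ t'.ht ≤ y.ht + 3 ∧ a'.r .q = t'.ptr ∧
      Keeps balRegs a a' ∧ TreeFrame L a.f a'.f := by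
  obtain ⟨c1, c2, -⟩ := sl_props s
  obtain ⟨ll, b, lr, rfl⟩ := T.exists_mk s (t := t) (by omega)
  rw [T.ptr_mk] at hb
  rw [T.lst_mk] at hL
  rw [T.in_mk] at hin1
  obtain ⟨hb1, hb2, -, il, ir⟩ := hin1
  have hl := il.ht_ptr h0
  have hr := ir.ht_ptr h0
  have vb : Blk d E.space (b - 5) := hv b (by simp [hL])
  have vl : TPtr d E.space ll.ptr := T.ptr_valid fun q hq => hv q (by simp [hL, T.mem_lst, hq])
  have vr : TPtr d E.space lr.ptr := T.ptr_valid fun q hq => hv q (by simp [hL, T.mem_lst, hq])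
  have sb := valid_side s vb
  rw [T.ht_mk] at hh
  rw [T.avl_mk] at ha1
  obtain ⟨al, ar, a3, a4⟩ := ha1
  refine (Tr.seq (K := 13) (K' := 87) (Q := fun a1 => a1.f = a.f ∧ Keeps balRegs a a1 ∧
    a1.r .h1 = ll.ht ∧ a1.r .h2 = lr.ht ∧ a1.r .ba = lr.ptr ∧ a1.r .bl = b) (Tr.blk hE ?_ ?_) ?_)
  · have : Fld.ht.isChar = false := rfl
    simp only [Valid, TPtr] at *
    simp [Oks, Instr.Ok, Instr.ev, Valid, hb, hb1, hb2, c1, c2, sb, this]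
    exact ⟨vl, vr⟩
  · refine ⟨rfl, ⟨rfl, rfl, fun x hx => ?_⟩, ?_, ?_, ?_, ?_⟩
    · simp only [balRegs, List.mem_cons, List.not_mem_nil, or_false, not_or] at hx
      simp [evs, Instr.ev, Function.update_of_ne, hx]
    all_goals simp [evs, Instr.ev, hb, hb1, hb2, hl, hr]
  rintro a1 ⟨f1, k1, e1, e2, e3, e4⟩
  have o1 : a1.r .one = 1 := by rw [k1.r _ (by simp [balRegs]), hone]
  have ex : a1.r .tp = x := by rw [k1.r _ (by simp [balRegs]), hx]
  rw [← f1] at h0 il ir hin3 hx2 hb1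
  refine Tr.ite (K := 86) (ll.ht < lr.ht) (by simp [BT.Is, e1, e2]) (fun h => ?_) (fun h => ?_)
  · obtain ⟨t1, m, t2, rfl⟩ := T.exists_mk s (t := lr) (by omega)
    rw [T.ptr_mk] at e3
    rw [T.avl_mk] at ar
    rw [T.ht_mk] at *
    rw [T.in_mk] at ir
    obtain ⟨i1, i2, -, i3, i4⟩ := ir
    refine (rotDouble_spec hE s a1 h0 o1 ll t1 t2 y x b m ex e4 e3 il i3 i4 hin3 hx2 hb1 i1 i2
      L (by simp [hL, T.lst_mk]) hv hd hW).mono le_rfl ?_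
    rintro a2 ⟨j1, j2, j3, j4⟩
    refine ⟨_, ?_, j1, ?_, ?_, ?_, ?_, k1.trans j3, f1 ▸ j4⟩
    · simp [hL, T.lst_mk]
    · simp only [T.avl_mk, T.ht_mk]
      refine ⟨⟨al, ar.1, ?_, ?_⟩, ⟨ar.2.1, ha2, ?_, ?_⟩, ?_, ?_⟩ <;> omega
    · simp only [T.ht_mk]; omega
    · simp only [T.ht_mk]; omega
    · rw [T.ptr_mk, j2]
  · refine (rotSingle_spec hE s a1 h0 o1 ll lr y x b ex e4 e3 il ir hin3 hx2 hb1
      L (by simp [hL]) hv hd hW).mono le_rfl ?_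
    rintro a2 ⟨j1, j2, j3, j4⟩
    refine ⟨_, ?_, j1, ?_, ?_, ?_, ?_, k1.trans j3, f1 ▸ j4⟩
    · simp [hL, T.lst_mk]
    · simp only [T.avl_mk, T.ht_mk]
      refine ⟨al, ⟨ar, ha2, ?_, ?_⟩, ?_, ?_⟩ <;> omega
    · simp only [T.ht_mk]; omega
    · simp only [T.ht_mk]; omega
    · rw [T.ptr_mk, j2]

/-- Rebalances the tree at `tp`, and puts the new root into `q`. -/
def balance : Prog :=
  .seq (blk [.ld .bl .l .tp, .ld .br .r .tp, .ld .h1 .ht .bl, .ld .h2 .ht .br,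
      .arith .add .b1 .h1 .one, .arith .add .b2 .h2 .one])
    (.ite (BT.lt .b2 .h1).compile (balSide true)
      (.ite (BT.lt .b1 .h2).compile (.seq (blk [.copy .bl .br]) (balSide false))
        (.seq (fixht .tp) (blk [.copy .q .tp]))))

/-- The clause on trees that need no rotation is required in `ascend_spec`: the bounds `max` and
`max + 1` alone would not keep the height within 1 of its old value. -/
theorem balance_spec {E : Env α} {d : ℕ} (hE : Fits E d) (a : AS α) (h0 : a.f .ht 0 = 0)
    (hone : a.r .one = 1) (tl tr : T) (x : ℤ) (hx : a.r .tp = x) (hx1 : a.f .l x = tl.ptr)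
    (hx2 : a.f .r x = tr.ptr) (hin1 : tl.In a.f) (hin2 : tr.In a.f) 
    (L : List ℤ) (hL : L = tl.list ++ x :: tr.list)
    (hv : ∀ q ∈ L, Blk d E.space (q - 5)) (hd : L.Nodup) (hW : L.length + 1 ≤ E.wordMax)
    (ha1 : tl.Avl) (ha2 : tr.Avl) (hh1 : tl.ht ≤ tr.ht + 2) (hh2 : tr.ht ≤ tl.ht + 2) :
    Tr E d balance a 130 fun a' => ∃ t' : T,
      t'.list = L ∧ t'.In a'.f ∧ t'.Avl ∧ max tl.ht tr.ht ≤ t'.ht ∧ t'.ht ≤ max tl.ht tr.ht + 1 ∧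
      (tl.ht ≤ tr.ht + 1 → tr.ht ≤ tl.ht + 1 → t'.ht = max tl.ht tr.ht + 1) ∧ a'.r .q = t'.ptr ∧
      Keeps balRegs a a' ∧ TreeFrame L a.f a'.f := by
  have hl := hin1.ht_ptr h0
  have hr := hin2.ht_ptr h0
  have bl := tl.ht_le
  have br := tr.ht_le
  have hlen : L.length = tl.list.length + tr.list.length + 1 := by simp [hL]; omega
  have vx : Blk d E.space (x - 5) := hv x (by simp [hL])
  have vl : TPtr d E.space tl.ptr := T.ptr_valid fun q hq => hv q (by simp [hL, hq])
  have vr : TPtr d E.space tr.ptr := T.ptr_valid fun q hq => hv q (by simp [hL, hq])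
  refine (Tr.seq (K := 19) (K' := 111) (Q := fun a1 => a1.f = a.f ∧ Keeps balRegs a a1 ∧
    a1.r .h1 = tl.ht ∧ a1.r .h2 = tr.ht ∧ a1.r .b1 = tl.ht + 1 ∧ a1.r .b2 = tr.ht + 1 ∧
    a1.r .bl = tl.ptr ∧ a1.r .br = tr.ptr) (Tr.blk hE ?_ ?_) ?_)
  · simp only [Valid, TPtr] at *
    simp [Oks, Instr.Ok, Instr.ev, Valid, hx, hx1, hx2, hl, hr, ArithOp.eval, hone, Fld.isChar, vx]
    refine ⟨vl, vr, ?_, ?_⟩ <;> rw [abs_le] <;> omega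
  · refine ⟨rfl, ⟨rfl, rfl, fun x hx => ?_⟩, ?_⟩
    · simp only [balRegs, List.mem_cons, List.not_mem_nil, or_false, not_or] at hx
      simp [evs, Instr.ev, Function.update_of_ne, hx]
    · simp [evs, Instr.ev, hx, hx1, hx2, hl, hr, ArithOp.eval, hone]
  rintro a1 ⟨f1, k1, e1, e2, e3, e4, e5, e6⟩
  have o1 : a1.r .one = 1 := by rw [k1.r _ (by simp [balRegs]), hone]
  have ex : a1.r .tp = x := by rw [k1.r _ (by simp [balRegs]), hx]
  rw [← f1] at h0 hin1 hin2 hx1 hx2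
  refine Tr.ite (K := 110) (tr.ht + 1 < tl.ht) ?_ (fun h => ?_) (fun h => ?_)
  · simp only [BT.Is, e1, e4]; omega
  · refine (balSide_spec hE true a1 h0 o1 tl tr x ex e5 hin1 hin2 hx2 L (by simp [hL, T.lst])
      hv hd hW ha1 ha2 (by omega)).mono (by norm_num) ?_
    rintro a2 ⟨t', j1, j2, j3, j4, j5, j6, j7, j8⟩
    exact ⟨t', by simpa [T.lst] using j1, j2, j3, by omega, by omega, by omega, j6, k1.trans j7,
      f1 ▸ j8⟩
  · refine Tr.ite (K := 109) (tl.ht + 1 < tr.ht) ?_ (fun h => ?_) (fun h => ?_)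
    · simp only [BT.Is, e2, e3]; omega
    · refine (Tr.seq (K := 4) (K' := 100) (Q := fun a2 => a2.f = a1.f ∧ Keeps balRegs a1 a2 ∧
        a2.r .bl = tr.ptr) (Tr.blk hE ?_ ?_) ?_).mono (by norm_num) fun _ h => h
      · simp [Oks, Instr.Ok]
      · refine ⟨rfl, ⟨rfl, rfl, fun x hx => ?_⟩, ?_⟩
        · simp only [balRegs, List.mem_cons, List.not_mem_nil, or_false, not_or] at hx
          simp [evs, Instr.ev, Function.update_of_ne, hx]
        · simp [evs, Instr.ev, e6]
      rintro a2 ⟨f2, k2, e7⟩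
      have o2 : a2.r .one = 1 := by rw [k2.r _ (by simp [balRegs]), o1]
      have ex2 : a2.r .tp = x := by rw [k2.r _ (by simp [balRegs]), ex]
      rw [← f2] at h0 hin1 hin2 hx1 hx2
      -- Seen from the right side, the in-order list is reversed.
      refine (balSide_spec hE false a2 h0 o2 tr tl x ex2 e7 hin2 hin1 hx1 L.reverse
        (by simp [hL, T.lst]) (by simpa using hv) (by simpa using hd) (by simpa using hW)
        ha2 ha1 (by omega)).mono le_rfl ?_
      rintro a3 ⟨t', j1, j2, j3, j4, j5, j6, j7, j8⟩
      refine ⟨t', by simpa [T.lst] using j1, j2, j3, by omega, by omega, by omega, j6,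
        (k1.trans k2).trans j7, f1 ▸ f2 ▸ j8.mono (by simp)⟩
    · refine (Tr.seq (K := 21) (K' := 4) (fixht_mk hE true a1 .tp (by simp) h0 o1 tl tr
        (by rw [ex]; exact hx1) (by rw [ex]; exact hx2) hin1 hin2 ?_
        ?_ (by omega)) ?_).mono (by norm_num) fun _ h => h
      · simpa [ex, T.lst, hL] using hv
      · simpa [ex, T.lst, hL] using hd
      rintro a2 ⟨j1, j2, j3⟩
      rw [ex] at j1 j2
      refine Tr.blk hE (by simp [Oks, Instr.Ok]) ⟨_, ?_, j1, ?_, ?_, ?_, ?_, ?_, ?_, ?_⟩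
      · simp [T.mk, T.list, hL]
      · rw [T.avl_mk]; exact ⟨ha1, ha2, by omega, by omega⟩
      · rw [T.ht_mk]; omega
      · rw [T.ht_mk]
      · intro _ _; rw [T.ht_mk]
      · simp [evs, Instr.ev, T.ptr_mk, j3.r, ex]
      · refine (k1.trans (j3.mono (by simp [balRegs]))).trans ⟨rfl, rfl, fun x hx => ?_⟩
        simp only [balRegs, List.mem_cons, List.not_mem_nil, or_false, not_or] at hx
        simp [evs, Instr.ev, Function.update_of_ne, hx]
      · intro fl p hp
        change a2.f fl p = _
        rw [j2, f1]
        rintro rfl rfl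
        exact hp (by simp) (by simp [hL])

end

section

variable {α : Type u} [LinearOrder α]

/-! ### Paths in trees -/

/-- A step from the node `x` to its left child if `dir` holds, and to its right child otherwise;
`sib` is the tree at the other child. -/
structure Fr where
  dir : Bool
  x : ℤ
  sib : T

/-- The node at the end of a path. -/
def ctop : List Fr → ℤ
  | [] => 0
  | F :: _ => F.x

/-- The path is stored in the fields `f`. -/
def CIn (f : Fld → ℤ → ℤ) : List Fr → Prop
  | [] => True
  | F :: ctx => f .up F.x = ctop ctx ∧ f .dir F.x = (if F.dir then 0 else 1) ∧
      f (sr F.dir) F.x = F.sib.ptr ∧ F.sib.In f ∧ CIn f ctx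

/-- The pointers to the left of the path. -/
def lf : List Fr → List ℤ
  | [] => []
  | F :: ctx => if F.dir then lf ctx else lf ctx ++ (F.sib.list ++ [F.x])

/-- The pointers to the right of the path. -/
def rt : List Fr → List ℤ
  | [] => []
  | F :: ctx => if F.dir then F.x :: (F.sib.list ++ rt ctx) else rt ctx

/-- All trees along a path to a tree of height `h` are balanced. -/
def CAvl : ℕ → List Fr → Prop
  | _, [] => True
  | h, F :: ctx => F.sib.Avl ∧ h ≤ F.sib.ht + 1 ∧ F.sib.ht ≤ h + 1 ∧ CAvl (max h F.sib.ht + 1) ctx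

/-- The height of the whole tree, given the height at the end of the path. -/
def hgt : ℕ → List Fr → ℕ
  | h, [] => h
  | h, F :: ctx => hgt (max h F.sib.ht + 1) ctx

theorem CIn_congr {f f' : Fld → ℤ → ℤ} {ctx : List Fr}
    (h : ∀ q, q ∈ lf ctx ∨ q ∈ rt ctx → ∀ fl ∈ [Fld.l, .r, .ht, .up, .dir], f' fl q = f fl q)
    (hc : CIn f ctx) : CIn f' ctx := by
  induction ctx with
  | nil => trivial
  | cons F ctx ih =>
    obtain ⟨h1, h2, h3, h4, h5⟩ := hc
    have hx : ∀ fl ∈ [Fld.l, .r, .ht, .up, .dir], f' fl F.x = f fl F.x :=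
      h _ (by cases e : F.dir <;> simp [lf, rt, e])
    refine ⟨by rw [hx _ (by simp), h1], by rw [hx _ (by simp), h2], ?_, ?_, ih (fun q hq => h q ?_) h5⟩
    · rw [hx _ (by cases F.dir <;> simp [sr]), h3]
    · refine T.In_congr (fun q hq => ?_) h4
      have := h q (by cases e : F.dir <;> simp [lf, rt, e, hq])
      exact ⟨this _ (by simp), this _ (by simp), this _ (by simp)⟩
    · cases e : F.dir <;> simp [lf, rt, e] <;> tauto

theorem CIn.frame {P : List ℤ} {f f' : Fld → ℤ → ℤ} (h : TreeFrame P f f') {ctx : List Fr}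
    (hd : ∀ q, q ∈ lf ctx ∨ q ∈ rt ctx → q ∉ P) (hc : CIn f ctx) : CIn f' ctx :=
  CIn_congr (fun q hq _ _ => h _ _ fun _ => hd q hq) hc

/-- Moves up from the node `tp` along the stored path, starting with the tree at `q`. -/
def ascend : Prog :=
  .while (BT.lt .zr .tp).compile
    (.seq (blk [.ld .u .up .tp, .ld .h3 .dir .tp])
      (.seq (.ite (BT.eq .h3 .zr).compile (blk [.st .l .tp .q]) (blk [.st .r .tp .q]))
        (.seq balance (blk [.copy .tp .u]))))

def ascRegs : List Reg := .tp :: .u :: balRegs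

theorem nodup_mid {A B C : List ℤ} (h : (A ++ B ++ C).Nodup) :
    B.Nodup ∧ ∀ q, q ∈ A ∨ q ∈ C → q ∉ B := by
  simp only [List.nodup_append, List.mem_append] at h
  refine ⟨h.1.2.1, fun q hq hb => ?_⟩
  rcases hq with hq | hq
  · exact h.1.2.2 q hq q hb rfl
  · exact h.2.2 q (Or.inr hb) q hq rfl

/-- Here `h` is the old height at the end of the path, for which the whole tree was balanced, and
`t` is the new tree put there, whose height differs from `h` by at most 1. At each level the heights
of `t` and its sibling then differ by at most 2, so `balance` applies, and the result again differs
by at most 1 from the old height one level up. The same statement serves insertions and deletions.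
-/
theorem ascend_spec {E : Env α} {d : ℕ} (hE : Fits E d) (ctx : List Fr) :
    ∀ (a : AS α) (_ : a.f .ht 0 = 0) (_ : a.r .one = 1) (_ : a.r .zr = 0) (t : T) (h : ℕ)
    (_ : a.r .tp = ctop ctx) (_ : a.r .q = t.ptr) (_ : t.In a.f) (_ : CIn a.f ctx)
    (L : List ℤ) (_ : L = lf ctx ++ t.list ++ rt ctx)
    (_ : ∀ q ∈ L, Blk d E.space (q - 5)) (_ : L.Nodup) (_ : L.length + 1 ≤ E.wordMax)
    (_ : t.Avl) (_ : CAvl h ctx) (_ : t.ht ≤ h + 1) (_ : h ≤ t.ht + 1),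
    Tr E d ascend a (150 * ctx.length + 1) fun a' => ∃ t' : T,
      t'.list = L ∧ t'.In a'.f ∧ t'.Avl ∧ t'.ht ≤ hgt h ctx + 1 ∧ hgt h ctx ≤ t'.ht + 1 ∧
      a'.r .q = t'.ptr ∧ Keeps ascRegs a a' ∧ TreeFrame L a.f a'.f := by
  induction ctx with
  | nil =>
    intro a h0 hone hz t h htp hq hin hc L hL hv hd hW ha hca hh1 hh2
    refine (Tr.while_false (p := False) ?_ not_false ?_)
    · simp [BT.Is, htp, hz, ctop]
    · exact ⟨t, by simp [hL, lf, rt], hin, ha, hh1, hh2, hq, ⟨rfl, rfl, fun _ _ => rfl⟩,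
        fun _ _ _ => rfl⟩
  | cons F ctx ih =>
    intro a h0 hone hz t h htp hq hin hc L hL hv hd hW ha hca hh1 hh2
    obtain ⟨D, x, sib⟩ := F
    obtain ⟨c1, c2, c3, c4, c5⟩ := hc
    obtain ⟨b1, b2, b3, b4⟩ := hca
    simp only [ctop] at htp
    simp only at c1 c2 c3 c4 c5 b1 b2 b3 b4
    -- `M` lists the subtree that is rebuilt at this level. It is a segment of `L`, so rebalancing
    -- does not touch the rest of the path.
    obtain ⟨M, hM⟩ : ∃ M, M = if D then t.list ++ x :: sib.list else sib.list ++ x :: t.list :=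
      ⟨_, rfl⟩
    have hL' : L = lf ctx ++ M ++ rt ctx := by
      cases D <;> simp [hL, hM, lf, rt]
    have hMs : ∀ q ∈ M, q ∈ L := fun q hq => by simp [hL', hq]
    have hxM : x ∈ M := by cases D <;> simp [hM]
    have htM : ∀ q ∈ t.list, q ∈ M := by intro q hq; cases D <;> simp [hM, hq]
    have hsM : ∀ q ∈ sib.list, q ∈ M := by intro q hq; cases D <;> simp [hM, hq]
    have hMd : M.Nodup ∧ ∀ q, q ∈ lf ctx ∨ q ∈ rt ctx → q ∉ M := nodup_mid (hL' ▸ hd)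
    have hlen : M.length ≤ L.length := by rw [hL']; simp; omega
    have vx := hv x (hMs x hxM)
    have ntx : ∀ q ∈ t.list, q ≠ x := by
      rintro q hq rfl
      have := hMd.1
      cases D
      · simp only [hM, Bool.false_eq_true, if_false, List.nodup_append, List.nodup_cons] at this
        exact this.2.1.1 hq
      · simp only [hM, if_true, List.nodup_append, List.mem_cons] at this
        exact this.2.2 q hq q (Or.inl rfl) rfl
    have nsx : ∀ q ∈ sib.list, q ≠ x := by
      rintro q hq rfl
      have := hMd.1
      cases D
      · simp only [hM, Bool.false_eq_true, if_false, List.nodup_append, List.mem_cons] at this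
        exact this.2.2 q hq q (Or.inl rfl) rfl
      · simp only [hM, if_true, List.nodup_append, List.nodup_cons] at this
        exact this.2.1.1 hq
    have : 150 * (⟨D, x, sib⟩ :: ctx : List Fr).length + 1 = 149 + (150 * ctx.length + 1) + 1 := by
      simp; ring
    rw [this]
    refine Tr.while_true (p := True) ?_ trivial ?_
    · simp [BT.Is, htp, hz, vx.pos]
    have hs : balRegs ⊆ ascRegs := by intro y hy; simp [ascRegs, hy]
    refine (Tr.seq (K := 7) (K' := 139) (Q := fun a1 => a1.f = a.f ∧ Keeps ascRegs a a1 ∧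
      a1.r .u = ctop ctx ∧ a1.r .h3 = (if D then 0 else 1) ∧ a1.r .q = t.ptr ∧ a1.r .tp = x)
      (Tr.blk hE ?_ ?_) ?_).mono (by norm_num) fun _ h => h
    · simp [Oks, Instr.Ok, Instr.ev, Valid, htp, vx, Fld.isChar]
    · refine ⟨rfl, ⟨rfl, rfl, fun x hx => ?_⟩, ?_, ?_, ?_, ?_⟩
      · simp only [ascRegs, balRegs, List.mem_cons, List.not_mem_nil, or_false, not_or] at hx
        simp [evs, Instr.ev, Function.update_of_ne, hx]
      all_goals simp [evs, Instr.ev, htp, hq, c1, c2]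
    rintro a1 ⟨f1, k1, e1, e2, e3, e4⟩
    have z1 : a1.r .zr = 0 := by rw [k1.r _ (by simp [ascRegs, balRegs]), hz]
    have o1 : a1.r .one = 1 := by rw [k1.r _ (by simp [ascRegs, balRegs]), hone]
    refine Tr.seq (K := 5) (K' := 134) (Q := fun a2 => (∀ fl p, (fl ∈ [Fld.l, .r] → p ≠ x) →
      a2.f fl p = a.f fl p) ∧ a2.f (sl D) x = t.ptr ∧ a2.f (sr D) x = sib.ptr ∧
      a2.r = a1.r ∧ Keeps ascRegs a a2) ?_ ?_
    · refine Tr.ite (K := 4) (D = true) (by cases D <;> simp [BT.Is, e2, z1]) (fun h => ?_)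
        (fun h => ?_)
      · subst h
        refine Tr.blk hE ?_ ⟨?_, ?_, ?_, rfl, k1.trans ⟨rfl, rfl, fun _ _ => rfl⟩⟩
        · simp [Oks, Instr.Ok, Valid, e4, vx, Fld.isChar]
        · intro fl p hp
          by_cases e : fl = .l
          · subst e; simp [evs, Instr.ev, e4, f1, hp]
          · simp [evs, Instr.ev, f1, Function.update_of_ne e]
        · simp [evs, Instr.ev, e4, e3, sl]
        · simpa [evs, Instr.ev, f1, sr] using c3
      · rw [Bool.not_eq_true] at h
        subst h
        refine Tr.blk hE ?_ ⟨?_, ?_, ?_, rfl, k1.trans ⟨rfl, rfl, fun _ _ => rfl⟩⟩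
        · simp [Oks, Instr.Ok, Valid, e4, vx, Fld.isChar]
        · intro fl p hp
          by_cases e : fl = .r
          · subst e; simp [evs, Instr.ev, e4, f1, hp]
          · simp [evs, Instr.ev, f1, Function.update_of_ne e]
        · simp [evs, Instr.ev, e4, e3, sl]
        · simpa [evs, Instr.ev, f1, sr] using c3
    rintro a2 ⟨g2, s1, s2, r2, k2⟩
    have z2 : a2.f .ht 0 = 0 := by rw [g2 _ _ (by simp), h0]
    have fr2 : TreeFrame [x] a.f a2.f := by
      intro fl p hp
      refine g2 _ _ fun h => ?_
      simpa using hp (by simp at h ⊢; tauto)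
    have it := hin.frame fr2 (by simpa using ntx)
    have is' := c4.frame fr2 (by simpa using nsx)
    have ic := c5.frame fr2 (fun q hq => by
      have hqM := hMd.2 q hq
      rw [List.mem_singleton]; rintro rfl; exact hqM hxM)
    have bal : Tr E d balance a2 130 fun a' => ∃ t' : T, t'.list = M ∧ t'.In a'.f ∧ t'.Avl ∧
        max t.ht sib.ht ≤ t'.ht ∧ t'.ht ≤ max t.ht sib.ht + 1 ∧
        (t.ht ≤ sib.ht + 1 → sib.ht ≤ t.ht + 1 → t'.ht = max t.ht sib.ht + 1) ∧ a'.r .q = t'.ptr ∧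
        Keeps balRegs a2 a' ∧ TreeFrame M a2.f a'.f := by
      have ex : a2.r .tp = x := by rw [r2, e4]
      have o2 : a2.r .one = 1 := by rw [r2, o1]
      cases D
      · refine (balance_spec hE a2 z2 o2 sib t x ex s2 s1 is' it M (by simp [hM])
          (fun q hq => hv q (hMs q hq)) hMd.1 (by omega) b1 ha (by omega) (by omega)).mono le_rfl ?_
        rintro a3 ⟨t', j1, j2, j3, j4, j5, j6, j7⟩
        exact ⟨t', j1, j2, j3, by omega, by omega, by omega, j7⟩
      · exact (balance_spec hE a2 z2 o2 t sib x ex s1 s2 it is' M (by simp [hM])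
          (fun q hq => hv q (hMs q hq)) hMd.1 (by omega) ha b1 (by omega) (by omega))
    refine Tr.seq (K := 130) (K' := 4) bal ?_
    rintro a3 ⟨t', j1, j2, j3, j4, j5, j6, j7, j8, j9⟩
    refine Tr.blk hE (by simp [Oks, Instr.Ok]) ?_
    have k4 : Keeps ascRegs a (evs E a3 [Instr.copy Reg.tp Reg.u]) := by
      refine (k2.trans (j8.mono hs)).trans ⟨rfl, rfl, fun x hx => ?_⟩
      simp only [ascRegs, balRegs, List.mem_cons, List.not_mem_nil, or_false, not_or] at hx
      simp [evs, Instr.ev, Function.update_of_ne, hx]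
    have fr4 : TreeFrame L a.f (evs E a3 [Instr.copy Reg.tp Reg.u]).f :=
      (fr2.mono (by simpa using hMs x hxM)).trans (j9.mono hMs)
    refine (ih (evs E a3 [Instr.copy Reg.tp Reg.u]) ?_ ?_ ?_ t' (max h sib.ht + 1) ?_ ?_ j2 (ic.frame j9 hMd.2) L (by rw [hL', j1])
      hv hd hW j3 b4 (by omega) (by omega)).mono le_rfl ?_
    · exact (j9 _ _ fun _ h => by simpa using (hv 0 (hMs _ h)).pos).trans z2
    · rw [k4.r _ (by simp [ascRegs, balRegs]), hone]
    · rw [k4.r _ (by simp [ascRegs, balRegs]), hz]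
    · simp [evs, Instr.ev, j8.r _ (by simp [balRegs] : Reg.u ∉ balRegs), r2, e1]
    · simp [evs, Instr.ev, j7]
    · rintro a5 ⟨t5, l1, l2, l3, l4, l5, l6, l7, l8⟩
      exact ⟨t5, l1, l2, l3, l4, l5, l6, k4.trans l7, fr4.trans l8⟩

/-- Moves down from the root `q` along the search path for the character `c`, and stores the
path. -/
def descend : Prog :=
  .seq (blk [.copy .tp .zr, .copy .fl .one])
    (.while (BT.lt .zr .fl).compile
      (.ite (BT.lt .zr .q).compile
        (.seq (blk [.ldc .t .tlab .q])
          (.ite (BT.ceq .t .c).compile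
            (blk [.copy .fl .zr])
            (.ite (BT.clt .c .t).compile
              (blk [.st .up .q .tp, .st .dir .q .zr, .copy .tp .q, .ld .q .l .q])
              (blk [.st .up .q .tp, .st .dir .q .one, .copy .tp .q, .ld .q .r .q]))))
        (blk [.copy .fl .zr])))

/-- `f'` agrees with `f` up to the path information of the tree nodes in `P`. -/
def PathFrame (P : List ℤ) (f f' : Fld → ℤ → ℤ) : Prop :=
  ∀ fl p, (fl ∈ [Fld.up, .dir] → p ∉ P) → f' fl p = f fl p

theorem PathFrame.trans {P : List ℤ} {f f' f'' : Fld → ℤ → ℤ} (h : PathFrame P f f')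
    (h' : PathFrame P f' f'') : PathFrame P f f'' :=
  fun fl p hp => (h' fl p hp).trans (h fl p hp)

theorem PathFrame.mono {P P' : List ℤ} {f f' : Fld → ℤ → ℤ} (h : PathFrame P f f') (hs : P ⊆ P') :
    PathFrame P' f f' :=
  fun fl p hp => h fl p (fun h1 h2 => hp h1 (hs h2))

theorem T.In.pathFrame {P : List ℤ} {f f' : Fld → ℤ → ℤ} (h : PathFrame P f f') {t : T}
    (ht : t.In f) : t.In f' :=
  T.In_congr (fun q _ => ⟨h _ _ (by simp), h _ _ (by simp), h _ _ (by simp)⟩) ht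

theorem CIn.pathFrame {P : List ℤ} {f f' : Fld → ℤ → ℤ} (h : PathFrame P f f') {ctx : List Fr}
    (hd : ∀ q, q ∈ lf ctx ∨ q ∈ rt ctx → q ∉ P) (hc : CIn f ctx) : CIn f' ctx :=
  CIn_congr (fun q hq _ _ => h _ _ fun _ => hd q hq) hc

/-- The registers `q` and `tp` describe the tree `t` at the end of the stored path `ctx` in a
balanced tree of height `H` with the list `L` of pointers. -/
structure AtPath (a : AS α) (t : T) (ctx : List Fr) (H : ℕ) (L : List ℤ) : Prop where
  q : a.r .q = t.ptr
  tp : a.r .tp = ctop ctx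
  tin : t.In a.f
  cin : CIn a.f ctx
  list : L = lf ctx ++ t.list ++ rt ctx
  avl : t.Avl
  cavl : CAvl t.ht ctx
  hgt : hgt t.ht ctx = H
  len : ctx.length + t.ht ≤ H

def descRegs : List Reg := [.q, .tp, .fl]

omit [LinearOrder α] in
-- The new frame records exactly what the step leaves behind, so the whole list and the total height
-- are unchanged. The path lives in the fields `up` and `dir` of the tree nodes passed, which the
-- shape of the tree does not depend on.
theorem descend_step {f f' : Fld → ℤ → ℤ} {l r : T} {q : ℤ} {ctx : List Fr} {L : List ℤ} {H : ℕ}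
    {a a' : AS α} (h : AtPath a (.node l q r) ctx H L) (hd : L.Nodup) (D : Bool) (hf : a.f = f)
    (hf' : a'.f = f') (htp : a'.r .tp = q) (hq : a'.r .q = if D then l.ptr else r.ptr)
    (hup : f' .up q = a.r .tp) (hdir : f' .dir q = if D then 0 else 1)
    (hfr : PathFrame [q] f f') :
    AtPath a' (if D then l else r) (⟨D, q, if D then r else l⟩ :: ctx) H L := by
  subst hf hf'
  obtain ⟨i1, i2, i3, i4, i5⟩ := h.tin
  obtain ⟨v1, v2, v3, v4⟩ := h.avl
  have hnd := hd
  rw [h.list] at hnd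
  have nq : ∀ p, p ∈ lf ctx ∨ p ∈ rt ctx → p ∉ [q] := by
    intro p hp
    have := (nodup_mid hnd).2 p hp
    simp only [T.list, List.mem_append, List.mem_cons] at this
    simp; tauto
  have hlen := h.len
  have hg := h.hgt
  have hca := h.cavl
  simp only [T.ht] at hlen hg hca
  cases D
  · refine ⟨by simpa using hq, by simpa [ctop] using htp, i5.pathFrame hfr,
      ⟨by rw [hup, h.tp], hdir, ?_, i4.pathFrame hfr, h.cin.pathFrame hfr nq⟩, ?_, v2,
      ⟨v1, v4, v3, ?_⟩, ?_, ?_⟩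
    · simp only [sr, Bool.false_eq_true, if_false]; rw [hfr _ _ (by simp), i1]
    · rw [h.list]; simp [lf, rt, T.list]
    · simpa [max_comm] using hca
    · simpa [SlidingEertree.hgt, max_comm] using hg
    · simp; omega
  · refine ⟨by simpa using hq, by simpa [ctop] using htp, i4.pathFrame hfr,
      ⟨by rw [hup, h.tp], hdir, ?_, i5.pathFrame hfr, h.cin.pathFrame hfr nq⟩, ?_, v1,
      ⟨v2, v3, v4, ?_⟩, ?_, ?_⟩
    · simp only [sr, if_true]; rw [hfr _ _ (by simp), i2]
    · rw [h.list]; simp [lf, rt, T.list]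
    · simpa using hca
    · simpa [SlidingEertree.hgt] using hg
    · simp; omega

/-- The machine has no compound loop conditions, so the loop is controlled by the flag `fl`, which
is cleared both at an empty tree and at a node with label `c`. The separation of labels along the
path is what later fixes the place of an insertion. -/
theorem descend_spec {E : Env α} {d : ℕ} (hE : Fits E d) (a : AS α) (hone : a.r .one = 1)
    (hz : a.r .zr = 0) (t0 : T) (hq : a.r .q = t0.ptr) (hin : t0.In a.f) (ha : t0.Avl)
    (hv : ∀ q ∈ t0.list, Blk d E.space (q - 5)) (hd : t0.list.Nodup) (lb : ℤ → α)
    (hlb : ∀ q ∈ t0.list, a.g .tlab q = Word.chr (lb q))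
    (hs : t0.list.Pairwise fun p q => lb p < lb q) (c : α) (hc : a.c .c = Word.chr c) :
    Tr E d descend a (30 * t0.ht + 30) fun a' => ∃ t ctx, AtPath a' t ctx t0.ht t0.list ∧
      (∀ q ∈ lf ctx, lb q < c) ∧ (∀ q ∈ rt ctx, c < lb q) ∧ (∀ l q r, t = .node l q r → lb q = c) ∧
      Keeps descRegs a a' ∧ PathFrame t0.list a.f a'.f := by
  refine (Tr.seq (K := 7) (K' := 23 * t0.ht + 23) (Q := fun a1 => a1.f = a.f ∧ Keeps descRegs a a1 ∧
    AtPath a1 t0 [] t0.ht t0.list ∧ a1.r .fl = 1) (Tr.blk hE ?_ ?_) ?_).mono (by omega) fun _ h => h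
  · simp [Oks, Instr.Ok]
  · refine ⟨rfl, ⟨rfl, rfl, fun x hx => ?_⟩, ⟨?_, ?_, hin, trivial, ?_, ha, trivial, rfl, ?_⟩, ?_⟩
    · simp only [descRegs, List.mem_cons, List.not_mem_nil, or_false, not_or] at hx
      simp [evs, Instr.ev, Function.update_of_ne, hx]
    · simp [evs, Instr.ev, hq]
    · simp [evs, Instr.ev, hz, ctop]
    · simp [lf, rt]
    · simp
    · simp [evs, Instr.ev, hone]
  rintro a1 ⟨f1, k1, p1, e1⟩
  -- The loop is handled by induction on the height of the tree that is still to be searched.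
  suffices H : ∀ (n : ℕ) (a1 : AS α) (t : T) (ctx : List Fr), t.ht = n → Keeps descRegs a a1 →
      PathFrame t0.list a.f a1.f → AtPath a1 t ctx t0.ht t0.list → a1.r .fl = 1 →
      (∀ q ∈ lf ctx, lb q < c) → (∀ q ∈ rt ctx, c < lb q) →
      Tr E d (.while (BT.lt .zr .fl).compile
      (.ite (BT.lt .zr .q).compile
        (.seq (blk [.ldc .t .tlab .q])
          (.ite (BT.ceq .t .c).compile
            (blk [.copy .fl .zr])
            (.ite (BT.clt .c .t).compile
              (blk [.st .up .q .tp, .st .dir .q .zr, .copy .tp .q, .ld .q .l .q])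
              (blk [.st .up .q .tp, .st .dir .q .one, .copy .tp .q, .ld .q .r .q]))))
        (blk [.copy .fl .zr]))) a1 (23 * n + 23) fun a' => ∃ t ctx, AtPath a' t ctx t0.ht t0.list ∧
      (∀ q ∈ lf ctx, lb q < c) ∧ (∀ q ∈ rt ctx, c < lb q) ∧ (∀ l q r, t = .node l q r → lb q = c) ∧
      Keeps descRegs a a' ∧ PathFrame t0.list a.f a'.f by
    exact H _ a1 t0 [] rfl k1 (fun fl p _ => by rw [f1]) p1 e1 (by simp [lf]) (by simp [rt])
  clear f1 k1 p1 e1 a1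
  intro n
  induction n using Nat.strong_induction_on with | _ n ih => ?_
  intro a1 t ctx hn k1 f1 p1 e1 hl hr
  have z1 : a1.r .zr = 0 := by rw [k1.r _ (by simp [descRegs]), hz]
  have o1 : a1.r .one = 1 := by rw [k1.r _ (by simp [descRegs]), hone]
  -- Clearing the flag ends the loop and leaves the current position on the path valid.
  have hstp : ∀ a2 : AS α, a2.f = a1.f → a2.g = a1.g → a2.c .c = a1.c .c →
      a2.r = Function.update a1.r .fl 0 → AtPath a2 t ctx t0.ht t0.list ∧
      Keeps descRegs a a2 ∧ PathFrame t0.list a.f a2.f ∧ a2.r .fl = 0 ∧ a2.r .zr = 0 := by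
    intro a2 h1 h2 h4 h3
    refine ⟨⟨?_, ?_, h1 ▸ p1.tin, h1 ▸ p1.cin, p1.list, p1.avl, p1.cavl, p1.hgt, p1.len⟩,
      k1.trans ⟨h2, h4, fun x hx => ?_⟩, h1 ▸ f1, ?_, ?_⟩
    · simp [h3, p1.q]
    · simp [h3, p1.tp]
    · simp only [descRegs, List.mem_cons, List.not_mem_nil, or_false, not_or] at hx
      simp [h3, hx]
    · simp [h3]
    · simp [h3, z1]
  cases t with
  | nil =>
    subst hn
    refine (Tr.while_true (K := 5) (K' := 1) (p := True) (by simp [BT.Is, z1, e1]) trivial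
      (Tr.ite (K := 4) False (by simp [BT.Is, p1.q, T.ptr, z1]) (fun h => h.elim) fun _ =>
        (Tr.blk hE (by simp [Oks, Instr.Ok]) ?_))).mono (by simp) fun _ h => h
    obtain ⟨s1, s2, s3, s4, s5⟩ := hstp (evs E a1 [Instr.copy Reg.fl Reg.zr]) rfl rfl rfl
      (by simp [evs, Instr.ev, z1])
    exact Tr.while_false (p := False) (by simp [BT.Is, s4, s5]) not_false
      ⟨_, ctx, s1, hl, hr, by simp, s2, s3⟩
  | node l q r =>
    have hqm : q ∈ t0.list := by rw [p1.list]; simp [T.list]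
    have vq := hv q hqm
    have eq1 : a1.r .q = q := p1.q
    have hcc : a1.c .c = Word.chr c := k1.c ▸ hc
    have i1 := p1.tin
    obtain ⟨i1, i2, i3, i4, i5⟩ := i1
    have hss := hs
    rw [p1.list] at hss
    simp only [T.list, List.append_assoc, List.pairwise_append, List.mem_append, List.mem_cons,
      List.cons_append, List.pairwise_cons] at hss
    obtain ⟨-, ⟨-, ⟨q1, -⟩, q2⟩, q3⟩ := hss
    have hn' : n = max l.ht r.ht + 1 := hn.symm
    -- One step to the side `D`: by sortedness, the node `q` and the abandoned subtree all lie on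
    -- the correct side of `c`.
    have cont : ∀ (D : Bool) (a2 : AS α), (D = true ↔ c < lb q) → (D = false ↔ lb q < c) →
        a2.r .fl = 1 →
        AtPath a2 (if D then l else r) (⟨D, q, if D then r else l⟩ :: ctx) t0.ht t0.list →
        Keeps descRegs a1 a2 → PathFrame [q] a1.f a2.f →
        Tr E d (.while (BT.lt .zr .fl).compile
      (.ite (BT.lt .zr .q).compile
        (.seq (blk [.ldc .t .tlab .q])
          (.ite (BT.ceq .t .c).compile
            (blk [.copy .fl .zr])
            (.ite (BT.clt .c .t).compile
              (blk [.st .up .q .tp, .st .dir .q .zr, .copy .tp .q, .ld .q .l .q])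
              (blk [.st .up .q .tp, .st .dir .q .one, .copy .tp .q, .ld .q .r .q]))))
        (blk [.copy .fl .zr]))) a2 (23 * (n - 1) + 23) fun a' => ∃ t ctx,
          AtPath a' t ctx t0.ht t0.list ∧
      (∀ q ∈ lf ctx, lb q < c) ∧ (∀ q ∈ rt ctx, c < lb q) ∧ (∀ l q r, t = .node l q r → lb q = c) ∧
      Keeps descRegs a a' ∧ PathFrame t0.list a.f a'.f := by
      intro D a2 h1 h1' h2 h3 h4 h5
      have hlt : (if D then l else r).ht < n := by cases D <;> simp <;> omega
      refine (ih _ hlt a2 _ _ rfl (k1.trans h4) (f1.trans (h5.mono (by simpa using hqm))) h3 h2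
        ?_ ?_).mono (by omega) fun _ h => h
      · intro p hp
        cases D
        · have := h1'.1 rfl
          simp [lf] at hp
          rcases hp with hp | hp | rfl
          · exact hl p hp
          · exact (q2 p hp q (by simp)).trans this
          · exact this
        · simp [lf] at hp
          exact hl p hp
      · intro p hp
        cases D
        · simp [rt] at hp
          exact hr p hp
        · have := h1.1 rfl
          simp [rt] at hp
          rcases hp with rfl | hp | hp
          · exact this
          · exact this.trans (q1 p (Or.inl hp))
          · exact hr p hp
    refine (Tr.while_true (K := 22) (K' := 23 * (n - 1) + 23) (p := True) (by simp [BT.Is, z1, e1])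
      trivial (Tr.ite (K := 21) True (by simp [BT.Is, eq1, vq.pos, z1]) (fun _ => ?_)
        (fun h => (h trivial).elim))).mono (by omega) fun _ h => h
    refine Tr.seq (K := 4) (K' := 17) (Q := fun a2 => a2.f = a1.f ∧ a2.r = a1.r ∧
      a2.g = a1.g ∧ a2.c .c = a1.c .c ∧ a2.c .t = Word.chr (lb q)) (Tr.blk hE ?_ ?_) ?_
    · simp [Oks, Instr.Ok, eq1, Valid, vq, Fld.isChar]
    · simp [evs, Instr.ev, eq1, k1.g, hlb q hqm]
    rintro a2 ⟨f2, r2, g2, c2, t2⟩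
    rw [hcc] at c2
    refine Tr.ite (K := 16) (lb q = c) ⟨_, _, t2, c2, Iff.rfl⟩ (fun h => ?_) (fun h => ?_)
    · refine (Tr.blk hE (by simp [Oks, Instr.Ok]) ?_).mono (by norm_num) fun _ h => h
      obtain ⟨s1, s2, s3, s4, s5⟩ := hstp (evs E a2 [Instr.copy Reg.fl Reg.zr])
        (by simp [evs, Instr.ev, f2]) (by simp [evs, Instr.ev, g2])
        (by simp [evs, Instr.ev, c2, hcc])
        (by simp [evs, Instr.ev, z1, r2])
      refine (Tr.while_false (p := False) (by simp [BT.Is, s4, s5]) not_false ?_).mono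
        (by omega) fun _ h => h
      exact ⟨_, ctx, s1, hl, hr, by simpa using h, s2, s3⟩
    · refine Tr.ite (K := 15) (c < lb q) ⟨_, _, c2, t2, Iff.rfl⟩ (fun h' => ?_) (fun h' => ?_)
      · refine (Tr.blk hE ?_ ?_).mono (by norm_num) fun _ h => h
        · simp [Oks, Instr.Ok, Instr.ev, eq1, Valid, vq, Fld.isChar, r2]
        · have pf : PathFrame [q] a1.f (evs E a2 [.st .up .q .tp, .st .dir .q .zr, .copy .tp .q,
              .ld .q .l .q]).f := by
            intro fl p hp
            simp only [List.mem_cons, List.not_mem_nil, or_false] at hp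
            by_cases e1 : fl = .up
            · subst e1; simp [evs, Instr.ev, eq1, r2, f2, hp (Or.inl rfl)]
            · by_cases e2 : fl = .dir
              · subst e2; simp [evs, Instr.ev, eq1, r2, f2, hp (Or.inr rfl)]
              · simp [evs, Instr.ev, f2, e1, e2]
          refine cont true _ (by simpa using h') (by simpa using h'.le) ?_
            (descend_step p1 hd true rfl rfl ?_ ?_ ?_ ?_ pf) ⟨?_, ?_, fun x hx => ?_⟩ pf
          · simp [evs, Instr.ev, r2, e1]
          · simp [evs, Instr.ev, r2, eq1]
          · simp [evs, Instr.ev, r2, eq1, f2, i1]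
          · simp [evs, Instr.ev, r2, eq1]
          · simp [evs, Instr.ev, r2, eq1, z1]
          · simp [evs, Instr.ev, g2]
          · simp [evs, Instr.ev, c2, hcc]
          · simp only [descRegs, List.mem_cons, List.not_mem_nil, or_false, not_or] at hx
            simp [evs, Instr.ev, Function.update_of_ne, hx, r2]
      · have h'' : lb q < c := lt_of_le_of_ne (not_lt.1 h') h
        refine (Tr.blk hE ?_ ?_).mono (by norm_num) fun _ h => h
        · simp [Oks, Instr.Ok, Instr.ev, eq1, Valid, vq, Fld.isChar, r2]
        · have pf : PathFrame [q] a1.f (evs E a2 [.st .up .q .tp, .st .dir .q .one, .copy .tp .q,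
              .ld .q .r .q]).f := by
            intro fl p hp
            simp only [List.mem_cons, List.not_mem_nil, or_false] at hp
            by_cases e1 : fl = .up
            · subst e1; simp [evs, Instr.ev, eq1, r2, f2, hp (Or.inl rfl)]
            · by_cases e2 : fl = .dir
              · subst e2; simp [evs, Instr.ev, eq1, r2, f2, hp (Or.inr rfl)]
              · simp [evs, Instr.ev, f2, e1, e2]
          refine cont false _ (by simpa using h''.le) (by simpa using h'') ?_
            (descend_step p1 hd false rfl rfl ?_ ?_ ?_ ?_ pf) ⟨?_, ?_, fun x hx => ?_⟩ pf
          · simp [evs, Instr.ev, r2, e1]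
          · simp [evs, Instr.ev, r2, eq1]
          · simp [evs, Instr.ev, r2, eq1, f2, i2]
          · simp [evs, Instr.ev, r2, eq1]
          · simp [evs, Instr.ev, r2, eq1, o1]
          · simp [evs, Instr.ev, g2]
          · simp [evs, Instr.ev, c2, hcc]
          · simp only [descRegs, List.mem_cons, List.not_mem_nil, or_false, not_or] at hx
            simp [evs, Instr.ev, Function.update_of_ne, hx, r2]

end

/-! ### Removing tree nodes; inserting and deleting edges -/

section

variable {α : Type u} [LinearOrder α]

/-- `f'` agrees with `f` up to the auxiliary fields of the tree nodes in `P`. -/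
def EdgeFrame (P : List ℤ) (f f' : Fld → ℤ → ℤ) : Prop :=
  ∀ fl p, (fl ∈ [Fld.l, .r, .ht, .up, .dir] → p ∉ P) → f' fl p = f fl p

theorem EdgeFrame.trans {P : List ℤ} {f f' f'' : Fld → ℤ → ℤ} (h : EdgeFrame P f f')
    (h' : EdgeFrame P f' f'') : EdgeFrame P f f'' :=
  fun fl p hp => (h' fl p hp).trans (h fl p hp)

theorem EdgeFrame.mono {P P' : List ℤ} {f f' : Fld → ℤ → ℤ} (h : EdgeFrame P f f') (hs : P ⊆ P') :
    EdgeFrame P' f f' :=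
  fun fl p hp => h fl p (fun h1 h2 => hp h1 (hs h2))

theorem TreeFrame.edge {P : List ℤ} {f f' : Fld → ℤ → ℤ} (h : TreeFrame P f f') :
    EdgeFrame P f f' :=
  fun fl p hp => h fl p fun h1 => hp (by simp at h1 ⊢; tauto)

theorem PathFrame.edge {P : List ℤ} {f f' : Fld → ℤ → ℤ} (h : PathFrame P f f') :
    EdgeFrame P f f' :=
  fun fl p hp => h fl p fun h1 => hp (by simp at h1 ⊢; tauto)

theorem T.In.edgeFrame {P : List ℤ} {f f' : Fld → ℤ → ℤ} (h : EdgeFrame P f f') {t : T}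
    (ht : t.In f) (hd : ∀ q ∈ t.list, q ∉ P) : t.In f' :=
  T.In_congr (fun q hq => ⟨h _ _ (fun _ => hd q hq), h _ _ (fun _ => hd q hq),
    h _ _ (fun _ => hd q hq)⟩) ht

theorem CIn.edgeFrame {P : List ℤ} {f f' : Fld → ℤ → ℤ} (h : EdgeFrame P f f') {ctx : List Fr}
    (hd : ∀ q, q ∈ lf ctx ∨ q ∈ rt ctx → q ∉ P) (hc : CIn f ctx) : CIn f' ctx :=
  CIn_congr (fun q hq _ _ => h _ _ fun _ => hd q hq) hc

/-- Moves from the root `q` to the rightmost node, and stores the path. -/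
def descMax : Prog :=
  .seq (blk [.copy .tp .zr, .ld .u .r .q])
    (.while (BT.lt .zr .u).compile
      (blk [.st .up .q .tp, .st .dir .q .one, .copy .tp .q, .copy .q .u, .ld .u .r .q]))

def descMaxRegs : List Reg := [.q, .tp, .u]

/-- Since `m` has no right child and nothing lies to the right of the path, `m` is the last pointer
in order. -/
theorem descMax_spec {E : Env α} {d : ℕ} (hE : Fits E d) (a : AS α) (hone : a.r .one = 1)
    (hz : a.r .zr = 0) (t0 : T) (hne : t0 ≠ .nil) (hq : a.r .q = t0.ptr) (hin : t0.In a.f)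
    (ha : t0.Avl) (hv : ∀ q ∈ t0.list, Blk d E.space (q - 5)) (hd : t0.list.Nodup) :
    Tr E d descMax a (30 * t0.ht + 30) fun a' => ∃ l m ctx,
      AtPath a' (.node l m .nil) ctx t0.ht t0.list ∧ rt ctx = [] ∧
      Keeps descMaxRegs a a' ∧ PathFrame t0.list a.f a'.f := by
  have hv0 : ∀ {l r : T} {q : ℤ}, t0 = .node l q r → Blk d E.space (q - 5) := by
    rintro l r q rfl; exact hv q (by simp [T.list])
  refine (Tr.seq (K := 7) (K' := 17 * t0.ht + 23) (Q := fun a1 => a1.f = a.f ∧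
    Keeps descMaxRegs a a1 ∧ AtPath a1 t0 [] t0.ht t0.list ∧ a1.r .u = a1.f .r t0.ptr)
    (Tr.blk hE ?_ ?_) ?_).mono (by omega) fun _ h => h
  · cases t0 with
    | nil => exact (hne rfl).elim
    | node l q r => simp [Oks, Instr.Ok, Instr.ev, Fld.isChar, Valid, hq, T.ptr, hv0 rfl]
  · refine ⟨rfl, ⟨rfl, rfl, fun x hx => ?_⟩, ⟨?_, ?_, hin, trivial, ?_, ha, trivial, rfl, ?_⟩, ?_⟩
    · simp only [descMaxRegs, List.mem_cons, List.not_mem_nil, or_false, not_or] at hx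
      simp [evs, Instr.ev, Function.update_of_ne, hx]
    · simp [evs, Instr.ev, hq]
    · simp [evs, Instr.ev, hz, ctop]
    · simp [lf, rt]
    · simp
    · simp [evs, Instr.ev, hq]
  rintro a1 ⟨f1, k1, p1, e1⟩
  suffices H : ∀ (n : ℕ) (a1 : AS α) (t : T) (ctx : List Fr), t.ht = n → t ≠ .nil →
      Keeps descMaxRegs a a1 → PathFrame t0.list a.f a1.f → AtPath a1 t ctx t0.ht t0.list →
      a1.r .u = a1.f .r t.ptr → rt ctx = [] →
      Tr E d (.while (BT.lt .zr .u).compile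
        (blk [.st .up .q .tp, .st .dir .q .one, .copy .tp .q, .copy .q .u, .ld .u .r .q])) a1
        (17 * n + 23) fun a' => ∃ l m ctx,
      AtPath a' (.node l m .nil) ctx t0.ht t0.list ∧ rt ctx = [] ∧
      Keeps descMaxRegs a a' ∧ PathFrame t0.list a.f a'.f by
    exact H _ a1 t0 [] rfl hne k1 (fun fl p _ => by rw [f1]) p1 e1 rfl
  clear f1 k1 p1 e1 a1
  intro n
  induction n using Nat.strong_induction_on with | _ n ih => ?_
  intro a1 t ctx hn hnt k1 f1 p1 e1 hr
  have z1 : a1.r .zr = 0 := by rw [k1.r _ (by simp [descMaxRegs]), hz]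
  have o1 : a1.r .one = 1 := by rw [k1.r _ (by simp [descMaxRegs]), hone]
  cases t with
  | nil => exact (hnt rfl).elim
  | node l q r =>
    have hqm : q ∈ t0.list := by rw [p1.list]; simp [T.list]
    have vq := hv q hqm
    have eq1 : a1.r .q = q := p1.q
    have i2 : a1.f .r q = r.ptr := p1.tin.2.1
    simp only [T.ptr, i2] at e1
    cases r with
    | nil =>
      refine (Tr.while_false (p := False) (by simp [BT.Is, z1, e1]) not_false
        ⟨l, q, ctx, p1, hr, k1, f1⟩).mono (by omega) fun _ h => h
    | node l' q' r' =>
      have hq'm : q' ∈ t0.list := by rw [p1.list]; simp [T.list]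
      have vq' := hv q' hq'm
      have hpos := vq'.pos
      simp only [T.ptr] at e1 i2
      have hqq' : q' ≠ q := by
        rintro rfl
        rw [p1.list] at hd
        have := (nodup_mid hd).1
        simp [T.list, List.nodup_append] at this
      have hlt : (T.node l' q' r').ht < n := by simp [T.ht] at hn ⊢; omega
      refine (Tr.while_true (K := 16) (K' := 17 * (n - 1) + 23) (p := True)
        (by simp [BT.Is, z1, e1, hpos]) trivial (Tr.blk hE ?_ ?_)).mono (by omega) fun _ h => h
      · simp [Oks, Instr.Ok, Instr.ev, eq1, Valid, vq, vq', Fld.isChar, e1]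
      · have pf : PathFrame [q] a1.f (evs E a1 [.st .up .q .tp, .st .dir .q .one, .copy .tp .q,
            .copy .q .u, .ld .u .r .q]).f := by
          intro fl p hp
          simp only [List.mem_cons, List.not_mem_nil, or_false] at hp
          by_cases e1 : fl = .up
          · subst e1; simp [evs, Instr.ev, eq1, hp (Or.inl rfl)]
          · by_cases e2 : fl = .dir
            · subst e2; simp [evs, Instr.ev, eq1, hp (Or.inr rfl)]
            · simp [evs, Instr.ev, e1, e2]
        refine (ih _ hlt (evs E a1 [.st .up .q .tp, .st .dir .q .one, .copy .tp .q,
            .copy .q .u, .ld .u .r .q]) (.node l' q' r') (⟨false, q, l⟩ :: ctx) rfl (by simp)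
          (k1.trans ⟨rfl, rfl, fun x hx => ?_⟩) (f1.trans (pf.mono (by simpa using hqm)))
          (descend_step p1 hd false rfl rfl ?_ ?_ ?_ ?_ pf) ?_
          (by simpa [rt] using hr)).mono (by omega) fun _ h => h
        · simp only [descMaxRegs, List.mem_cons, List.not_mem_nil, or_false, not_or] at hx
          simp [evs, Instr.ev, Function.update_of_ne, hx]
        · simp [evs, Instr.ev, eq1]
        · simp [evs, Instr.ev, e1, T.ptr]
        · simp [evs, Instr.ev, eq1]
        · simp [evs, Instr.ev, eq1, o1]
        · simp [evs, Instr.ev, e1, T.ptr]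

/-- Removes the tree node `q` with the path `tp`; the new root is put into `q`. -/
def delNode : Prog :=
  .seq (blk [.copy .xs .tp, .copy .tv .q, .ld .q .l .q])
    (.seq
      (.ite (BT.lt .zr .q).compile
        (.seq descMax (.seq (blk [.copy .tm .q, .ld .q .l .q]) (.seq ascend
          (.seq (blk [.st .l .tm .q, .ld .u .r .tv, .st .r .tm .u, .copy .tp .tm]) balance))))
        (blk [.ld .q .r .tv]))
      (.seq (blk [.copy .tp .xs]) ascend))

/-- The registers used by the operations on trees. -/
def treeRegs : List Reg := .fl :: .xs :: .tv :: .tm :: ascRegs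

/-- If the left subtree is empty, the right one replaces the node. Otherwise the in-order
predecessor `m` is cut out of the left subtree, that subtree is rebalanced, and `m` itself is linked
into the place of `v`. Copying the contents of `m` into `v` is not an option, because a tree node
lies in the block of the node that its edge leads to. The inner path is stored in the left subtree
only, so the outer path survives and is ascended last. -/
theorem delNode_spec {E : Env α} {d : ℕ} (hE : Fits E d) (a : AS α) (h0 : a.f .ht 0 = 0)
    (hone : a.r .one = 1) (hz : a.r .zr = 0) (l r : T) (v : ℤ) (ctx : List Fr) (H : ℕ)
    (L : List ℤ) (hp : AtPath a (.node l v r) ctx H L)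
    (hv : ∀ q ∈ L, Blk d E.space (q - 5)) (hd : L.Nodup) (hW : L.length + 1 ≤ E.wordMax) :
    Tr E d delNode a (330 * H + 330) fun a' => ∃ t' : T,
      t'.list = lf ctx ++ (l.list ++ r.list) ++ rt ctx ∧ t'.In a'.f ∧ t'.Avl ∧
      a'.r .q = t'.ptr ∧ Keeps treeRegs a a' ∧ EdgeFrame L a.f a'.f := by
  have hd0 := hd
  rw [hp.list] at hd0
  have hd1 := (nodup_mid hd0).1
  have hdc := (nodup_mid hd0).2
  have hlist := hp.list
  simp only [T.list] at hd1 hdc hlist hd0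
  obtain ⟨i1, i2, -, il, ir⟩ := hp.tin
  obtain ⟨al, ar, a3, a4⟩ := hp.avl
  have hlL : ∀ q ∈ l.list, q ∈ L := fun q hq => by simp [hlist, hq]
  have hrL : ∀ q ∈ r.list, q ∈ L := fun q hq => by simp [hlist, hq]
  have hvL : v ∈ L := by simp [hlist]
  have vv := hv v hvL
  have hdl : l.list.Nodup := (List.nodup_append.1 hd1).1
  have hlr : ∀ q ∈ r.list, q ∉ l.list := fun q hq hq' =>
    (List.nodup_append.1 hd1).2.2 q hq' q (by simp [hq]) rfl
  have hvl : v ∉ l.list := fun hq' => (List.nodup_append.1 hd1).2.2 v hq' v (by simp) rfl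
  have hd2 : (l.list ++ r.list).Nodup := hd1.sublist (by simp)
  have hd3 : (lf ctx ++ (l.list ++ r.list) ++ rt ctx).Nodup := hd0.sublist (by simp)
  have hlen3 : (lf ctx ++ (l.list ++ r.list) ++ rt ctx).length + 1 ≤ L.length := by
    rw [hlist]; simp
  have hlen2 : (l.list ++ r.list).length + 1 ≤ L.length := by
    simp at hlen3 ⊢; omega
  have hH := hp.len
  have hcavl := hp.cavl
  have hhgt := hp.hgt
  simp only [T.ht] at hH hcavl hhgt
  have sub3 : ∀ q ∈ lf ctx ++ (l.list ++ r.list) ++ rt ctx, q ∈ L := by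
    intro q hq; rw [hlist]; simp at hq ⊢; tauto
  have sub2 : ∀ q ∈ l.list ++ r.list, q ∈ L := by
    intro q hq; rw [hlist]; simp at hq ⊢; tauto
  have s1 : descMaxRegs ⊆ treeRegs := by simp [descMaxRegs, treeRegs, ascRegs, balRegs]
  have s2 : ascRegs ⊆ treeRegs := by intro x; simp [treeRegs]; tauto
  have s3 : balRegs ⊆ treeRegs := by intro x; simp [treeRegs, ascRegs]; tauto
  have hposq : ∀ {q}, q ∈ L → (0 : ℤ) ≠ q := fun hq => (hv _ hq).pos.ne
  refine (Tr.seq (K := 10) (K' := 330 * H + 320) (Q := fun a1 => a1.f = a.f ∧ Keeps treeRegs a a1 ∧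
    a1.r .xs = ctop ctx ∧ a1.r .tv = v ∧ a1.r .q = l.ptr) (Tr.blk hE ?_ ?_) ?_).mono
    (by omega) fun _ h => h
  · simp [Oks, Instr.Ok, Instr.ev, Fld.isChar, Valid, hp.q, T.ptr, vv]
  · refine ⟨rfl, ⟨rfl, rfl, fun x hx => ?_⟩, ?_, ?_, ?_⟩
    · simp only [treeRegs, ascRegs, balRegs, List.mem_cons, List.not_mem_nil, or_false,
        not_or] at hx
      simp [evs, Instr.ev, Function.update_of_ne, hx]
    all_goals simp [evs, Instr.ev, hp.q, hp.tp, i1, T.ptr]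
  rintro a1 ⟨f1, k1, e1, e2, e3⟩
  have z1 : a1.r .zr = 0 := by rw [k1.r _ (by simp [treeRegs, ascRegs, balRegs]), hz]
  have o1 : a1.r .one = 1 := by rw [k1.r _ (by simp [treeRegs, ascRegs, balRegs]), hone]
  rw [← f1] at i1 i2 il ir h0
  refine (Tr.seq (K := 180 * l.ht + 190) (K' := 150 * ctx.length + 10) (Q := fun a2 => ∃ t : T,
    t.list = l.list ++ r.list ∧ t.In a2.f ∧ t.Avl ∧ t.ht ≤ max l.ht r.ht + 1 + 1 ∧
    max l.ht r.ht + 1 ≤ t.ht + 1 ∧ a2.r .q = t.ptr ∧ a2.r .xs = ctop ctx ∧ Keeps treeRegs a a2 ∧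
    EdgeFrame (l.list ++ r.list) a.f a2.f) ?_ ?_).mono (by omega) fun _ h => h
  · refine (Tr.ite (K := 180 * l.ht + 189) (l ≠ .nil) ?_ (fun h => ?_) (fun h => ?_)).mono
      le_rfl fun _ h => h
    · cases l with
      | nil => simp [BT.Is, z1, e3, T.ptr]
      | node l1 q1 r1 => simp [BT.Is, z1, e3, T.ptr, (hv q1 (hlL _ (by simp [T.list]))).pos]
    · refine (Tr.seq (K := 30 * l.ht + 30) (K' := 150 * l.ht + 159) (descMax_spec hE a1 o1 z1 l h
        e3 il al (fun q hq => hv q (hlL q hq)) hdl) ?_).mono (by omega) fun _ h => h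
      rintro a2 ⟨ll, m, ctx2, p2, hr2, k2, g2⟩
      have hll : l.list = (lf ctx2 ++ ll.list) ++ [m] := by
        rw [p2.list, hr2]; simp [T.list]
      have hml : m ∈ l.list := by simp [hll]
      have vm := hv m (hlL m hml)
      refine (Tr.seq (K := 7) (K' := 150 * l.ht + 152) (Q := fun a3 => a3.f = a2.f ∧
        Keeps treeRegs a2 a3 ∧ a3.r .xs = ctop ctx ∧ a3.r .tv = v ∧ a3.r .tm = m ∧
        a3.r .q = ll.ptr ∧ a3.r .tp = ctop ctx2) (Tr.blk hE ?_ ?_) ?_).mono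
        (by omega) fun _ h => h
      · simp [Oks, Instr.Ok, Instr.ev, Fld.isChar, Valid, p2.q, T.ptr, vm]
      · refine ⟨rfl, ⟨rfl, rfl, fun x hx => ?_⟩, ?_, ?_, ?_, ?_, ?_⟩
        · simp only [treeRegs, ascRegs, balRegs, List.mem_cons, List.not_mem_nil, or_false,
            not_or] at hx
          simp [evs, Instr.ev, Function.update_of_ne, hx]
        · simp [evs, Instr.ev, k2.r _ (by simp [descMaxRegs] : Reg.xs ∉ descMaxRegs), e1]
        · simp [evs, Instr.ev, k2.r _ (by simp [descMaxRegs] : Reg.tv ∉ descMaxRegs), e2]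
        · simp [evs, Instr.ev, p2.q, T.ptr]
        · simp [evs, Instr.ev, p2.q, T.ptr, p2.tin.1]
        · simp [evs, Instr.ev, p2.tp]
      rintro a3 ⟨f3, k3, x3, v3, m3, q3, tp3⟩
      have kk3 : Keeps treeRegs a a3 := (k1.trans (k2.mono s1)).trans k3
      have z3 : a3.r .zr = 0 := by rw [kk3.r _ (by simp [treeRegs, ascRegs, balRegs]), hz]
      have o3 : a3.r .one = 1 := by rw [kk3.r _ (by simp [treeRegs, ascRegs, balRegs]), hone]
      have ht2 : (T.node ll m T.nil).ht = ll.ht + 1 := by simp [T.ht]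
      have hc2 := p2.len
      rw [ht2] at hc2
      -- The end of the inner path held `m` with its left subtree `ll`, of height `ll.ht + 1`, and
      -- now holds `ll` alone.
      refine (Tr.seq (K := 150 * ctx2.length + 1) (K' := 143) (ascend_spec hE ctx2 a3
        (by rw [f3, g2 _ _ (by simp), h0]) o3 z3 ll (ll.ht + 1) tp3 q3 (f3 ▸ p2.tin.2.2.2.1)
        (f3 ▸ p2.cin) (lf ctx2 ++ ll.list) (by rw [hr2]; simp)
        (fun q hq => hv q (hlL q (by rw [hll]; simp at hq ⊢; tauto)))
        (by rw [hll] at hdl; exact (List.nodup_append.1 hdl).1)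
        (by rw [hll] at hlen2; simp at hlen2 ⊢; omega) p2.avl.1 (ht2 ▸ p2.cavl) (by omega)
        (by omega)) ?_).mono (by omega) fun _ h => h
      rintro a4 ⟨l', j1, j2, j3, j4, j5, j6, j7, j8⟩
      rw [← ht2, p2.hgt] at j4 j5
      have ef4 : EdgeFrame l.list a1.f a4.f :=
        g2.edge.trans (f3 ▸ (j8.mono (by rw [hll]; intro q hq; simp at hq ⊢; tauto)).edge)
      have x4 : a4.r .xs = ctop ctx := by rw [j7.r _ (by simp [ascRegs, balRegs]), x3]
      have v4 : a4.r .tv = v := by rw [j7.r _ (by simp [ascRegs, balRegs]), v3]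
      have m4 : a4.r .tm = m := by rw [j7.r _ (by simp [ascRegs, balRegs]), m3]
      have kk4 : Keeps treeRegs a a4 := kk3.trans (j7.mono s2)
      have hvm : v ≠ m := fun h => hvl (h ▸ hml)
      have hml' : m ∉ l'.list := by
        rw [j1]; rw [hll] at hdl
        intro hm
        exact (List.nodup_append.1 hdl).2.2 m hm m (by simp) rfl
      refine Tr.seq (K := 13) (K' := 130) (Q := fun a5 => EdgeFrame [m] a4.f a5.f ∧
        Keeps treeRegs a4 a5 ∧ a5.r .xs = ctop ctx ∧ a5.r .tp = m ∧ a5.f .l m = l'.ptr ∧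
        a5.f .r m = r.ptr) (Tr.blk hE ?_ ?_) ?_
      · simp [Oks, Instr.Ok, Instr.ev, Fld.isChar, Valid, m4, v4, vm, vv]
      · refine ⟨?_, ⟨rfl, rfl, fun x hx => ?_⟩, ?_, ?_, ?_, ?_⟩
        · intro fl p hp
          simp only [List.mem_cons, List.not_mem_nil, or_false] at hp
          by_cases e1 : fl = .l
          · subst e1; simp [evs, Instr.ev, m4, hp]
          · by_cases e2 : fl = .r
            · subst e2; simp [evs, Instr.ev, m4, hp]
            · simp [evs, Instr.ev, e1, e2]
        · simp only [treeRegs, ascRegs, balRegs, List.mem_cons, List.not_mem_nil, or_false,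
            not_or] at hx
          simp [evs, Instr.ev, Function.update_of_ne, hx]
        · simp [evs, Instr.ev, x4]
        · simp [evs, Instr.ev, m4]
        · simp [evs, Instr.ev, m4, j6]
        · have := ef4 .r v (fun _ => hvl)
          rw [i2] at this
          simp [evs, Instr.ev, m4, v4, this]
      rintro a5 ⟨g5, k5, x5, t5, ml5, mr5⟩
      have ef5 : EdgeFrame l.list a1.f a5.f := ef4.trans (g5.mono (by simpa using hml))
      have kk5 := kk4.trans k5
      have o5 : a5.r .one = 1 := by rw [kk5.r _ (by simp [treeRegs, ascRegs, balRegs]), hone]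
      refine (balance_spec hE a5
        (by rw [ef5 _ _ (fun _ h => hposq (hlL _ h) rfl), h0]) o5 l' r m t5 ml5 mr5
        (j2.edgeFrame g5 (by intro q hq; rw [List.mem_singleton]; rintro rfl; exact hml' hq)) (ir.edgeFrame ef5 hlr)
        (l.list ++ r.list) (by rw [hll, j1]; simp) (fun q hq => hv q (sub2 q hq)) hd2 (by omega)
        j3 ar (by omega) (by omega)).mono le_rfl ?_
      rintro a6 ⟨t, n1, n2, n3, n4, n5, n6, n7, n8, n9⟩
      refine ⟨t, n1, n2, n3, by omega, by omega, n7, ?_, kk5.trans (n8.mono s3), ?_⟩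
      · rw [n8.r _ (by simp [balRegs]), x5]
      · rw [← f1]
        exact (ef5.mono (by intro q; simp; tauto)).trans n9.edge
    · have h : l = .nil := not_not.1 h
      subst h
      refine (Tr.blk hE ?_ ?_).mono (by simp) fun _ h => h
      · simp [Oks, Instr.Ok, Fld.isChar, Valid, e2, vv]
      · refine ⟨r, by simp [T.list], by simpa [evs, Instr.ev] using ir, ar, ?_, ?_, ?_, ?_,
          k1.trans ⟨rfl, rfl, fun x hx => ?_⟩, ?_⟩
        · simp [T.ht]; omega
        · simp [T.ht]
        · simp [evs, Instr.ev, e2, i2]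
        · simp [evs, Instr.ev, e1]
        · simp only [treeRegs, ascRegs, balRegs, List.mem_cons, List.not_mem_nil, or_false,
            not_or] at hx
          simp [evs, Instr.ev, Function.update_of_ne, hx]
        · intro _ _ _; simp [evs, Instr.ev, f1]
  rintro a2 ⟨t, j1, j2, j3, j4, j5, j6, j7, k2, g2⟩
  refine (Tr.seq (K := 4) (K' := 150 * ctx.length + 1) (Q := fun a3 => a3.f = a2.f ∧
    Keeps treeRegs a2 a3 ∧ a3.r .q = t.ptr ∧ a3.r .tp = ctop ctx) (Tr.blk hE ?_ ?_) ?_).mono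
    (by omega) fun _ h => h
  · simp [Oks, Instr.Ok]
  · refine ⟨rfl, ⟨rfl, rfl, fun x hx => ?_⟩, ?_, ?_⟩
    · simp only [treeRegs, ascRegs, balRegs, List.mem_cons, List.not_mem_nil, or_false,
        not_or] at hx
      simp [evs, Instr.ev, Function.update_of_ne, hx]
    · simp [evs, Instr.ev, j6]
    · simp [evs, Instr.ev, j7]
  rintro a3 ⟨f3, k3, q3, t3⟩
  have kk3 := k2.trans k3
  have z3 : a3.r .zr = 0 := by rw [kk3.r _ (by simp [treeRegs, ascRegs, balRegs]), hz]
  have o3 : a3.r .one = 1 := by rw [kk3.r _ (by simp [treeRegs, ascRegs, balRegs]), hone]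
  refine (ascend_spec hE ctx a3 ?_ o3 z3 t (max l.ht r.ht + 1) t3 q3 (f3 ▸ j2)
    (f3 ▸ hp.cin.edgeFrame g2 ?_) (lf ctx ++ (l.list ++ r.list) ++ rt ctx) (by rw [j1])
    (fun q hq => hv q (sub3 q hq)) hd3 (by omega) j3 hcavl j4 j5).mono le_rfl ?_
  · rw [f3, g2 _ _ (fun _ h => hposq (sub2 _ h) rfl), ← f1, h0]
  · intro q hq h
    have := hdc q hq
    simp at this h; tauto
  · rintro a4 ⟨t', n1, n2, n3, n4, n5, n6, n7, n8⟩
    exact ⟨t', n1, n2, n3, n6, kk3.trans (n7.mono s2),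
      (g2.mono sub2).trans (f3 ▸ (n8.mono sub3).edge)⟩

/-- Inserts the edge from the node `pn` to the node `nv` with label `c`. -/
def insertEdge : Prog :=
  .seq (blk [.ld .q .root .pn]) (.seq descend
    (.seq (blk [.const .u 5, .arith .add .q .nv .u, .st .l .q .zr, .st .r .q .zr, .st .ht .q .one,
        .stc .tlab .q .c, .st .tgt .q .nv])
      (.seq ascend (blk [.st .root .pn .q]))))

/-- The tree node of the new edge is placed at `v + 5`, inside the block of the child `v`. The split
`A`, `B` of the old list is the part to the left and to the right of the search path. -/
theorem insertEdge_spec {E : Env α} {d : ℕ} (hE : Fits E d) (a : AS α) (h0 : a.f .ht 0 = 0)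
    (hone : a.r .one = 1) (hz : a.r .zr = 0) (x v : ℤ) (hx : a.r .pn = x) (hvv : a.r .nv = v)
    (bx : Blk d E.space x) (bv : Blk d E.space v) (t0 : T) (hr : a.f .root x = t0.ptr)
    (hin : t0.In a.f) (ha : t0.Avl) (hv : ∀ q ∈ t0.list, Blk d E.space (q - 5))
    (hd : t0.list.Nodup) (hW : t0.list.length + 2 ≤ E.wordMax) (hW' : v + 5 ≤ E.wordMax)
    (hnew : v + 5 ∉ t0.list) (lb : ℤ → α) (hlb : ∀ q ∈ t0.list, a.g .tlab q = Word.chr (lb q))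
    (hs : t0.list.Pairwise fun p q => lb p < lb q) (c : α) (hc : a.c .c = Word.chr c)
    (hcn : ∀ q ∈ t0.list, lb q ≠ c) :
    Tr E d insertEdge a (180 * t0.ht + 70) fun a' => ∃ (t' : T) (A B : List ℤ),
      t0.list = A ++ B ∧ t'.list = A ++ (v + 5) :: B ∧ (∀ q ∈ A, lb q < c) ∧ (∀ q ∈ B, c < lb q) ∧
      t'.In a'.f ∧ t'.Avl ∧ a'.f .root x = t'.ptr ∧ a'.f .tgt (v + 5) = v ∧
      a'.g = Function.update a.g .tlab (Function.update (a.g .tlab) (v + 5) (Word.chr c)) ∧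
      a'.c .c = a.c .c ∧ (∀ y, y ∉ treeRegs → a'.r y = a.r y) ∧
      ∀ fl p, (fl ∈ [Fld.l, .r, .ht, .up, .dir] → p ∉ (v + 5) :: t0.list) →
        (fl = .root → p ≠ x) → (fl = .tgt → p ≠ v + 5) → a'.f fl p = a.f fl p := by
  have ex5 : ((v + 5 : ℤ) - 5) = v := by ring
  have bv5 : Blk d E.space (v + 5 - 5) := by rw [ex5]; exact bv
  have hvpos := bv5.pos
  have s0 : descRegs ⊆ treeRegs := by simp [descRegs, treeRegs, ascRegs, balRegs]
  have s2 : ascRegs ⊆ treeRegs := by intro x; simp [treeRegs]; tauto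
  refine (Tr.seq (K := 4) (K' := 180 * t0.ht + 66) (Q := fun a1 => a1.f = a.f ∧ Keeps treeRegs a a1
    ∧ a1.r .q = t0.ptr) (Tr.blk hE ?_ ?_) ?_).mono (by omega) fun _ h => h
  · simp [Oks, Instr.Ok, Fld.isChar, Valid, hx, bx]
  · refine ⟨rfl, ⟨rfl, rfl, fun x hx => ?_⟩, ?_⟩
    · simp only [treeRegs, ascRegs, balRegs, List.mem_cons, List.not_mem_nil, or_false,
        not_or] at hx
      simp [evs, Instr.ev, hx]
    · simp [evs, Instr.ev, hx, hr]
  rintro a1 ⟨f1, k1, q1⟩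
  have z1 : a1.r .zr = 0 := by rw [k1.r _ (by simp [treeRegs, ascRegs, balRegs]), hz]
  have o1 : a1.r .one = 1 := by rw [k1.r _ (by simp [treeRegs, ascRegs, balRegs]), hone]
  refine (Tr.seq (K := 30 * t0.ht + 30) (K' := 150 * t0.ht + 36) (descend_spec hE a1 o1 z1 t0 q1
    (f1 ▸ hin) ha hv hd lb (by rw [k1.g]; exact hlb) hs c (by rw [k1.c, hc])) ?_).mono (by omega)
    fun _ h => h
  rintro a2 ⟨t, ctx, p2, hl, hr', hn, k2, g2⟩
  -- No edge is labelled `c` yet, so the search ends at an empty tree.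
  have ht : t = .nil := by
    cases t with
    | nil => rfl
    | node l q r =>
      have := hn l q r rfl
      exact absurd this (hcn q (by rw [p2.list]; simp [T.list]))
  subst ht
  have hlist : t0.list = lf ctx ++ rt ctx := by rw [p2.list]; simp [T.list]
  have kk2 := k1.trans (k2.mono s0)
  have z2 : a2.r .zr = 0 := by rw [kk2.r _ (by simp [treeRegs, ascRegs, balRegs]), hz]
  have o2 : a2.r .one = 1 := by rw [kk2.r _ (by simp [treeRegs, ascRegs, balRegs]), hone]
  have v2 : a2.r .nv = v := by rw [kk2.r _ (by simp [treeRegs, ascRegs, balRegs]), hvv]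
  have hlen := p2.len
  have hsp := hE.space
  have hwd := hE.word
  refine (Tr.seq (K := 22) (K' := 150 * t0.ht + 10) (Q := fun a3 =>
    (∀ fl p, (fl ∈ [Fld.l, .r, .ht, .tgt] → p ≠ v + 5) → a3.f fl p = a2.f fl p) ∧
    a3.f .tgt (v + 5) = v ∧ (T.node .nil (v + 5) .nil).In a3.f ∧ a3.r .q = v + 5 ∧
    a3.r .tp = a2.r .tp ∧ a3.c .c = a2.c .c ∧
    a3.g = Function.update a2.g .tlab (Function.update (a2.g .tlab) (v + 5) (Word.chr c)) ∧
    (∀ y, y ∉ treeRegs → a3.r y = a2.r y)) (Tr.blk hE ?_ ?_) ?_).mono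
    (by omega) fun _ h => h
  · simp [Oks, Instr.Ok, Instr.ev, Fld.isChar, Valid, ArithOp.eval, v2, bv, abs_le]
    omega
  · refine ⟨?_, ?_, ?_, ?_, ?_, rfl, ?_, ?_⟩
    · intro fl p hp
      simp only [List.mem_cons, List.not_mem_nil, or_false] at hp
      by_cases e1 : fl = .l
      · subst e1; simp [evs, Instr.ev, ArithOp.eval, v2, hp]
      by_cases e2 : fl = .r
      · subst e2; simp [evs, Instr.ev, ArithOp.eval, v2, hp]
      by_cases e3 : fl = .ht
      · subst e3; simp [evs, Instr.ev, ArithOp.eval, v2, hp]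
      by_cases e4 : fl = .tgt
      · subst e4; simp [evs, Instr.ev, ArithOp.eval, v2, hp]
      simp [evs, Instr.ev, e1, e2, e3, e4]
    · simp [evs, Instr.ev, ArithOp.eval, v2]
    · simp [evs, Instr.ev, ArithOp.eval, v2, T.In, T.ptr, T.ht, z2, o2]
    · simp [evs, Instr.ev, ArithOp.eval, v2]
    · simp [evs, Instr.ev]
    · simp [evs, Instr.ev, ArithOp.eval, v2, kk2.c, hc]
    · intro y hy
      simp only [treeRegs, ascRegs, balRegs, List.mem_cons, List.not_mem_nil, or_false,
        not_or] at hy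
      simp [evs, Instr.ev, hy]
  rintro a3 ⟨g3, tg3, in3, q3, tp3, c3, gg3, r3⟩
  have z3 : a3.r .zr = 0 := by rw [r3 _ (by simp [treeRegs, ascRegs, balRegs]), z2]
  have o3 : a3.r .one = 1 := by rw [r3 _ (by simp [treeRegs, ascRegs, balRegs]), o2]
  -- The old height at the end of the path is 0, and the new leaf has height 1.
  refine (Tr.seq (K := 150 * ctx.length + 1) (K' := 4) (ascend_spec hE ctx a3
    ?_ o3 z3 (.node .nil (v + 5) .nil) 0 (by rw [tp3, p2.tp]) (by simp [q3, T.ptr]) in3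
    (CIn_congr (fun q hq fl hfl => g3 _ _ fun _ => ?_) p2.cin) (lf ctx ++ (v + 5) :: rt ctx)
    (by simp [T.list]) ?_ ?_ ?_ (by simp [T.Avl]) (by simpa [T.ht] using p2.cavl)
    (by simp [T.ht]) (by simp)) ?_).mono (by omega) fun _ h => h
  · rw [g3 _ _ (fun _ => hvpos.ne), g2 _ _ (by simp), f1, h0]
  · rintro rfl
    exact hnew (by rw [hlist]; simpa using hq)
  · intro q hq
    simp only [List.mem_append, List.mem_cons] at hq
    rcases hq with hq | rfl | hq
    exacts [hv q (by rw [hlist]; simp [hq]), bv5, hv q (by rw [hlist]; simp [hq])]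
  · rw [hlist] at hnew hd
    rw [List.nodup_middle, List.nodup_cons]
    exact ⟨hnew, hd⟩
  · rw [hlist] at hW; simp at hW ⊢; omega
  rintro a4 ⟨t', j1, j2, j3, -, -, j6, j7, j8⟩
  have x4 : a4.r .pn = x := by
    rw [j7.r _ (by simp [ascRegs, balRegs]), r3 _ (by simp [treeRegs, ascRegs, balRegs]),
      kk2.r _ (by simp [treeRegs, ascRegs, balRegs]), hx]
  refine Tr.blk hE ?_ ⟨t', lf ctx, rt ctx, hlist, j1, hl, hr', ?_, j3, ?_, ?_, ?_, ?_, ?_, ?_⟩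
  · simp [Oks, Instr.Ok, Fld.isChar, Valid, x4, bx]
  · refine T.In_congr (fun q hq => ?_) j2
    simp [evs, Instr.ev]
  · simp [evs, Instr.ev, x4, j6]
  · simp only [evs, Instr.ev, ne_eq, reduceCtorEq, not_false_eq_true, Function.update_of_ne]
    rw [j8 _ _ (by simp), tg3]
  · simp [evs, Instr.ev, j7.g, gg3, kk2.g]
  · simp [evs, Instr.ev, j7.c, c3, kk2.c]
  · intro y hy
    change a4.r y = _
    rw [j7.r y (fun h => hy (s2 h)), r3 y hy, kk2.r y hy]
  · intro fl p h1 h2 h3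
    have e1 : (evs E a4 [Instr.st Fld.root Reg.pn Reg.q]).f fl p = a4.f fl p := by
      by_cases e : fl = .root
      · subst e; simp [evs, Instr.ev, x4, h2]
      · simp [evs, Instr.ev, e]
    have sub : ∀ q, q ∈ lf ctx ++ (v + 5) :: rt ctx → q ∈ (v + 5) :: t0.list := by
      intro q hq; rw [hlist]; simp at hq ⊢; tauto
    rw [e1, j8.edge _ _ fun h hp => h1 h (sub _ hp), g3, g2.edge _ _ fun h hp => h1 h (by simp [hp]),
      f1]
    intro h
    by_cases e : fl = .tgt
    · exact h3 e
    · rintro rfl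
      exact h1 (by simp at h ⊢; tauto) (by simp)

/-- Removes the edge with label `c` that leaves the node `pn`. -/
def deleteEdge : Prog :=
  .seq (blk [.ld .q .root .pn]) (.seq descend (.seq delNode (blk [.st .root .pn .q])))

theorem deleteEdge_spec {E : Env α} {d : ℕ} (hE : Fits E d) (a : AS α) (h0 : a.f .ht 0 = 0)
    (hone : a.r .one = 1) (hz : a.r .zr = 0) (x v : ℤ) (hx : a.r .pn = x)
    (bx : Blk d E.space x) (t0 : T) (hr : a.f .root x = t0.ptr)
    (hin : t0.In a.f) (ha : t0.Avl) (hv : ∀ q ∈ t0.list, Blk d E.space (q - 5))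
    (hd : t0.list.Nodup) (hW : t0.list.length + 2 ≤ E.wordMax)
    (hold : v ∈ t0.list) (lb : ℤ → α) (hlb : ∀ q ∈ t0.list, a.g .tlab q = Word.chr (lb q))
    (hs : t0.list.Pairwise fun p q => lb p < lb q) (c : α) (hc : a.c .c = Word.chr c)
    (hcv : lb v = c) :
    Tr E d deleteEdge a (360 * t0.ht + 370) fun a' => ∃ (t' : T) (A B : List ℤ),
      t0.list = A ++ v :: B ∧ t'.list = A ++ B ∧ t'.In a'.f ∧ t'.Avl ∧ a'.f .root x = t'.ptr ∧
      Keeps treeRegs a a' ∧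
      ∀ fl p, (fl ∈ [Fld.l, .r, .ht, .up, .dir] → p ∉ t0.list) →
        (fl = .root → p ≠ x) → a'.f fl p = a.f fl p := by
  have s0 : descRegs ⊆ treeRegs := by simp [descRegs, treeRegs, ascRegs, balRegs]
  refine (Tr.seq (K := 4) (K' := 360 * t0.ht + 366) (Q := fun a1 => a1.f = a.f ∧ Keeps treeRegs a a1
    ∧ a1.r .q = t0.ptr) (Tr.blk hE ?_ ?_) ?_).mono (by omega) fun _ h => h
  · simp [Oks, Instr.Ok, Fld.isChar, Valid, hx, bx]
  · refine ⟨rfl, ⟨rfl, rfl, fun x hx => ?_⟩, ?_⟩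
    · simp only [treeRegs, ascRegs, balRegs, List.mem_cons, List.not_mem_nil, or_false,
        not_or] at hx
      simp [evs, Instr.ev, hx]
    · simp [evs, Instr.ev, hx, hr]
  rintro a1 ⟨f1, k1, q1⟩
  have z1 : a1.r .zr = 0 := by rw [k1.r _ (by simp [treeRegs, ascRegs, balRegs]), hz]
  have o1 : a1.r .one = 1 := by rw [k1.r _ (by simp [treeRegs, ascRegs, balRegs]), hone]
  refine (Tr.seq (K := 30 * t0.ht + 30) (K' := 330 * t0.ht + 334) (descend_spec hE a1 o1 z1 t0 q1
    (f1 ▸ hin) ha hv hd lb (by rw [k1.g]; exact hlb) hs c (by rw [k1.c, hc])) ?_).mono (by omega)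
    fun _ h => h
  rintro a2 ⟨t, ctx, p2, hl, hr', hn, k2, g2⟩
  have kk2 := k1.trans (k2.mono s0)
  have z2 : a2.r .zr = 0 := by rw [kk2.r _ (by simp [treeRegs, ascRegs, balRegs]), hz]
  have o2 : a2.r .one = 1 := by rw [kk2.r _ (by simp [treeRegs, ascRegs, balRegs]), hone]
  -- Labels are strictly increasing, so the search for the label of `v` can only end at `v`.
  have hinj : ∀ p ∈ t0.list, lb p = lb v → p = v := by
    have h1 : (t0.list.map lb).Pairwise (· < ·) := List.pairwise_map.2 hs
    exact fun p hp he => List.inj_on_of_nodup_map (h1.imp fun h => h.ne) hp hold he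
  cases t with
  | nil =>
    exfalso
    rw [p2.list] at hold
    simp only [T.list, List.append_nil, List.mem_append] at hold
    rcases hold with h | h
    · exact (hl v h).ne hcv
    · exact (hr' v h).ne hcv.symm
  | node l q r =>
    have hqc := hn l q r rfl
    have hqv : q = v := hinj q (by rw [p2.list]; simp [T.list]) (by rw [hqc, hcv])
    subst hqv
    refine Tr.seq (K := 330 * t0.ht + 330) (K' := 4) (delNode_spec hE a2
      (by rw [g2 _ _ (by simp), f1, h0]) o2 z2 l r q ctx t0.ht t0.list p2 hv hd (by omega)) ?_
    rintro a3 ⟨t', j1, j2, j3, j4, j5, j6⟩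
    have kk3 := kk2.trans j5
    have x3 : a3.r .pn = x := by rw [kk3.r _ (by simp [treeRegs, ascRegs, balRegs]), hx]
    refine Tr.blk hE ?_ ⟨t', lf ctx ++ l.list, r.list ++ rt ctx, ?_, ?_, ?_, j3, ?_, ?_, ?_⟩
    · simp [Oks, Instr.Ok, Fld.isChar, Valid, x3, bx]
    · rw [p2.list]; simp [T.list]
    · rw [j1]; simp
    · refine T.In_congr (fun q hq => ?_) j2
      simp [evs, Instr.ev]
    · simp [evs, Instr.ev, x3, j4]
    · exact kk3.trans ⟨rfl, rfl, fun _ _ => rfl⟩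
    · intro fl p h1 h2
      have e1 : (evs E a3 [Instr.st Fld.root Reg.pn Reg.q]).f fl p = a3.f fl p := by
        by_cases e : fl = .root
        · subst e; simp [evs, Instr.ev, x3, h2]
        · simp [evs, Instr.ev, e]
      rw [e1, j6 _ _ h1, g2.edge _ _ h1, f1]

end

section

/-! ### Longest palindromic suffixes -/

section Words

variable {α : Type u} [DecidableEq α]

/-- The longest palindromic suffix. -/
def lpsuf : List α → List α
  | [] => []
  | a :: l => if (a :: l).Palindrome then a :: l else lpsuf l

theorem lpsuf_suffix (l : List α) : lpsuf l <:+ l := by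
  induction l with
  | nil => simp [lpsuf]
  | cons a l ih =>
    unfold lpsuf
    split_ifs
    · exact List.suffix_rfl
    · exact ih.trans (List.suffix_cons a l)

theorem lpsuf_pal (l : List α) : (lpsuf l).Palindrome := by
  induction l with
  | nil => exact .nil
  | cons a l ih =>
    unfold lpsuf
    split_ifs with h
    · exact h
    · exact ih

theorem suffix_lpsuf {q l : List α} (h : q <:+ l) (hq : q.Palindrome) : q <:+ lpsuf l := by
  induction l with
  | nil => simpa [lpsuf] using h
  | cons a l ih =>
    unfold lpsuf
    split_ifs with hp
    · exact h
    · rcases List.suffix_cons_iff.1 h with rfl | h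
      · exact (hp hq).elim
      · exact ih h

theorem lpsuf_ne_nil {l : List α} (h : l ≠ []) : lpsuf l ≠ [] := by
  have : [l.getLast h] <:+ lpsuf l :=
    suffix_lpsuf ⟨l.dropLast, List.dropLast_append_getLast h⟩ (.singleton _)
  intro e
  rw [e] at this
  simp at this

/-- A proper suffix that is a palindrome and as long as possible. -/
def plink (p : List α) : List α := lpsuf p.tail

theorem plink_length_lt {p : List α} (h : p ≠ []) : (plink p).length < p.length := by
  have h1 := (lpsuf_suffix p.tail).length_le
  have h2 : p.length ≠ 0 := by simpa using h
  simp only [plink, List.length_tail] at *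
  omega

theorem plink_suffix (p : List α) : plink p <:+ p :=
  (lpsuf_suffix _).trans (List.tail_suffix p)

theorem plink_pal (p : List α) : (plink p).Palindrome := lpsuf_pal _

omit [DecidableEq α] in
theorem suffix_tail_of_ne {q p : List α} (h : q <:+ p) (hne : q ≠ p) : q <:+ p.tail := by
  cases p with
  | nil => simpa using h
  | cons a p =>
    rcases List.suffix_cons_iff.1 h with rfl | h
    · exact (hne rfl).elim
    · exact h

theorem suffix_plink {q p : List α} (h : q <:+ p) (hne : q ≠ p) (hq : q.Palindrome) :
    q <:+ plink p :=
  suffix_lpsuf (suffix_tail_of_ne h hne) hq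

omit [DecidableEq α] in
theorem pal_prefix_of_suffix {q p : List α} (hp : p.Palindrome) (hq : q.Palindrome)
    (h : q <:+ p) : q <+: p := by
  rw [← List.reverse_suffix, hp.reverse_eq, hq.reverse_eq]; exact h

omit [DecidableEq α] in
theorem pal_suffix_of_prefix {q p : List α} (hp : p.Palindrome) (hq : q.Palindrome)
    (h : q <+: p) : q <:+ p := by
  rw [← List.reverse_prefix, hp.reverse_eq, hq.reverse_eq]; exact h

omit [DecidableEq α] in
theorem palSubstrings_mono {w w' : List α} (h : w <:+: w') : palSubstrings w ⊆ palSubstrings w' :=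
  fun _ hp => ⟨hp.1, hp.2.1.trans h, hp.2.2⟩

/-- Suffix links from `x` pass through all palindromic suffixes of `x` in order of decreasing
length. So they reach `p`, and the palindrome just before it links to `p`. -/
theorem exists_plink_eq {w : List α} {p : List α} (hp : p.Palindrome) (h0 : p ≠ []) :
    ∀ (n : ℕ) (x : List α), x.length ≤ n → x ∈ palSubstrings w → p <:+ x → p ≠ x →
      ∃ q ∈ palSubstrings w, plink q = p := by
  intro n
  induction n with
  | zero =>
    intro x hx h
    exact (h.1 (by simpa using hx)).elim
  | succ n ih =>
    intro x hx h hs hne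
    by_cases e : plink x = p
    · exact ⟨x, h, e⟩
    · have hs' := suffix_plink hs hne hp
      have hx' : plink x ≠ [] := by
        intro e'; rw [e'] at hs'; exact h0 (by simpa using hs')
      refine ih (plink x) ?_ ⟨hx', ?_, plink_pal x⟩ hs' (Ne.symm e)
      · have := plink_length_lt h.1; omega
      · exact (plink_suffix x).isInfix.trans h.2.1

/-- Appending a character creates at most one palindrome. -/
theorem palSubstrings_concat (w : List α) (c : α) :
    palSubstrings (w ++ [c]) = insert (lpsuf (w ++ [c])) (palSubstrings w) := by
  ext q
  constructor
  · rintro ⟨h1, h2, h3⟩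
    rw [List.infix_concat_iff] at h2
    rcases h2 with h2 | h2
    · by_cases e : q = lpsuf (w ++ [c])
      · exact Or.inl e
      · right
        -- A palindromic suffix of the longest one is also a prefix of it; being a proper prefix, it
        -- avoids the last character and occurs in `w`.
        have hs := suffix_lpsuf h2 h3
        have hp := pal_prefix_of_suffix (lpsuf_pal _) h3 hs
        have hsuf := lpsuf_suffix (w ++ [c])
        rw [List.suffix_concat_iff] at hsuf
        rcases hsuf with h | ⟨z, hz, hzw⟩
        · rw [h] at hp
          exact (h1 (by simpa using hp)).elim
        · rw [hz, List.prefix_concat_iff] at hp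
          rcases hp with hp | hp
          · exact (e (by rw [hp, hz])).elim
          · exact ⟨h1, hp.isInfix.trans hzw.isInfix, h3⟩
    · exact Or.inr ⟨h1, h2, h3⟩
  · rintro (rfl | h)
    · exact ⟨lpsuf_ne_nil (by simp), (lpsuf_suffix _).isInfix, lpsuf_pal _⟩
    · exact palSubstrings_mono (List.prefix_append w [c]).isInfix h

omit [DecidableEq α] in
theorem palSubstrings_reverse (w : List α) : palSubstrings w.reverse = palSubstrings w := by
  ext q
  simp only [palSubstrings, Set.mem_ofPred_eq]
  refine and_congr_right fun _ => and_congr_left fun h => ?_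
  rw [← List.reverse_infix, List.reverse_reverse, h.reverse_eq]

/-- The longest palindromic prefix. -/
def lppre (w : List α) : List α := lpsuf w.reverse

theorem lppre_prefix (w : List α) : lppre w <+: w := by
  have := lpsuf_suffix w.reverse
  rw [← List.reverse_prefix, List.reverse_reverse, (lpsuf_pal _).reverse_eq] at this
  exact this

theorem prefix_lppre {q w : List α} (h : q <+: w) (hq : q.Palindrome) : q <+: lppre w := by
  have : q <:+ lppre w := suffix_lpsuf (by
    rw [← List.reverse_suffix, hq.reverse_eq] at h; exact h) hq
  exact pal_prefix_of_suffix (lpsuf_pal _) hq this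

/-- Removing the first character destroys at most one palindrome. -/
theorem palSubstrings_cons (a : α) (w : List α) :
    palSubstrings (a :: w) = insert (lppre (a :: w)) (palSubstrings w) := by
  rw [← palSubstrings_reverse, List.reverse_cons, palSubstrings_concat, palSubstrings_reverse,
    ← List.reverse_cons, lppre]

theorem palSubstrings_finite_ncard (w : List α) :
    (palSubstrings w).Finite ∧ (palSubstrings w).ncard ≤ w.length := by
  induction w with
  | nil =>
    have : palSubstrings ([] : List α) = ∅ := by
      ext q
      simp only [palSubstrings, Set.mem_ofPred_eq, List.infix_nil, Set.mem_empty_iff_false]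
      tauto
    simp [this]
  | cons a w ih =>
    rw [palSubstrings_cons]
    exact ⟨ih.1.insert _, (Set.ncard_insert_le _ _).trans (by simpa using ih.2)⟩

/-! ### Nodes -/

/-- The node of a palindrome, where the empty string is represented by the `0`-node. -/
def mkN (p : List α) : ENode α := if p = [] then .zero else .ord p

/-- The suffix link of a node. -/
def slink : ENode α → ENode α
  | .negOne => .negOne
  | .zero => .negOne
  | .ord p => mkN (plink p)

/-- The parent of an ordinary node. -/
def parN (p : List α) : ENode α := if p.length = 1 then .negOne else mkN p.tail.dropLast

omit [DecidableEq α] in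
theorem mkN_len (p : List α) : (mkN p).len = p.length := by
  unfold mkN; split_ifs with h <;> simp [h, ENode.len]

omit [DecidableEq α] in
theorem mkN_pal (p : List α) : (mkN p).pal = p := by
  unfold mkN; split_ifs with h <;> simp [h, ENode.pal]

/-- The nodes of palindromic suffixes of `w`. -/
def SufN (w : List α) : ENode α → Prop
  | .negOne => True
  | .zero => True
  | .ord x => x ≠ [] ∧ x <:+ w ∧ x.Palindrome

omit [DecidableEq α] in
theorem SufN.isNode {w : List α} {v : ENode α} (h : SufN w v) : v.IsNode w := by
  cases v with
  | negOne => trivial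
  | zero => trivial
  | ord x => exact ⟨h.1, h.2.1.isInfix, h.2.2⟩

omit [DecidableEq α] in
theorem sufN_mkN {w p : List α} (h : p <:+ w) (hp : p.Palindrome) : SufN w (mkN p) := by
  unfold mkN
  split_ifs with e
  · trivial
  · exact ⟨e, h, hp⟩

theorem sufN_slink {w : List α} {v : ENode α} (h : SufN w v) : SufN w (slink v) := by
  cases v with
  | negOne => trivial
  | zero => trivial
  | ord x => exact sufN_mkN ((plink_suffix x).trans h.2.1) (plink_pal x)

omit [DecidableEq α] in
theorem isNode_mkN {w p : List α} (h : p <:+: w) (hp : p.Palindrome) : (mkN p).IsNode w := by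
  unfold mkN
  split_ifs with e
  · trivial
  · exact ⟨e, h, hp⟩

theorem isNode_slink {w : List α} {v : ENode α} (h : v.IsNode w) : (slink v).IsNode w := by
  cases v with
  | negOne => trivial
  | zero => trivial
  | ord x => exact isNode_mkN ((plink_suffix x).isInfix.trans h.2.1) (plink_pal x)

omit [DecidableEq α] in
theorem isNode_parN {w p : List α} (h : p ∈ palSubstrings w) : (parN p).IsNode w := by
  unfold parN
  split_ifs with e
  · trivial
  · refine isNode_mkN (((List.dropLast_prefix _).isInfix.trans (List.tail_suffix p).isInfix).trans
      h.2.1) ?_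
    obtain ⟨-, -, h3⟩ := h
    cases h3 with
    | nil => exact .nil
    | singleton x => exact .nil
    | cons_concat x h => simpa using h

omit [DecidableEq α] in
-- Suffixes of one word are determined by their lengths, and the auxiliary nodes have the lengths -1
-- and 0, which no ordinary node has. Searches along suffix links can therefore be analysed through
-- lengths alone.
theorem SufN.ext {w : List α} {u v : ENode α} (hu : SufN w u) (hv : SufN w v)
    (h : u.len = v.len) : u = v := by
  have pos : ∀ {p : List α}, SufN w (.ord p) → p.length ≠ 0 := fun hp e =>
    hp.1 (List.length_eq_zero_iff.1 e)
  cases u with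
  | negOne => cases v <;> simp [ENode.len] at h ⊢
  | zero =>
    cases v <;> simp [ENode.len] at h ⊢
    exact hv.1 (List.length_eq_zero_iff.1 (by omega))
  | ord p =>
    cases v with
    | negOne => simp [ENode.len] at h
    | zero => have := pos hu; simp [ENode.len] at h; simp [h] at this
    | ord q =>
      simp only [ENode.len] at h
      congr 1
      exact (List.suffix_of_suffix_length_le hu.2.1 hv.2.1 (by omega)).eq_of_length (by omega)

omit [DecidableEq α] in
theorem SufN.neg_one_le {w : List α} {v : ENode α} (_ : SufN w v) : -1 ≤ v.len := by
  cases v <;> simp [ENode.len]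

/-- Following suffix links skips no palindromic suffix: a shorter one is a proper palindromic suffix
of `v`, and the link takes the longest of these. -/
theorem SufN.len_le_slink {w : List α} {u v : ENode α} (hu : SufN w u) (hv : SufN w v)
    (h : u.len < v.len) : u.len ≤ (slink v).len := by
  cases v with
  | negOne => have := hu.neg_one_le; have : (ENode.negOne : ENode α).len = -1 := rfl; omega
  | zero => simp only [ENode.len, slink] at *; omega
  | ord p =>
    simp only [slink, mkN_len]
    simp only [ENode.len] at h
    cases u with
    | negOne => simp [ENode.len]
    | zero => simp [ENode.len]
    | ord q =>
      simp only [ENode.len] at h ⊢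
      have hs : q <:+ p := List.suffix_of_suffix_length_le hu.2.1 hv.2.1 (by omega)
      have := (suffix_plink hs (by rintro rfl; omega) hu.2.2).length_le
      omega

theorem SufN.len_le {w : List α} {u : ENode α} (hu : SufN w u) : u.len ≤ (mkN (lpsuf w)).len := by
  rw [mkN_len]
  cases u with
  | negOne => simp only [ENode.len]; omega
  | zero => simp [ENode.len]
  | ord q =>
    have := (suffix_lpsuf hu.2.1 hu.2.2).length_le
    simp only [ENode.len]; omega

theorem slink_len_lt {w : List α} {v : ENode α} (hv : SufN w v) (h : v ≠ .negOne) :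
    (slink v).len < v.len := by
  cases v with
  | negOne => exact (h rfl).elim
  | zero => simp [slink, ENode.len]
  | ord p =>
    have := plink_length_lt hv.1
    simp only [slink, mkN_len]
    simp only [ENode.len]; omega

/-- The palindrome of the child of `v` along an edge with label `c`. -/
def ext (c : α) : ENode α → List α
  | .negOne => [c]
  | .zero => [c, c]
  | .ord x => c :: (x ++ [c])

omit [DecidableEq α] in
theorem ext_length (c : α) (v : ENode α) : ((ext c v).length : ℤ) = v.len + 2 := by
  cases v <;> simp [ext, ENode.len]; ring

omit [DecidableEq α] in
theorem ext_ne_nil (c : α) (v : ENode α) : ext c v ≠ [] := by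
  cases v <;> simp [ext]

omit [DecidableEq α] in
theorem ext_pal {w : List α} {c : α} {v : ENode α} (h : SufN w v) : (ext c v).Palindrome := by
  cases v with
  | negOne => exact .singleton c
  | zero => exact .cons_concat c .nil
  | ord x => exact .cons_concat c h.2.2

omit [DecidableEq α] in
theorem parN_ext {w : List α} {c : α} {v : ENode α} (h : SufN w v) : parN (ext c v) = v := by
  cases v with
  | negOne => simp [ext, parN]
  | zero => simp [ext, parN, mkN]
  | ord x => simp [ext, parN, mkN, h.1]

omit [DecidableEq α] in
theorem ext_head (c : α) (v : ENode α) : (ext c v).head? = some c := by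
  cases v <;> simp [ext]

omit [DecidableEq α] in
-- Stripping both end characters leaves a palindromic suffix of `w`. The one-letter palindrome comes
-- from the -1-node and `cc` from the 0-node.
theorem exists_ext {w q : List α} {c : α} (h : q <:+ w ++ [c]) (hq : q.Palindrome) (h0 : q ≠ []) :
    ∃ v, SufN w v ∧ q = ext c v := by
  rw [List.suffix_concat_iff] at h
  rcases h with rfl | ⟨t, rfl, ht⟩
  · exact (h0 rfl).elim
  · generalize hz : t ++ [c] = z at hq
    cases hq with
    | nil => simp at hz
    | singleton x =>
      have : t = [] := by
        have := congrArg List.length hz; simp at this; exact this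
      subst this
      simp at hz
      exact ⟨.negOne, trivial, by simp [ext, hz]⟩
    | @cons_concat x l hp =>
      have h1 : t = x :: l ∧ [c] = [x] := List.append_inj' (by simpa using hz) rfl
      obtain ⟨rfl, h2⟩ := h1
      simp at h2
      subst h2
      refine ⟨mkN l, sufN_mkN ((List.suffix_cons _ _).trans ht) hp, ?_⟩
      unfold mkN
      split_ifs with e
      · simp [ext, e]
      · simp [ext]

omit [DecidableEq α] in
-- Edges are thus given by the parent function. The condition on lengths is what distinguishes the
-- -1-node from the 0-node, whose palindromes are both empty.
theorem edge_iff {w : List α} {v v' : ENode α} {c : α} (hv : v.IsNode w) (hv' : v'.IsNode w) :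
    v.Edge v' c ↔ ∃ p, v' = .ord p ∧ v = parN p ∧ p.head? = some c := by
  constructor
  · rintro ⟨h1, h2, h3⟩
    cases v' with
    | negOne => simp [ENode.pal] at h3
    | zero => simp [ENode.pal] at h3
    | ord p =>
      refine ⟨p, rfl, ?_, h3⟩
      simp only [ENode.len, ENode.pal] at h1 h2 h3
      unfold parN mkN
      cases v with
      | negOne =>
        have : p.length = 1 := by simp only [] at h1; omega
        simp [this]
      | zero =>
        simp only [] at h1 h2
        rw [if_neg (by omega), if_pos h2.symm]
      | ord x =>
        simp only [] at h1 h2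
        have : x.length ≠ 0 := by simpa using hv.1
        rw [if_neg (by omega), ← h2, if_neg hv.1]
  · rintro ⟨p, rfl, rfl, h3⟩
    have hl : p.length ≠ 0 := by simpa using hv'.1
    refine ⟨?_, ?_, h3⟩
    · unfold parN
      split_ifs with e
      · simp [ENode.len, e]
      · rw [mkN_len]; simp [ENode.len]; omega
    · unfold parN
      split_ifs with e
      · obtain ⟨x, rfl⟩ := List.length_eq_one_iff.1 e
        simp [ENode.pal]
      · rw [mkN_pal]; rfl

theorem sLink_slink {w : List α} {v : ENode α} (hv : v.IsNode w) : v.SLink (slink v) := by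
  cases v with
  | negOne => exact .negOne
  | zero => exact .zero
  | ord p =>
    have hl : p.length ≠ 0 := by simpa using hv.1
    by_cases e : p.length = 1
    · obtain ⟨x, rfl⟩ := List.length_eq_one_iff.1 e
      simpa [slink, plink, lpsuf, mkN] using ENode.SLink.single x
    · have : plink p ≠ [] := lpsuf_ne_nil (by
        intro h; have := congrArg List.length h; simp at this; omega)
      simp only [slink, mkN, this, if_false]
      refine .long p _ (by omega) ⟨⟨plink_suffix p, ?_, plink_pal p⟩, fun q h1 h2 h3 => ?_⟩
      · intro h; have := plink_length_lt hv.1; rw [h] at this; omega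
      · exact (suffix_plink h1 h2 h3).length_le

omit [DecidableEq α] in
-- A palindrome is determined by its interior and its first letter, so a node has at most one child
-- per label.
theorem eq_ext_of_parN {w : List α} {c : α} {q : List α} {v : ENode α} (hq : q ∈ palSubstrings w)
    (h : parN q = v) (hc : q.head? = some c) : q = ext c v := by
  obtain ⟨h1, -, h3⟩ := hq
  subst h
  cases h3 with
  | nil => exact (h1 rfl).elim
  | singleton x => simp at hc; simp [parN, ext, hc]
  | @cons_concat x l hp =>
    simp at hc
    by_cases e : l = []
    · simp [parN, ext, mkN, hc, e]
    · simp [parN, ext, mkN, hc, e]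

/-- The longest matching suffix node yields the longest palindromic suffix after an append. -/
theorem lpsuf_concat {w : List α} {c : α} {v : ENode α} (hv : SufN w v) (hm : ext c v <:+ w ++ [c])
    (hmax : ∀ u, SufN w u → ext c u <:+ w ++ [c] → u.len ≤ v.len) : lpsuf (w ++ [c]) = ext c v := by
  obtain ⟨u, hu, he⟩ := exists_ext (lpsuf_suffix (w ++ [c])) (lpsuf_pal _) (lpsuf_ne_nil (by simp))
  have h1 := hmax u hu (he ▸ lpsuf_suffix _)
  have h2 := (suffix_lpsuf hm (ext_pal hv)).length_le
  have h3 := ext_length c u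
  have h4 := ext_length c v
  rw [he] at h2
  rw [he, hu.ext hv (by omega)]

/-- The longest matching suffix node below the parent yields the suffix link. -/
theorem plink_ext {w : List α} {c : α} {x y : ENode α} (hy : SufN w y)
    (hmx : ext c x <:+ w ++ [c]) (hmy : ext c y <:+ w ++ [c]) (hlt : y.len < x.len)
    (hmax : ∀ u, SufN w u → ext c u <:+ w ++ [c] → u.len < x.len → u.len ≤ y.len) :
    plink (ext c x) = ext c y := by
  have h3 := ext_length c x
  have h4 := ext_length c y
  have hs : ext c y <:+ ext c x := List.suffix_of_suffix_length_le hmy hmx (by omega)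
  have hs' := suffix_plink hs (by intro h; rw [h] at h4; omega) (ext_pal hy)
  have hne : plink (ext c x) ≠ [] := by
    intro h; rw [h] at hs'; exact ext_ne_nil c y (by simpa using hs')
  have hsw := (plink_suffix (ext c x)).trans hmx
  obtain ⟨u, hu, he⟩ := exists_ext hsw (plink_pal _) hne
  have h5 := plink_length_lt (ext_ne_nil c x)
  have h6 := ext_length c u
  rw [he] at h5 hs' hsw
  have h1 := hmax u hu hsw (by omega)
  have h2 := hs'.length_le
  rw [he, hu.ext hy (by omega)]

end Words

end

/-! ### Occurrences of palindromes in a window -/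

section

section Occurrences

variable {α : Type u}

/-- The substring of `S` at the positions `a, …, b - 1`. -/
def sub (S : List α) (a b : ℕ) : List α := (S.drop a).take (b - a)

theorem sub_length {S : List α} {a b : ℕ} (h : b ≤ S.length) : (sub S a b).length = b - a := by
  simp [sub]; omega

theorem sub_getElem? (S : List α) (a b j : ℕ) :
    (sub S a b)[j]? = if j < b - a then S[a + j]? else none := by
  simp [sub, List.getElem?_take]

theorem drop_sub {S : List α} {a b k : ℕ} : (sub S a b).drop k = sub S (a + k) b := by
  simp only [sub, List.drop_take, List.drop_drop]
  congr 1
  omega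

theorem take_sub {S : List α} {a b k : ℕ} (h : a + k ≤ b) :
    (sub S a b).take k = sub S a (a + k) := by
  simp only [sub, List.take_take]
  congr 1
  omega

theorem sub_suffix {S : List α} {a b k : ℕ} (h : a ≤ k) : sub S k b <:+ sub S a b := by
  have : sub S k b = (sub S a b).drop (k - a) := by rw [drop_sub]; congr 1; omega
  rw [this]; exact List.drop_suffix _ _

theorem sub_prefix {S : List α} {a b k : ℕ} (h : k ≤ b) : sub S a k <+: sub S a b := by
  by_cases h' : a ≤ k
  · have : sub S a k = (sub S a b).take (k - a) := by rw [take_sub (by omega)]; congr 1; omega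
    rw [this]; exact List.take_prefix _ _
  · have : sub S a k = [] := by simp [sub]; omega
    rw [this]; exact List.nil_prefix

theorem sub_infix {S : List α} {a b k l : ℕ} (h : a ≤ k) (h' : l ≤ b) :
    sub S k l <:+: sub S a b :=
  (sub_suffix h).isInfix.trans (sub_prefix h').isInfix

theorem eq_sub_of_suffix {S x : List α} {a b : ℕ} (hb : b ≤ S.length) (hx : x ≠ [])
    (h : x <:+ sub S a b) : a + x.length ≤ b ∧ x = sub S (b - x.length) b := by
  have h1 := h.length_le
  rw [sub_length hb] at h1
  have h0 : x.length ≠ 0 := by simpa using hx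
  refine ⟨by omega, ?_⟩
  rw [List.suffix_iff_eq_drop, sub_length hb, drop_sub] at h
  have e : a + (b - a - x.length) = b - x.length := by omega
  rw [e] at h
  exact h

theorem eq_sub_of_prefix {S x : List α} {a b : ℕ} (hb : b ≤ S.length) (hx : x ≠ [])
    (h : x <+: sub S a b) : a + x.length ≤ b ∧ x = sub S a (a + x.length) := by
  have h1 := h.length_le
  rw [sub_length hb] at h1
  have h0 : x.length ≠ 0 := by simpa using hx
  refine ⟨by omega, ?_⟩
  rw [List.prefix_iff_eq_take, take_sub (by omega)] at h
  exact h

theorem eq_sub_of_infix {S x : List α} {a b : ℕ} (hb : b ≤ S.length) (hx : x ≠ [])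
    (h : x <:+: sub S a b) : ∃ k, a ≤ k ∧ k + x.length ≤ b ∧ x = sub S k (k + x.length) := by
  obtain ⟨s, t, h⟩ := h
  have h1 : s ++ x <+: sub S a b := ⟨t, h⟩
  obtain ⟨h2, h3⟩ := eq_sub_of_prefix hb (by simp [hx]) h1
  have h4 : x <:+ sub S a (a + (s ++ x).length) := ⟨s, h3⟩
  obtain ⟨h5, h6⟩ := eq_sub_of_suffix (by omega) hx h4
  refine ⟨a + s.length, by omega, by simp at h2; omega, ?_⟩
  simp only [List.length_append] at h6
  have e1 : a + (s.length + x.length) - x.length = a + s.length := by omega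
  rw [e1, ← add_assoc] at h6
  exact h6

theorem sub_succ {S : List α} {a e : ℕ} (h : a ≤ e) (he : e < S.length) :
    sub S a (e + 1) = sub S a e ++ [S[e]] := by
  have e1 : e + 1 - a = (e - a) + 1 := by omega
  have e2 : a + (e - a) = e := by omega
  simp [sub, e1, List.take_add_one, e2, he]

theorem sub_cons {S : List α} {a e : ℕ} (h : a < e) (he : e ≤ S.length) :
    sub S a e = S[a] :: sub S (a + 1) e := by
  have e1 : e - a = (e - (a + 1)) + 1 := by omega
  rw [sub, List.drop_eq_getElem_cons (by omega), e1, List.take_succ_cons, sub]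

theorem sub_tail {S : List α} {a e : ℕ} : (sub S a e).tail = sub S (a + 1) e := by
  rw [← List.drop_one, drop_sub]

theorem sub_self_succ {S : List α} {a : ℕ} (h : a < S.length) : sub S a (a + 1) = [S[a]] := by
  rw [sub_succ le_rfl h]; simp [sub]

theorem sub_ne_nil {S : List α} {a b : ℕ} (h : a < b) (hb : b ≤ S.length) : sub S a b ≠ [] := by
  intro e
  have := congrArg List.length e
  rw [sub_length hb] at this
  simp at this; omega

/-- Symmetry in absolute positions: reflections and shifts of occurrences become linear arithmetic.
-/
theorem pal_sub_iff {S : List α} {a b : ℕ} (hb : b ≤ S.length) : (sub S a b).Palindrome ↔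
    ∀ x y, a ≤ x → a ≤ y → x + y + 1 = a + b → S[x]? = S[y]? := by
  rw [List.Palindrome.iff_reverse_eq]
  constructor
  · intro h x y hx hy hxy
    have h1 := congrArg (fun l => l[x - a]?) h
    rw [List.getElem?_reverse (by rw [sub_length hb]; omega), sub_getElem?, sub_getElem?,
      sub_length hb, if_pos (by omega), if_pos (by omega)] at h1
    have e1 : a + (b - a - 1 - (x - a)) = y := by omega
    have e2 : a + (x - a) = x := by omega
    rw [e1, e2] at h1
    exact h1.symm
  · intro h
    apply List.ext_getElem?
    intro j
    by_cases hj : j < b - a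
    · rw [List.getElem?_reverse (by rw [sub_length hb]; omega), sub_getElem?, sub_getElem?,
        sub_length hb, if_pos (by omega), if_pos (by omega)]
      exact h _ _ (by omega) (by omega) (by omega)
    · rw [List.getElem?_eq_none (by rw [List.length_reverse, sub_length hb]; omega),
        List.getElem?_eq_none (by rw [sub_length hb]; omega)]

/-- If a palindrome is a proper prefix of another one, then from every position in it there starts
a palindrome that ends after it and inside the longer one. -/
theorem exists_pal_sub {S : List α} {i : ℕ} : ∀ (b : ℕ) {e : ℕ} (_ : e ≤ S.length) (_ : b < e)
    (_ : (sub S i e).Palindrome) (_ : (sub S i b).Palindrome) {a : ℕ} (_ : i ≤ a) (_ : a < b),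
    ∃ f, b < f ∧ f ≤ e ∧ (sub S a f).Palindrome := by
  intro b
  induction b using Nat.strong_induction_on with | _ b ih => ?_
  intro e he hbe h1 h2 a ha hab
  rcases eq_or_lt_of_le ha with rfl | hia
  · exact ⟨e, hbe, le_rfl, h1⟩
  rw [pal_sub_iff he] at h1
  rw [pal_sub_iff (by omega)] at h2
  -- Trimming `[i, e)` by `a - i` at both ends keeps a palindrome. If less than `e - b` is cut off,
  -- it still ends after `b`.
  by_cases hlt : a - i < e - b
  · refine ⟨e - (a - i), by omega, by omega, ?_⟩
    rw [pal_sub_iff (by omega)]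
    intro x y hx hy hxy
    exact h1 x y (by omega) (by omega) (by omega)
  -- The composition of the reflections of `[i, b)` and of `[i, e)` is a shift by `e - b`, so this
  -- is a period of `[i, e)`.
  · have per : ∀ x, i ≤ x → x < b → S[x]? = S[x + (e - b)]? := by
      intro x hx hxb
      rw [h2 x (i + b - 1 - x) hx (by omega) (by omega),
        h1 (i + b - 1 - x) (x + (e - b)) (by omega) (by omega) (by omega)]
    have h3 : (sub S i (b - (e - b))).Palindrome := by
      rw [pal_sub_iff (by omega)]
      intro x y hx hy hxy
      rw [h2 x (y + (e - b)) hx (by omega) (by omega), ← per y hy (by omega)]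
    have h2' : (sub S i b).Palindrome := (pal_sub_iff (by omega)).2 h2
    -- The prefix of `[i, b)` shorter by one period is a palindrome too. Apply the induction
    -- hypothesis to these two one period to the left of `a`, and shift the result back.
    obtain ⟨f, hf1, hf2, hf3⟩ := ih (b - (e - b)) (by omega) (e := b) (by omega) (by omega)
      h2' h3 (a := a - (e - b)) (by omega) (by omega)
    refine ⟨f + (e - b), by omega, by omega, ?_⟩
    rw [pal_sub_iff (by omega)] at hf3 ⊢
    intro x y hx hy hxy
    have e1 := per (x - (e - b)) (by omega) (by omega)
    have e2 := per (y - (e - b)) (by omega) (by omega)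
    have e3 : x - (e - b) + (e - b) = x := by omega
    have e4 : y - (e - b) + (e - b) = y := by omega
    rw [e3] at e1
    rw [e4] at e2
    rw [← e1, ← e2]
    exact hf3 _ _ (by omega) (by omega) (by omega)

/-- `R k` is the length of the palindrome that is registered at the position `k` of the window
`[i, e)`, or `0`; all occurrences of palindromes that are neither proper prefixes nor proper
suffixes of longer ones are registered. -/
structure Registered (S : List α) (i e : ℕ) (R : ℕ → ℕ) : Prop where
  zero : ∀ k, k < i ∨ e ≤ k → R k = 0
  le : ∀ k, i ≤ k → k < e → k + R k ≤ e
  pal : ∀ k, i ≤ k → k < e → (sub S k (k + R k)).Palindrome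
  surf : ∀ k b, i ≤ k → k < b → b ≤ e → (sub S k b).Palindrome →
    (∀ b', b < b' → b' ≤ e → ¬ (sub S k b').Palindrome) →
    (∀ k', i ≤ k' → k' < k → ¬ (sub S k' b).Palindrome) → R k = b - k

/-- Registers a palindrome of length `m` at the position `k`. -/
def regAt (R : ℕ → ℕ) (k m : ℕ) : ℕ → ℕ := if R k < m then Function.update R k m else R

theorem regAt_apply (R : ℕ → ℕ) (k m j : ℕ) :
    regAt R k m j = if j = k then max (R k) m else R j := by
  unfold regAt
  split_ifs with h1 h2 h2
  · subst h2; simp; omega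
  · simp [h2]
  · subst h2; omega
  · rfl

variable [DecidableEq α]

/-- A surface that ends at the new end of the window is the longest palindromic suffix, which is now
registered. Any other surface was one before, and it does not start where that suffix starts, since
it would then be a proper prefix of it; so its registration is not overwritten. -/
theorem Registered.append {S : List α} {i e : ℕ} {R : ℕ → ℕ} (h : Registered S i e R) (hi : i ≤ e)
    (he : e < S.length) :
    Registered S i (e + 1) (regAt R (e + 1 - (lpsuf (sub S i (e + 1))).length)
      (lpsuf (sub S i (e + 1))).length) := by
  have hne : sub S i (e + 1) ≠ [] := sub_ne_nil (by omega) (by omega)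
  obtain ⟨h1, h2⟩ := eq_sub_of_suffix (by omega) (lpsuf_ne_nil hne) (lpsuf_suffix (sub S i (e + 1)))
  have h3 := lpsuf_pal (sub S i (e + 1))
  have h0 : (lpsuf (sub S i (e + 1))).length ≠ 0 := by simpa using lpsuf_ne_nil hne
  have hmax : ∀ k, i ≤ k → k < e + 1 → (sub S k (e + 1)).Palindrome →
      e + 1 - (lpsuf (sub S i (e + 1))).length ≤ k := by
    intro k hk hk' hp
    have := (suffix_lpsuf (sub_suffix hk) hp).length_le
    rw [sub_length (by omega)] at this
    omega
  rw [h2] at h3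
  generalize (lpsuf (sub S i (e + 1))).length = m at *
  clear h2
  -- Whatever was registered there ends at `e` at the latest, so the new registration replaces it.
  have hR : R (e + 1 - m) ≤ m := by
    by_cases hk : e + 1 - m < e
    · have := h.le _ (by omega) hk; omega
    · rw [h.zero _ (by omega)]; omega
  refine ⟨?_, ?_, ?_, ?_⟩
  · intro k hk
    rw [regAt_apply, if_neg (by omega), h.zero k (by omega)]
  · intro k hk hk'
    rw [regAt_apply]
    split_ifs with e1
    · subst e1; omega
    · by_cases hke : k < e
      · have := h.le k hk hke; omega
      · rw [h.zero k (by omega)]; omega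
  · intro k hk hk'
    rw [regAt_apply]
    split_ifs with e1
    · subst e1
      have e2 : e + 1 - m + max (R (e + 1 - m)) m = e + 1 := by omega
      rw [e2]; exact h3
    · by_cases hke : k < e
      · exact h.pal k hk hke
      · rw [h.zero k (by omega)]; simp [sub]; exact .nil
  · intro k b hk hkb hbe hp hmr hml
    rw [regAt_apply]
    by_cases hb : b = e + 1
    · subst hb
      have h4 := hmax k hk hkb hp
      have : k = e + 1 - m := by
        by_contra hne
        exact hml (e + 1 - m) (by omega) (by omega) h3
      rw [if_pos this, ← this]
      subst this
      omega
    · have hk1 : k ≠ e + 1 - m := by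
        rintro rfl
        exact hmr (e + 1) (by omega) le_rfl h3
      rw [if_neg hk1]
      exact h.surf k b hk hkb (by omega) hp (fun b' h1 h2 => hmr b' h1 (by omega)) hml

theorem lppre_sub {S : List α} {i e : ℕ} (hi : i < e) (he : e ≤ S.length) :
    0 < (lppre (sub S i e)).length ∧ i + (lppre (sub S i e)).length ≤ e ∧
      lppre (sub S i e) = sub S i (i + (lppre (sub S i e)).length) := by
  have hne : lppre (sub S i e) ≠ [] := lpsuf_ne_nil (by simpa using sub_ne_nil hi he)
  have h0 : (lppre (sub S i e)).length ≠ 0 := by simpa using hne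
  exact ⟨by omega, eq_sub_of_prefix he hne (lppre_prefix _)⟩

theorem le_lppre {S : List α} {i e b : ℕ} (he : e ≤ S.length) (hb : b ≤ e)
    (hp : (sub S i b).Palindrome) : b ≤ i + (lppre (sub S i e)).length := by
  have := (prefix_lppre (sub_prefix hb) hp).length_le
  rw [sub_length (by omega)] at this
  omega

/-- The longest palindromic prefix of the window is registered. -/
theorem Registered.first {S : List α} {i e : ℕ} {R : ℕ → ℕ} (h : Registered S i e R) (hi : i < e)
    (he : e ≤ S.length) : R i = (lppre (sub S i e)).length := by
  obtain ⟨h0, h1, h2⟩ := lppre_sub hi he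
  -- The prefix is a surface: it is the longest palindrome starting at `i`, and no position of the
  -- window precedes `i`.
  rw [h.surf i (i + (lppre (sub S i e)).length) le_rfl (by omega) h1 (h2 ▸ lpsuf_pal _)]
  · omega
  · intro b' hb hbe hp
    have := le_lppre he hbe hp
    omega
  · intro k' hk hk'; omega

theorem plink_sub {S : List α} {i k b : ℕ} (hb : b ≤ S.length) (hik : i < k) (hkb : k < b)
    (hp : (sub S k b).Palindrome) (hmax : ∀ k', i < k' → k' < k → ¬ (sub S k' b).Palindrome) :
    plink (sub S i b) = sub S k b := by
  have h1 : sub S k b <:+ plink (sub S i b) :=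
    suffix_plink (sub_suffix hik.le) (fun h => by
      have := congrArg List.length h
      rw [sub_length hb, sub_length hb] at this; omega) hp
  have h2 : plink (sub S i b) <:+ sub S (i + 1) b := by
    rw [plink, sub_tail]; exact lpsuf_suffix _
  have hne : plink (sub S i b) ≠ [] := by
    intro h; rw [h] at h1; exact sub_ne_nil hkb hb (by simpa using h1)
  obtain ⟨h3, h4⟩ := eq_sub_of_suffix hb hne h2
  have h5 := h1.length_le
  rw [sub_length hb] at h5
  have h6 : b - (plink (sub S i b)).length = k := by
    by_contra hk
    exact hmax _ (by omega) (by omega) (h4 ▸ plink_pal _)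
  rw [h4, h6]

/-- The registered lengths after the deletion of the first character. -/
def delAt (S : List α) (i e : ℕ) (R : ℕ → ℕ) : ℕ → ℕ :=
  regAt (Function.update R i 0)
    (i + (lppre (sub S i e)).length - (plink (lppre (sub S i e))).length)
    (plink (lppre (sub S i e))).length

/-- An occurrence `[k, b)` can become a surface only because it was a proper suffix of a palindrome
`[i, b)`. If `[i, b)` were shorter than the longest palindromic prefix, `exists_pal_sub` would give
a palindrome starting at `k` and ending after `b`, so `[k, b)` would still not be a surface. Hence
`[i, b)` is the longest palindromic prefix and `[k, b)` its longest proper palindromic suffix, which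
`delAt` registers. -/
theorem Registered.delete {S : List α} {i e : ℕ} {R : ℕ → ℕ} (h : Registered S i e R) (hi : i < e)
    (he : e ≤ S.length) : Registered S (i + 1) e (delAt S i e R) := by
  obtain ⟨h0, h1, h2⟩ := lppre_sub hi he
  have hpal : (lppre (sub S i e)).Palindrome := lpsuf_pal _
  have hq := plink_length_lt (p := lppre (sub S i e)) (by intro h; rw [h] at h0; simp at h0)
  have hqp := plink_pal (lppre (sub S i e))
  have hqs : plink (lppre (sub S i e)) ≠ [] → plink (lppre (sub S i e)) =
      sub S (i + (lppre (sub S i e)).length - (plink (lppre (sub S i e))).length)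
        (i + (lppre (sub S i e)).length) := by
    intro hne
    have := plink_suffix (lppre (sub S i e))
    conv at this => rhs; rw [h2]
    exact (eq_sub_of_suffix (by omega) hne this).2
  have hmaxp : ∀ b, b ≤ e → (sub S i b).Palindrome → b ≤ i + (lppre (sub S i e)).length :=
    fun b => le_lppre he
  have hlink : ∀ k, i < k → k < i + (lppre (sub S i e)).length →
      (sub S k (i + (lppre (sub S i e)).length)).Palindrome →
      (∀ k', i < k' → k' < k → ¬ (sub S k' (i + (lppre (sub S i e)).length)).Palindrome) →
      (plink (lppre (sub S i e))).length = i + (lppre (sub S i e)).length - k := by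
    intro k hk hk' hp hm
    have := plink_sub (by omega) hk hk' hp hm
    rw [← h2] at this
    rw [this, sub_length (by omega)]
  have hR1 : ∀ k, i + 1 ≤ k → Function.update R i 0 k = R k := fun k hk => by
    rw [Function.update_of_ne (by omega)]
  rw [h2] at hpal
  unfold delAt
  generalize (lppre (sub S i e)).length = m at *
  have hq0 : plink (lppre (sub S i e)) = [] ↔ (plink (lppre (sub S i e))).length = 0 := by simp
  generalize hn : (plink (lppre (sub S i e))).length = n at *
  refine ⟨?_, ?_, ?_, ?_⟩
  · intro k hk
    rw [regAt_apply]
    split_ifs with e1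
    · subst e1
      have : n = 0 := by omega
      subst this
      rcases hk with hk | hk
      · omega
      · rw [hR1 _ (by omega), h.zero _ (by omega)]; rfl
    · by_cases hki : k = i
      · subst hki; simp
      · rw [Function.update_of_ne hki, h.zero k (by omega)]
  · intro k hk hk'
    rw [regAt_apply]
    split_ifs with e1
    · subst e1
      rw [hR1 _ hk]
      have := h.le _ (by omega) hk'
      omega
    · rw [hR1 _ hk]; exact h.le _ (by omega) hk'
  · intro k hk hk'
    rw [regAt_apply]
    split_ifs with e1
    · subst e1
      rw [hR1 _ hk]
      rcases le_total n (R (i + m - n)) with hh | hh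
      · rw [max_eq_left hh]; exact h.pal _ (by omega) hk'
      · rw [max_eq_right hh]
        by_cases hz : n = 0
        · subst hz
          have : sub S (i + m - 0) (i + m - 0 + 0) = [] := by simp [sub]
          rw [this]; exact .nil
        · have e2 : i + m - n + n = i + m := by omega
          rw [e2, ← hqs (fun h => hz (hq0.1 h))]
          exact hqp
    · rw [hR1 _ hk]; exact h.pal _ (by omega) hk'
  · intro k b hk hkb hbe hp hmr hml
    -- No palindrome that starts at `k` is longer than a surface there, so taking the maximum in
    -- `regAt` never hides the surface.
    have hRk : k + R k ≤ b := by
      by_contra hlt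
      exact hmr (k + R k) (by omega) (h.le k (by omega) (by omega)) (h.pal k (by omega) (by omega))
    rw [regAt_apply]
    by_cases hpi : (sub S i b).Palindrome
    · have hbm := hmaxp b hbe hpi
      rcases eq_or_lt_of_le hbm with rfl | hlt
      · have hnk := hlink k (by omega) hkb hp (fun k' h1 h2 => hml k' (by omega) h2)
        have e3 : i + m - n = k := by omega
        rw [e3, if_pos rfl, hR1 k hk]
        omega
      · obtain ⟨f, hf1, hf2, hf3⟩ := exists_pal_sub (e := i + m) (i := i) (a := k) b
          (by omega) hlt hpal hpi (by omega) hkb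
        exact (hmr f hf1 (by omega) hf3).elim
    · have hs := h.surf k b (by omega) hkb hbe hp hmr (fun k' hk' hlt hp' => by
        rcases eq_or_lt_of_le hk' with rfl | hlt'
        · exact hpi hp'
        · exact hml k' (by omega) hlt hp')
      split_ifs with e1
      · rw [← e1, hR1 k hk, hs]
        -- The newly registered palindrome starts at `k` as well, so it cannot be longer than the
        -- surface.
        have : n ≤ b - k := by
          by_contra hlt
          have hz : n ≠ 0 := by omega
          refine hmr (i + m) (by omega) h1 ?_
          rw [e1, ← hqs (fun h => hz (hq0.1 h))]
          exact hqp
        omega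
      · rw [hR1 k hk, hs]

/-- The longest palindromic prefix has another occurrence in the window if and only if it is
registered elsewhere or is the target of a suffix link. -/
theorem lppre_mem_iff {S : List α} {i e : ℕ} {R : ℕ → ℕ} (hi : i < e) (he : e ≤ S.length)
    (h : Registered S (i + 1) e R) : lppre (sub S i e) ∈ palSubstrings (sub S (i + 1) e) ↔
      (∃ k, i + 1 ≤ k ∧ k < e ∧ sub S k (k + R k) = lppre (sub S i e)) ∨
        ∃ q ∈ palSubstrings (sub S i e), plink q = lppre (sub S i e) := by
  obtain ⟨h0, h1, h2⟩ := lppre_sub hi he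
  have hpal : (lppre (sub S i e)).Palindrome := lpsuf_pal _
  have hne : lppre (sub S i e) ≠ [] := by intro h; rw [h] at h0; simp at h0
  have hcons : palSubstrings (sub S i e) =
      insert (lppre (sub S i e)) (palSubstrings (sub S (i + 1) e)) := by
    rw [sub_cons hi he, palSubstrings_cons]
  have hmono : palSubstrings (sub S (i + 1) e) ⊆ palSubstrings (sub S i e) :=
    palSubstrings_mono (sub_suffix (by omega)).isInfix
  generalize lppre (sub S i e) = P at *
  constructor
  · rintro ⟨-, hinf, -⟩
    obtain ⟨a, ha, hae, hPa⟩ := eq_sub_of_infix he hne hinf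
    have hpa : (sub S a (a + P.length)).Palindrome := hPa ▸ hpal
    -- An occurrence that is not a surface lies at the end or at the start of a longer palindrome.
    -- In the second case `P` is also a suffix of that palindrome by symmetry, and in both cases
    -- suffix links lead from it to `P`.
    by_cases hex : ∃ k', i + 1 ≤ k' ∧ k' < a ∧ (sub S k' (a + P.length)).Palindrome
    · obtain ⟨k', hk1, hk2, hk3⟩ := hex
      right
      have hx : sub S k' (a + P.length) ∈ palSubstrings (sub S i e) :=
        ⟨sub_ne_nil (by omega) (by omega), sub_infix (by omega) (by omega), hk3⟩
      refine exists_plink_eq hpal hne _ _ le_rfl hx ?_ ?_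
      · conv => lhs; rw [hPa]
        exact sub_suffix hk2.le
      · intro h
        have := congrArg List.length h
        rw [sub_length (by omega)] at this; omega
    by_cases hex' : ∃ b', a + P.length < b' ∧ b' ≤ e ∧ (sub S a b').Palindrome
    · obtain ⟨b', hb1, hb2, hb3⟩ := hex'
      right
      have hx : sub S a b' ∈ palSubstrings (sub S i e) :=
        ⟨sub_ne_nil (by omega) (by omega), sub_infix (by omega) (by omega), hb3⟩
      refine exists_plink_eq hpal hne _ _ le_rfl hx (pal_suffix_of_prefix hb3 hpal ?_) ?_
      · conv => lhs; rw [hPa]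
        exact sub_prefix hb1.le
      · intro h
        have := congrArg List.length h
        rw [sub_length (by omega)] at this; omega
    · left
      refine ⟨a, ha, by omega, ?_⟩
      have := h.surf a (a + P.length) ha (by omega) hae hpa
        (fun b' h1 h2 h3 => hex' ⟨b', h1, h2, h3⟩) (fun k' h1 h2 h3 => hex ⟨k', h1, h2, h3⟩)
      rw [this]
      have e1 : a + (a + P.length - a) = a + P.length := by omega
      rw [e1, ← hPa]
  · rintro (⟨k, hk, hke, hP⟩ | ⟨q, hq, hqP⟩)
    · rw [← hP]
      refine ⟨by rw [hP]; exact hne, sub_infix hk (h.le k hk hke), h.pal k hk hke⟩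
    -- A link is strictly shorter than its source, so the source is not `P` itself; it survives the
    -- deletion and contains `P`.
    · rw [hcons] at hq
      have hlt := plink_length_lt (p := q) (by
        rintro rfl; simp [plink, lpsuf] at hqP; exact hne hqP)
      rcases hq with rfl | hq
      · rw [hqP] at hlt; omega
      · exact ⟨hne, (hqP ▸ (plink_suffix q).isInfix).trans hq.2.1, hpal⟩

end Occurrences

end

/-! ### The invariant of the data structure, and the search along suffix links -/

section

variable {α : Type u}

/-- `v` is auxiliary, or its palindrome belongs to `N`. -/
def NodeIn (N : Set (List α)) : ENode α → Prop
  | .negOne => True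
  | .zero => True
  | .ord p => p ∈ N

theorem isNode_iff {w : List α} {v : ENode α} : v.IsNode w ↔ NodeIn (palSubstrings w) v := by
  cases v <;> exact Iff.rfl

/-- The list of free blocks, linked by the field `link`. -/
def FreeList (f : Fld → ℤ → ℤ) : ℤ → List ℤ → Prop
  | p, [] => p = 0
  | p, q :: l => p = q ∧ FreeList f (f .link q) l

theorem FreeList.congr {f f' : Fld → ℤ → ℤ} {l : List ℤ} (h : ∀ q ∈ l, f' .link q = f .link q) :
    ∀ {p : ℤ}, FreeList f p l → FreeList f' p l := by
  induction l with
  | nil => exact fun h => h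
  | cons q l ih =>
    rintro p ⟨h1, h2⟩
    exact ⟨h1, by rw [h q (by simp)]; exact ih (fun q hq => h q (by simp [hq])) h2⟩

variable [LinearOrder α]

/-- `t` is stored at the root of the node `v`, and its entries are the children of `v`. -/
structure IsTree (N : Set (List α)) (addr : ENode α → ℤ) (lb : ℤ → α) (f : Fld → ℤ → ℤ)
    (v : ENode α) (t : T) : Prop where
  root : f .root (addr v) = t.ptr
  tin : t.In f
  avl : t.Avl
  sorted : t.list.Pairwise fun p q => lb p < lb q
  mem : ∀ q, q ∈ t.list ↔ ∃ p ∈ N, parN p = v ∧ q = addr (.ord p) + 5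

/-- The number of registered occurrences of `p` and of suffix links that point to `p`. -/
noncomputable def refs (S : List α) (i e : ℕ) (R : ℕ → ℕ) (N : Set (List α)) (p : List α) : ℕ :=
  (∑ k ∈ Finset.Ico i e, if sub S k (k + R k) = p then 1 else 0) + {q ∈ N | plink q = p}.ncard

/-- The data structure for the nodes with palindromes in `N` and for the occurrences registered by
`R` in the window `[i, e)`. -/
structure NInv (S : List α) (d M i e : ℕ) (N : Set (List α)) (R : ℕ → ℕ) (addr : ENode α → ℤ)
    (fl : List ℤ) (lb : ℤ → α) (a : AS α) : Prop where
  rd : a.r .d = d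
  rneg : a.r .neg = addr .negOne
  rzero : a.r .zero = addr .zero
  rzr : a.r .zr = 0
  rone : a.r .one = 1
  ht0 : a.f .ht 0 = 0
  len0 : a.f .len 0 = 0
  cnt0 : a.f .cnt 0 = 0
  fin : N.Finite
  ne : [] ∉ N
  blk : ∀ v, NodeIn N v → Blk d M (addr v)
  inj : ∀ v v', NodeIn N v → NodeIn N v' → addr v = addr v' → v = v'
  clink : ∀ v, NodeIn N v → NodeIn N (slink v)
  cpar : ∀ p ∈ N, NodeIn N (parN p)
  len : ∀ v, NodeIn N v → a.f .len (addr v) = v.len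
  link : ∀ v, NodeIn N v → a.f .link (addr v) = addr (slink v)
  par : ∀ p ∈ N, a.f .par (addr (.ord p)) = addr (parN p)
  lab : ∀ p ∈ N, ∀ c, p.head? = some c → a.g .lab (addr (.ord p)) = Word.chr c
  tgt : ∀ p ∈ N, a.f .tgt (addr (.ord p) + 5) = addr (.ord p)
  tlab : ∀ p ∈ N, ∀ c, p.head? = some c → a.g .tlab (addr (.ord p) + 5) = Word.chr c
  lbs : ∀ p ∈ N, ∀ c, p.head? = some c → lb (addr (.ord p) + 5) = c
  tree : ∀ v, NodeIn N v → ∃ t, IsTree N addr lb a.f v t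
  cnt : ∀ p ∈ N, a.f .cnt (addr (.ord p)) = refs S i e R N p
  occ : ∀ k, i ≤ k → k < e → R k ≠ 0 → sub S k (k + R k) ∈ N
  arr : ∀ k, i ≤ k → k < e → a.f .arr ((k % d : ℕ) : ℤ) =
    if R k = 0 then 0 else addr (.ord (sub S k (k + R k)))
  arr0 : ∀ m : ℕ, m < d → (∀ k, i ≤ k → k < e → k % d ≠ m) → a.f .arr m = 0
  free : FreeList a.f (a.r .free) fl
  fnodup : fl.Nodup
  fblk : ∀ p ∈ fl, Blk d M p ∧ p < a.r .bump
  fnew : ∀ p ∈ fl, ∀ v, NodeIn N v → addr v ≠ p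
  bump : a.r .bump = 13 + d + 13 * (N.ncard + 2 + fl.length : ℕ)
  old : ∀ v, NodeIn N v → addr v < a.r .bump

variable {S : List α} {d M i e : ℕ} {N : Set (List α)} {R : ℕ → ℕ} {addr : ENode α → ℤ}
  {fl : List ℤ} {lb : ℤ → α} {a a' : AS α}

/-- The registers that the data structure depends on. -/
def coreRegs : List Reg := [.d, .neg, .zero, .zr, .one, .free, .bump]

theorem NInv.of_eq (h : NInv S d M i e N R addr fl lb a) (hf : a'.f = a.f) (hg : a'.g = a.g)
    (hr : ∀ x ∈ coreRegs, a'.r x = a.r x) : NInv S d M i e N R addr fl lb a' := by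
  have h1 := hr .d (by simp [coreRegs])
  have h2 := hr .neg (by simp [coreRegs])
  have h3 := hr .zero (by simp [coreRegs])
  have h4 := hr .zr (by simp [coreRegs])
  have h5 := hr .one (by simp [coreRegs])
  have h6 := hr .free (by simp [coreRegs])
  have h7 := hr .bump (by simp [coreRegs])
  cases h
  constructor <;> first | assumption | (simp only [hf, hg, h1, h2, h3, h4, h5, h6, h7]; assumption)

theorem Blk.pos' {d M : ℕ} {p : ℤ} (h : Blk d M p) : 13 ≤ p := by
  obtain ⟨k, h, -⟩ := h; omega

theorem Blk.le {d M : ℕ} {p : ℤ} (h : Blk d M p) : p + 13 ≤ M := by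
  obtain ⟨k, h, h'⟩ := h; omega

theorem NInv.tree_blk (h : NInv S d M i e N R addr fl lb a) {v : ENode α} {t : T}
    (ht : IsTree N addr lb a.f v t) : ∀ q ∈ t.list, Blk d M (q - 5) := by
  intro q hq
  obtain ⟨p, hp, -, rfl⟩ := (ht.mem q).1 hq
  simpa using h.blk (.ord p) hp

theorem IsTree.nodup {f : Fld → ℤ → ℤ} {v : ENode α} {t : T} (ht : IsTree N addr lb f v t) :
    t.list.Nodup :=
  ht.sorted.imp fun h e => by subst e; exact lt_irrefl _ h

omit [LinearOrder α] in
theorem exists_head {p : List α} (h : p ≠ []) : ∃ c, p.head? = some c := by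
  cases p with
  | nil => exact (h rfl).elim
  | cons x l => exact ⟨x, rfl⟩

theorem NInv.tree_lab (h : NInv S d M i e N R addr fl lb a) {v : ENode α} {t : T}
    (ht : IsTree N addr lb a.f v t) : ∀ q ∈ t.list, a.g .tlab q = Word.chr (lb q) := by
  intro q hq
  obtain ⟨p, hp, -, rfl⟩ := (ht.mem q).1 hq
  obtain ⟨c, hc⟩ := exists_head (p := p) (by rintro rfl; exact h.ne hp)
  rw [h.tlab p hp c hc, h.lbs p hp c hc]

/-- The labels in one tree are distinct, and each is the first character of a palindrome that occurs
in `w`. -/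
theorem NInv.tree_length (h : NInv S d M i e N R addr fl lb a) {v : ENode α} {t : T}
    (ht : IsTree N addr lb a.f v t) {w : List α} (hN : N = palSubstrings w) :
    t.list.length ≤ w.toFinset.card := by
  have h1 : (t.list.map lb).Pairwise (· < ·) := List.pairwise_map.2 ht.sorted
  have h2 : (t.list.map lb).Nodup := h1.imp fun h => h.ne
  rw [← List.length_map (f := lb), ← List.toFinset_card_of_nodup h2]
  apply Finset.card_le_card
  intro c hc
  simp only [List.mem_toFinset, List.mem_map] at hc ⊢
  obtain ⟨q, hq, rfl⟩ := hc
  obtain ⟨p, hp, -, rfl⟩ := (ht.mem q).1 hq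
  obtain ⟨c, hc⟩ := exists_head (p := p) (by rintro rfl; exact h.ne hp)
  rw [h.lbs p hp c hc]
  rw [hN] at hp
  exact hp.2.1.subset (List.mem_of_mem_head? hc)

theorem NInv.tree_ht (h : NInv S d M i e N R addr fl lb a) {v : ENode α} {t : T}
    (ht : IsTree N addr lb a.f v t) {w : List α} (hN : N = palSubstrings w) :
    t.ht ≤ 2 * Nat.log 2 (w.toFinset.card + 1) :=
  ht.avl.ht_le_log.trans (Nat.mul_le_mul_left 2 (Nat.log_mono_right
    (Nat.add_le_add_right (h.tree_length ht hN) 1)))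

omit [LinearOrder α] in
theorem NodeIn.of_sufN {w : List α} {v : ENode α} (h : SufN w v) : NodeIn (palSubstrings w) v :=
  isNode_iff.1 h.isNode

omit [LinearOrder α] in
/-- A suffix node can be extended if and only if the character before its palindrome matches. -/
theorem ext_suffix_iff {S : List α} {i e : ℕ} (hi : i ≤ e) (he : e < S.length) {v : ENode α}
    (hv : SufN (sub S i e) v) : ext S[e] v <:+ sub S i e ++ [S[e]] ↔
      (i : ℤ) ≤ e - v.len - 1 ∧ S[((e : ℤ) - v.len - 1).toNat]? = some S[e] := by
  rw [← sub_succ hi he]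
  have hlen := ext_length S[e] v
  have hneg := hv.neg_one_le
  constructor
  · intro h
    obtain ⟨h1, h2⟩ := eq_sub_of_suffix (by omega) (ext_ne_nil _ v) h
    refine ⟨by omega, ?_⟩
    have h3 := ext_head S[e] v
    rw [h2, List.head?_eq_getElem?, sub_getElem?, if_pos (by omega)] at h3
    rw [← h3]
    congr 1
    omega
  · rintro ⟨h1, h2⟩
    cases v with
    | negOne =>
      have : ext S[e] (.negOne : ENode α) = sub S e (e + 1) := by rw [sub_self_succ he]; rfl
      rw [this]; exact sub_suffix hi
    | zero =>
      simp only [ENode.len] at h1 h2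
      have e1 : ((e : ℤ) - 0 - 1).toNat = e - 1 := by omega
      rw [e1, List.getElem?_eq_getElem (by omega)] at h2
      have : ext S[e] (.zero : ENode α) = sub S (e - 1) (e + 1) := by
        rw [sub_cons (by omega) (by omega)]
        have e2 : e - 1 + 1 = e := by omega
        simp only [e2]
        rw [sub_self_succ he, Option.some.inj h2]; rfl
      rw [this]; exact sub_suffix (by omega)
    | ord x =>
      simp only [ENode.len] at h1 h2
      obtain ⟨h3, h4⟩ := eq_sub_of_suffix (by omega) hv.1 hv.2.1
      have e1 : ((e : ℤ) - x.length - 1).toNat = e - x.length - 1 := by omega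
      rw [e1, List.getElem?_eq_getElem (by omega)] at h2
      have : ext S[e] (.ord x) = sub S (e - x.length - 1) (e + 1) := by
        rw [sub_cons (by omega) (by omega)]
        have e2 : e - x.length - 1 + 1 = e - x.length := by omega
        simp only [e2]
        rw [sub_succ (by omega) he, Option.some.inj h2, ← h4]; rfl
      rw [this]; exact sub_suffix (by omega)

/-- The word size suffices for the window and for the array. -/
structure Big (E : Env α) (S : List α) (d : ℕ) : Prop extends Fits E d where
  text : E.text = S
  big : 4 * (S.length + d) + 100 ≤ E.wordMax

/-- Follows suffix links from `nx` to the first node that can be extended by the character `c`. -/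
def findMatch : Prog :=
  .seq (blk [.copy .fl .one])
    (.while (BT.lt .zr .fl).compile
      (.seq (blk [.ld .tmp .len .nx, .arith .sub .pos .hi .tmp, .arith .sub .pos .pos .one])
        (.ite (BT.lt .pos .lo).compile (blk [.ld .nx .link .nx])
          (.seq (blk [.read .t .pos])
            (.ite (BT.ceq .t .c).compile (blk [.copy .fl .zr]) (blk [.ld .nx .link .nx]))))))

def matchRegs : List Reg := [.nx, .tmp, .pos, .fl]

/-- `y` is the first node on the path of suffix links from `x` that can be extended by `c`. -/
structure IsMatch (w : List α) (c : α) (x y : ENode α) : Prop where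
  suf : SufN w y
  ext : ext c y <:+ w ++ [c]
  le : y.len ≤ x.len
  max : ∀ u, SufN w u → SlidingEertree.ext c u <:+ w ++ [c] → u.len ≤ x.len → u.len ≤ y.len

/-- Each link step shortens the palindrome by at least 1, so the number of steps is at most `x.len -
y.len`. The target `y` is quantified outside `Tr` so that the bound can mention it, which the
amortization needs. -/
theorem findMatch_spec {E : Env α} (hE : Big E S d) (hi : i ≤ e) (he : e < S.length)
    (hlo : E.lo = i) (hhi : E.hi = e) (h : NInv S d E.space i e N R addr fl lb a)
    (hN : N = palSubstrings (sub S i e)) (x : ENode α) (hx : SufN (sub S i e) x)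
    (hnx : a.r .nx = addr x) (hrlo : a.r .lo = i) (hrhi : a.r .hi = e)
    (hc : a.c .c = Word.chr S[e]) :
    ∃ y, IsMatch (sub S i e) S[e] x y ∧
      Tr E d findMatch a (40 * (x.len - y.len).toNat + 50) fun a' => a'.r .nx = addr y ∧
        a'.f = a.f ∧ Keeps matchRegs a a' := by
  suffices H : ∀ (n : ℕ) (x : ENode α), SufN (sub S i e) x → (x.len + 1).toNat = n →
      ∃ y, IsMatch (sub S i e) S[e] x y ∧ ∀ a1 : AS α, a1.f = a.f → Keeps matchRegs a a1 →
        a1.r .nx = addr x → a1.r .fl = 1 →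
        Tr E d (.while (BT.lt .zr .fl).compile
      (.seq (blk [.ld .tmp .len .nx, .arith .sub .pos .hi .tmp, .arith .sub .pos .pos .one])
        (.ite (BT.lt .pos .lo).compile (blk [.ld .nx .link .nx])
          (.seq (blk [.read .t .pos])
            (.ite (BT.ceq .t .c).compile (blk [.copy .fl .zr]) (blk [.ld .nx .link .nx])))))) a1
          (40 * (x.len - y.len).toNat + 40) fun a' => a'.r .nx = addr y ∧
        a'.f = a.f ∧ Keeps matchRegs a a' by
    obtain ⟨y, hy, hT⟩ := H _ x hx rfl
    refine ⟨y, hy, (Tr.seq (K := 4) (K' := 40 * (x.len - y.len).toNat + 40) (Tr.blk hE.toFits ?_ ?_)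
      fun a1 (h1 : a1.f = a.f ∧ Keeps matchRegs a a1 ∧ a1.r .nx = addr x ∧ a1.r .fl = 1) =>
      hT a1 h1.1 h1.2.1 h1.2.2.1 h1.2.2.2).mono (by omega) fun _ h => h⟩
    · simp [Oks, Instr.Ok]
    · refine ⟨rfl, ⟨rfl, rfl, fun x hx => ?_⟩, ?_, ?_⟩
      · simp only [matchRegs, List.mem_cons, List.not_mem_nil, or_false, not_or] at hx
        simp [evs, Instr.ev, hx]
      · simp [evs, Instr.ev, hnx]
      · simp [evs, Instr.ev, h.rone]
  intro n
  induction n using Nat.strong_induction_on with | _ n ih => ?_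
  intro x hx hn
  have hNx : NodeIn N x := hN ▸ NodeIn.of_sufN hx
  have hbig := hE.big
  have hx1 := hx.neg_one_le
  have hxle : x.len ≤ e - i := by
    cases x with
    | negOne => simp only [ENode.len]; omega
    | zero => simp only [ENode.len]; omega
    | ord p =>
      have := hx.2.1.length_le
      rw [sub_length he.le] at this
      simp only [ENode.len]; omega
  have vlen : Valid d E.space .len (addr x) := Or.inr (h.blk x hNx)
  have vlink : Valid d E.space .link (addr x) := h.blk x hNx
  -- The character to be compared stands just before the palindrome. For the -1-node this is the
  -- position `e` itself, so the new character is compared with itself.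
  have first : ∀ a1 : AS α, a1.f = a.f → Keeps matchRegs a a1 → a1.r .nx = addr x →
      a1.r .fl = 1 → Tr E d (SlidingEertree.blk [.ld .tmp .len .nx, .arith .sub .pos .hi .tmp,
        .arith .sub .pos .pos .one]) a1 10 fun a2 => a2.f = a.f ∧ Keeps matchRegs a a2 ∧
          a2.r .nx = addr x ∧ a2.r .fl = 1 ∧ a2.r .pos = e - x.len - 1 := by
    intro a1 f1 k1 n1 l1
    have hi1 : a1.r .hi = e := by rw [k1.r _ (by simp [matchRegs]), hrhi]
    have o1 : a1.r .one = 1 := by rw [k1.r _ (by simp [matchRegs]), h.rone]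
    have hlen : a1.f .len (addr x) = x.len := by rw [f1, h.len x hNx]
    refine Tr.blk hE.toFits ?_ ⟨f1, k1.trans ⟨rfl, rfl, fun x hx => ?_⟩, ?_, ?_, ?_⟩
    · simp [Oks, Instr.Ok, Instr.ev, Fld.isChar, n1, vlen, hi1, o1, hlen, ArithOp.eval, abs_le]
      omega
    · simp only [matchRegs, List.mem_cons, List.not_mem_nil, or_false, not_or] at hx
      simp [evs, Instr.ev, hx]
    · simp [evs, Instr.ev, n1]
    · simp [evs, Instr.ev, l1]
    · simp [evs, Instr.ev, n1, hi1, o1, hlen, ArithOp.eval]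
  have linkstep : ∀ a1 : AS α, a1.f = a.f → Keeps matchRegs a a1 → a1.r .nx = addr x →
      a1.r .fl = 1 → Tr E d (SlidingEertree.blk [.ld .nx .link .nx]) a1 4 fun a2 => a2.f = a.f ∧
        Keeps matchRegs a a2 ∧ a2.r .nx = addr (slink x) ∧ a2.r .fl = 1 := by
    intro a1 f1 k1 n1 l1
    refine Tr.blk hE.toFits ?_ ⟨f1, k1.trans ⟨rfl, rfl, fun x hx => ?_⟩, ?_, ?_⟩
    · simp [Oks, Instr.Ok, Fld.isChar, n1, vlink]
    · simp only [matchRegs, List.mem_cons, List.not_mem_nil, or_false, not_or] at hx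
      simp [evs, Instr.ev, hx]
    · simp [evs, Instr.ev, n1, f1, h.link x hNx]
    · simp [evs, Instr.ev, l1]
  by_cases hm : ext S[e] x <:+ sub S i e ++ [S[e]]
  · refine ⟨x, ⟨hx, hm, le_rfl, fun u _ _ h => h⟩, fun a1 f1 k1 n1 l1 => ?_⟩
    obtain ⟨m1, m2⟩ := (ext_suffix_iff hi he hx).1 hm
    have z1 : a1.r .zr = 0 := by rw [k1.r _ (by simp [matchRegs]), h.rzr]
    refine (Tr.while_true (K := 20) (K' := 1) (p := True) (by simp [BT.Is, z1, l1]) trivial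
      (Tr.seq (K := 10) (K' := 10) (first a1 f1 k1 n1 l1) ?_)).mono (by omega) fun _ h => h
    rintro a2 ⟨f2, k2, n2, l2, p2⟩
    have lo2 : a2.r .lo = i := by rw [k2.r _ (by simp [matchRegs]), hrlo]
    refine Tr.ite (K := 9) False (iff_of_false not_false (by rw [p2, lo2]; omega))
      (fun h => h.elim) fun _ => ?_
    refine Tr.seq (K := 4) (K' := 5) (Q := fun a3 => a3.f = a.f ∧ Keeps matchRegs a a3 ∧
      a3.r .nx = addr x ∧ a3.r .fl = 1 ∧ a3.c .t = Word.chr S[e]) (Tr.blk hE.toFits ?_ ?_) ?_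
    · obtain ⟨m3, -⟩ := List.getElem?_eq_some_iff.1 m2
      simp [Oks, Instr.Ok, p2, hlo, hhi, hE.text]
      omega
    · refine ⟨f2, k2.trans ⟨rfl, rfl, fun _ _ => rfl⟩, n2, l2, ?_⟩
      simp only [evs, Instr.ev, Function.update_self, charAt, hE.text, p2, m2]
    rintro a3 ⟨f3, k3, n3, l3, t3⟩
    have z3 : a3.r .zr = 0 := by rw [k3.r _ (by simp [matchRegs]), h.rzr]
    refine Tr.ite (K := 4) True ⟨_, _, t3, k3.c ▸ hc, by simp⟩ (fun _ => ?_) fun h => (h trivial).elim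
    refine Tr.blk hE.toFits (by simp [Oks, Instr.Ok]) ?_
    refine Tr.while_false (p := False) (by simp [BT.Is, evs, Instr.ev]) not_false ⟨?_, f3, ?_⟩
    · simp [evs, Instr.ev, n3]
    · refine k3.trans ⟨rfl, rfl, fun x hx => ?_⟩
      simp only [matchRegs, List.mem_cons, List.not_mem_nil, or_false, not_or] at hx
      simp [evs, Instr.ev, hx]
  -- The -1-node always matches, because its extension is the single letter; so the search stops
  -- before its self-link is followed.
  · have hxn : x ≠ .negOne := by
      rintro rfl
      exact hm ⟨sub S i e, rfl⟩
    have hlt := slink_len_lt hx hxn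
    have hsx := sufN_slink hx
    have hs1 := hsx.neg_one_le
    obtain ⟨y, hy, hT⟩ := ih _ (by omega) (slink x) hsx rfl
    have hyle := hy.le
    have hy1 := hy.suf.neg_one_le
    refine ⟨y, ⟨hy.suf, hy.ext, by omega, fun u hu hmu hle => ?_⟩, fun a1 f1 k1 n1 l1 => ?_⟩
    -- An extendable suffix node differs from `x`, hence is strictly shorter, hence no longer than
    -- the suffix link of `x`.
    · refine hy.max u hu hmu (hu.len_le_slink hx (lt_of_le_of_ne hle fun hh => ?_))
      exact hm (hu.ext hx hh ▸ hmu)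
    have z1 : a1.r .zr = 0 := by rw [k1.r _ (by simp [matchRegs]), h.rzr]
    refine (Tr.while_true (K := 20) (K' := 40 * ((slink x).len - y.len).toNat + 40) (p := True)
      (by simp [BT.Is, z1, l1]) trivial
      (Tr.seq (K := 10) (K' := 10) (first a1 f1 k1 n1 l1) ?_)).mono (by omega) fun _ h => h
    rintro a2 ⟨f2, k2, n2, l2, p2⟩
    have lo2 : a2.r .lo = i := by rw [k2.r _ (by simp [matchRegs]), hrlo]
    refine Tr.ite (K := 9) ((e : ℤ) - x.len - 1 < i) (by simp only [BT.Is, p2, lo2]) (fun h => ?_)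
      fun hge => ?_
    · exact (linkstep a2 f2 k2 n2 l2).mono (by norm_num) fun a3 h3 => hT a3 h3.1 h3.2.1 h3.2.2.1
        h3.2.2.2
    have hlt' : ((e : ℤ) - x.len - 1).toNat < S.length := by omega
    refine Tr.seq (K := 4) (K' := 5) (Q := fun a3 => a3.f = a.f ∧ Keeps matchRegs a a3 ∧
      a3.r .nx = addr x ∧ a3.r .fl = 1 ∧
      a3.c .t = Word.chr S[((e : ℤ) - x.len - 1).toNat]) (Tr.blk hE.toFits ?_ ?_) ?_
    · simp [Oks, Instr.Ok, p2, hlo, hhi, hE.text]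
      omega
    · refine ⟨f2, k2.trans ⟨rfl, rfl, fun _ _ => rfl⟩, n2, l2, ?_⟩
      simp only [evs, Instr.ev, Function.update_self, charAt, hE.text, p2,
        List.getElem?_eq_getElem hlt']
    rintro a3 ⟨f3, k3, n3, l3, t3⟩
    refine Tr.ite (K := 4) False ⟨_, _, t3, k3.c ▸ hc, ?_⟩ (fun h => h.elim) fun _ => ?_
    · refine iff_of_false not_false fun hh => hm ((ext_suffix_iff hi he hx).2 ⟨by omega, ?_⟩)
      rw [List.getElem?_eq_getElem hlt', hh]
    · exact (linkstep a3 f3 k3 n3 l3).mono (by norm_num) fun a4 h4 => hT a4 h4.1 h4.2.1 h4.2.2.1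
        h4.2.2.2

end

section

variable {α : Type u} [LinearOrder α] {S : List α} {d M i e : ℕ} {N : Set (List α)} {R : ℕ → ℕ}
  {addr : ENode α → ℤ} {fl : List ℤ} {lb : ℤ → α} {a a' : AS α}

/-! ### Looking up and creating nodes -/

omit [LinearOrder α] in
theorem FreeList.fields {f f' : Fld → ℤ → ℤ} {p : ℤ} {l : List ℤ} (h : FreeList f p l)
    (hf : ∀ q, f' .link q = f .link q) : FreeList f' p l :=
  h.congr fun q _ => hf q

theorem IsTree.pathFrame {P : List ℤ} {f f' : Fld → ℤ → ℤ} {v : ENode α} {t : T}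
    (h : IsTree N addr lb f v t) (hf : PathFrame P f f') : IsTree N addr lb f' v t :=
  ⟨(hf _ _ (by simp)).trans h.root, h.tin.pathFrame hf, h.avl, h.sorted, h.mem⟩

theorem NInv.of_pathFrame {P : List ℤ} (h : NInv S d M i e N R addr fl lb a)
    (hf : PathFrame P a.f a'.f) (hg : a'.g = a.g) (hr : ∀ x ∈ coreRegs, a'.r x = a.r x) :
    NInv S d M i e N R addr fl lb a' := by
  have h1 := hr .d (by simp [coreRegs])
  have h2 := hr .neg (by simp [coreRegs])
  have h3 := hr .zero (by simp [coreRegs])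
  have h4 := hr .zr (by simp [coreRegs])
  have h5 := hr .one (by simp [coreRegs])
  have h6 := hr .free (by simp [coreRegs])
  have h7 := hr .bump (by simp [coreRegs])
  have e : ∀ fl p, fl ∉ [Fld.up, .dir] → a'.f fl p = a.f fl p :=
    fun fl p hn => hf fl p fun h => absurd h hn
  have tree := h.tree
  have free := h.free
  cases h
  constructor
  case tree =>
    intro v hv
    obtain ⟨t, ht⟩ := tree v hv
    exact ⟨t, ht.pathFrame hf⟩
  case free => rw [h6]; exact free.fields fun q => e _ _ (by simp)
  all_goals first
    | assumption
    | (simp only [hg, h1, h2, h3, h4, h5, h6, h7]; assumption)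
    | (intros; rw [e _ _ (by simp)]; solve_by_elim)

/-- Looks for the edge with label `c` that leaves the node `nx`. -/
def lookup : Prog :=
  .seq (blk [.ld .q .root .nx]) (.seq descend
    (.ite (BT.lt .zr .q).compile (blk [.ld .nv .tgt .q]) (blk [.copy .nv .zr])))

def lookupRegs : List Reg := .nv :: descRegs

open Classical in
theorem lookup_spec {E : Env α} (hE : Fits E d) {w : List α}
    (h : NInv S d E.space i e N R addr fl lb a) (hN : N = palSubstrings w) {x : ENode α}
    (hx : SufN w x) (hnx : a.r .nx = addr x) {c : α} (hc : a.c .c = Word.chr c) {G : ℕ}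
    (hG : Nat.log 2 (w.toFinset.card + 1) ≤ G) :
    Tr E d lookup a (60 * G + 50) fun a' => NInv S d E.space i e N R addr fl lb a' ∧
      a'.r .nv = (if ext c x ∈ N then addr (.ord (ext c x)) else 0) ∧
      Keeps lookupRegs a a' := by
  have hNx : NodeIn N x := hN ▸ NodeIn.of_sufN hx
  obtain ⟨t0, ht0⟩ := h.tree x hNx
  have hht := h.tree_ht ht0 hN
  have hb := h.tree_blk ht0
  refine (Tr.seq (K := 4) (K' := 30 * t0.ht + 36) (Q := fun a1 => a1.f = a.f ∧
    Keeps lookupRegs a a1 ∧ a1.r .q = t0.ptr) (Tr.blk hE ?_ ?_) ?_).mono (by omega) fun _ h => h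
  · simp [Oks, Instr.Ok, Fld.isChar, Valid, hnx, h.blk x hNx]
  · refine ⟨rfl, ⟨rfl, rfl, fun x hx => ?_⟩, ?_⟩
    · simp only [lookupRegs, descRegs, List.mem_cons, List.not_mem_nil, or_false, not_or] at hx
      simp [evs, Instr.ev, hx]
    · simp [evs, Instr.ev, hnx, ht0.root]
  rintro a1 ⟨f1, k1, q1⟩
  have z1 : a1.r .zr = 0 := by rw [k1.r _ (by simp [lookupRegs, descRegs]), h.rzr]
  have o1 : a1.r .one = 1 := by rw [k1.r _ (by simp [lookupRegs, descRegs]), h.rone]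
  refine (Tr.seq (K := 30 * t0.ht + 30) (K' := 5) (descend_spec hE a1 o1 z1 t0 q1
    (f1 ▸ ht0.tin) ht0.avl hb ht0.nodup lb (by rw [k1.g]; exact h.tree_lab ht0) ht0.sorted c
    (by rw [k1.c, hc])) ?_).mono (by omega) fun _ h => h
  rintro a2 ⟨t, ctx, p2, hl, hr, hn, k2, g2⟩
  have k12 : Keeps lookupRegs a a2 := k1.trans (k2.mono (by simp [lookupRegs]))
  have z2 : a2.r .zr = 0 := by rw [k12.r _ (by simp [lookupRegs, descRegs]), h.rzr]
  have h2 : NInv S d E.space i e N R addr fl lb a2 :=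
    h.of_pathFrame (f1 ▸ g2) k12.g fun x hx => k12.r x fun hm => by
      simp [coreRegs, lookupRegs, descRegs] at hx hm
      rcases hx with rfl | rfl | rfl | rfl | rfl | rfl | rfl <;> simp at hm
  have core : ∀ v : ℤ, ∀ x ∈ coreRegs, Function.update a2.r .nv v x = a2.r x := fun v x hx =>
    Function.update_of_ne (by rintro rfl; simp [coreRegs] at hx) _ _
  have keep : ∀ v : ℤ, Keeps lookupRegs a { a2 with r := Function.update a2.r .nv v } := fun v =>
    k12.trans ⟨rfl, rfl, fun x hx => Function.update_of_ne
      (by rintro rfl; simp [lookupRegs] at hx) _ _⟩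
  have mem : ∀ q ∈ t0.list, lb q = c → q = addr (.ord (ext c x)) + 5 ∧ ext c x ∈ N := by
    intro q hq hqc
    obtain ⟨p, hp, hpx, rfl⟩ := (ht0.mem q).1 hq
    obtain ⟨c', hc'⟩ := exists_head (p := p) (by rintro rfl; exact h.ne hp)
    have : p = ext c x := eq_ext_of_parN (hN ▸ hp) hpx (by rw [hc', ← h.lbs p hp c' hc', hqc])
    subst this
    exact ⟨rfl, hp⟩
  cases t with
  | nil =>
    have q2 : a2.r .q = 0 := p2.q
    refine Tr.ite (K := 4) False (iff_of_false not_false (by rw [q2, z2]; omega))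
      (fun h => h.elim) fun _ => Tr.blk hE (by simp [Oks, Instr.Ok])
        ⟨h2.of_eq rfl rfl (core _), ?_, keep _⟩
    rw [if_neg]
    · simp [evs, Instr.ev, z2]
    · intro hm
      have hq : addr (.ord (ext c x)) + 5 ∈ t0.list := (ht0.mem _).2 ⟨_, hm, parN_ext hx, rfl⟩
      have hlb := h.lbs _ hm c (ext_head c x)
      rw [p2.list] at hq
      simp only [T.list, List.append_nil, List.mem_append] at hq
      rcases hq with hq | hq
      · exact (hl _ hq).ne hlb
      · exact (hr _ hq).ne' hlb
  | node l q r =>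
    have q2 : a2.r .q = q := p2.q
    have hq : q ∈ t0.list := by rw [p2.list]; simp [T.list]
    obtain ⟨e1, e2⟩ := mem q hq (hn l q r rfl)
    have hbq := hb q hq
    have hpos := hbq.pos'
    refine Tr.ite (K := 4) True (iff_of_true trivial (by rw [q2, z2]; omega))
      (fun _ => Tr.blk hE ?_ ⟨h2.of_eq rfl rfl (core _), ?_, keep _⟩) fun h => (h trivial).elim
    · simp [Oks, Instr.Ok, Fld.isChar, Valid, q2, hbq]
    · rw [if_pos e2]
      simp only [evs, Instr.ev, Function.update_self, q2, e1]
      exact h2.tgt _ e2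

theorem NInv.ncard_le (h : NInv S d M i e N R addr fl lb a) (he : e ≤ S.length)
    (hN : N ⊆ palSubstrings (sub S i e)) : N.ncard ≤ e - i := by
  refine (Set.ncard_le_ncard hN (palSubstrings_finite_ncard _).1).trans ?_
  exact (palSubstrings_finite_ncard _).2.trans (sub_length he).le

theorem refs_le (hfin : N.Finite) (p : List α) : refs S i e R N p ≤ (e - i) + N.ncard := by
  refine Nat.add_le_add ?_ (Set.ncard_le_ncard (fun q hq => hq.1) hfin)
  rw [← Finset.card_filter]
  exact (Finset.card_filter_le _ _).trans (by simp)

end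

/-! ### Effect of a new node on the invariant -/

section

variable {α : Type u} [LinearOrder α] {S : List α} {d M i e : ℕ} {N : Set (List α)} {R : ℕ → ℕ}
  {addr : ENode α → ℤ} {fl fl' : List ℤ} {lb : ℤ → α} {a a' : AS α}

theorem NInv.plink_ne (h : NInv S d M i e N R addr fl lb a) {q : List α} {p : List α} (hp : p ∉ N)
    (h0 : p ≠ []) (hq : q ∈ N) : plink q ≠ p := by
  rintro rfl
  have := h.clink (.ord q) hq
  simp only [slink, mkN, if_neg h0] at this
  exact hp this

/-- Registered palindromes and targets of suffix links stay inside `N`, and the link of `p` is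
shorter than `p`; so nothing refers to `p`, and its counter may start at 0. -/
theorem NInv.refs_new (h : NInv S d M i e N R addr fl lb a) {p : List α} (hp : p ∉ N)
    (h0 : p ≠ []) : refs S i e R (insert p N) p = 0 := by
  unfold refs
  have h1 : ∀ k ∈ Finset.Ico i e, (if sub S k (k + R k) = p then 1 else 0) = 0 := by
    intro k hk
    rw [Finset.mem_Ico] at hk
    rw [if_neg]
    rintro rfl
    by_cases hR : R k = 0
    · exact h0 (by simp [hR, sub])
    · exact hp (h.occ k hk.1 hk.2 hR)
  rw [Finset.sum_eq_zero h1, zero_add]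
  have : {q ∈ insert p N | plink q = p} = ∅ := by
    ext q
    simp only [Set.mem_ofPred_eq, Set.mem_insert_iff, Set.mem_empty_iff_false, iff_false, not_and]
    rintro (rfl | hq)
    · intro hh
      have := plink_length_lt h0
      rw [hh] at this
      exact lt_irrefl _ this
    · exact h.plink_ne hp h0 hq
  rw [this, Set.ncard_empty]

theorem refs_insert (hfin : N.Finite) {np p : List α} (hp : np ∉ N) :
    refs S i e R (insert np N) p = refs S i e R N p + if plink np = p then 1 else 0 := by
  unfold refs
  rw [add_assoc]
  congr 1
  split_ifs with hh
  · have : {q ∈ insert np N | plink q = p} = insert np {q ∈ N | plink q = p} := by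
      ext q; simp only [Set.mem_ofPred_eq, Set.mem_insert_iff]
      constructor
      · rintro ⟨rfl | h1, h2⟩
        · exact Or.inl rfl
        · exact Or.inr ⟨h1, h2⟩
      · rintro (rfl | h1)
        · exact ⟨Or.inl rfl, hh⟩
        · exact ⟨Or.inr h1.1, h1.2⟩
    rw [this, Set.ncard_insert_of_notMem (fun h => hp h.1) (hfin.subset fun q hq => hq.1)]
  · have : {q ∈ insert np N | plink q = p} = {q ∈ N | plink q = p} := by
      ext q; simp only [Set.mem_ofPred_eq, Set.mem_insert_iff]
      constructor
      · rintro ⟨rfl | h1, h2⟩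
        · exact (hh h2).elim
        · exact ⟨h1, h2⟩
      · exact fun h1 => ⟨Or.inr h1.1, h1.2⟩
    rw [this, add_zero]

/-- The effect on the fields of linking the new block `v` to the tree `t0` of the node at `x`. -/
structure Linked (v x : ℤ) (t0 : T) (c : α) (lb : ℤ → α) (a a' : AS α) : Prop where
  tree : ∃ (t' : T) (A B : List ℤ), t0.list = A ++ B ∧ t'.list = A ++ (v + 5) :: B ∧
    (∀ q ∈ A, lb q < c) ∧ (∀ q ∈ B, c < lb q) ∧ t'.In a'.f ∧ t'.Avl ∧ a'.f .root x = t'.ptr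
  tgt : a'.f .tgt (v + 5) = v
  g : a'.g = Function.update a.g .tlab (Function.update (a.g .tlab) (v + 5) (Word.chr c))
  frame : ∀ fl p, (fl ∈ [Fld.l, .r, .ht, .up, .dir] → p ∉ (v + 5) :: t0.list) →
    (fl = .root → p ≠ x) → (fl = .tgt → p ≠ v + 5) → a'.f fl p = a.f fl p

/-- The effect on the fields of filling the new block `v`. -/
structure Filled (v : ℤ) (np : List α) (addr : ENode α → ℤ) (N : Set (List α)) (c : α)
    (a a' : AS α) : Prop where
  len : a'.f .len v = np.length
  link : a'.f .link v = addr (slink (.ord np))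
  par : a'.f .par v = addr (parN np)
  root : a'.f .root v = 0
  cnt : a'.f .cnt v = 0
  cntN : ∀ p ∈ N, a'.f .cnt (addr (.ord p)) =
    a.f .cnt (addr (.ord p)) + if plink np = p then 1 else 0
  cnt0 : a'.f .cnt 0 = a.f .cnt 0
  lab : a'.g .lab v = Word.chr c
  frame : ∀ fl p, fl ≠ .cnt → (fl ∈ [Fld.len, .link, .par, .root] → p ≠ v) → a'.f fl p = a.f fl p
  gframe : ∀ fl p, (fl = .lab → p ≠ v) → a'.g fl p = a.g fl p

omit [LinearOrder α] in
theorem Blk.add_five_ne {d M M' : ℕ} {p q : ℤ} (h : Blk d M p) (h' : Blk d M' (q - 5)) : p ≠ q := by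
  obtain ⟨k, hk, -⟩ := h
  obtain ⟨l, hl, -⟩ := h'
  omega

/-- This concerns states only, not programs. `Filled` and `Linked` confine the changes to the block
of `np`, the edge tree of its parent and the counter of its suffix link; all the rest is framed,
using that `v` is the address of no node and of no block that remains free. -/
theorem NInv.create (h : NInv S d M i e N R addr fl lb a) {np : List α} (hnp : np ∉ N)
    (h0 : np ≠ []) (hsl : NodeIn N (slink (.ord np))) (hpar : NodeIn N (parN np)) {v : ℤ}
    (hv : Blk d M v) (hnew : ∀ u, NodeIn N u → addr u ≠ v) (hvl : v ∉ fl') (hsub : fl' ⊆ fl)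
    (hnd : fl'.Nodup) {a1 a2 : AS α} {c : α} (hc : np.head? = some c)
    (hfree : FreeList a.f (a1.r .free) fl')
    (hbump : a1.r .bump = 13 + d + 13 * (N.ncard + 3 + fl'.length : ℕ))
    (hle : a.r .bump ≤ a1.r .bump) (hvb : v < a1.r .bump)
    (hr : ∀ x ∈ [Reg.d, .neg, .zero, .zr, .one], a1.r x = a.r x)
    (hfill : Filled v np addr N c a a1) {t0 : T} (ht0 : IsTree N addr lb a.f (parN np) t0)
    (hlink : Linked v (addr (parN np)) t0 c lb a1 a2) (hr2 : ∀ x ∈ coreRegs, a2.r x = a1.r x)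
    {addr' : ENode α → ℤ} (hself : addr' (.ord np) = v) (ao : ∀ u, NodeIn N u → addr' u = addr u) :
    NInv S d M i e (insert np N) R addr' fl'
      (Function.update lb (v + 5) c) a2 := by
  have cases' : ∀ u, NodeIn (insert np N) u → u = .ord np ∨ NodeIn N u := by
    rintro (_ | _ | p) hu
    · exact Or.inr trivial
    · exact Or.inr trivial
    · rcases hu with rfl | hu
      · exact Or.inl rfl
      · exact Or.inr hu
  have up : ∀ u, NodeIn N u → NodeIn (insert np N) u := by
    rintro (_ | _ | p) hu
    · trivial
    · trivial
    · exact Or.inr hu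
  have lbo : ∀ u, NodeIn N u → Function.update lb (v + 5) c (addr u + 5) = lb (addr u + 5) :=
    fun u hu => Function.update_of_ne (fun hh => hnew u hu (by omega)) _ _
  have hvpos := hv.pos'
  have tb := h.tree_blk ht0
  have e5 : ∀ p, Blk d M (p - 5) → p ≠ v := fun p hp hh => hv.add_five_ne hp hh.symm
  have bl5 : ∀ u, NodeIn N u → Blk d M (addr u + 5 - 5) := fun u hu => by simpa using h.blk u hu
  have frN : ∀ fl ∈ [Fld.len, .link, .par], ∀ u, NodeIn N u → a2.f fl (addr u) = a.f fl (addr u) := by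
    intro fl hfl u hu
    rw [hlink.frame, hfill.frame]
    · rintro rfl; simp at hfl
    · exact fun _ => hnew u hu
    · intro hh; simp at hfl hh; rcases hfl with rfl | rfl | rfl <;> simp at hh
    · rintro rfl; simp at hfl
    · rintro rfl; simp at hfl
  have frV : ∀ fl ∈ [Fld.len, .link, .par, .cnt], ∀ p, a2.f fl p = a1.f fl p := by
    intro fl hfl p
    apply hlink.frame
    · intro hh; simp at hfl hh; rcases hfl with rfl | rfl | rfl | rfl <;> simp at hh
    · rintro rfl; simp at hfl
    · rintro rfl; simp at hfl
  have r2 : ∀ x ∈ [Reg.d, .neg, .zero, .zr, .one], a2.r x = a.r x := by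
    intro x hx
    rw [hr2 x (by simp [coreRegs] at hx ⊢; tauto), hr x hx]
  obtain ⟨t', A, B, l1, l2, l3, l4, l5, l6, l7⟩ := hlink.tree
  constructor
  case rd => rw [r2 _ (by simp), h.rd]
  case rneg => rw [r2 _ (by simp), h.rneg, ao .negOne trivial]
  case rzero => rw [r2 _ (by simp), h.rzero, ao .zero trivial]
  case rzr => rw [r2 _ (by simp), h.rzr]
  case rone => rw [r2 _ (by simp), h.rone]
  case ht0 =>
    rw [hlink.frame _ _ (fun _ hm => ?_) (by simp) (by simp),
      hfill.frame _ _ (by simp) (by simp), h.ht0]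
    rcases List.mem_cons.1 hm with hh | hh
    · omega
    · have := (tb 0 hh).pos'; omega
  case len0 => rw [frV _ (by simp), hfill.frame, h.len0] <;> simp; omega
  case cnt0 => rw [frV _ (by simp), hfill.cnt0, h.cnt0]
  case fin => exact h.fin.insert _
  case ne => rintro (hh | hh); exacts [h0 hh.symm, h.ne hh]
  case blk =>
    intro u hu
    rcases cases' u hu with rfl | hu
    · rwa [hself]
    · rw [ao u hu]; exact h.blk u hu
  case inj =>
    intro u u' hu hu' hh
    rcases cases' u hu with rfl | hu <;> rcases cases' u' hu' with rfl | hu'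
    · rfl
    · rw [hself, ao u' hu'] at hh; exact (hnew u' hu' hh.symm).elim
    · rw [hself, ao u hu] at hh; exact (hnew u hu hh).elim
    · rw [ao u hu, ao u' hu'] at hh; exact h.inj u u' hu hu' hh
  case clink =>
    intro u hu
    rcases cases' u hu with rfl | hu
    · exact up _ hsl
    · exact up _ (h.clink u hu)
  case cpar =>
    rintro p (rfl | hp)
    · exact up _ hpar
    · exact up _ (h.cpar p hp)
  case len =>
    intro u hu
    rcases cases' u hu with rfl | hu
    · rw [hself, frV _ (by simp), hfill.len]; rfl
    · rw [ao u hu, frN _ (by simp) u hu, h.len u hu]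
  case link =>
    intro u hu
    rcases cases' u hu with rfl | hu
    · rw [hself, frV _ (by simp), hfill.link, ao _ hsl]
    · rw [ao u hu, frN _ (by simp) u hu, h.link u hu, ao _ (h.clink u hu)]
  case par =>
    rintro p (rfl | hp)
    · rw [hself, frV _ (by simp), hfill.par, ao _ hpar]
    · rw [ao (.ord _) hp, frN _ (by simp) (.ord p) hp, h.par p hp, ao _ (h.cpar p hp)]
  case lab =>
    rintro p (rfl | hp) c' hc'
    · rw [hself, hlink.g, Function.update_of_ne (by simp), hfill.lab]
      rw [hc] at hc'; rw [Option.some.inj hc']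
    · rw [ao (.ord _) hp, hlink.g, Function.update_of_ne (by simp), hfill.gframe _ _ fun _ => hnew (.ord _) hp,
        h.lab p hp c' hc']
  case tgt =>
    rintro p (rfl | hp)
    · rw [hself, hlink.tgt]
    · have := hnew (.ord p) hp
      rw [ao (.ord _) hp, hlink.frame, hfill.frame, h.tgt p hp] <;> simp
      exact this
  case tlab =>
    rintro p (rfl | hp) c' hc'
    · rw [hself, hlink.g, Function.update_self, Function.update_self]
      rw [hc] at hc'; rw [Option.some.inj hc']
    · have := hnew (.ord p) hp
      rw [ao (.ord _) hp, hlink.g, Function.update_self, Function.update_of_ne (by omega),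
        hfill.gframe _ _ (by simp), h.tlab p hp c' hc']
  case lbs =>
    rintro p (rfl | hp) c' hc'
    · rw [hself, Function.update_self]
      rw [hc] at hc'; exact Option.some.inj hc'
    · rw [ao (.ord _) hp, lbo (.ord p) hp, h.lbs p hp c' hc']
  case tree =>
    intro u hu
    rcases cases' u hu with rfl | hu
    -- The new node has no children: the old nodes and `np` all have their parents among the old
    -- nodes.
    · refine ⟨.nil, ?_, trivial, trivial, by simp [T.list], ?_⟩
      · rw [hself, hlink.frame, hfill.root, T.ptr] <;> simp
        exact fun hh => hnew _ hpar hh.symm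
      · intro q
        simp only [T.list, List.not_mem_nil, false_iff]
        rintro ⟨p, rfl | hp, hh, -⟩
        · have h3 := hpar
          rw [hh] at h3
          exact hnp h3
        · have h3 := h.cpar p hp
          rw [hh] at h3
          exact hnp h3
    by_cases hux : u = parN np
    · subst hux
      refine ⟨t', ?_, l5, l6, ?_, ?_⟩
      · rw [ao _ hu, l7]
      · have hlb : ∀ q ∈ t0.list, Function.update lb (v + 5) c q = lb q := by
          intro q hq
          refine Function.update_of_ne ?_ _ _
          rintro rfl
          obtain ⟨p, hp, -, hh⟩ := (ht0.mem _).1 hq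
          exact hnew (.ord p) hp (by omega)
        have hs := ht0.sorted
        rw [l1] at hs hlb
        rw [l2]
        simp only [List.pairwise_append, List.pairwise_cons, List.mem_append, List.mem_cons] at hs hlb ⊢
        refine ⟨hs.1.imp_of_mem fun {x y} hx hy hxy => ?_, ⟨fun y hy => ?_,
          hs.2.1.imp_of_mem fun {x y} hx hy hxy => ?_⟩, ?_⟩
        · rwa [hlb x (Or.inl hx), hlb y (Or.inl hy)]
        · rw [Function.update_self, hlb y (Or.inr hy)]; exact l4 y hy
        · rwa [hlb x (Or.inr hx), hlb y (Or.inr hy)]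
        · rintro x hx y (rfl | hy)
          · rw [Function.update_self, hlb x (Or.inl hx)]; exact l3 x hx
          · rw [hlb x (Or.inl hx), hlb y (Or.inr hy)]; exact hs.2.2 x hx y hy
      · intro q
        have hm := ht0.mem q
        rw [l1] at hm
        rw [l2]
        simp only [List.mem_append, List.mem_cons] at hm ⊢
        constructor
        · rintro (hq | rfl | hq)
          · obtain ⟨p, hp, hh, rfl⟩ := hm.1 (Or.inl hq)
            exact ⟨p, Or.inr hp, hh, by rw [ao (.ord _) hp]⟩
          · exact ⟨np, Or.inl rfl, rfl, by rw [hself]⟩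
          · obtain ⟨p, hp, hh, rfl⟩ := hm.1 (Or.inr hq)
            exact ⟨p, Or.inr hp, hh, by rw [ao (.ord _) hp]⟩
        · rintro ⟨p, rfl | hp, hh, rfl⟩
          · rw [hself]; exact Or.inr (Or.inl rfl)
          · rcases hm.2 ⟨p, hp, hh, by rw [ao (.ord p) hp]⟩ with hq | hq
            · exact Or.inl hq
            · exact Or.inr (Or.inr hq)
    · obtain ⟨t, ht⟩ := h.tree u hu
      have hax : addr u ≠ addr (parN np) := fun hh => hux (h.inj u _ hu hpar hh)
      have hdis : ∀ q ∈ t.list, q ∉ (v + 5) :: t0.list := by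
        intro q hq hq0
        obtain ⟨p, hp, hh, rfl⟩ := (ht.mem q).1 hq
        rcases List.mem_cons.1 hq0 with hh' | hq0
        · exact hnew (.ord p) hp (by omega)
        · obtain ⟨p', hp', hh', he⟩ := (ht0.mem _).1 hq0
          have := h.inj (.ord p) (.ord p') hp hp' (by omega)
          injection this with this
          subst this
          exact hux (hh.symm.trans hh')
      refine ⟨t, ?_, ?_, ht.avl, ?_, ?_⟩
      · rw [ao u hu, hlink.frame, hfill.frame, ht.root] <;> simp
        · exact hnew u hu
        · exact hax
      · refine T.In_congr (fun q hq => ?_) ht.tin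
        have := hdis q hq
        refine ⟨?_, ?_, ?_⟩ <;>
          (rw [hlink.frame _ _ (fun _ => this) (by simp) (by simp), hfill.frame _ _ (by simp) (by simp)])
      · refine ht.sorted.imp_of_mem fun {x y} hx hy hxy => ?_
        rwa [Function.update_of_ne, Function.update_of_ne]
        · rintro rfl; exact hdis _ hy (by simp)
        · rintro rfl; exact hdis _ hx (by simp)
      · intro q
        rw [ht.mem q]
        constructor
        · rintro ⟨p, hp, hh, rfl⟩
          exact ⟨p, Or.inr hp, hh, by rw [ao (.ord _) hp]⟩
        · rintro ⟨p, rfl | hp, hh, rfl⟩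
          · exact (hux hh.symm).elim
          · exact ⟨p, hp, hh, by rw [ao (.ord _) hp]⟩
  case cnt =>
    rintro p (rfl | hp)
    · rw [hself, frV _ (by simp), hfill.cnt, h.refs_new hnp h0]; rfl
    · rw [ao (.ord _) hp, frV _ (by simp), hfill.cntN p hp, h.cnt p hp, refs_insert h.fin hnp]
      push_cast; rfl
  case occ => exact fun k hk hk' hR => Or.inr (h.occ k hk hk' hR)
  case arr =>
    intro k hk hk'
    rw [hlink.frame _ _ (by simp) (by simp) (by simp), hfill.frame _ _ (by simp) (by simp),
      h.arr k hk hk']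
    split_ifs with hR
    · rfl
    · rw [ao (.ord _) (h.occ k hk hk' hR)]
  case arr0 =>
    intro m hm hm'
    rw [hlink.frame _ _ (by simp) (by simp) (by simp), hfill.frame _ _ (by simp) (by simp),
      h.arr0 m hm hm']
  case free =>
    rw [hr2 _ (by simp [coreRegs])]
    refine hfree.congr fun q hq => ?_
    rw [frV _ (by simp), hfill.frame _ _ (by simp) fun _ => ?_]
    rintro rfl; exact hvl hq
  case fnodup => exact hnd
  case fblk =>
    intro p hp
    rw [hr2 _ (by simp [coreRegs])]
    exact ⟨(h.fblk p (hsub hp)).1, (h.fblk p (hsub hp)).2.trans_le hle⟩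
  case fnew =>
    intro p hp u hu
    rcases cases' u hu with rfl | hu
    · rw [hself]; rintro rfl; exact hvl hp
    · rw [ao u hu]; exact h.fnew p (hsub hp) u hu
  case bump =>
    rw [hr2 _ (by simp [coreRegs]), hbump, Set.ncard_insert_of_notMem hnp h.fin]
  case old =>
    intro u hu
    rw [hr2 _ (by simp [coreRegs])]
    rcases cases' u hu with rfl | hu
    · rwa [hself]
    · rw [ao u hu]; exact (h.old u hu).trans_le hle

end

/-! ### Allocating, filling and linking the block of a node -/

section

variable {α : Type u} [LinearOrder α] {S : List α} {d M i e : ℕ} {N : Set (List α)} {R : ℕ → ℕ}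
  {addr : ENode α → ℤ} {fl : List ℤ} {lb : ℤ → α} {a a' : AS α}

/-- Allocates a block at `nv`. -/
def alloc : Prog :=
  .ite (BT.eq .free .zr).compile
    (blk [.copy .nv .bump, .const .tmp 13, .arith .add .bump .bump .tmp])
    (blk [.copy .nv .free, .ld .free .link .free])

def allocRegs : List Reg := [.nv, .tmp, .bump, .free]

/-- The block `v` has been allocated, and `fl'` is the new free list. -/
structure Alloc (d M : ℕ) (N : Set (List α)) (addr : ENode α → ℤ) (fl fl' : List ℤ) (v : ℤ)
    (a a' : AS α) : Prop where
  nv : a'.r .nv = v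
  blk : Blk d M v
  new : ∀ u, NodeIn N u → addr u ≠ v
  notMem : v ∉ fl'
  sub : fl' ⊆ fl
  nodup : fl'.Nodup
  free : FreeList a.f (a'.r .free) fl'
  bump : a'.r .bump = 13 + d + 13 * (N.ncard + 3 + fl'.length : ℕ)
  le : a.r .bump ≤ a'.r .bump
  lt : v < a'.r .bump

/-- A fresh block is taken only if the free list is empty. Then exactly `N.ncard + 2` blocks are in
use, so one more fits; this is why the space depends on the maximum number of nodes and not on the
number of insertions. -/
theorem alloc_spec {E : Env α} (hE : Fits E d) (h : NInv S d E.space i e N R addr fl lb a)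
    (hM : 13 + d + 13 * (N.ncard + 3) ≤ E.space) (h13 : 13 ≤ E.wordMax) :
    Tr E d alloc a 11 fun a' => a'.f = a.f ∧ Keeps allocRegs a a' ∧
      ∃ v fl', Alloc d E.space N addr fl fl' v a a' := by
  have hz := h.rzr
  have hfree := h.free
  have hb := h.bump
  have hw := hE.word
  cases fl with
  | nil =>
    have e0 : a.r .free = 0 := hfree
    simp only [List.length_nil, add_zero] at hb
    refine Tr.ite (K := 10) True (iff_of_true trivial (by rw [e0, hz])) (fun _ => ?_)
      fun h => (h trivial).elim
    refine Tr.blk hE ?_ ⟨rfl, ⟨rfl, rfl, fun x hx => ?_⟩, a.r .bump, [], ?_⟩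
    · simp [Oks, Instr.Ok, Instr.ev, ArithOp.eval, hb, abs_le]
      omega
    · simp only [allocRegs, List.mem_cons, List.not_mem_nil, or_false, not_or] at hx
      simp [evs, Instr.ev, hx]
    · constructor
      · simp [evs, Instr.ev]
      · exact ⟨N.ncard + 2, by rw [hb, Nat.cast_add, Nat.cast_two], by omega⟩
      · exact fun u hu => (h.old u hu).ne
      · simp
      · simp
      · simp
      · simp [evs, Instr.ev, FreeList, e0]
      · simp [evs, Instr.ev, ArithOp.eval, hb]
        ring
      · simp [evs, Instr.ev, ArithOp.eval]
      · simp [evs, Instr.ev, ArithOp.eval]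
  | cons p l =>
    obtain ⟨e0, e1⟩ := hfree
    have hp := h.fblk p (by simp)
    have hpos := hp.1.pos'
    have hnd := h.fnodup
    rw [List.nodup_cons] at hnd
    refine Tr.ite (K := 10) False (iff_of_false not_false (by rw [e0, hz]; omega))
      (fun h => h.elim) fun _ => ?_
    refine (Tr.blk (Q := fun a' => a'.f = a.f ∧ Keeps allocRegs a a' ∧
      ∃ v fl', Alloc d E.space N addr (p :: l) fl' v a a') hE ?_
      ⟨rfl, ⟨rfl, rfl, fun x hx => ?_⟩, p, l, ?_⟩).mono (by simp) fun _ h => h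
    · simp [Oks, Instr.Ok, Instr.ev, Fld.isChar, Valid, e0, hp.1]
    · simp only [allocRegs, List.mem_cons, List.not_mem_nil, or_false, not_or] at hx
      simp [evs, Instr.ev, hx]
    · constructor
      · simp [evs, Instr.ev, e0]
      · exact hp.1
      · exact h.fnew p (by simp)
      · exact hnd.1
      · simp
      · exact hnd.2
      · simp only [evs, Instr.ev, Function.update_self, ne_eq, reduceCtorEq, not_false_eq_true,
          Function.update_of_ne, e0]
        exact e1
      · simp only [evs, Instr.ev, ne_eq, reduceCtorEq, not_false_eq_true,
          Function.update_of_ne, hb, List.length_cons]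
        push_cast; ring
      · simp [evs, Instr.ev]
      · simpa [evs, Instr.ev] using hp.2

/-- Fills the block `nv` with the record of a node with parent `pn`, label `c` and suffix link
`ny`. -/
def fill : Prog :=
  .seq (blk [.ld .tmp .len .pn, .arith .add .tmp .tmp .one, .arith .add .tmp .tmp .one,
      .st .len .nv .tmp, .st .link .nv .ny, .st .par .nv .pn, .stc .lab .nv .c, .st .root .nv .zr,
      .st .cnt .nv .zr])
    (.ite (BT.eq .ny .zero).compile (blk [])
      (blk [.ld .tmp .cnt .ny, .arith .add .tmp .tmp .one, .st .cnt .ny .tmp]))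

theorem slink_ord_eq {p q : List α} (hq : q ≠ []) : slink (.ord p) = .ord q ↔ plink p = q := by
  change mkN (plink p) = _ ↔ _
  unfold mkN
  constructor
  · split_ifs with h
    · exact fun hh => by cases hh
    · exact fun hh => by injection hh
  · rintro rfl; rw [if_neg hq]

/-- A suffix link to the 0-node is not counted: auxiliary nodes are never removed, and the invariant
says nothing about their counters. -/
theorem fill_spec {E : Env α} (hE : Fits E d) {a0 : AS α}
    (h : NInv S d E.space i e N R addr fl lb a) (f0 : a0.f = a.f) (g0 : a0.g = a.g)
    {x : ENode α} (hx : NodeIn N x) {np : List α} {c : α} (hlen : (np.length : ℤ) = x.len + 2)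
    (hp : parN np = x) {v : ℤ} (hv : Blk d E.space v) (hnew : ∀ u, NodeIn N u → addr u ≠ v)
    (hs : NodeIn N (slink (.ord np)))
    (hpn : a0.r .pn = addr x) (hny : a0.r .ny = addr (slink (.ord np))) (hnv : a0.r .nv = v)
    (hz : a0.r .zr = 0) (h1 : a0.r .one = 1) (hzero : a0.r .zero = addr .zero)
    (hc : a0.c .c = Word.chr c)
    (hW : (e - i) + N.ncard + 1 ≤ E.wordMax) (hW' : np.length ≤ E.wordMax) :
    Tr E d fill a0 39 fun a' => Filled v np addr N c a a' ∧ a'.c = a0.c ∧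
      ∀ y, y ≠ .tmp → a'.r y = a0.r y := by
  have bx := h.blk x hx
  have bs := h.blk _ hs
  have bpos := bs.pos'
  have vpos := hv.pos'
  have lx := h.len x hx
  have sv := hnew _ hs
  have hneg : -1 ≤ x.len := by cases x <;> simp [ENode.len]
  have hNv : ∀ p ∈ N, addr (.ord p) ≠ v := fun p hp => hnew (.ord p) hp
  refine Tr.seq (K := 28) (K' := 11) (Q := fun a1 => a1 = evs E a0 [.ld .tmp .len .pn,
    .arith .add .tmp .tmp .one, .arith .add .tmp .tmp .one,
    .st .len .nv .tmp, .st .link .nv .ny, .st .par .nv .pn, .stc .lab .nv .c, .st .root .nv .zr,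
    .st .cnt .nv .zr]) (Tr.blk hE ?_ rfl) ?_
  · simp [Oks, Instr.Ok, Instr.ev, Fld.isChar, Valid, ArithOp.eval, hpn, bx, hnv, hv, f0, lx, h1, abs_le]
    omega
  rintro a1 rfl
  by_cases hsz : slink (.ord np) = .zero
  · refine Tr.ite (K := 10) True (iff_of_true trivial ?_) (fun _ => ?_) fun h => (h trivial).elim
    · simp [evs, Instr.ev, hny, hzero, hsz]
    have hnil : plink np = [] := by
      simp only [slink, mkN] at hsz
      split_ifs at hsz with hh
      exact hh
    refine Tr.mono (K := 1) (Q := fun a' => Filled v np addr N c a a' ∧ a'.c = a0.c ∧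
      ∀ y, y ≠ .tmp → a'.r y = a0.r y) ?_ (by norm_num) fun _ h => h
    refine Tr.blk (l := []) hE trivial ⟨?_, rfl, ?_⟩
    · constructor
      · simp [evs, Instr.ev, hnv, hpn, f0, lx, ArithOp.eval, h1]; omega
      · simp [evs, Instr.ev, hnv, hny]
      · simp [evs, Instr.ev, hnv, hpn, hp]
      · simp [evs, Instr.ev, hnv, hz]
      · simp [evs, Instr.ev, hnv, hz]
      · intro p hp
        have : plink np ≠ p := by rw [hnil]; rintro rfl; exact h.ne hp
        simp [evs, Instr.ev, hnv, f0, hNv p hp, this]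
      · simp [evs, Instr.ev, hnv, f0, Function.update_of_ne (show (0 : ℤ) ≠ v by omega)]
      · simp [evs, Instr.ev, hnv, hc]
      · intro fl p hfl hp
        cases fl <;> simp at hfl hp <;> simp [evs, Instr.ev, f0, hnv, Function.update_of_ne, hp]
      · intro fl p hp
        cases fl <;> simp at hp <;> simp [evs, Instr.ev, g0, hnv, Function.update_of_ne, hp]
    · intro y hy
      simp [evs, Instr.ev, hy]
  · have hzn : addr (slink (.ord np)) ≠ addr .zero := fun hh => hsz (h.inj _ _ hs trivial hh)
    obtain ⟨y, hy⟩ : ∃ y, slink (.ord np) = .ord y := by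
      simp only [slink, mkN] at hsz ⊢
      split_ifs at hsz ⊢ with hh
      · exact (hsz rfl).elim
      · exact ⟨_, rfl⟩
    have hyN : y ∈ N := by rw [hy] at hs; exact hs
    have hy0 : y ≠ [] := by rintro rfl; exact h.ne hyN
    have hpl : plink np = y := (slink_ord_eq hy0).1 hy
    have hcnt := h.cnt y hyN
    have hle := refs_le (S := S) (i := i) (e := e) (R := R) h.fin y
    rw [hy] at sv bpos
    refine Tr.ite (K := 10) False (iff_of_false not_false ?_) (fun h => h.elim) fun _ => ?_
    · simpa [evs, Instr.ev, hny, hzero] using hzn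
    have bs' : Blk d E.space (addr (.ord y)) := hy ▸ bs
    refine Tr.blk hE ?_ ⟨?_, rfl, ?_⟩
    · simp [evs, Oks, Instr.Ok, Instr.ev, Fld.isChar, Valid, ArithOp.eval, hnv, hny, f0, h1, abs_le,
        hy, bs', sv, hcnt]
      omega
    · constructor
      · simp [evs, Instr.ev, hnv, hpn, f0, lx, ArithOp.eval, h1]; omega
      · simp [evs, Instr.ev, hnv, hny]
      · simp [evs, Instr.ev, hnv, hpn, hp]
      · simp [evs, Instr.ev, hnv, hz]
      · simp [evs, Instr.ev, hnv, hz, hny, hy, sv.symm]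
      · intro p hp
        by_cases hpy : p = y
        · subst hpy
          simp [evs, Instr.ev, hnv, f0, hNv p hp, hny, hy, hpl, ArithOp.eval, h1]
        · have : addr (.ord p) ≠ addr (.ord y) := fun hh => hpy (by
            have := h.inj (.ord p) (.ord y) hp hyN hh
            injection this)
          simp [evs, Instr.ev, hnv, f0, hNv p hp, hny, hy, hpl, this, Ne.symm hpy]
      · simp [evs, Instr.ev, hnv, f0, hny, hy, Function.update_of_ne (show (0 : ℤ) ≠ v by omega),
          Function.update_of_ne (show (0 : ℤ) ≠ addr (.ord y) by omega)]
      · simp [evs, Instr.ev, hnv, hc]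
      · intro fl p hfl hp
        cases fl <;> simp at hfl hp <;> simp [evs, Instr.ev, f0, hnv, Function.update_of_ne, hp]
      · intro fl p hp
        cases fl <;> simp at hp <;> simp [evs, Instr.ev, g0, hnv, Function.update_of_ne, hp]
    · intro y hy
      simp [evs, Instr.ev, hy]

/-- Creates a node with parent `pn`, label `c` and suffix link `ny`. -/
def create : Prog := .seq alloc (.seq fill insertEdge)

def createRegs : List Reg := allocRegs ++ treeRegs

theorem create_spec {E : Env α} (hE : Big E S d) (he : e ≤ S.length)
    (h : NInv S d E.space i e N R addr fl lb a) (hN : N = palSubstrings (sub S i e))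
    {x : ENode α} (hx : SufN (sub S i e) x) {c : α} (hnp : ext c x ∉ N)
    (hsl : NodeIn N (slink (.ord (ext c x)))) (hM : 13 + d + 13 * (N.ncard + 3) ≤ E.space)
    (hpn : a.r .pn = addr x) (hny : a.r .ny = addr (slink (.ord (ext c x))))
    (hc : a.c .c = Word.chr c) {G : ℕ} (hG : Nat.log 2 ((sub S i e).toFinset.card + 1) ≤ G) :
    Tr E d create a (360 * G + 120) fun a' => ∃ addr' fl' lb',
      NInv S d E.space i e (insert (ext c x) N) R addr' fl' lb' a' ∧
      a'.r .nv = addr' (.ord (ext c x)) ∧ (∀ u, NodeIn N u → addr' u = addr u) ∧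
      (∀ y, y ∉ createRegs → a'.r y = a.r y) ∧ a'.c .c = a.c .c := by
  have hbig := hE.big
  have hpar := parN_ext (c := c) hx
  have hNx : NodeIn N x := hN ▸ NodeIn.of_sufN hx
  have hnc := h.ncard_le he hN.le
  have hlen := ext_length c x
  have hxle : x.len ≤ e - i ∨ x.len ≤ 0 := by
    cases x with
    | negOne => right; simp [ENode.len]
    | zero => right; simp [ENode.len]
    | ord p =>
      left
      have := hx.2.1.length_le
      have h0 := List.length_pos_of_ne_nil hx.1
      rw [sub_length he] at this
      simp only [ENode.len]; omega
  refine (Tr.seq (K := 11) (K' := 360 * G + 109) (alloc_spec hE.toFits h hM (by omega)) ?_).mono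
    (by omega) fun _ h => h
  rintro a1 ⟨f1, k1, v, fl', al⟩
  have r1 : ∀ y, y ∉ allocRegs → a1.r y = a.r y := k1.r
  refine (Tr.seq (K := 39) (K' := 360 * G + 70) (fill_spec hE.toFits h f1 k1.g hNx hlen hpar al.blk
    al.new hsl (by rw [r1 _ (by simp [allocRegs]), hpn]) (by rw [r1 _ (by simp [allocRegs]), hny])
    al.nv (by rw [r1 _ (by simp [allocRegs]), h.rzr]) (by rw [r1 _ (by simp [allocRegs]), h.rone])
    (by rw [r1 _ (by simp [allocRegs]), h.rzero]) (by rw [k1.c, hc]) (by omega) (by omega)) ?_).mono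
    (by omega) fun _ h => h
  rintro a2 ⟨fi, c2, r2⟩
  have r12 : ∀ y, y ∉ allocRegs → a2.r y = a.r y := fun y hy => by
    rw [r2 y (by rintro rfl; simp [allocRegs] at hy), r1 y hy]
  obtain ⟨t0, ht0⟩ := h.tree x hNx
  have hht := h.tree_ht ht0 hN
  have htl := h.tree_length ht0 hN
  have hcard := (List.toFinset_card_le (sub S i e)).trans (sub_length he).le
  have hb := h.tree_blk ht0
  have hvs := al.blk.le
  have hws := hE.word
  have hvpos := al.blk.pos'
  have h5 : v + 5 ∉ t0.list := by
    intro hm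
    obtain ⟨p, hp, -, hh⟩ := (ht0.mem _).1 hm
    exact al.new (.ord p) hp (by omega)
  have hfr : ∀ q ∈ t0.list, ∀ fl ≠ Fld.cnt, fl ≠ .root → a2.f fl q = a.f fl q := by
    intro q hq fl h1 _
    exact fi.frame _ _ h1 fun _ hh => al.blk.add_five_ne (hb q hq) hh.symm
  have hroot : a2.f .root (addr x) = t0.ptr := by
    rw [fi.frame _ _ (by simp) fun _ => al.new x hNx, ht0.root]
  have hht0 : a2.f .ht 0 = 0 := by rw [fi.frame _ _ (by simp) (by simp), h.ht0]
  refine (insertEdge_spec hE.toFits a2 hht0 (by rw [r12 _ (by simp [allocRegs]), h.rone])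
    (by rw [r12 _ (by simp [allocRegs]), h.rzr]) (addr x) v
    (by rw [r12 _ (by simp [allocRegs]), hpn]) (by rw [r2 _ (by simp), al.nv]) (h.blk x hNx) al.blk
    t0 hroot (T.In_congr (fun q hq => ?_) ht0.tin) ht0.avl hb ht0.nodup (by omega) (by omega) h5 lb
    (fun q hq => ?_) ht0.sorted c (by rw [c2, k1.c, hc]) (fun q hq hqc => ?_)).mono (by omega) ?_
  · exact ⟨hfr q hq _ (by simp) (by simp), hfr q hq _ (by simp) (by simp),
      hfr q hq _ (by simp) (by simp)⟩
  · rw [fi.gframe _ _ (by simp)]; exact h.tree_lab ht0 q hq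
  · obtain ⟨p, hp, hpx, rfl⟩ := (ht0.mem q).1 hq
    obtain ⟨c', hc'⟩ := exists_head (p := p) (by rintro rfl; exact h.ne hp)
    have : p = ext c x := eq_ext_of_parN (hN ▸ hp) hpx (by rw [hc', ← h.lbs p hp c' hc', hqc])
    exact hnp (this ▸ hp)
  · rintro a3 ⟨t', A, B, l1, l2, l3, l4, l5, l6, l7, l8, l9, l10, l11, l12⟩
    classical
    have hself : Function.update addr (.ord (ext c x)) v (.ord (ext c x)) = v :=
      Function.update_self ..
    have ao : ∀ u, NodeIn N u → Function.update addr (.ord (ext c x)) v u = addr u :=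
      fun u hu => Function.update_of_ne (by rintro rfl; exact hnp hu) _ _
    have core : ∀ y ∈ coreRegs, y ∉ treeRegs := by
      intro y hy
      simp only [coreRegs, List.mem_cons, List.not_mem_nil, or_false] at hy
      rcases hy with rfl | rfl | rfl | rfl | rfl | rfl | rfl <;> simp [treeRegs, ascRegs, balRegs]
    refine ⟨Function.update addr (.ord (ext c x)) v, fl', Function.update lb (v + 5) c, ?_, ?_, ao,
      ?_, ?_⟩
    · refine h.create hnp (ext_ne_nil c x) hsl (hpar.symm ▸ hNx) al.blk al.new al.notMem al.sub
        al.nodup (a1 := a2) (ext_head c x) ?_ ?_ ?_ ?_ ?_ fi (t0 := t0) (hpar.symm ▸ ht0)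
        ⟨⟨t', A, B, l1, l2, l3, l4, l5, l6, hpar.symm ▸ l7⟩, l8, l9, hpar.symm ▸ l12⟩ ?_ hself ao
      · rw [r2 _ (by simp)]; exact al.free
      · rw [r2 _ (by simp)]; exact al.bump
      · rw [r2 _ (by simp)]; exact al.le
      · rw [r2 _ (by simp)]; exact al.lt
      · intro y hy
        refine r12 y fun hh => ?_
        simp [allocRegs] at hy hh
        rcases hy with rfl | rfl | rfl | rfl | rfl <;> simp at hh
      · exact fun y hy => l11 y (core y hy)
    · rw [hself, l11 _ (by simp [treeRegs, ascRegs, balRegs]), r2 _ (by simp), al.nv]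
    · intro y hy
      simp only [createRegs, List.mem_append, not_or] at hy
      rw [l11 y hy.2, r12 y hy.1]
    · rw [l10, c2, k1.c]

end

/-! ### Locating the longest palindromic suffix after an append -/

section

variable {α : Type u} [LinearOrder α] {S : List α} {d M i e : ℕ} {N : Set (List α)} {R : ℕ → ℕ}
  {addr : ENode α → ℤ} {fl : List ℤ} {lb : ℤ → α} {a a' : AS α}

/-- Finds the suffix link of the new node with parent `nx`. -/
def findLink : Prog :=
  .ite (BT.eq .nx .neg).compile (blk [.copy .ny .zero])
    (.seq (blk [.ld .nx .link .nx]) (.seq findMatch (.seq lookup (blk [.copy .ny .nv]))))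

/-- Finds or creates the node of the longest palindromic suffix after an append, given the node `nx`
of the longest palindromic suffix before. -/
def locate : Prog :=
  .seq findMatch (.seq (blk [.copy .pn .nx]) (.seq lookup
    (.ite (BT.lt .zr .nv).compile (blk []) (.seq findLink create))))

def linkRegs : List Reg := .ny :: (matchRegs ++ lookupRegs)

def locateRegs : List Reg := .pn :: (linkRegs ++ createRegs)

/-- The potential of a node. -/
def pot (v : ENode α) : ℤ := v.len + (slink v).len

theorem coreRegs_linkRegs {y : Reg} (hy : y ∈ coreRegs) : y ∉ linkRegs := by
  simp only [coreRegs, List.mem_cons, List.not_mem_nil, or_false] at hy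
  rcases hy with rfl | rfl | rfl | rfl | rfl | rfl | rfl <;>
    simp [linkRegs, matchRegs, lookupRegs, descRegs]

theorem SufN.slink_mono {w : List α} {x v : ENode α} (hx : SufN w x) (hv : SufN w v)
    (h : x.len ≤ v.len) : (slink x).len ≤ (slink v).len := by
  rcases h.lt_or_eq with h | h
  · have h1 := hx.len_le_slink hv h
    by_cases hn : x = .negOne
    · subst hn; exact h1
    · exact (slink_len_lt hx hn).le.trans h1
  · rw [hx.ext hv h]

/-- The suffix nodes shorter than `x` are those of length at most that of its suffix link, so a
search from there finds the second longest extendable node. The -1-node is excluded because its link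
is itself. -/
theorem slink_ext {w : List α} {c : α} {x y : ENode α} (hx : SufN w x) (hxn : x ≠ .negOne)
    (hm : ext c x <:+ w ++ [c]) (hy : IsMatch w c (slink x) y) :
    slink (.ord (ext c x)) = .ord (ext c y) := by
  rw [slink_ord_eq (ext_ne_nil c y)]
  have hlt := slink_len_lt hx hxn
  exact plink_ext hy.suf hm hy.ext (lt_of_le_of_lt hy.le hlt) fun u hu hmu hul =>
    hy.max u hu hmu (hu.len_le_slink hx hul)

/-- If the suffix link of the extension is non-empty, it extends a suffix node strictly shorter than
`v`, which is thus no longer than the link of `v`. This bounds the growth of the second summand of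
the potential. -/
theorem slink_len_ext_le {w : List α} {c : α} {x v : ENode α} (hx : SufN w x) (hv : SufN w v)
    (hm : ext c x <:+ w ++ [c]) (h : x.len ≤ v.len) :
    (slink (.ord (ext c x))).len ≤ (slink v).len + 2 := by
  have h1 := (sufN_slink hv).neg_one_le
  change (mkN (plink (ext c x))).len ≤ _
  rw [mkN_len]
  by_cases h0 : plink (ext c x) = []
  · rw [h0]; simp; omega
  · obtain ⟨y, hy, hyq⟩ := exists_ext ((plink_suffix _).trans hm) (plink_pal _) h0
    have h2 := plink_length_lt (ext_ne_nil c x)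
    have h3 := ext_length c x
    have h4 := ext_length c y
    rw [← hyq] at h4
    have := hy.len_le_slink hv (by omega)
    omega

/-- The search from the link of `x` ends at a node `y` whose extension is the link sought, so `y` is
shorter than that link by 2. This expresses the cost through lengths that occur in the potential. -/
theorem findLink_spec {E : Env α} (hE : Big E S d) (hi : i ≤ e) (he : e < S.length)
    (hlo : E.lo = i) (hhi : E.hi = e) (h : NInv S d E.space i e N R addr fl lb a)
    (hN : N = palSubstrings (sub S i e)) {x : ENode α} (hx : SufN (sub S i e) x)
    (hm : ext S[e] x <:+ sub S i e ++ [S[e]])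
    (hsl : NodeIn N (slink (.ord (ext S[e] x))))
    (hnx : a.r .nx = addr x) (hrlo : a.r .lo = i) (hrhi : a.r .hi = e)
    (hc : a.c .c = Word.chr S[e]) {G : ℕ} (hG : Nat.log 2 ((sub S i e).toFinset.card + 1) ≤ G) :
    Tr E d findLink a ((40 * ((slink x).len - (slink (.ord (ext S[e] x))).len + 2)).toNat +
        60 * G + 120) fun a' =>
      NInv S d E.space i e N R addr fl lb a' ∧ a'.r .ny = addr (slink (.ord (ext S[e] x))) ∧
      Keeps linkRegs a a' := by
  have hNx : NodeIn N x := hN ▸ NodeIn.of_sufN hx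
  by_cases hxn : x = .negOne
  · subst hxn
    refine Tr.mono (K := 5) (Tr.ite (K := 4) True (iff_of_true trivial (by rw [hnx, h.rneg]))
      (fun _ => ?_) fun h => (h trivial).elim) (by omega) fun _ h => h
    refine Tr.blk hE.toFits (by simp [Oks, Instr.Ok]) ⟨h.of_eq rfl rfl fun x hx => ?_, ?_,
      rfl, rfl, fun x hx => ?_⟩
    · have := coreRegs_linkRegs hx
      simp only [linkRegs, List.mem_cons, not_or] at this
      simp [evs, Instr.ev, this]
    · simp only [evs, Instr.ev, Function.update_self, h.rzero]; rfl
    · simp only [linkRegs, List.mem_cons, not_or] at hx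
      simp [evs, Instr.ev, hx]
  have hne : addr x ≠ addr .negOne := fun hh => hxn (h.inj _ _ hNx trivial hh)
  have hsx := sufN_slink hx
  suffices H : ∃ K K' : ℕ, K ≤ (40 * ((slink x).len - (slink (.ord (ext S[e] x))).len + 2)).toNat +
      60 * G + 119 ∧ K = 4 + K' ∧ ∀ a1 : AS α, NInv S d E.space i e N R addr fl lb a1 →
      a1.r .nx = addr (slink x) → Keeps linkRegs a a1 →
      Tr E d (.seq findMatch (.seq lookup (SlidingEertree.blk [.copy .ny .nv]))) a1 K' fun a' =>
        NInv S d E.space i e N R addr fl lb a' ∧ a'.r .ny = addr (slink (.ord (ext S[e] x))) ∧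
        Keeps linkRegs a a' by
    obtain ⟨K, K', hK, rfl, H⟩ := H
    refine Tr.mono (Tr.ite (K := 4 + K') False (iff_of_false not_false (by rw [hnx, h.rneg]; exact hne))
      (fun h => h.elim) fun _ => Tr.seq (K := 4) (Q := fun a1 =>
        NInv S d E.space i e N R addr fl lb a1 ∧ a1.r .nx = addr (slink x) ∧ Keeps linkRegs a a1)
        (Tr.blk hE.toFits ?_ ⟨h.of_eq rfl rfl fun x hx => ?_, ?_, rfl, rfl, fun x hx => ?_⟩)
        fun a1 h1 => H a1 h1.1 h1.2.1 h1.2.2) (by omega) fun _ h => h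
    · simp [Oks, Instr.Ok, Fld.isChar, Valid, hnx, h.blk x hNx]
    · have := coreRegs_linkRegs hx
      simp only [linkRegs, matchRegs, List.mem_cons, List.mem_append, not_or] at this
      simp [evs, Instr.ev, this]
    · simp [evs, Instr.ev, hnx, h.link x hNx]
    · simp only [linkRegs, matchRegs, List.mem_cons, List.mem_append, not_or] at hx
      simp [evs, Instr.ev, hx]
  -- This fictitious state serves only to obtain the target `y`, and with it the cost, before the
  -- actual state is known; the target does not depend on the state, by maximality.
  obtain ⟨a0, f0, g0, c0, r0, n0⟩ : ∃ a0 : AS α, a0.f = a.f ∧ a0.g = a.g ∧ a0.c = a.c ∧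
      (∀ y, y ≠ .nx → a0.r y = a.r y) ∧ a0.r .nx = addr (slink x) :=
    ⟨{ a with r := Function.update a.r .nx (addr (slink x)) }, rfl, rfl, rfl,
      fun y hy => Function.update_of_ne hy _ _, by simp⟩
  have h0 : NInv S d E.space i e N R addr fl lb a0 := h.of_eq f0 g0 fun y hy => r0 y (by
    rintro rfl; simp [coreRegs] at hy)
  obtain ⟨y, hy, -⟩ := findMatch_spec hE hi he hlo hhi h0 hN (slink x) hsx n0
    (by rw [r0 _ (by simp), hrlo]) (by rw [r0 _ (by simp), hrhi]) (by rw [c0, hc])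
  have hs := slink_ext hx hxn hm hy
  have hsy : ext S[e] y ∈ N := by rw [hs] at hsl; exact hsl
  have hly : (slink (.ord (ext S[e] x))).len = y.len + 2 := by
    rw [hs]; exact ext_length _ _
  have hyle := hy.le
  refine ⟨_, 40 * ((slink x).len - y.len).toNat + 50 + (60 * G + 50 + 4), ?_, rfl, ?_⟩
  · rw [hly]; omega
  intro a1 h1 n1 k1
  obtain ⟨y', hy', hT⟩ := findMatch_spec hE hi he hlo hhi h1 hN (slink x) hsx n1
    (by rw [k1.r _ (by simp [linkRegs, matchRegs, lookupRegs, descRegs]), hrlo])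
    (by rw [k1.r _ (by simp [linkRegs, matchRegs, lookupRegs, descRegs]), hrhi]) (by rw [k1.c, hc])
  have hyy : y' = y := hy'.suf.ext hy.suf (le_antisymm (hy.max _ hy'.suf hy'.ext hy'.le)
    (hy'.max _ hy.suf hy.ext hy.le))
  subst hyy
  refine Tr.seq hT ?_
  rintro a2 ⟨n2, f2, k2⟩
  have k12 : Keeps linkRegs a a2 := k1.trans (k2.mono (by simp [linkRegs]))
  have h2 : NInv S d E.space i e N R addr fl lb a2 := h1.of_eq f2 k2.g fun y hy => k2.r y fun hh =>
    coreRegs_linkRegs hy (by simp [linkRegs, hh])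
  refine Tr.seq (lookup_spec hE.toFits h2 hN hy.suf n2 (c := S[e]) (by rw [k12.c, hc]) hG) ?_
  rintro a3 ⟨h3, v3, k3⟩
  have k13 : Keeps linkRegs a a3 := k12.trans (k3.mono (by simp [linkRegs]))
  refine Tr.blk hE.toFits (by simp [Oks, Instr.Ok]) ⟨h3.of_eq rfl rfl fun x hx => ?_, ?_,
    k13.trans ⟨rfl, rfl, fun x hx => ?_⟩⟩
  · have := coreRegs_linkRegs hx
    simp only [linkRegs, List.mem_cons, not_or] at this
    simp [evs, Instr.ev, this]
  · simp only [evs, Instr.ev, Function.update_self, v3, if_pos hsy, hs]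
  · simp only [linkRegs, List.mem_cons, not_or] at hx
    simp [evs, Instr.ev, hx]

theorem locate_spec {E : Env α} (hE : Big E S d) (hi : i ≤ e) (he : e < S.length)
    (hlo : E.lo = i) (hhi : E.hi = e) (h : NInv S d E.space i e N R addr fl lb a)
    (hN : N = palSubstrings (sub S i e)) 
    (hnx : a.r .nx = addr (mkN (lpsuf (sub S i e)))) (hrlo : a.r .lo = i) (hrhi : a.r .hi = e)
    (hc : a.c .c = Word.chr S[e]) {G : ℕ} (hG : Nat.log 2 ((sub S i e).toFinset.card + 1) ≤ G)
    (hM : 13 + d + 13 * ((palSubstrings (sub S i (e + 1))).ncard + 2) ≤ E.space) :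
    Tr E d locate a ((40 * (pot (mkN (lpsuf (sub S i e))) - pot (mkN (lpsuf (sub S i (e + 1)))) +
        4)).toNat + 480 * G + 400) fun a' => ∃ addr' fl' lb',
      NInv S d E.space i e (palSubstrings (sub S i (e + 1))) R addr' fl' lb' a' ∧
      a'.r .nv = addr' (.ord (lpsuf (sub S i (e + 1)))) ∧
      (∀ y, y ∉ locateRegs → a'.r y = a.r y) ∧ a'.c .c = a.c .c := by
  set w := sub S i e with hw
  have hcur : SufN w (mkN (lpsuf w)) := sufN_mkN (lpsuf_suffix w) (lpsuf_pal w)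
  have hw' : sub S i (e + 1) = w ++ [S[e]] := sub_succ hi he
  rw [hw'] at hM ⊢
  obtain ⟨x, hx, hT⟩ := findMatch_spec hE hi he hlo hhi h hN _ hcur hnx hrlo hrhi hc
  have hq : lpsuf (w ++ [S[e]]) = ext S[e] x := lpsuf_concat hx.suf hx.ext fun u hu hm =>
    hx.max u hu hm hu.len_le
  have hpal := palSubstrings_concat w S[e]
  rw [hq] at hpal ⊢
  rw [hpal] at hM ⊢
  have hmk : mkN (ext S[e] x) = .ord (ext S[e] x) := by simp [mkN, ext_ne_nil]
  rw [hmk]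
  have hnode : (slink (.ord (ext S[e] x))).IsNode (w ++ [S[e]]) :=
    isNode_slink (v := .ord (ext S[e] x)) (by
      rw [isNode_iff, hpal]; exact Or.inl rfl)
  -- The suffix link is shorter than the only palindrome that can be new, so its node exists
  -- already.
  have hsl : NodeIn N (slink (.ord (ext S[e] x))) := by
    rw [isNode_iff, hpal] at hnode
    rw [hN]
    cases hz : slink (.ord (ext S[e] x)) with
    | negOne => trivial
    | zero => trivial
    | ord p =>
      rw [hz] at hnode
      rcases hnode with rfl | hh
      · have h1 := congrArg ENode.len hz
        change (mkN (plink (ext S[e] x))).len = ((ext S[e] x).length : ℤ) at h1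
        rw [mkN_len] at h1
        have := plink_length_lt (ext_ne_nil S[e] x)
        omega
      · exact hh
  have hle1 := hx.le
  have hle2 := hx.suf.slink_mono hcur hx.le
  have hle3 := slink_len_ext_le hx.suf hcur hx.ext hx.le
  have hlen : (ENode.ord (ext S[e] x)).len = x.len + 2 := ext_length _ _
  set P := (slink (mkN (lpsuf w))).len with hP
  set Q := (slink (.ord (ext S[e] x))).len with hQ
  set L := (mkN (lpsuf w)).len with hL
  -- The first summand pays for the search for the parent `x` and the second one for the search for
  -- the suffix link, each up to a constant; the latter starts at the link of `x`, which is no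
  -- longer than `P`.
  have hpot : pot (mkN (lpsuf w)) - pot (.ord (ext S[e] x)) = (L - x.len - 2) + (P - Q) := by
    unfold pot; rw [← hP, ← hQ, ← hL, hlen]; ring
  rw [hpot]
  have sub1 : matchRegs ⊆ locateRegs := by intro y; simp [locateRegs, linkRegs]; tauto
  have sub2 : lookupRegs ⊆ locateRegs := by intro y; simp [locateRegs, linkRegs]; tauto
  have core : ∀ y ∈ coreRegs, y ∉ Reg.pn :: linkRegs := by
    intro y hy
    rw [List.mem_cons, not_or]
    exact ⟨by rintro rfl; simp [coreRegs] at hy, coreRegs_linkRegs hy⟩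
  refine (Tr.seq (K' := 4 + (60 * G + 50 + ((40 * (P - Q + 2)).toNat + 420 * G + 241 + 1))) hT ?_).mono
    (by omega) fun _ h => h
  rintro a1 ⟨n1, f1, k1⟩
  have h1 : NInv S d E.space i e N R addr fl lb a1 := h.of_eq f1 k1.g fun y hy => k1.r y fun hh =>
    coreRegs_linkRegs hy (by simp [linkRegs, hh])
  refine Tr.seq (K := 4) (Q := fun a2 => NInv S d E.space i e N R addr fl lb a2 ∧
    a2.r .nx = addr x ∧ a2.r .pn = addr x ∧ Keeps locateRegs a a2) (Tr.blk hE.toFits ?_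
    ⟨h1.of_eq rfl rfl fun x hx => ?_, ?_, ?_, (k1.mono sub1).trans ⟨rfl, rfl, fun x hx => ?_⟩⟩) ?_
  · simp [Oks, Instr.Ok]
  · have := core _ hx
    simp only [List.mem_cons, not_or] at this
    simp [evs, Instr.ev, this]
  · simp [evs, Instr.ev, n1]
  · simp [evs, Instr.ev, n1]
  · simp only [locateRegs, List.mem_cons, not_or] at hx
    simp [evs, Instr.ev, hx]
  rintro a2 ⟨h2, n2, p2, k2⟩
  refine Tr.seq (lookup_spec hE.toFits h2 hN hx.suf n2 (c := S[e]) (by rw [k2.c, hc]) hG) ?_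
  rintro a3 ⟨h3, v3, k3⟩
  have k13 : Keeps locateRegs a a3 := k2.trans (k3.mono sub2)
  by_cases hmem : ext S[e] x ∈ N
  · have hb := (h3.blk (.ord (ext S[e] x)) hmem).pos'
    rw [if_pos hmem] at v3
    refine Tr.ite True (iff_of_true trivial (by rw [v3, h3.rzr]; omega)) (fun _ => ?_)
      fun h => (h trivial).elim
    refine Tr.mono (K := 1) ?_ (by omega) fun _ h => h
    refine Tr.blk (l := []) hE.toFits trivial ⟨addr, fl, lb, ?_, v3, k13.r, k13.c⟩
    rw [← hN, Set.insert_eq_of_mem hmem]; exact h3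
  · rw [if_neg hmem] at v3
    refine Tr.ite False (iff_of_false not_false (by rw [v3, h3.rzr]; omega)) (fun h => h.elim)
      fun _ => ?_
    have hnx3 : a3.r .nx = addr x := by rw [k3.r _ (by simp [lookupRegs, descRegs]), n2]
    have hpn3 : a3.r .pn = addr x := by rw [k3.r _ (by simp [lookupRegs, descRegs]), p2]
    have nl : ∀ y ∈ [Reg.lo, .hi], y ∉ locateRegs := by
      simp [locateRegs, linkRegs, matchRegs, lookupRegs, descRegs, createRegs, allocRegs, treeRegs,
        ascRegs, balRegs]
    refine (Tr.seq (K' := 360 * G + 120) (findLink_spec hE hi he hlo hhi h3 hN hx.suf hx.ext hsl hnx3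
      (by rw [k13.r _ (nl _ (by simp)), hrlo]) (by rw [k13.r _ (nl _ (by simp)), hrhi])
      (by rw [k13.c, hc]) hG) ?_).mono (by omega) fun _ h => h
    rintro a4 ⟨h4, y4, k4⟩
    have hcard : (insert (ext S[e] x) N).ncard = N.ncard + 1 :=
      Set.ncard_insert_of_notMem hmem h.fin
    refine (create_spec hE he.le h4 hN hx.suf hmem hsl ?_
      (by rw [k4.r _ (by simp [linkRegs, matchRegs, lookupRegs, descRegs]), hpn3]) y4
      (by rw [k4.c, k13.c, hc]) hG).mono le_rfl ?_
    · rw [← hN, hcard] at hM; omega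
    rintro a5 ⟨addr', fl', lb', h5, v5, -, r5, c5⟩
    refine ⟨addr', fl', lb', by rw [← hN]; exact h5, v5, fun y hy => ?_, by rw [c5, k4.c, k13.c]⟩
    have hy' := hy
    simp only [locateRegs, List.mem_cons, List.mem_append, not_or] at hy'
    rw [r5 y hy'.2.2, k4.r y hy'.2.1, k13.r y hy]

end

section

variable {α : Type u} [LinearOrder α] {S : List α} {d M i e : ℕ} {N : Set (List α)} {R : ℕ → ℕ}
  {addr : ENode α → ℤ} {fl : List ℤ} {lb : ℤ → α} {a a' : AS α}

/-! ### Registering occurrences -/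

theorem mod_ne_of_lt {k l d : ℕ} (h : k < l) (h' : l < k + d) : k % d ≠ l % d := by
  intro hh
  have h1 : (l - k) % d = 0 := Nat.sub_mod_eq_zero_of_mod_eq hh.symm
  rw [Nat.mod_eq_of_lt (by omega)] at h1
  omega

omit [LinearOrder α] in
theorem sub_zero_right (S : List α) (k : ℕ) : sub S k (k + 0) = [] := by simp [sub]

/-- The extended window has at most `d` positions, so the cell of the position `e` belongs to no
other position of the window and is empty by `arr0`. -/
theorem NInv.extend (h : NInv S d M i e N R addr fl lb a) (hi : i ≤ e) (hR : R e = 0)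
    (hd : e + 1 - i ≤ d) : NInv S d M i (e + 1) N R addr fl lb a := by
  have hrefs : ∀ p ∈ N, refs S i (e + 1) R N p = refs S i e R N p := by
    intro p hp
    unfold refs
    rw [Finset.sum_Ico_succ_top hi, hR, sub_zero_right, if_neg, add_zero]
    rintro rfl; exact h.ne hp
  have hcnt := h.cnt
  have hocc := h.occ
  have harr := h.arr
  have harr0 := h.arr0
  have he : a.f .arr ((e % d : ℕ) : ℤ) = 0 := harr0 _ (Nat.mod_lt _ (by omega)) fun k hk hk' =>
    mod_ne_of_lt hk' (by omega)
  cases h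
  constructor
  case cnt => intro p hp; rw [hrefs p hp, hcnt p hp]
  case occ =>
    intro k hk hk' hkR
    rcases Nat.lt_succ_iff_lt_or_eq.1 hk' with h1 | rfl
    · exact hocc k hk h1 hkR
    · exact (hkR hR).elim
  case arr =>
    intro k hk hk'
    rcases Nat.lt_succ_iff_lt_or_eq.1 hk' with h1 | rfl
    · exact harr k hk h1
    · rw [if_pos hR, he]
  case arr0 => exact fun m hm hk => harr0 m hm fun k h1 h2 => hk k h1 (by omega)
  all_goals assumption

theorem NInv.shrink (h : NInv S d M i e N R addr fl lb a) (hi : i < e) (hR : R i = 0) :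
    NInv S d M (i + 1) e N R addr fl lb a := by
  have hrefs : ∀ p ∈ N, refs S (i + 1) e R N p = refs S i e R N p := by
    intro p hp
    unfold refs
    rw [Finset.sum_eq_sum_Ico_succ_bot hi, hR, sub_zero_right, if_neg, zero_add]
    rintro rfl; exact h.ne hp
  have hcnt := h.cnt
  have hocc := h.occ
  have harr := h.arr
  have harr0 := h.arr0
  have he : a.f .arr ((i % d : ℕ) : ℤ) = 0 := by rw [harr i le_rfl hi, if_pos hR]
  cases h
  constructor
  case cnt => intro p hp; rw [hrefs p hp, hcnt p hp]
  case occ => exact fun k hk hk' hkR => hocc k (by omega) hk' hkR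
  case arr => exact fun k hk hk' => harr k (by omega) hk'
  case arr0 =>
    intro m hm hk
    by_cases hh : i % d = m
    · rw [← hh, he]
    · refine harr0 m hm fun k h1 h2 => ?_
      rcases h1.lt_or_eq with h1 | rfl
      · exact hk k h1 h2
      · exact hh
  all_goals assumption

/-- Written additively because the counters are natural numbers. -/
theorem refs_update {k : ℕ} (hk : i ≤ k) (hk' : k < e) (m : ℕ) (p : List α) :
    refs S i e (Function.update R k m) N p + (if sub S k (k + R k) = p then 1 else 0) =
      refs S i e R N p + if sub S k (k + m) = p then 1 else 0 := by
  have hm : k ∈ Finset.Ico i e := Finset.mem_Ico.2 ⟨hk, hk'⟩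
  unfold refs
  rw [← Finset.add_sum_erase _ _ hm, ← Finset.add_sum_erase (a := k) _
    (fun k => if sub S k (k + R k) = p then 1 else 0) hm, Function.update_self,
    Finset.sum_congr rfl fun j hj => by
      rw [Function.update_of_ne (Finset.ne_of_mem_erase hj)]]
  omega

/-- The occurrence registered at the position `k` is changed. -/
theorem NInv.reassign (h : NInv S d M i e N R addr fl lb a) (hd : e - i ≤ d) {k m : ℕ} (hk : i ≤ k)
    (hk' : k < e) (hm : m = 0 ∨ sub S k (k + m) ∈ N) (hg : a'.g = a.g)
    (hr : ∀ x ∈ coreRegs, a'.r x = a.r x)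
    (hf : ∀ fl p, fl ≠ .cnt → fl ≠ .arr → a'.f fl p = a.f fl p)
    (harr : ∀ p : ℤ, a'.f .arr p = if p = (k % d : ℕ) then
      (if m = 0 then 0 else addr (.ord (sub S k (k + m)))) else a.f .arr p)
    (hc0 : a'.f .cnt 0 = 0)
    (hc : ∀ p ∈ N, a'.f .cnt (addr (.ord p)) + (if sub S k (k + R k) = p then 1 else 0) =
      a.f .cnt (addr (.ord p)) + if sub S k (k + m) = p then 1 else 0) :
    NInv S d M i e N (Function.update R k m) addr fl lb a' := by
  have h1 := hr .d (by simp [coreRegs])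
  have h2 := hr .neg (by simp [coreRegs])
  have h3 := hr .zero (by simp [coreRegs])
  have h4 := hr .zr (by simp [coreRegs])
  have h5 := hr .one (by simp [coreRegs])
  have h6 := hr .free (by simp [coreRegs])
  have h7 := hr .bump (by simp [coreRegs])
  have tree := h.tree
  have free := h.free
  have cnt := h.cnt
  have occ := h.occ
  have arr := h.arr
  have arr0 := h.arr0
  cases h
  constructor
  case tree =>
    intro v hv
    obtain ⟨t, ht⟩ := tree v hv
    refine ⟨t, ?_, T.In_congr (fun q _ => ?_) ht.tin, ht.avl, ht.sorted, ht.mem⟩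
    · rw [hf _ _ (by simp) (by simp), ht.root]
    · simp [hf]
  case free => rw [h6]; exact free.fields fun q => hf _ _ (by simp) (by simp)
  case cnt0 => exact hc0
  case cnt =>
    intro p hp
    have e1 := hc p hp
    have e2 := refs_update (S := S) (R := R) (N := N) hk hk' m p
    rw [cnt p hp] at e1
    split_ifs at e1 e2 <;> omega
  case occ =>
    intro j hj hj' hR
    by_cases e : j = k
    · subst e
      rw [Function.update_self] at hR ⊢
      exact hm.resolve_left hR
    · rw [Function.update_of_ne e] at hR ⊢
      exact occ j hj hj' hR
  case arr =>
    intro j hj hj'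
    rw [harr]
    by_cases e : j = k
    · subst e
      rw [if_pos rfl, Function.update_self]
    · rw [if_neg, Function.update_of_ne e, arr j hj hj']
      rcases lt_or_gt_of_ne e with e | e
      · exact_mod_cast mod_ne_of_lt e (by omega)
      · exact_mod_cast (mod_ne_of_lt e (by omega)).symm
  case arr0 =>
    intro j hj hn
    rw [harr, if_neg, arr0 j hj hn]
    exact_mod_cast (hn k hk hk').symm
  all_goals first
    | assumption
    | (simp only [hg, h1, h2, h3, h4, h5, h6, h7]; assumption)
    | (intros; rw [hf _ _ (by simp) (by simp)]; solve_by_elim)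

/-- Registers the occurrence of the palindrome of the node `nv` at the position `pos`, unless a
longer one is registered there. -/
def register : Prog :=
  .seq (blk [.arith .mod .ix .pos .d, .ld .ny .arr .ix, .ld .tmp .len .ny, .ld .tm .len .nv])
    (.ite (BT.lt .tmp .tm).compile
      (blk [.st .arr .ix .nv, .ld .tmp .cnt .ny, .arith .sub .tmp .tmp .one, .st .cnt .ny .tmp,
        .ld .tmp .cnt .nv, .arith .add .tmp .tmp .one, .st .cnt .nv .tmp, .st .cnt .zr .zr])
      (blk []))

def registerRegs : List Reg := [.ix, .ny, .tmp, .tm]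

theorem NInv.old_valid (h : NInv S d M i e N R addr fl lb a) {k : ℕ} (hk : i ≤ k) (hk' : k < e) :
    a.f .arr ((k % d : ℕ) : ℤ) = 0 ∨ Blk d M (a.f .arr ((k % d : ℕ) : ℤ)) := by
  rw [h.arr k hk hk']
  split_ifs with hR
  · exact Or.inl rfl
  · exact Or.inr (h.blk (.ord _) (h.occ k hk hk' hR))

/-- An empty cell holds the null pointer, whose length field is 0, so any palindrome beats it. Its
counter field is then decremented to -1, and the last store of the program resets it to 0; thus no
case distinction is needed. -/
theorem register_spec {E : Env α} (hE : Big E S d) (he : e ≤ S.length)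
    (h : NInv S d E.space i e N R addr fl lb a) (hd : e - i ≤ d) {k m : ℕ} (hk : i ≤ k)
    (hk' : k < e) (hN : N.ncard ≤ S.length) (hm : 0 < m) (hke : k + m ≤ S.length)
    (hRe : k + R k ≤ S.length) (hp : sub S k (k + m) ∈ N)
    (hnv : a.r .nv = addr (.ord (sub S k (k + m)))) (hpos : a.r .pos = k) :
    Tr E d register a 40 fun a' => NInv S d E.space i e N (regAt R k m) addr fl lb a' ∧
      Keeps registerRegs a a' := by
  have hbig := hE.big
  have core : ∀ y ∈ coreRegs, y ∉ registerRegs := by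
    intro y hy
    simp only [coreRegs, List.mem_cons, List.not_mem_nil, or_false] at hy
    rcases hy with rfl | rfl | rfl | rfl | rfl | rfl | rfl <;> simp [registerRegs]
  set p := sub S k (k + m) with hpdef
  have hplen : p.length = m := by rw [hpdef, sub_length hke]; omega
  have hold := h.old_valid hk hk'
  set y := a.f .arr ((k % d : ℕ) : ℤ) with hy
  have hylen : a.f .len y = R k := by
    rw [hy, h.arr k hk hk']
    split_ifs with hR
    · rw [h.len0, hR]; rfl
    · rw [h.len (.ord _) (h.occ k hk hk' hR)]
      simp only [ENode.len]
      rw [sub_length hRe]; congr 1; omega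
  have hmod : ((k : ℤ) % (d : ℤ)) = ((k % d : ℕ) : ℤ) := by push_cast; rfl
  have hdpos : 0 < d := by omega
  have hml : k % d < d := Nat.mod_lt _ hdpos
  have bv := h.blk (.ord p) hp
  have vpos := bv.pos'
  have hvl : a.f .len (addr (.ord p)) = m := by
    rw [h.len (.ord p) hp]; simp only [ENode.len]; rw [hplen]
  refine Tr.seq (K := 13) (K' := 27) (Q := fun a1 => a1.f = a.f ∧ Keeps registerRegs a a1 ∧
    a1.r .ix = (k % d : ℕ) ∧ a1.r .ny = y ∧ a1.r .tmp = R k ∧ a1.r .tm = m)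
    (Tr.blk hE.toFits ?_ ⟨rfl, ⟨rfl, rfl, fun x hx => ?_⟩, ?_, ?_, ?_, ?_⟩) ?_
  · simp only [Oks, Instr.Ok, Instr.ev, Fld.isChar, Valid, ArithOp.eval, hpos, h.rd, hmod,
      Function.update_self, ne_eq, reduceCtorEq, not_false_eq_true, Function.update_of_ne, ← hy,
      hnv, abs_le]
    refine ⟨⟨by omega, by omega⟩, ⟨trivial, by omega, by omega⟩, ⟨trivial, hold⟩,
      ⟨trivial, Or.inr bv⟩, trivial⟩
  · simp only [registerRegs, List.mem_cons, List.not_mem_nil, or_false, not_or] at hx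
    simp [evs, Instr.ev, hx]
  · simp [evs, Instr.ev, ArithOp.eval, hpos, h.rd]
  · simp [evs, Instr.ev, ArithOp.eval, hpos, h.rd, hy]
  · simp only [evs, Instr.ev, ArithOp.eval, hpos, h.rd, hmod, Function.update_self, ne_eq,
      reduceCtorEq, not_false_eq_true, Function.update_of_ne, ← hy, hylen]
  · simp [evs, Instr.ev, hnv, hvl]
  rintro a1 ⟨f1, k1, x1, y1, t1, m1⟩
  have h1 : NInv S d E.space i e N R addr fl lb a1 := h.of_eq f1 k1.g fun y hy => k1.r y (core y hy)
  have v1 : a1.r .nv = addr (.ord p) := by rw [k1.r _ (by simp [registerRegs]), hnv]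
  refine Tr.ite (K := 26) (R k < m) (by simp only [BT.Is]; rw [t1, m1]; omega) (fun hlt => ?_)
    fun hge => ?_
  · have hregAt : regAt R k m = Function.update R k m := if_pos hlt
    rw [hregAt]
    -- The old and the new palindrome have different lengths, so the two counter updates concern
    -- different cells.
    have hyv : y ≠ addr (.ord p) := by
      intro hh; rw [hh, hvl] at hylen; omega
    have hcle := refs_le (S := S) (i := i) (e := e) (R := R) h.fin p
    have hcp := h.cnt p hp
    have hcy : a.f .cnt y = 0 ∨ ∃ q ∈ N, a.f .cnt y = refs S i e R N q := by
      rw [hy, h.arr k hk hk']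
      split_ifs with hR
      · exact Or.inl h.cnt0
      · exact Or.inr ⟨_, h.occ k hk hk' hR, h.cnt _ (h.occ k hk hk' hR)⟩
    have hcyb : 0 ≤ a.f .cnt y ∧ a.f .cnt y ≤ 2 * S.length := by
      rcases hcy with hh | ⟨q, -, hh⟩
      · omega
      · have := refs_le (S := S) (i := i) (e := e) (R := R) h.fin q
        omega
    have ev1 : ∀ q, q ≠ y → q ≠ addr (.ord p) → q ≠ 0 → (evs E a1 [.st .arr .ix .nv,
        .ld .tmp .cnt .ny, .arith .sub .tmp .tmp .one, .st .cnt .ny .tmp,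
        .ld .tmp .cnt .nv, .arith .add .tmp .tmp .one, .st .cnt .nv .tmp,
        .st .cnt .zr .zr]).f .cnt q = a.f .cnt q := by
      intro q q1 q2 q3
      simp [evs, Instr.ev, y1, v1, f1, h1.rzr, q1, q2, q3]
    refine Tr.mono (K := 25) (Tr.blk hE.toFits ?_ ⟨h1.reassign hd hk hk' (Or.inr hp) rfl
      (fun x hx => ?_) ?_ ?_ ?_ ?_, k1.trans ⟨rfl, rfl, fun x hx => ?_⟩⟩) (by omega) fun _ h => h
    · simp [Oks, Instr.Ok, Instr.ev, Fld.isChar, Valid, ArithOp.eval, x1, y1, v1, f1, h1.rone,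
        h1.rzr, bv, hold, hyv.symm, abs_le, hcp]
      omega
    · have := core x hx
      simp only [registerRegs, List.mem_cons, List.not_mem_nil, or_false, not_or] at this
      simp [evs, Instr.ev, this]
    · intro fl q hfl hfl'
      cases fl <;> simp at hfl hfl' <;> simp [evs, Instr.ev]
    · intro q
      rw [if_neg hm.ne']
      simp [evs, Instr.ev, x1, v1, Function.update_apply, hpdef]
    · simp [evs, Instr.ev, h1.rzr]
    · intro q hq
      have bq := (h.blk (.ord q) hq).pos'
      rw [f1]
      by_cases hqp : q = p
      · have n1 : sub S k (k + R k) ≠ q := by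
          intro hh
          have := congrArg List.length hh
          rw [sub_length hRe, hqp, hplen] at this
          omega
        have n2 : sub S k (k + m) = q := hpdef.symm.trans hqp.symm
        rw [if_neg n1, if_pos n2, hqp]
        simp [evs, Instr.ev, y1, v1, f1, h1.rzr, h1.rone, ArithOp.eval, hyv.symm,
          Function.update_of_ne (show addr (.ord p) ≠ 0 by omega)]
      · have hne : addr (.ord q) ≠ addr (.ord p) := fun hh => hqp (by
            have := h.inj (.ord q) (.ord p) hq hp hh
            injection this)
        have n2 : sub S k (k + m) ≠ q := fun hh => hqp (hh.symm.trans hpdef.symm)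
        rw [if_neg n2]
        by_cases hqy : addr (.ord q) = y
        · have n1 : sub S k (k + R k) = q := by
            rw [hy, h.arr k hk hk'] at hqy
            split_ifs at hqy with hR
            · omega
            · have := h.inj (.ord q) (.ord _) hq (h.occ k hk hk' hR) hqy
              injection this with this; exact this.symm
          rw [if_pos n1, hqy]
          simp [evs, Instr.ev, y1, v1, f1, h1.rzr, h1.rone, ArithOp.eval, hyv,
            Function.update_of_ne (show y ≠ 0 by omega)]
        · have n1 : sub S k (k + R k) ≠ q := by
            rintro rfl
            by_cases hR : R k = 0
            · rw [hR, sub_zero_right] at hq; exact h.ne hq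
            · exact hqy (by rw [hy, h.arr k hk hk', if_neg hR])
          rw [ev1 _ hqy hne (by omega), if_neg n1]
    · simp only [registerRegs, List.mem_cons, List.not_mem_nil, or_false, not_or] at hx
      simp [evs, Instr.ev, hx]
  · have hregAt : regAt R k m = R := if_neg hge
    rw [hregAt]
    exact Tr.mono (K := 1) (Tr.blk (l := []) hE.toFits trivial ⟨h1, k1⟩) (by omega) fun _ h => h

end

section

variable {α : Type u} [LinearOrder α] {S : List α} {d M i e : ℕ} {N : Set (List α)} {R : ℕ → ℕ}
  {addr : ENode α → ℤ} {fl : List ℤ} {lb : ℤ → α} {a a' : AS α}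

/-! ### Removing nodes -/

theorem refs_eq_zero_iff (hfin : N.Finite) {p : List α} : refs S i e R N p = 0 ↔
    (∀ k, i ≤ k → k < e → sub S k (k + R k) ≠ p) ∧ ∀ q ∈ N, plink q ≠ p := by
  unfold refs
  rw [Nat.add_eq_zero_iff, Finset.sum_eq_zero_iff,
    Set.ncard_eq_zero (hfin.subset fun q hq => hq.1)]
  refine and_congr ⟨fun h k hk hk' hh => ?_, fun h k hk => ?_⟩ ⟨fun h q hq hh => ?_, fun h => ?_⟩
  · simpa [hh] using h k (Finset.mem_Ico.2 ⟨hk, hk'⟩)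
  · rw [Finset.mem_Ico] at hk
    rw [if_neg (h k hk.1 hk.2)]
  · exact Set.notMem_empty q (h ▸ (⟨hq, hh⟩ : q ∈ {q ∈ N | plink q = p}))
  · ext q
    simp only [Set.mem_ofPred_eq, Set.mem_empty_iff_false, iff_false, not_and]
    exact h q

/-- The effect of removing the node at the address `v` with the palindrome `P`. -/
structure Erased (v x : ℤ) (P : List α) (addr : ENode α → ℤ) (N : Set (List α)) (t0 : T)
    (a a' : AS α) : Prop where
  regs : ∀ y ∈ [Reg.d, .neg, .zero, .zr, .one, .bump], a'.r y = a.r y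
  free : a'.r .free = v
  link : a'.f .link v = a.r .free
  tree : ∃ (t' : T) (A B : List ℤ), t0.list = A ++ (v + 5) :: B ∧ t'.list = A ++ B ∧ t'.In a'.f ∧
    t'.Avl ∧ a'.f .root x = t'.ptr
  cnt : ∀ q ∈ N, a'.f .cnt (addr (.ord q)) + (if plink P = q then 1 else 0) =
    a.f .cnt (addr (.ord q))
  cnt0 : a'.f .cnt 0 = 0
  g : a'.g = a.g
  frame : ∀ fl p, (fl ∈ [Fld.l, .r, .ht, .up, .dir] → p ∉ t0.list) → (fl = .root → p ≠ x) →
    (fl = .link → p ≠ v) → fl ≠ .cnt → a'.f fl p = a.f fl p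

/-- With a counter of 0, neither the array nor a suffix link points to the block. The remaining
nodes have their parents among themselves, so none is a child of `P`, and the only pointer to cut is
the incoming edge. The block joins the free list through its field `link`. -/
theorem NInv.erase {P : List α} (h : NInv S d M i e (insert P N) R addr fl lb a) (hP : P ∉ N)
    (hrefs : refs S i e R (insert P N) P = 0) (hcl : ∀ v, NodeIn N v → NodeIn N (slink v))
    (hcp : ∀ p ∈ N, NodeIn N (parN p)) {t0 : T}
    (ht0 : IsTree (insert P N) addr lb a.f (parN P) t0)
    (hE : Erased (addr (.ord P)) (addr (parN P)) P addr N t0 a a') :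
    NInv S d M i e N R addr (addr (.ord P) :: fl) lb a' := by
  have hPm : P ∈ insert P N := Or.inl rfl
  have hfin : N.Finite := h.fin.subset (Set.subset_insert _ _)
  have up : ∀ u, NodeIn N u → NodeIn (insert P N) u := by
    rintro (_ | _ | p) hu
    · trivial
    · trivial
    · exact Or.inr hu
  have hne : ∀ u, NodeIn N u → addr u ≠ addr (.ord P) := fun u hu hh => by
    have := h.inj u (.ord P) (up u hu) hPm hh
    subst this; exact hP hu
  have hparP := h.cpar P hPm
  have hv := h.blk (.ord P) hPm
  have hvpos := hv.pos'
  have tb := h.tree_blk ht0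
  have ht00 : (0 : ℤ) ∉ t0.list := fun hh => by have := (tb 0 hh).pos'; omega
  have z := (refs_eq_zero_iff h.fin).1 hrefs
  obtain ⟨t', A, B, l1, l2, l3, l4, l5⟩ := hE.tree
  have fr : ∀ fl ∈ [Fld.len, .par, .tgt, .arr], ∀ p, a'.f fl p = a.f fl p := by
    intro fl hfl p
    apply hE.frame
    · intro hh; simp at hfl hh; rcases hfl with rfl | rfl | rfl | rfl <;> simp at hh
    · rintro rfl; simp at hfl
    · rintro rfl; simp at hfl
    · rintro rfl; simp at hfl
  have frl : ∀ p, p ≠ addr (.ord P) → a'.f .link p = a.f .link p := fun p hp =>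
    hE.frame _ _ (by simp) (by simp) (fun _ => hp) (by simp)
  have hmem : ∀ q ∈ t0.list, q ∈ t'.list ∨ q = addr (.ord P) + 5 := by
    intro q hq
    rw [l1] at hq
    rw [l2]
    simp only [List.mem_append, List.mem_cons] at hq ⊢
    tauto
  constructor
  case rd => rw [hE.regs _ (by simp), h.rd]
  case rneg => rw [hE.regs _ (by simp), h.rneg]
  case rzero => rw [hE.regs _ (by simp), h.rzero]
  case rzr => rw [hE.regs _ (by simp), h.rzr]
  case rone => rw [hE.regs _ (by simp), h.rone]
  case ht0 => rw [hE.frame _ _ (fun _ => ht00) (by simp) (by simp) (by simp), h.ht0]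
  case len0 => rw [fr _ (by simp), h.len0]
  case cnt0 => exact hE.cnt0
  case fin => exact hfin
  case ne => exact fun hh => h.ne (Or.inr hh)
  case blk => exact fun u hu => h.blk u (up u hu)
  case inj => exact fun u u' hu hu' => h.inj u u' (up u hu) (up u' hu')
  case clink => exact hcl
  case cpar => exact hcp
  case len => intro u hu; rw [fr _ (by simp), h.len u (up u hu)]
  case link => intro u hu; rw [frl _ (hne u hu), h.link u (up u hu)]
  case par => intro p hp; rw [fr _ (by simp), h.par p (Or.inr hp)]
  case lab => intro p hp c hc; rw [hE.g, h.lab p (Or.inr hp) c hc]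
  case tgt => intro p hp; rw [fr _ (by simp), h.tgt p (Or.inr hp)]
  case tlab => intro p hp c hc; rw [hE.g, h.tlab p (Or.inr hp) c hc]
  case lbs => exact fun p hp => h.lbs p (Or.inr hp)
  case tree =>
    intro u hu
    by_cases hux : u = parN P
    · subst hux
      have hnd := ht0.nodup
      have hs := ht0.sorted
      rw [l1] at hnd hs
      refine ⟨t', l5, l3, l4, ?_, fun q => ?_⟩
      · rw [l2]
        exact hs.sublist (List.Sublist.append_left (List.sublist_cons_self _ _) _)
      · constructor
        · intro hq
          have hq0 : q ∈ t0.list := by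
            rw [l2] at hq; rw [l1]
            simp only [List.mem_append, List.mem_cons] at hq ⊢; tauto
          obtain ⟨p, hp | hp, hh, rfl⟩ := (ht0.mem q).1 hq0
          · subst hp
            exfalso
            rw [l2] at hq
            rw [List.nodup_middle, List.nodup_cons] at hnd
            exact hnd.1 hq
          · exact ⟨p, hp, hh, rfl⟩
        · rintro ⟨p, hp, hh, rfl⟩
          refine (hmem _ ((ht0.mem _).2 ⟨p, Or.inr hp, hh, rfl⟩)).resolve_right fun h5 => ?_
          exact hne (.ord p) hp (by omega)
    · obtain ⟨t, ht⟩ := h.tree u (up u hu)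
      have hdis : ∀ q ∈ t.list, q ∉ t0.list := by
        intro q hq hq0
        obtain ⟨p, hp, hh, rfl⟩ := (ht.mem q).1 hq
        obtain ⟨p', hp', hh', he⟩ := (ht0.mem _).1 hq0
        have := h.inj (.ord p) (.ord p') hp hp' (by omega)
        injection this with this
        subst this
        exact hux (hh.symm.trans hh')
      refine ⟨t, ?_, T.In_congr (fun q hq => ?_) ht.tin, ht.avl, ht.sorted, fun q => ?_⟩
      · rw [hE.frame _ _ (by simp) (fun _ hh => hux (h.inj u _ (up u hu) hparP hh)) (by simp)
          (by simp), ht.root]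
      · have := hdis q hq
        refine ⟨?_, ?_, ?_⟩ <;> exact hE.frame _ _ (fun _ => this) (by simp) (by simp) (by simp)
      · rw [ht.mem q]
        constructor
        · rintro ⟨p, rfl | hp, hh, rfl⟩
          · exact (hux hh.symm).elim
          · exact ⟨p, hp, hh, rfl⟩
        · rintro ⟨p, hp, hh, rfl⟩
          exact ⟨p, Or.inr hp, hh, rfl⟩
  case cnt =>
    intro p hp
    have e1 := hE.cnt p hp
    rw [h.cnt p (Or.inr hp), refs_insert hfin hP] at e1
    push_cast at e1
    omega
  case occ =>
    intro k hk hk' hR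
    exact (h.occ k hk hk' hR).resolve_left (z.1 k hk hk')
  case arr => intro k hk hk'; rw [fr _ (by simp), h.arr k hk hk']
  case arr0 => intro m hm hk; rw [fr _ (by simp), h.arr0 m hm hk]
  case free =>
    refine ⟨hE.free, ?_⟩
    rw [hE.link]
    exact h.free.congr fun q hq => frl q fun hh => h.fnew q hq (.ord P) hPm hh.symm
  case fnodup =>
    rw [List.nodup_cons]
    exact ⟨fun hh => h.fnew _ hh (.ord P) hPm rfl, h.fnodup⟩
  case fblk =>
    intro p hp
    rw [hE.regs _ (by simp)]
    rcases List.mem_cons.1 hp with rfl | hp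
    · exact ⟨hv, h.old (.ord P) hPm⟩
    · exact h.fblk p hp
  case fnew =>
    intro p hp u hu
    rcases List.mem_cons.1 hp with rfl | hp
    · exact hne u hu
    · exact h.fnew p hp u (up u hu)
  case bump =>
    rw [hE.regs _ (by simp), h.bump, Set.ncard_insert_of_notMem hP hfin, List.length_cons]
    congr 3; omega
  case old => intro u hu; rw [hE.regs _ (by simp)]; exact h.old u (up u hu)

/-- Removes the node `nx`, which must not be referenced. -/
def removeNode : Prog :=
  .seq (blk [.ld .pn .par .nx, .ldc .c .lab .nx]) (.seq deleteEdge
    (.seq (blk [.ld .ny .link .nx, .st .link .nx .free, .copy .free .nx])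
      (.ite (BT.eq .ny .zero).compile (blk [])
        (blk [.ld .tmp .cnt .ny, .arith .sub .tmp .tmp .one, .st .cnt .ny .tmp]))))

def removeRegs : List Reg := .pn :: .ny :: .free :: .tmp :: treeRegs

theorem removeNode_spec {E : Env α} (hE : Big E S d) {P w : List α}
    (h : NInv S d E.space i e (insert P N) R addr fl lb a) (hP : P ∉ N)
    (hN : insert P N = palSubstrings w) (hw : w.length ≤ S.length) (he : e ≤ S.length)
    (hrefs : refs S i e R (insert P N) P = 0) (hcl : ∀ v, NodeIn N v → NodeIn N (slink v))
    (hcp : ∀ p ∈ N, NodeIn N (parN p)) (hnx : a.r .nx = addr (.ord P)) {G : ℕ}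
    (hG : Nat.log 2 (w.toFinset.card + 1) ≤ G) :
    Tr E d removeNode a (720 * G + 410) fun a' =>
      NInv S d E.space i e N R addr (addr (.ord P) :: fl) lb a' ∧
      ∀ y, y ∉ removeRegs → a'.r y = a.r y := by
  have hbig := hE.big
  have hPm : P ∈ insert P N := Or.inl rfl
  have hfin : N.Finite := h.fin.subset (Set.subset_insert _ _)
  have hP0 : P ≠ [] := fun hh => h.ne (hh ▸ hPm)
  obtain ⟨c, hc⟩ := exists_head hP0
  have hv := h.blk (.ord P) hPm
  have hvpos := hv.pos'
  have hparP := h.cpar P hPm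
  obtain ⟨t0, ht0⟩ := h.tree _ hparP
  have hht := h.tree_ht ht0 hN
  have htl := h.tree_length ht0 hN
  have hcard := List.toFinset_card_le w
  have hb := h.tree_blk ht0
  have hsl := h.clink (.ord P) hPm
  have hncard : (insert P N).ncard ≤ S.length := by
    rw [hN]; exact (palSubstrings_finite_ncard w).2.trans hw
  have up : ∀ u, NodeIn N u → NodeIn (insert P N) u := by
    rintro (_ | _ | p) hu
    · trivial
    · trivial
    · exact Or.inr hu
  refine (Tr.seq (K := 7) (K' := 720 * G + 403) (Q := fun a1 => a1.f = a.f ∧ a1.g = a.g ∧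
    a1.c .c = Word.chr c ∧ a1.r .pn = addr (parN P) ∧ ∀ y, y ≠ .pn → a1.r y = a.r y)
    ?_ ?_).mono (by omega) fun _ h => h
  · refine Tr.blk hE.toFits ?_ ⟨rfl, rfl, ?_, ?_, fun y hy => ?_⟩
    · simp [Oks, Instr.Ok, Instr.ev, Fld.isChar, Valid, hnx, hv]
    · simp [evs, Instr.ev, hnx, h.lab P hPm c hc]
    · simp [evs, Instr.ev, hnx, h.par P hPm]
    · simp [evs, Instr.ev, hy]
  rintro a1 ⟨f1, g1, c1, p1, r1⟩
  refine (Tr.seq (K := 720 * G + 370) (K' := 33) ((deleteEdge_spec hE.toFits a1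
    (by rw [f1, h.ht0]) (by rw [r1 _ (by simp), h.rone])
    (by rw [r1 _ (by simp), h.rzr]) (addr (parN P)) (addr (.ord P) + 5) p1 (h.blk _ hparP) t0
    (by rw [f1, ht0.root]) (f1 ▸ ht0.tin) ht0.avl hb ht0.nodup (by omega)
    ((ht0.mem _).2 ⟨P, hPm, rfl, rfl⟩) lb (by rw [g1]; exact h.tree_lab ht0) ht0.sorted c c1
    (h.lbs P hPm c hc)).mono (by omega) fun _ h => h) ?_).mono (by omega) fun _ h => h
  rintro a2 ⟨t', A, B, l1, l2, l3, l4, l5, k2, fr2⟩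
  have nt : ∀ y ∈ [Reg.d, .neg, .zero, .zr, .one, .bump, .free, .nx], y ∉ treeRegs ∧ y ≠ .pn := by
    intro y hy
    simp only [List.mem_cons, List.not_mem_nil, or_false] at hy
    rcases hy with rfl | rfl | rfl | rfl | rfl | rfl | rfl | rfl <;>
      simp [treeRegs, ascRegs, balRegs]
  have r2 : ∀ y ∈ [Reg.d, .neg, .zero, .zr, .one, .bump, .free, .nx], a2.r y = a.r y :=
    fun y hy => by rw [k2.r y (nt y hy).1, r1 y (nt y hy).2]
  have nx2 : a2.r .nx = addr (.ord P) := by rw [r2 _ (by simp), hnx]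
  have ff : ∀ fl ∈ [Fld.link, .cnt], ∀ p, a2.f fl p = a.f fl p := by
    intro fl hfl p
    rw [fr2, f1]
    · intro hh; simp at hfl hh; rcases hfl with rfl | rfl <;> simp at hh
    · rintro rfl; simp at hfl
  have ly : a2.f .link (addr (.ord P)) = addr (slink (.ord P)) := by
    rw [ff _ (by simp), h.link (.ord P) hPm]
  refine Tr.seq (K := 10) (K' := 23) (Q := fun a3 => a3 = evs E a2 [.ld .ny .link .nx,
    .st .link .nx .free, .copy .free .nx]) (Tr.blk hE.toFits ?_ rfl) ?_
  · simp [Oks, Instr.Ok, Instr.ev, Fld.isChar, Valid, nx2, hv]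
  rintro a3 rfl
  have keyfr : ∀ (f' : Fld → ℤ → ℤ), (∀ fl p, fl ≠ .cnt → (fl = .link → p ≠ addr (.ord P)) →
      f' fl p = a2.f fl p) → ∀ fl p, (fl ∈ [Fld.l, .r, .ht, .up, .dir] → p ∉ t0.list) →
      (fl = .root → p ≠ addr (parN P)) → (fl = .link → p ≠ addr (.ord P)) → fl ≠ .cnt →
      f' fl p = a.f fl p := by
    intro f' hf' fl p q1 q2 q3 q4
    rw [hf' fl p q4 q3, fr2 fl p q1 q2, f1]
  have keytree : ∀ (f' : Fld → ℤ → ℤ), (∀ fl p, fl ≠ .cnt → (fl = .link → p ≠ addr (.ord P)) →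
      f' fl p = a2.f fl p) → ∃ (t' : T) (A B : List ℤ), t0.list = A ++ (addr (.ord P) + 5) :: B ∧
      t'.list = A ++ B ∧ t'.In f' ∧ t'.Avl ∧ f' .root (addr (parN P)) = t'.ptr := by
    intro f' hf'
    refine ⟨t', A, B, l1, l2, T.In_congr (fun q _ => ?_) l3, l4, ?_⟩
    · refine ⟨?_, ?_, ?_⟩ <;> exact hf' _ _ (by simp) (by simp)
    · rw [hf' _ _ (by simp) (by simp), l5]
  by_cases hsz : slink (.ord P) = .zero
  · have hnil : plink P = [] := by
      simp only [slink, mkN] at hsz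
      split_ifs at hsz with hh
      exact hh
    refine Tr.ite (K := 22) True (iff_of_true trivial ?_) (fun _ => ?_) fun h => (h trivial).elim
    · simp [evs, Instr.ev, nx2, ly, hsz, r2, h.rzero]
    refine Tr.mono (K := 1) ?_ (by norm_num) fun _ h => h
    have hf' : ∀ fl p, fl ≠ .cnt → (fl = .link → p ≠ addr (.ord P)) → (evs E a2 [.ld .ny .link .nx,
        .st .link .nx .free, .copy .free .nx]).f fl p = a2.f fl p := by
      intro fl p hfl hp
      cases fl <;> simp at hfl hp <;> simp [evs, Instr.ev, nx2, Function.update_of_ne, hp]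
    refine Tr.blk (l := []) hE.toFits trivial
      ⟨h.erase hP hrefs hcl hcp ht0 ⟨?_, ?_, ?_, keytree _ hf', ?_, ?_, ?_, keyfr _ hf'⟩, ?_⟩
    · intro y hy
      have := nt y (by simp at hy ⊢; tauto)
      have e1 : y ≠ .ny := by rintro rfl; simp at hy
      have e2 : y ≠ .free := by rintro rfl; simp at hy
      simp only [evs, Instr.ev, Function.update_of_ne e1, Function.update_of_ne e2]
      exact r2 y (by simp at hy ⊢; tauto)
    · simp [evs, Instr.ev, nx2]
    · simp [evs, Instr.ev, nx2, r2]
    · intro q hq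
      rw [if_neg (by rw [hnil]; rintro rfl; exact h.ne (Or.inr hq))]
      simp [evs, Instr.ev, ff]
    · simp [evs, Instr.ev, ff, h.cnt0]
    · simp [evs, Instr.ev, k2.g, g1]
    · intro y hy
      simp only [removeRegs, List.mem_cons, not_or] at hy
      simp [evs, Instr.ev, hy, k2.r y hy.2.2.2.2, r1]
  · have hzn : addr (slink (.ord P)) ≠ addr .zero := fun hh => hsz (h.inj _ _ hsl trivial hh)
    obtain ⟨y, hy⟩ : ∃ y, slink (.ord P) = .ord y := by
      simp only [slink, mkN] at hsz ⊢
      split_ifs at hsz ⊢ with hh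
      · exact (hsz rfl).elim
      · exact ⟨_, rfl⟩
    have hyN : y ∈ insert P N := by rw [hy] at hsl; exact hsl
    have hy0 : y ≠ [] := by rintro rfl; exact h.ne hyN
    have hpl : plink P = y := (slink_ord_eq hy0).1 hy
    have hcnt := h.cnt y hyN
    have hle := refs_le (S := S) (i := i) (e := e) (R := R) h.fin y
    have hby := h.blk (.ord y) hyN
    have hypos := hby.pos'
    refine Tr.ite (K := 22) False (iff_of_false not_false ?_) (fun h => h.elim) fun _ => ?_
    · simpa [evs, Instr.ev, nx2, ly, r2, h.rzero] using hzn
    refine Tr.mono (K := 10) ?_ (by norm_num) fun _ h => h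
    have hf' : ∀ fl p, fl ≠ .cnt → (fl = .link → p ≠ addr (.ord P)) → (evs E (evs E a2
        [.ld .ny .link .nx, .st .link .nx .free, .copy .free .nx]) [.ld .tmp .cnt .ny,
        .arith .sub .tmp .tmp .one, .st .cnt .ny .tmp]).f fl p = a2.f fl p := by
      intro fl p hfl hp
      cases fl <;> simp at hfl hp <;> simp [evs, Instr.ev, nx2, Function.update_of_ne, hp]
    refine Tr.blk hE.toFits ?_
      ⟨h.erase hP hrefs hcl hcp ht0 ⟨?_, ?_, ?_, keytree _ hf', ?_, ?_, ?_, keyfr _ hf'⟩, ?_⟩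
    · simp [evs, Oks, Instr.Ok, Instr.ev, Fld.isChar, Valid, ArithOp.eval, nx2, ly, hy, hby, ff,
        hcnt, r2, h.rone, abs_le]
      omega
    · intro y hy
      have e1 : y ≠ .ny := by rintro rfl; simp at hy
      have e2 : y ≠ .free := by rintro rfl; simp at hy
      have e3 : y ≠ .tmp := by rintro rfl; simp at hy
      simp only [evs, Instr.ev, Function.update_of_ne e1, Function.update_of_ne e2,
        Function.update_of_ne e3]
      exact r2 y (by simp at hy ⊢; tauto)
    · simp [evs, Instr.ev, nx2]
    · simp [evs, Instr.ev, nx2, r2]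
    · intro q hq
      by_cases hqy : q = y
      · subst hqy
        simp [evs, Instr.ev, nx2, ly, hy, ff, r2, h.rone, ArithOp.eval, hpl]
      · have : addr (.ord q) ≠ addr (.ord y) := fun hh => hqy (by
          have := h.inj (.ord q) (.ord y) (Or.inr hq) hyN hh
          injection this)
        simp [evs, Instr.ev, nx2, ly, hy, ff, this, hpl, Ne.symm hqy]
    · simp [evs, Instr.ev, nx2, ly, hy, ff, Function.update_of_ne (show (0 : ℤ) ≠ addr (.ord y) by omega),
        h.cnt0]
    · simp [evs, Instr.ev, k2.g, g1]
    · intro y hy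
      simp only [removeRegs, List.mem_cons, not_or] at hy
      simp [evs, Instr.ev, hy, k2.r y hy.2.2.2.2, r1]

end

section

variable {α : Type u} [LinearOrder α] {S : List α} {d M i e : ℕ} {N : Set (List α)} {R : ℕ → ℕ}
  {addr : ENode α → ℤ} {fl : List ℤ} {lb : ℤ → α} {a a' : AS α}

/-! ### The sliding-window routines -/

/-- The data structure stores the eertree of the window `[i, e)` of `S`. -/
def Inv (S : List α) (d M i e : ℕ) (a : AS α) : Prop :=
  ∃ (R : ℕ → ℕ) (addr : ENode α → ℤ) (fl : List ℤ) (lb : ℤ → α),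
    NInv S d M i e (palSubstrings (sub S i e)) R addr fl lb a ∧ Registered S i e R ∧
    a.r .cur = addr (mkN (lpsuf (sub S i e))) ∧ a.r .lo = i ∧ a.r .hi = e

/-- The potential of a window. -/
def potAt (S : List α) (i e : ℕ) : ℤ := pot (mkN (lpsuf (sub S i e)))

def append : Prog :=
  .seq (blk [.read .c .hi, .copy .nx .cur]) (.seq locate
    (.seq (blk [.copy .cur .nv, .ld .tmp .len .nv, .arith .add .hi .hi .one,
        .arith .sub .pos .hi .tmp])
      register))

/-- The node is created first, while the positions are still those of `[i, e)`; then the window is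
extended, and the new longest palindromic suffix is registered. The bound is amortized: link steps
are charged to the fall of the potential. -/
theorem append_spec {E : Env α} (hE : Big E S d) (hi : i ≤ e) (he : e < S.length)
    (hlo : E.lo = i) (hhi : E.hi = e) (hd : e + 1 - i ≤ d) (h : Inv S d E.space i e a) {G : ℕ}
    (hG : Nat.log 2 ((sub S i e).toFinset.card + 1) ≤ G)
    (hM : 13 + d + 13 * ((palSubstrings (sub S i (e + 1))).ncard + 2) ≤ E.space) :
    Tr E d append a ((40 * (potAt S i e - potAt S i (e + 1) + 4)).toNat + 480 * G + 460)
      (Inv S d E.space i (e + 1)) := by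
  obtain ⟨R, addr, fl, lb, hinv, hreg, hcur, hrlo, hrhi⟩ := h
  have hbig := hE.big
  have core : ∀ y ∈ coreRegs, y ≠ .nx := by rintro y hy rfl; simp [coreRegs] at hy
  refine (Tr.seq (K := 7) (K' := (40 * (potAt S i e - potAt S i (e + 1) + 4)).toNat + 480 * G + 453)
    (Q := fun a1 => NInv S d E.space i e (palSubstrings (sub S i e)) R addr fl lb a1 ∧
      a1.r .nx = addr (mkN (lpsuf (sub S i e))) ∧ a1.r .lo = i ∧ a1.r .hi = e ∧
      a1.c .c = Word.chr S[e]) ?_ ?_).mono (by omega) fun _ h => h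
  · refine Tr.blk hE.toFits ?_ ⟨hinv.of_eq rfl rfl fun y hy => ?_, ?_, ?_, ?_, ?_⟩
    · simp [Oks, Instr.Ok, hrhi, hlo, hhi, hE.text]
      omega
    · simp [evs, Instr.ev, core y hy]
    · simp [evs, Instr.ev, hcur]
    · simp [evs, Instr.ev, hrlo]
    · simp [evs, Instr.ev, hrhi]
    · simp [evs, Instr.ev, charAt, hrhi, hE.text, List.getElem?_eq_getElem he]
  rintro a1 ⟨h1, n1, lo1, hi1, c1⟩
  refine (Tr.seq (K' := 53) (locate_spec hE hi he hlo hhi h1 rfl n1 lo1 hi1 c1 hG hM) ?_).mono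
    (by unfold potAt; omega) fun _ h => h
  rintro a2 ⟨addr', fl', lb', h2, v2, r2, -⟩
  have nl : ∀ y ∈ [Reg.lo, .hi], y ∉ locateRegs := by
    simp [locateRegs, linkRegs, matchRegs, lookupRegs, descRegs, createRegs, allocRegs, treeRegs,
      ascRegs, balRegs]
  have lo2 : a2.r .lo = i := by rw [r2 _ (nl _ (by simp)), lo1]
  have hi2 : a2.r .hi = e := by rw [r2 _ (nl _ (by simp)), hi1]
  have hne : lpsuf (sub S i (e + 1)) ≠ [] := lpsuf_ne_nil (sub_ne_nil (by omega) (by omega))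
  obtain ⟨l1, l2⟩ := eq_sub_of_suffix (by omega) hne (lpsuf_suffix (sub S i (e + 1)))
  have hmem : lpsuf (sub S i (e + 1)) ∈ palSubstrings (sub S i (e + 1)) :=
    ⟨hne, (lpsuf_suffix _).isInfix, lpsuf_pal _⟩
  have hreg' := hreg.append hi he
  have hlen2 : a2.f .len (addr' (.ord (lpsuf (sub S i (e + 1))))) =
      (lpsuf (sub S i (e + 1))).length := h2.len (.ord _) hmem
  have hpos := List.length_pos_of_ne_nil hne
  have bv := h2.blk (.ord _) hmem
  have h2' := h2.extend hi (hreg.zero e (Or.inr le_rfl)) hd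
  have hmk : mkN (lpsuf (sub S i (e + 1))) = .ord (lpsuf (sub S i (e + 1))) := if_neg hne
  have hnc : (palSubstrings (sub S i (e + 1))).ncard ≤ S.length :=
    (palSubstrings_finite_ncard _).2.trans (by rw [sub_length (by omega)]; omega)
  have hRk : ∀ k, i ≤ k → k < e + 1 → k + R k ≤ S.length := by
    intro k hk hk'
    rcases Nat.lt_succ_iff_lt_or_eq.1 hk' with hk' | rfl
    · exact (hreg.le k hk hk').trans he.le
    · rw [hreg.zero k (Or.inr le_rfl)]; omega
  generalize hq : lpsuf (sub S i (e + 1)) = q at *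
  refine Tr.seq (K := 13) (K' := 40) (Q := fun a3 =>
    NInv S d E.space i (e + 1) (palSubstrings (sub S i (e + 1))) R addr' fl' lb' a3 ∧
    a3.r .nv = addr' (.ord q) ∧ a3.r .cur = addr' (.ord q) ∧ a3.r .lo = i ∧
    a3.r .hi = (e + 1 : ℕ) ∧ a3.r .pos = (e + 1 - q.length : ℕ)) ?_ ?_
  · refine Tr.blk hE.toFits ?_ ⟨h2'.of_eq rfl rfl fun y hy => ?_, ?_, ?_, ?_, ?_, ?_⟩
    · simp [Oks, Instr.Ok, Instr.ev, Fld.isChar, Valid, ArithOp.eval, v2, bv, hi2, h2.rone, hlen2,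
        abs_le]
      omega
    · simp only [coreRegs, List.mem_cons, List.not_mem_nil, or_false] at hy
      rcases hy with rfl | rfl | rfl | rfl | rfl | rfl | rfl <;> simp [evs, Instr.ev]
    · simp [evs, Instr.ev, v2]
    · simp [evs, Instr.ev, v2]
    · simp [evs, Instr.ev, lo2]
    · simp [evs, Instr.ev, ArithOp.eval, hi2, h2.rone]
    · simp [evs, Instr.ev, ArithOp.eval, hi2, h2.rone, v2, hlen2]
      omega
  rintro a3 ⟨h3, v3, c3, lo3, hi3, p3⟩
  have hsub : sub S (e + 1 - q.length) (e + 1 - q.length + q.length) = q := by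
    rw [Nat.sub_add_cancel (by omega)]; exact l2.symm
  refine (register_spec hE (by omega) h3 hd (k := e + 1 - q.length) (m := q.length) (by omega)
    (by omega) hnc hpos (by omega) (hRk _ (by omega) (by omega)) (by rw [hsub]; exact hmem)
    (by rw [hsub]; exact v3) p3).mono le_rfl ?_
  rintro a4 ⟨h4, k4⟩
  refine ⟨_, addr', fl', lb', h4, hreg', ?_, ?_, ?_⟩
  · rw [k4.r _ (by simp [registerRegs]), c3, hq, hmk]
  · rw [k4.r _ (by simp [registerRegs]), lo3]
  · rw [k4.r _ (by simp [registerRegs]), hi3]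

/-- Registers the suffix link of the node `nx` at the end of its prefix occurrence. -/
def passOn : Prog :=
  .seq (blk [.ld .nv .link .nx])
    (.ite (BT.eq .nv .zero).compile (blk [])
      (.seq (blk [.ld .tmp .len .nx, .arith .add .pos .lo .tmp, .ld .tmp .len .nv,
        .arith .sub .pos .pos .tmp]) register))

def delete : Prog :=
  .seq (blk [.arith .mod .ix .lo .d, .ld .nx .arr .ix, .st .arr .ix .zr, .ld .tmp .cnt .nx,
      .arith .sub .tmp .tmp .one, .st .cnt .nx .tmp, .ld .tmp .len .nx, .arith .sub .pos .hi .lo])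
    (.seq (.ite (BT.eq .tmp .pos).compile (blk [.ld .cur .link .nx]) (blk []))
      (.seq passOn
        (.seq (blk [.ld .tmp .cnt .nx])
          (.seq (.ite (BT.eq .tmp .zr).compile removeNode (blk []))
            (blk [.arith .add .lo .lo .one])))))

/-- The longest palindromic suffix is affected only if it starts at `i`, that is, if the whole
window is a palindrome; its suffix link then takes over. -/
theorem lpsuf_delete (hi : i < e) (he : e ≤ S.length) :
    mkN (lpsuf (sub S (i + 1) e)) = if (lppre (sub S i e)).length = e - i then
      slink (.ord (lppre (sub S i e))) else mkN (lpsuf (sub S i e)) := by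
  have hlen := sub_length he (a := i)
  have hpal : (lppre (sub S i e)).Palindrome := by
    have := (lpsuf_pal (sub S i e).reverse)
    exact this
  split_ifs with h
  · have hP : lppre (sub S i e) = sub S i e := (lppre_prefix _).eq_of_length (by rw [h, hlen])
    rw [hP]
    change _ = mkN (lpsuf (sub S i e).tail)
    rw [sub_tail]
  · have hn : ¬ (sub S i e).Palindrome := fun hp => h (by
      have h1 := (prefix_lppre List.prefix_rfl hp).length_le
      have h2 := (lppre_prefix (sub S i e)).length_le
      omega)
    rw [sub_cons hi he] at hn ⊢
    rw [lpsuf, if_neg hn]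

/-- Either the current node is unchanged, or it is replaced by its suffix link, which increases
neither its length nor that of its link. -/
theorem potAt_delete (hi : i < e) (he : e ≤ S.length) : potAt S (i + 1) e ≤ potAt S i e := by
  have hlen := sub_length he (a := i)
  unfold potAt
  rw [lpsuf_delete hi he]
  split_ifs with h
  · have hP : lppre (sub S i e) = sub S i e := (lppre_prefix _).eq_of_length (by rw [h, hlen])
    have hpal : (sub S i e).Palindrome := by
      have := (lpsuf_pal (sub S i e).reverse)
      rw [← hP]; exact this
    have hl : lpsuf (sub S i e) = sub S i e := by
      have h1 := suffix_lpsuf List.suffix_rfl hpal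
      exact (lpsuf_suffix _).eq_of_length (le_antisymm (lpsuf_suffix _).length_le h1.length_le)
    have hne := sub_ne_nil hi he
    have hv : SufN (sub S i e) (.ord (sub S i e)) := ⟨hne, List.suffix_rfl, hpal⟩
    rw [hP, hl, show mkN (sub S i e) = .ord (sub S i e) from if_neg hne]
    have h1 := slink_len_lt hv (by simp)
    have h2 : (slink (slink (.ord (sub S i e)))).len ≤ (slink (.ord (sub S i e))).len := by
      by_cases hn : slink (.ord (sub S i e)) = .negOne
      · rw [hn]; rfl
      · exact (slink_len_lt (sufN_slink hv) hn).le
    unfold pot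
    omega
  · exact le_rfl

theorem NInv.len_eq (h : NInv S d M i e N R addr fl lb a) {p : List α} (hp : p ∈ N) :
    a.f .len (addr (.ord p)) = p.length := h.len (.ord p) hp

/-- This realizes the registration in `delAt`. The suffix is proper, so its position lies in the
shortened window; an empty suffix is skipped, in agreement with `regAt` for the length 0. -/
theorem passOn_spec {E : Env α} (hE : Big E S d) (hi : i < e) (he : e ≤ S.length)
    (h : NInv S d E.space (i + 1) e N R addr fl lb a) (hd : e - (i + 1) ≤ d)
    (hN : N.ncard ≤ S.length) {P : List α} (hP : P ∈ N)
    (hPl : i + P.length ≤ e) (hPs : P = sub S i (i + P.length))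
    (hR : ∀ k, i < k → k < e → k + R k ≤ S.length)
    (hnx : a.r .nx = addr (.ord P)) (hlo : a.r .lo = i) :
    Tr E d passOn a 58 fun a' => NInv S d E.space (i + 1) e N
      (regAt R (i + P.length - (plink P).length) (plink P).length) addr fl lb a' ∧
      Keeps (.nv :: .pos :: registerRegs) a a' := by
  have hbig := hE.big
  have hP0 : P ≠ [] := fun hh => h.ne (hh ▸ hP)
  have bP := h.blk (.ord P) hP
  have hlt := plink_length_lt hP0
  have core : ∀ y ∈ coreRegs, y ∉ Reg.nv :: .pos :: registerRegs := by
    intro y hy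
    simp only [coreRegs, List.mem_cons, List.not_mem_nil, or_false] at hy
    rcases hy with rfl | rfl | rfl | rfl | rfl | rfl | rfl <;> simp [registerRegs]
  have hsl := h.clink (.ord P) hP
  refine Tr.seq (K := 4) (K' := 54) (Q := fun a1 => a1.f = a.f ∧
    Keeps (.nv :: .pos :: registerRegs) a a1 ∧ a1.r .nv = addr (slink (.ord P))) ?_ ?_
  · refine Tr.blk hE.toFits ?_ ⟨rfl, ⟨rfl, rfl, fun y hy => ?_⟩, ?_⟩
    · simp [Oks, Instr.Ok, Fld.isChar, Valid, hnx, bP]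
    · simp only [List.mem_cons, not_or] at hy
      simp [evs, Instr.ev, hy]
    · simp [evs, Instr.ev, hnx, h.link (.ord P) hP]
  rintro a1 ⟨f1, k1, v1⟩
  have h1 : NInv S d E.space (i + 1) e N R addr fl lb a1 :=
    h.of_eq f1 k1.g fun y hy => k1.r y (core y hy)
  by_cases hQ : plink P = []
  · have hz : slink (.ord P) = .zero := by
      change mkN (plink P) = _
      rw [hQ]; rfl
    refine Tr.ite (K := 53) True (iff_of_true trivial (by rw [v1, hz, h1.rzero])) (fun _ => ?_)
      fun h => (h trivial).elim
    refine Tr.mono (K := 1) (Tr.blk (l := []) hE.toFits trivial ⟨?_, k1⟩) (by omega) fun _ h => h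
    rw [hQ, List.length_nil, show ∀ k, regAt R k 0 = R from fun k => if_neg (Nat.not_lt_zero _)]
    exact h1
  have hs : slink (.ord P) = .ord (plink P) := if_neg hQ
  rw [hs] at hsl v1
  have hQm : plink P ∈ N := hsl
  have hQl := h.len_eq hQm
  have hPlen := h.len_eq hP
  have hne : addr (.ord (plink P)) ≠ addr .zero := fun hh => by
    have := h.inj (.ord _) .zero hsl trivial hh
    cases this
  have bQ := h.blk (.ord _) hsl
  have hpos := List.length_pos_of_ne_nil hQ
  have hQs := plink_suffix P
  rw [hPs] at hQs
  obtain ⟨-, hQe⟩ := eq_sub_of_suffix (by omega) (by rwa [← hPs]) hQs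
  rw [← hPs] at hQe
  generalize hq : plink P = q at *
  have lo1 : a1.r .lo = i := by rw [k1.r _ (by simp [registerRegs]), hlo]
  have nx1 : a1.r .nx = addr (.ord P) := by rw [k1.r _ (by simp [registerRegs]), hnx]
  refine Tr.ite (K := 53) False (iff_of_false not_false (by rw [v1, h1.rzero]; exact hne))
    (fun h => h.elim) fun _ => ?_
  refine Tr.seq (K := 13) (K' := 40) (Q := fun a2 => NInv S d E.space (i + 1) e N R addr fl lb a2 ∧
    Keeps (.nv :: .pos :: registerRegs) a a2 ∧ a2.r .nv = addr (.ord q) ∧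
    a2.r .pos = (i + P.length - q.length : ℕ)) ?_ ?_
  · refine Tr.blk hE.toFits ?_ ⟨h1.of_eq rfl rfl fun y hy => ?_, k1.trans ⟨rfl, rfl, fun y hy => ?_⟩,
      ?_, ?_⟩
    · simp [Oks, Instr.Ok, Instr.ev, Fld.isChar, Valid, ArithOp.eval, v1, bP, bQ, lo1, nx1, f1, hQl,
        hPlen, abs_le]
      omega
    · have := core y hy
      simp only [registerRegs, List.mem_cons, List.not_mem_nil, or_false, not_or] at this
      simp [evs, Instr.ev, this]
    · simp only [registerRegs, List.mem_cons, List.not_mem_nil, or_false, not_or] at hy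
      simp [evs, Instr.ev, hy]
    · simp [evs, Instr.ev, v1]
    · simp [evs, Instr.ev, ArithOp.eval, v1, lo1, nx1, f1, hQl, hPlen]
      omega
  rintro a2 ⟨h2, k2, v2, p2⟩
  have hsub : sub S (i + P.length - q.length) (i + P.length - q.length + q.length) = q := by
    rw [Nat.sub_add_cancel (by omega)]; exact hQe.symm
  refine (register_spec hE he h2 hd (k := i + P.length - q.length) (m := q.length) (by omega)
    (by omega) hN hpos (by omega) (hR _ (by omega) (by omega)) (by rw [hsub]; exact hQm)
    (by rw [hsub]; exact v2) p2).mono le_rfl ?_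
  rintro a3 ⟨h3, k3⟩
  exact ⟨h3, k2.trans (k3.mono (by simp))⟩

end

/-! ### Deleting the first character -/

section

variable {α : Type u} [LinearOrder α] {S : List α} {d M i e : ℕ} {N : Set (List α)} {R : ℕ → ℕ}
  {addr : ENode α → ℤ} {fl : List ℤ} {lb : ℤ → α} {a a' : AS α}

theorem lppre_mem (hi : i < e) (he : e ≤ S.length) :
    lppre (sub S i e) ∈ palSubstrings (sub S i e) := by
  refine ⟨?_, (lppre_prefix _).isInfix, lpsuf_pal (sub S i e).reverse⟩
  exact List.ne_nil_of_length_pos (lppre_sub hi he).1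

/-- By `Registered.first`, the array cell of `i` gives the longest palindromic prefix without any
search. The set of nodes stays that of the old window for the moment. -/
theorem unregister_spec {E : Env α} (hE : Big E S d) (hi : i < e) (he : e ≤ S.length)
    (hd : e - i ≤ d) (h : NInv S d E.space i e (palSubstrings (sub S i e)) R addr fl lb a)
    (hreg : Registered S i e R) (hlo : a.r .lo = i) (hhi : a.r .hi = e) :
    Tr E d (blk [.arith .mod .ix .lo .d, .ld .nx .arr .ix, .st .arr .ix .zr, .ld .tmp .cnt .nx,
      .arith .sub .tmp .tmp .one, .st .cnt .nx .tmp, .ld .tmp .len .nx, .arith .sub .pos .hi .lo])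
      a 25 fun a' => NInv S d E.space (i + 1) e (palSubstrings (sub S i e)) (Function.update R i 0)
        addr fl lb a' ∧ Keeps [.ix, .nx, .tmp, .pos] a a' ∧
        a'.r .nx = addr (.ord (lppre (sub S i e))) ∧
        a'.r .tmp = (lppre (sub S i e)).length ∧ a'.r .pos = (e - i : ℕ) := by
  have hbig := hE.big
  obtain ⟨p1, p2, p3⟩ := lppre_sub hi he
  have hRi := hreg.first hi he
  have hP := lppre_mem hi he
  have hPlen := h.len_eq hP
  have harr := h.arr i le_rfl hi
  rw [if_neg (by omega), hRi, ← p3] at harr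
  have bP := h.blk (.ord _) hP
  have hPpos := bP.pos'
  have hcnt := h.cnt _ hP
  have hle := refs_le (S := S) (i := i) (e := e) (R := R) h.fin (lppre (sub S i e))
  have hnc : (palSubstrings (sub S i e)).ncard ≤ S.length :=
    (palSubstrings_finite_ncard _).2.trans (by rw [sub_length he]; omega)
  have hmod : ((i : ℤ) % (d : ℤ)) = ((i % d : ℕ) : ℤ) := by push_cast; rfl
  have hml : i % d < d := Nat.mod_lt _ (by omega)
  generalize hPP : lppre (sub S i e) = P at *
  have nxv : ∀ b : ℤ, Function.update (Function.update a.r .ix b) .nx (addr (.ord P)) .nx =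
      addr (.ord P) := fun b => Function.update_self ..
  refine Tr.blk hE.toFits ?_ ⟨NInv.shrink (h.reassign hd le_rfl hi (m := 0) (Or.inl rfl) rfl
    (fun x hx => ?_) (fun fl q h1 h2 => ?_) (fun q => ?_) ?_ (fun q hq => ?_)) hi
      (Function.update_self ..), ⟨rfl, rfl, fun y hy => ?_⟩, ?_, ?_, ?_⟩
  · simp only [Oks, Instr.Ok, Instr.ev, Fld.isChar, Valid, ArithOp.eval, hlo, h.rd, hmod,
      Function.update_self, ne_eq, reduceCtorEq, not_false_eq_true, Function.update_of_ne, harr,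
      hcnt, h.rone, hhi, abs_le]
    refine ⟨⟨by omega, by omega⟩, ⟨trivial, by omega, by omega⟩, ⟨trivial, by omega, by omega⟩,
      ⟨trivial, Or.inr bP⟩, ⟨by omega, by omega⟩, ⟨trivial, Or.inr bP⟩, ⟨trivial, Or.inr bP⟩,
      ⟨by omega, by omega⟩, trivial⟩
  · simp only [coreRegs, List.mem_cons, List.not_mem_nil, or_false] at hx
    rcases hx with rfl | rfl | rfl | rfl | rfl | rfl | rfl <;> simp [evs, Instr.ev]
  · cases fl <;> simp at h1 h2 <;> simp [evs, Instr.ev]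
  · simp only [evs, Instr.ev, ArithOp.eval, hlo, h.rd, hmod, Function.update_self, ne_eq,
      reduceCtorEq, not_false_eq_true, Function.update_of_ne, h.rzr, Function.update_apply, if_true]
  · simp only [evs, Instr.ev, ArithOp.eval, hlo, h.rd, hmod, Function.update_self, ne_eq,
      reduceCtorEq, not_false_eq_true, Function.update_of_ne, harr]
    rw [Function.update_of_ne (by omega), h.cnt0]
  · rw [hRi, ← p3, sub_zero_right, if_neg (show ¬ ([] : List α) = q from fun hh => h.ne (hh ▸ hq))]
    simp only [evs, Instr.ev, ArithOp.eval, hlo, h.rd, hmod, Function.update_self, ne_eq,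
      reduceCtorEq, not_false_eq_true, Function.update_of_ne, harr, h.rone]
    by_cases hqP : P = q
    · subst hqP
      rw [Function.update_self, if_pos rfl]; ring
    · rw [if_neg hqP, Function.update_of_ne]
      intro hh
      have := h.inj (.ord q) (.ord P) hq hP hh
      injection this with this
      exact hqP this.symm
  · simp only [List.mem_cons, List.not_mem_nil, or_false, not_or] at hy
    simp [evs, Instr.ev, hy]
  · simp only [evs, Instr.ev, ArithOp.eval, hlo, h.rd, hmod, Function.update_self, ne_eq,
      reduceCtorEq, not_false_eq_true, Function.update_of_ne, harr]
  · simp only [evs, Instr.ev, ArithOp.eval, hlo, h.rd, hmod, Function.update_self, ne_eq,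
      reduceCtorEq, not_false_eq_true, Function.update_of_ne, harr, hPlen]
  · simp only [evs, Instr.ev, ArithOp.eval, hlo, hhi, Function.update_self, ne_eq,
      reduceCtorEq, not_false_eq_true, Function.update_of_ne]
    omega

theorem nodeIn_slink {w : List α} {v : ENode α} (h : NodeIn (palSubstrings w) v) :
    NodeIn (palSubstrings w) (slink v) :=
  isNode_iff.1 (isNode_slink (isNode_iff.2 h))

/-- The counter of `P` is tested only after its suffix has been registered, since `lppre_mem_iff`
needs the invariant of the shortened window. Until then the nodes are those of the old window, so
the counter includes the links of all of them, as the criterion requires. -/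
theorem delete_spec {E : Env α} (hE : Big E S d) (hi : i < e) (he : e ≤ S.length)
    (hd : e - i ≤ d) (h : Inv S d E.space i e a) {G : ℕ}
    (hG : Nat.log 2 ((sub S i e).toFinset.card + 1) ≤ G) :
    Tr E d delete a (720 * G + 520) (Inv S d E.space (i + 1) e) := by
  obtain ⟨R, addr, fl, lb, hinv, hreg, hcur, hrlo, hrhi⟩ := h
  have hbig := hE.big
  have hP := lppre_mem hi he
  obtain ⟨p1, p2, p3⟩ := lppre_sub hi he
  have hreg' := hreg.delete hi he
  have hmem := lppre_mem_iff hi he hreg'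
  have hpc : palSubstrings (sub S i e) =
      insert (lppre (sub S i e)) (palSubstrings (sub S (i + 1) e)) := by
    rw [sub_cons hi he]; exact palSubstrings_cons _ _
  have hdl := lpsuf_delete hi he
  have hwl : (sub S i e).length ≤ S.length := by rw [sub_length he]; omega
  have hnc : (palSubstrings (sub S i e)).ncard ≤ S.length :=
    (palSubstrings_finite_ncard _).2.trans (by rw [sub_length he]; omega)
  refine (Tr.seq (K := 25) (K' := 720 * G + 495) (unregister_spec hE hi he hd hinv hreg hrlo hrhi)
    ?_).mono (by omega) fun _ h => h
  rintro a1 ⟨h1, k1, nx1, t1, ps1⟩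
  have hR : ∀ k, i < k → k < e → k + Function.update R i 0 k ≤ S.length := by
    intro k hk hk'
    rw [Function.update_of_ne (by omega)]
    exact (hreg.le k hk.le hk').trans he
  unfold delAt at hreg' hmem
  generalize hPP : lppre (sub S i e) = P at *
  have cur1 : a1.r .cur = addr (mkN (lpsuf (sub S i e))) := by rw [k1.r _ (by simp), hcur]
  refine (Tr.seq (K := 5) (K' := 720 * G + 490) (Q := fun a2 =>
    NInv S d E.space (i + 1) e (palSubstrings (sub S i e)) (Function.update R i 0) addr fl lb a2 ∧
    Keeps [.cur] a1 a2 ∧ a2.r .cur = addr (mkN (lpsuf (sub S (i + 1) e)))) ?_ ?_).mono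
    (by omega) fun _ h => h
  · refine Tr.ite (K := 4) (P.length = e - i) (by simp only [BT.Is]; rw [t1, ps1]; omega)
      (fun hh => ?_) fun hh => ?_
    · rw [hdl, if_pos hh]
      refine Tr.blk hE.toFits ?_ ⟨h1.of_eq rfl rfl fun x hx => ?_, ⟨rfl, rfl, fun y hy => ?_⟩, ?_⟩
      · simp [Oks, Instr.Ok, Fld.isChar, Valid, nx1, h1.blk (.ord P) hP]
      · simp only [coreRegs, List.mem_cons, List.not_mem_nil, or_false] at hx
        rcases hx with rfl | rfl | rfl | rfl | rfl | rfl | rfl <;> simp [evs, Instr.ev]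
      · simp only [List.mem_cons, List.not_mem_nil, or_false] at hy
        simp [evs, Instr.ev, hy]
      · simp [evs, Instr.ev, nx1, h1.link (.ord P) hP]
    · rw [hdl, if_neg hh]
      exact Tr.mono (K := 1) (Tr.blk (l := []) hE.toFits trivial
        ⟨h1, ⟨rfl, rfl, fun _ _ => rfl⟩, cur1⟩) (by omega) fun _ h => h
  rintro a2 ⟨h2, k2, cur2⟩
  refine (Tr.seq (K := 58) (K' := 720 * G + 432) (passOn_spec hE hi he h2 (by omega) hnc hP p2 p3
    hR (by rw [k2.r _ (by simp), nx1])
    (by rw [k2.r _ (by simp), k1.r _ (by simp), hrlo])) ?_).mono (by omega) fun _ h => h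
  rintro a3 ⟨h3, k3⟩
  have lo3 : a3.r .lo = i := by
    rw [k3.r _ (by simp [registerRegs]), k2.r _ (by simp), k1.r _ (by simp), hrlo]
  have hi3 : a3.r .hi = e := by
    rw [k3.r _ (by simp [registerRegs]), k2.r _ (by simp), k1.r _ (by simp), hrhi]
  have nx3 : a3.r .nx = addr (.ord P) := by
    rw [k3.r _ (by simp [registerRegs]), k2.r _ (by simp), nx1]
  have cur3 : a3.r .cur = addr (mkN (lpsuf (sub S (i + 1) e))) := by
    rw [k3.r _ (by simp [registerRegs]), cur2]
  set R' := regAt (Function.update R i 0) (i + P.length - (plink P).length) (plink P).length with hR'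
  have core : ∀ y ∈ coreRegs, y ≠ .tmp := by rintro y hy rfl; simp [coreRegs] at hy
  have hcnt := h3.cnt P hP
  refine (Tr.seq (K := 4) (K' := 720 * G + 420) (Q := fun a4 =>
    NInv S d E.space (i + 1) e (palSubstrings (sub S i e)) R' addr fl lb a4 ∧
    Keeps [.tmp] a3 a4 ∧ a4.r .tmp = refs S (i + 1) e R' (palSubstrings (sub S i e)) P) ?_ ?_).mono
    (by omega) fun _ h => h
  · refine Tr.blk hE.toFits ?_ ⟨h3.of_eq rfl rfl fun y hy => ?_, ⟨rfl, rfl, fun y hy => ?_⟩, ?_⟩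
    · simp [Oks, Instr.Ok, Fld.isChar, Valid, nx3, h3.blk (.ord P) hP]
    · simp [evs, Instr.ev, core y hy]
    · simp only [List.mem_cons, List.not_mem_nil, or_false] at hy
      simp [evs, Instr.ev, hy]
    · simp [evs, Instr.ev, nx3, hcnt]
  rintro a4 ⟨h4, k4, t4⟩
  have hiff := refs_eq_zero_iff (S := S) (i := i + 1) (e := e) (R := R') h4.fin (p := P)
  refine (Tr.seq (K := 720 * G + 411) (K' := 4) (Q := fun a5 => (∃ fl',
    NInv S d E.space (i + 1) e (palSubstrings (sub S (i + 1) e)) R' addr fl' lb a5) ∧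
    a5.r .cur = addr (mkN (lpsuf (sub S (i + 1) e))) ∧ a5.r .lo = i ∧ a5.r .hi = e) ?_ ?_).mono
    (by omega) fun _ h => h
  · refine Tr.ite (K := 720 * G + 410) (refs S (i + 1) e R' (palSubstrings (sub S i e)) P = 0)
      (by simp only [BT.Is]; rw [t4, h4.rzr]; omega) (fun hz => ?_) fun hz => ?_
    · have hPn : P ∉ palSubstrings (sub S (i + 1) e) := by
        rw [hmem]
        rintro (⟨k, hk, hk', hh⟩ | ⟨q, hq, hh⟩)
        · exact (hiff.1 hz).1 k hk hk' hh
        · exact (hiff.1 hz).2 q hq hh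
      rw [hpc] at h4 hz
      refine (removeNode_spec hE h4 hPn hpc.symm hwl he hz
        (fun v hv => nodeIn_slink hv) (fun p hp => isNode_iff.1 (isNode_parN hp))
        (by rw [k4.r _ (by simp), nx3]) hG).mono le_rfl ?_
      rintro a5 ⟨h5, r5⟩
      have nr : ∀ y ∈ [Reg.cur, .lo, .hi], y ∉ removeRegs := by
        simp [removeRegs, treeRegs, ascRegs, balRegs]
      refine ⟨⟨_, h5⟩, ?_, ?_, ?_⟩
      · rw [r5 _ (nr _ (by simp)), k4.r _ (by simp), cur3]
      · rw [r5 _ (nr _ (by simp)), k4.r _ (by simp), lo3]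
      · rw [r5 _ (nr _ (by simp)), k4.r _ (by simp), hi3]
    · have hPm : P ∈ palSubstrings (sub S (i + 1) e) := by
        by_contra hn
        rw [hmem] at hn
        push Not at hn
        exact hz (hiff.2 ⟨fun k hk hk' => hn.1 k hk hk', fun q hq => hn.2 q hq⟩)
      rw [Set.insert_eq_of_mem hPm] at hpc
      rw [hpc] at h4
      refine Tr.mono (K := 1) (Tr.blk (l := []) hE.toFits trivial ⟨⟨fl, h4⟩, ?_, ?_, ?_⟩) (by omega)
        fun _ h => h
      · exact (k4.r _ (by simp)).trans cur3
      · exact (k4.r _ (by simp)).trans lo3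
      · exact (k4.r _ (by simp)).trans hi3
  rintro a5 ⟨⟨fl', h5⟩, cur5, lo5, hi5⟩
  refine Tr.blk hE.toFits ?_ ⟨R', addr, fl', lb, h5.of_eq rfl rfl fun y hy => ?_, hreg', ?_, ?_, ?_⟩
  · simp [Oks, Instr.Ok, ArithOp.eval, lo5, h5.rone, abs_le]
    omega
  · simp only [coreRegs, List.mem_cons, List.not_mem_nil, or_false] at hy
    rcases hy with rfl | rfl | rfl | rfl | rfl | rfl | rfl <;> simp [evs, Instr.ev]
  · simp [evs, Instr.ev, cur5]
  · simp [evs, Instr.ev, ArithOp.eval, lo5, h5.rone]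
  · simp [evs, Instr.ev, hi5]

/-! ### Initialization -/

/-- The two auxiliary nodes occupy the first two blocks after the array. The register `nx` only
supplies the length -1; all cells not written keep their initial value 0, which is correct. -/
def setup : List Instr :=
  [.const .one 1, .const .tmp 13, .arith .add .neg .tmp .d, .arith .add .zero .neg .tmp,
    .arith .add .bump .zero .tmp, .arith .sub .nx .zr .one, .st .len .neg .nx, .st .link .neg .neg,
    .st .link .zero .neg, .copy .cur .zero]

def init : Prog := .seq (blk setup) append

/-- The structured start state. -/
def AS.start (d : ℕ) : AS α where
  r x := if x = .d then d else 0
  c _ := Word.int 0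
  f _ _ := 0
  g _ _ := Word.int 0

omit [LinearOrder α] in
theorem rep_start (d M : ℕ) : Rep d M (MState.start d : MState α) (AS.start d) where
  reg x := by cases x <;> simp [MState.start, AS.start, Reg.ctorIdx]
  creg x := by cases x <;> simp [MState.start, AS.start, CReg.num]
  fld fl p _ := by simp [MState.start, AS.start]

/-- The invariant makes sense for the empty window, so the first window is produced by an ordinary
append. -/
theorem setup_spec {E : Env α} (hE : Big E S d) (c : α) (hM : 13 + d + 13 * 2 ≤ E.space) :
    Tr E d (blk setup) (AS.start d) 31 (Inv S d E.space 0 0) := by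
  have hbig := hE.big
  have b0 : Blk d E.space (13 + d) := ⟨0, by simp, by omega⟩
  have b1 : Blk d E.space (13 + d + 13) := ⟨1, by simp, by omega⟩
  have hpal : palSubstrings (sub S 0 0) = ∅ := by
    ext p
    simp only [palSubstrings, sub, Set.mem_ofPred_eq, Set.mem_empty_iff_false, iff_false]
    rintro ⟨h1, h2, -⟩
    simp at h2
    exact h1 h2
  set addr : ENode α → ℤ := fun v => match v with
    | .negOne => 13 + d
    | .zero => 13 + d + 13
    | .ord _ => 0 with haddr
  have nd : ∀ v : ENode α, NodeIn ∅ v → v = .negOne ∨ v = .zero := by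
    rintro (_ | _ | p) hv
    · exact Or.inl rfl
    · exact Or.inr rfl
    · exact hv.elim
  have key : ∀ a : AS α, a = evs E (AS.start d) setup → a.r .d = d ∧ a.r .neg = 13 + d ∧
      a.r .zero = 13 + d + 13 ∧ a.r .zr = 0 ∧ a.r .one = 1 ∧ a.r .lo = 0 ∧ a.r .hi = 0 ∧
      a.r .cur = 13 + d + 13 ∧ a.r .free = 0 ∧ a.r .bump = 13 + d + 13 + 13 ∧
      (∀ fl p, fl ∉ [Fld.len, .link] → a.f fl p = 0) ∧ (∀ p : ℤ, p ≠ 13 + d → a.f .len p = 0) ∧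
      a.f .len (13 + d) = -1 ∧ a.f .link (13 + d) = 13 + d ∧ a.f .link (13 + d + 13) = 13 + d := by
    rintro a rfl
    refine ⟨?_, ?_, ?_, ?_, ?_, ?_, ?_, ?_, ?_, ?_, ?_, ?_, ?_, ?_, ?_⟩
    any_goals simp [setup, evs, Instr.ev, AS.start, ArithOp.eval]
    · intro fl p h1 h2; simp [Function.update_of_ne, h1, h2]
    · intro p hp; simp [hp]
  obtain ⟨e1, e2, e3, e4, e5, e6, e7, e8, e9, e10, e11, e12, e13, e14, e15⟩ := key _ rfl
  -- There are no tree nodes yet; the labelling by `c` is a dummy value, as is the address 0 of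
  -- ordinary nodes.
  refine Tr.blk hE.toFits ?_ ⟨fun _ => 0, addr, [], fun _ => c, ?_, ?_, ?_, by rw [e6]; rfl,
    by rw [e7]; rfl⟩
  · simp [setup, Oks, Instr.Ok, Instr.ev, Fld.isChar, Valid, AS.start, ArithOp.eval, abs_le, b0, b1]
    omega
  · rw [hpal]
    generalize evs E (AS.start d) setup = a at *
    constructor
    case rd => exact e1
    case rneg => exact e2
    case rzero => exact e3
    case rzr => exact e4
    case rone => exact e5
    case ht0 => exact e11 _ _ (by simp)
    case len0 => exact e12 _ (by omega)
    case cnt0 => exact e11 _ _ (by simp)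
    case fin => exact Set.finite_empty
    case ne => exact fun h => h
    case blk => intro v hv; rcases nd v hv with rfl | rfl; exacts [b0, b1]
    case inj =>
      intro v v' hv hv' hh
      rcases nd v hv with rfl | rfl <;> rcases nd v' hv' with rfl | rfl <;>
        simp [haddr] at hh ⊢
    case clink => intro v hv; rcases nd v hv with rfl | rfl <;> trivial
    case len => intro v hv; rcases nd v hv with rfl | rfl; exacts [e13, e12 _ (show (13 + d + 13 : ℤ) ≠ 13 + d by omega)]
    case link => intro v hv; rcases nd v hv with rfl | rfl; exacts [e14, e15]
    case tree =>
      intro v hv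
      exact ⟨.nil, e11 _ _ (by simp), trivial, trivial, by simp [T.list], by simp [T.list]⟩
    case arr0 => exact fun m _ _ => e11 _ _ (by simp)
    case free => exact e9
    case fnodup => simp
    case bump => rw [e10]; simp; ring
    case old => intro v hv; rw [e10]; rcases nd v hv with rfl | rfl <;> simp [haddr] <;> omega
    all_goals first
      | (intro p hp; exact hp.elim)
      | (intro k h1 h2; omega)
      | simp
  · constructor <;> intros <;> first | rfl | omega
  · rw [e8]; rfl

end

section

variable {α : Type u} [LinearOrder α] {S : List α} {d M i e : ℕ} {N : Set (List α)} {R : ℕ → ℕ}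
  {addr : ENode α → ℤ} {fl : List ℤ} {lb : ℤ → α} {a a' : AS α}

/-! ### The stored eertree -/

omit [LinearOrder α] in
theorem Rep.mem_fld {s : MState α} (h : Rep d M s a) {f : Fld} {p : ℤ} (hv : Valid d M f p)
    (hc : f.isChar = false) : s.mem (p.toNat + f.off) = Word.int (a.f f p) := by
  have := h.fld f p hv
  rw [hc, Int.toNat_add hv.nonneg (by omega), Int.toNat_natCast] at this
  exact this

omit [LinearOrder α] in
theorem Rep.mem_cfld {s : MState α} (h : Rep d M s a) {f : Fld} {p : ℤ} (hv : Valid d M f p)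
    (hc : f.isChar = true) : s.mem (p.toNat + f.off) = a.g f p := by
  have := h.fld f p hv
  rw [hc, Int.toNat_add hv.nonneg (by omega), Int.toNat_natCast] at this
  exact this

omit [LinearOrder α] in
theorem edgeTree_of_in {s : MState α} (hs : Rep d M s a) : ∀ {t : T}, t.In a.f →
    (∀ q ∈ t.list, Blk d M (q - 5) ∧ a.g .tlab q = Word.chr (lb q) ∧ 0 ≤ a.f .tgt q) →
    EdgeTree s.mem M t.ptr.toNat (t.list.map fun q => (lb q, (a.f .tgt q).toNat)) t.ht
  | .nil, _, _ => EdgeTree.nil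
  | .node l q r, ⟨h1, h2, _, h4, h5⟩, h => by
    simp only [T.list, List.mem_append, List.mem_cons] at h
    obtain ⟨hb, hg, ht⟩ := h q (by simp)
    have hl := edgeTree_of_in hs h4 fun q hq => h q (by simp [hq])
    have hr := edgeTree_of_in hs h5 fun q hq => h q (by simp [hq])
    have pl := (T.ptr_valid (t := l) fun q hq => (h q (by simp [hq])).1)
    have pr := (T.ptr_valid (t := r) fun q hq => (h q (by simp [hq])).1)
    have nn : ∀ {p : ℤ}, TPtr d M p → 0 ≤ p := by
      rintro p (rfl | hp)
      · exact le_rfl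
      · have := hp.pos'; omega
    have hpos := hb.pos'
    have hle := hb.le
    have e1 := hs.mem_cfld (f := .tlab) hb rfl
    have e2 := hs.mem_fld (f := .tgt) hb rfl
    have e3 := hs.mem_fld (f := .l) hb rfl
    have e4 := hs.mem_fld (f := .r) hb rfl
    rw [hg] at e1
    rw [h1] at e3
    rw [h2] at e4
    simp only [T.list, List.map_append, List.map_cons, T.ptr, T.ht]
    refine EdgeTree.node q.toNat l.ptr.toNat r.ptr.toNat _ _ _ _ _ _ (by omega) (by omega) e1 ?_ ?_ ?_
      hl hr
    · rw [Int.toNat_of_nonneg ht]; exact e2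
    · rw [Int.toNat_of_nonneg (nn pl)]; exact e3
    · rw [Int.toNat_of_nonneg (nn pr)]; exact e4

theorem Inv.stores {s : MState α} (h : Inv S d M i e a) (hs : Rep d M s a) {H : ℕ}
    (hH : 2 * Nat.log 2 ((sub S i e).toFinset.card + 1) ≤ H) :
    StoresEertree s M H (sub S i e) := by
  obtain ⟨R, addr, fl, lb, h, -, -, -, -⟩ := h
  have nn : ∀ v, NodeIn (palSubstrings (sub S i e)) v → ((addr v).toNat : ℤ) = addr v := fun v hv =>
    Int.toNat_of_nonneg (by have := (h.blk v hv).pos'; omega)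
  refine ⟨fun v => (addr v).toNat, ?_, ?_, ?_, ?_⟩
  · intro v hv v' hv' hh
    rw [Set.mem_ofPred_eq, isNode_iff] at hv hv'
    refine h.inj v v' hv hv' ?_
    rw [← nn v hv, ← nn v' hv']
    exact congrArg Nat.cast hh
  -- The registers `neg` and `zero` have the prescribed numbers 1 and 2 because of the order of the
  -- constructors of `Reg`.
  · rw [nn .negOne trivial, ← h.rneg]; exact hs.reg .neg
  · rw [nn .zero trivial, ← h.rzero]; exact hs.reg .zero
  · intro v hv
    have hv' := isNode_iff.1 hv
    have hb := h.blk v hv'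
    have hpos := hb.pos'
    have hle := hb.le
    refine ⟨by change (addr v).toNat ≠ 0; omega, by change (addr v).toNat + 4 < M; omega, ?_, ⟨slink v, isNode_slink hv, sLink_slink hv, ?_⟩,
      ?_, ?_⟩
    · have := hs.mem_fld (f := .len) (Or.inr hb) rfl
      rw [h.len v hv'] at this; exact this
    · have := hs.mem_fld (f := .link) hb rfl
      rw [h.link v hv', ← nn _ (h.clink v hv')] at this; exact this
    · intro v' c hvn hE
      obtain ⟨p, rfl, rfl, hc⟩ := (edge_iff hvn hv).1 hE
      have e1 := hs.mem_fld (f := .par) hb rfl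
      have e2 := hs.mem_cfld (f := .lab) hb rfl
      rw [h.par p hv', ← nn _ (h.cpar p hv')] at e1
      rw [h.lab p hv' c hc] at e2
      exact ⟨e1, e2⟩
    · obtain ⟨t, ht⟩ := h.tree v hv'
      have htb := h.tree_blk ht
      have htl := h.tree_lab ht
      have htt : ∀ q ∈ t.list, 0 ≤ a.f .tgt q := by
        intro q hq
        obtain ⟨p, hp, -, rfl⟩ := (ht.mem q).1 hq
        rw [h.tgt p hp]
        have := (h.blk (.ord p) hp).pos'
        omega
      have hptr : 0 ≤ t.ptr := by
        rcases T.ptr_valid htb with h0 | hp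
        · omega
        · have := hp.pos'; omega
      have e1 := hs.mem_fld (f := .root) hb rfl
      rw [ht.root, ← Int.toNat_of_nonneg hptr] at e1
      refine ⟨t.ptr.toNat, t.list.map fun q => (lb q, (a.f .tgt q).toNat), t.ht, e1,
        edgeTree_of_in hs ht.tin fun q hq => ⟨htb q hq, htl q hq, htt q hq⟩,
        (h.tree_ht ht rfl).trans hH, ?_, ?_⟩
      · rw [List.map_map]
        exact List.pairwise_map.2 ht.sorted
      · intro c x
        rw [List.mem_map]
        constructor
        · rintro ⟨q, hq, hh⟩
          obtain ⟨p, hp, hpv, rfl⟩ := (ht.mem q).1 hq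
          obtain ⟨c', hc'⟩ := exists_head (p := p) (by rintro rfl; exact h.ne hp)
          rw [h.lbs p hp c' hc', h.tgt p hp] at hh
          injection hh with hh1 hh2
          subst hh1
          exact ⟨.ord p, hp, (edge_iff hv (v' := .ord p) hp).2 ⟨p, rfl, hpv.symm, hc'⟩, hh2.symm⟩
        · rintro ⟨v', hvn, hE, rfl⟩
          obtain ⟨p, rfl, rfl, hc⟩ := (edge_iff hv hvn).1 hE
          exact ⟨addr (.ord p) + 5, (ht.mem _).2 ⟨p, hvn, rfl, rfl⟩, by
            rw [h.lbs p hvn c hc, h.tgt p hvn]⟩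

/-! ### Amortization -/

/-- The length of the longest palindromic suffix and the length of its suffix link each grow by at
most 2. -/
theorem potAt_append (hi : i ≤ e) (he : e < S.length) : potAt S i (e + 1) ≤ potAt S i e + 4 := by
  unfold potAt
  rw [sub_succ hi he]
  set w := sub S i e
  have hcur : SufN w (mkN (lpsuf w)) := sufN_mkN (lpsuf_suffix w) (lpsuf_pal w)
  obtain ⟨x, hx, hq⟩ := exists_ext (lpsuf_suffix (w ++ [S[e]])) (lpsuf_pal _)
    (lpsuf_ne_nil (by simp))
  have hm : ext S[e] x <:+ w ++ [S[e]] := hq ▸ lpsuf_suffix _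
  rw [hq, show mkN (ext S[e] x) = .ord (ext S[e] x) from if_neg (ext_ne_nil _ _)]
  have h1 := slink_len_ext_le hx hcur hm hx.len_le
  have h2 : (ENode.ord (ext S[e] x)).len = x.len + 2 := ext_length _ _
  have h3 := hx.len_le
  unfold pot
  omega

theorem neg_two_le_potAt : -2 ≤ potAt S i e := by
  have : ∀ v : ENode α, -1 ≤ v.len := by
    rintro (_ | _ | p) <;> simp [ENode.len]
  have h1 := this (mkN (lpsuf (sub S i e)))
  have h2 := this (slink (mkN (lpsuf (sub S i e))))
  unfold potAt pot
  omega

theorem potAt_zero : potAt S 0 0 = -1 := by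
  simp [potAt, pot, sub, lpsuf, mkN, slink, ENode.len]

/-- The sliding-window algorithm. -/
def alg : SlidingAlg := ⟨init, delete, append⟩

/-- The closed window `[i, j]` is the half-open `[i, j + 1)` of the invariant, and `substr S i j`
unfolds to `sub S i (j + 1)`. A run is built by recursion, and its cost is summed with the potential
times 40, the cost of a link step. -/
theorem alg_run {T : ℕ} {i j : ℕ → ℕ} (hw : IsWindowSeq S.length T i j)
    (hd : ∀ t ≤ T, j t + 1 - i t ≤ d) {M W G : ℕ} (hMW : M ≤ W)
    (hW : 4 * (S.length + d) + 100 ≤ W)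
    (hM : ∀ t ≤ T, 13 + d + 13 * ((palSubstrings (substr S (i t) (j t))).ncard + 2) ≤ M)
    (hG : ∀ t ≤ T, Nat.log 2 ((substr S (i t) (j t)).toFinset.card + 1) ≤ G) :
    ∃ (st : ℕ → MState α) (cost : ℕ → ℕ), alg.Run S M W d T i j st cost ∧
      (∀ t ≤ T, StoresEertree (st t) M (2 * G) (substr S (i t) (j t))) ∧
      ∑ t ∈ Finset.range (T + 1), cost t ≤ (T + 1) * (720 * G + 740) := by
  obtain ⟨hi0, hj0, hij, hstep⟩ := hw
  have big : ∀ lo hi : ℕ, Big (⟨S, lo, hi, M, W⟩ : Env α) S d := fun lo hi =>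
    ⟨⟨by have := hM 0 (Nat.zero_le _); change 13 + d ≤ M; omega, hMW⟩, rfl, hW⟩
  have h0 := hij 0 (Nat.zero_le _)
  have hn : 0 < S.length := by omega
  have hd0 := hd 0 (Nat.zero_le _)
  rw [hi0, hj0] at hd0
  let P : ℕ → MState α → Prop := fun t s => ∃ a, Rep d M s a ∧ Inv S d M (i t) (j t + 1) a
  let Φ : ℕ → ℤ := fun t => potAt S (i t) (j t + 1)
  have hinit : ∃ s k, Exec ⟨S, i 0, j 0, M, W⟩ init (MState.start d) s k ∧ P 0 s ∧
      (k : ℤ) + 40 * Φ 0 ≤ 480 * G + 700 + 40 * (-1) := by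
    have hM0 := hM 0 (Nat.zero_le _)
    rw [hi0, hj0] at hM0
    obtain ⟨a, ha, hT⟩ := Tr.seq (setup_spec (big 0 0) (S[0]) (by change _ ≤ M; omega)) fun a h =>
      append_spec (big 0 0) le_rfl hn rfl rfl (by omega) h (G := G) (by simp [sub]) hM0
    obtain ⟨s, k, h1, h2, h3⟩ := hT _ (rep_start d M)
    refine ⟨s, k, by rw [hi0, hj0]; exact h1, ⟨a, h3, by rw [hi0, hj0]; exact ha⟩, ?_⟩
    have h4 : Φ 0 ≤ potAt S 0 0 + 4 := by
      change potAt S (i 0) (j 0 + 1) ≤ _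
      rw [hi0, hj0]; exact potAt_append le_rfl hn
    have h5 : Φ 0 = potAt S 0 (0 + 1) := by change potAt S (i 0) (j 0 + 1) = _; rw [hi0, hj0]
    rw [potAt_zero] at h2 h4
    rw [← h5] at h2
    omega
  -- The hypotheses stand inside the existential statement so that `choose` yields total functions,
  -- by which the run is defined recursively.
  have hnext : ∀ t s, ∃ s' k, t < T → P t s →
      ((i (t + 1) = i t + 1 → Exec ⟨S, i t, j t, M, W⟩ delete s s' k) ∧
      (j (t + 1) = j t + 1 → Exec ⟨S, i (t + 1), j (t + 1), M, W⟩ append s s' k)) ∧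
      P (t + 1) s' ∧ (k : ℤ) + 40 * Φ (t + 1) ≤ 720 * G + 700 + 40 * Φ t := by
    intro t s
    by_cases hts : t < T ∧ P t s
    swap
    · exact ⟨s, 0, fun h1 h2 => absurd ⟨h1, h2⟩ hts⟩
    obtain ⟨ht, a, hs, hI⟩ := hts
    have hijt := hij t ht.le
    have hdt := hd t ht.le
    rcases hstep t ht with ⟨e1, e2⟩ | ⟨e1, e2⟩
    · have hlt := (hij (t + 1) ht).1
      obtain ⟨a', ha', hT⟩ := delete_spec (big (i t) (j t)) (by omega) (by omega) hdt hI
        (hG t ht.le)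
      obtain ⟨s', k, h1, h2, h3⟩ := hT s hs
      refine ⟨s', k, fun _ _ => ⟨⟨fun _ => h1, fun h => by omega⟩, ⟨a', h3, ?_⟩, ?_⟩⟩
      · rw [e1, e2]; exact ha'
      · have : Φ (t + 1) ≤ Φ t := by
          change potAt S (i (t + 1)) (j (t + 1) + 1) ≤ potAt S (i t) (j t + 1)
          rw [e1, e2]
          exact potAt_delete (by omega) (by omega)
        omega
    · have hlt := hij (t + 1) ht
      have hM1 := hM (t + 1) ht
      have hd1 := hd (t + 1) ht
      rw [e1, e2] at hM1 hd1
      obtain ⟨a', ha', hT⟩ := append_spec (big (i t) (j t + 1)) (i := i t) (e := j t + 1)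
        (by omega) (by omega) rfl rfl hd1 hI (hG t ht.le) hM1
      obtain ⟨s', k, h1, h2, h3⟩ := hT s hs
      refine ⟨s', k, fun _ _ => ⟨⟨fun h => by omega, fun _ => by rw [e1, e2]; exact h1⟩,
        ⟨a', h3, ?_⟩, ?_⟩⟩
      · rw [e1, e2]; exact ha'
      · have h4 : Φ (t + 1) = potAt S (i t) (j t + 1 + 1) := by
          change potAt S (i (t + 1)) (j (t + 1) + 1) = _
          rw [e1, e2]
        have h5 := potAt_append (S := S) (i := i t) (e := j t + 1) (by omega) (by omega)
        rw [h4]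
        change _ ≤ _ + 40 * potAt S (i t) (j t + 1)
        omega
  obtain ⟨s0, k0, hex0, hP0, hc0⟩ := hinit
  choose f g hfg using hnext
  let st : ℕ → MState α := fun t => Nat.rec s0 (fun t s => f t s) t
  let cost : ℕ → ℕ := fun t => Nat.casesOn t k0 fun t => g t (st t)
  have hP : ∀ t ≤ T, P t (st t) := by
    intro t
    induction t with
    | zero => exact fun _ => hP0
    | succ t ih => exact fun ht => (hfg t (st t) ht (ih (by omega))).2.1
  refine ⟨st, cost, ⟨hex0, fun t ht => (hfg t (st t) ht (hP t ht.le)).1⟩, fun t ht => ?_, ?_⟩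
  · obtain ⟨a, hs, hI⟩ := hP t ht
    exact hI.stores hs (Nat.mul_le_mul_left 2 (hG t ht))
  · have key : ∀ t ≤ T, ((∑ t ∈ Finset.range (t + 1), cost t : ℕ) : ℤ) + 40 * Φ t ≤
        (t + 1) * (720 * G + 740) + 40 * (-2) := by
      intro t
      induction t with
      | zero =>
        intro _
        rw [Finset.sum_range_one]
        change (k0 : ℤ) + _ ≤ _
        push_cast
        linarith
      | succ t ih =>
        intro ht
        have h1 := ih (by omega)
        have h2 := (hfg t (st t) ht (hP t (by omega))).2.2
        rw [Finset.sum_range_succ]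
        change ((_ + g t (st t) : ℕ) : ℤ) + _ ≤ _
        push_cast at h1 ⊢
        linarith
    have h1 := key T le_rfl
    have h2 : -2 ≤ Φ T := neg_two_le_potAt
    have h3 : ((∑ t ∈ Finset.range (T + 1), cost t : ℕ) : ℤ) ≤ (T + 1) * (720 * G + 740) := by
      linarith
    exact_mod_cast h3

end

end SlidingEertree

/-! ### The constants of the main theorem -/

theorem mainTheorem1 :
    ∃ (A : SlidingAlg) (C : ℕ),
      ∀ (α : Type u) [LinearOrder α] (S : List α) (d T : ℕ) (i j : ℕ → ℕ),
        IsWindowSeq S.length T i j →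
        (∀ t ≤ T, j t + 1 - i t ≤ d) →
        maxPals S T i j ≤ d ∧
        ∃ (st : ℕ → MState α) (cost : ℕ → ℕ),
          A.Run S (d + C * maxPals S T i j) (C * (S.length + d)) d T i j st cost ∧
          (∀ t ≤ T,
            StoresEertree (st t) (d + C * maxPals S T i j)
              (C * Nat.log 2 (maxChars S T i j + 1)) (substr S (i t) (j t))) ∧
          ∑ t ∈ Finset.range (T + 1), cost t ≤
            C * (S.length * Nat.log 2 (maxChars S T i j + 1)) := by
  -- The time bound needs `2 * 1460 = 2920`; space needs `13 * D + 39 ≤ 3000 * D` for `D ≥ 1`, and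
  -- words need to hold `4 * (n + d) + 100`.
  refine ⟨SlidingEertree.alg, 3000, fun α _ S d T i j hw hd => ?_⟩
  have hw' := hw
  obtain ⟨hi0, hj0, hij, hstep⟩ := hw'
  have hn : 0 < S.length := by have := hij 0 (Nat.zero_le _); omega
  have hlen : ∀ t ≤ T, (substr S (i t) (j t)).length = j t + 1 - i t := fun t ht =>
    SlidingEertree.sub_length (by have := hij t ht; omega)
  have hcard : ∀ t ≤ T, (palSubstrings (substr S (i t) (j t))).ncard ≤ j t + 1 - i t := fun t ht =>
    hlen t ht ▸ (SlidingEertree.palSubstrings_finite_ncard _).2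
  have hpalD : ∀ t ≤ T, (palSubstrings (substr S (i t) (j t))).ncard ≤ maxPals S T i j :=
    fun t ht => Finset.le_sup (f := fun t => (palSubstrings (substr S (i t) (j t))).ncard)
      (Finset.mem_range.2 (by omega))
  have hD : maxPals S T i j ≤ d := Finset.sup_le fun t ht =>
    (hcard t (by have := Finset.mem_range.1 ht; omega)).trans
      (hd t (by have := Finset.mem_range.1 ht; omega))
  -- Needed for addresses to fit into words, that is, `d + 3000 * D ≤ 3000 * (n + d)`.
  have hDn : maxPals S T i j ≤ S.length := Finset.sup_le fun t ht => by
    have ht' : t ≤ T := by have := Finset.mem_range.1 ht; omega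
    have h1 := hcard t ht'
    have h2 := hij t ht'
    omega
  have h0 : substr S (i 0) (j 0) = [S[0]] := by
    rw [hi0, hj0]; exact SlidingEertree.sub_self_succ hn
  have hD1 : 1 ≤ maxPals S T i j := by
    refine le_trans ?_ (hpalD 0 (Nat.zero_le _))
    rw [h0, Nat.one_le_iff_ne_zero, ← Nat.pos_iff_ne_zero,
      Set.ncard_pos (SlidingEertree.palSubstrings_finite_ncard _).1]
    exact ⟨[S[0]], by simp, List.infix_rfl, .singleton _⟩
  have hcC : ∀ t ≤ T, (substr S (i t) (j t)).toFinset.card ≤ maxChars S T i j := fun t ht =>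
    Finset.le_sup (f := fun t => (substr S (i t) (j t)).toFinset.card)
      (Finset.mem_range.2 (by omega))
  have hC1 : 1 ≤ maxChars S T i j := by
    refine le_trans ?_ (hcC 0 (Nat.zero_le _))
    rw [h0]; simp
  -- Since windows are non-empty, the logarithm is at least 1 and absorbs the additive constant of
  -- each operation.
  have hG1 : 1 ≤ Nat.log 2 (maxChars S T i j + 1) :=
    Nat.log_pos (by norm_num) (by omega)
  have hT : ∀ t ≤ T, i t + j t = t := by
    intro t
    induction t with
    | zero => intro _; omega
    | succ t ih =>
      intro ht
      have h1 := ih (by omega)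
      rcases hstep t ht with h2 | h2 <;> omega
  -- Each operation advances exactly one end of the window, and both ends stay below `n`.
  have hT2 : T + 1 ≤ 2 * S.length := by
    have h1 := hT T le_rfl
    have h2 := hij T le_rfl
    omega
  obtain ⟨st, cost, h1, h2, h3⟩ := SlidingEertree.alg_run hw hd (M := d + 3000 * maxPals S T i j)
    (W := 3000 * (S.length + d)) (G := Nat.log 2 (maxChars S T i j + 1)) (by omega) (by omega)
    (fun t ht => by have := hpalD t ht; omega)
    (fun t ht => Nat.log_mono_right (Nat.add_le_add_right (hcC t ht) 1))
  refine ⟨hD, st, cost, h1, fun t ht => ?_, h3.trans ?_⟩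
  · obtain ⟨addr, q1, q2, q3, q4⟩ := h2 t ht
    refine ⟨addr, q1, q2, q3, fun v hv => ?_⟩
    obtain ⟨r1, r2, r3, r4, r5, q, L, k, r6, r7, r8, r9⟩ := q4 v hv
    exact ⟨r1, r2, r3, r4, r5, q, L, k, r6, r7, r8.trans (by omega), r9⟩
  · generalize Nat.log 2 (maxChars S T i j + 1) = G at hG1
    calc (T + 1) * (720 * G + 740) ≤ (2 * S.length) * (1460 * G) :=
          Nat.mul_le_mul hT2 (by omega)
      _ = 2920 * (S.length * G) := by ring
      _ ≤ 3000 * (S.length * G) := Nat.mul_le_mul_right _ (by norm_num)
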